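/- Let $k$ be a field of characteristic zero, $H$ a cocommutative Hopf algebra over $k$ (its antipode $\mathsf{s}$ is then bijective), and $M$ a stable anti-Yetter–Drinfeld (SAYD) module over $H$: a right $H$-module and left $H$-comodule, with coaction $\varphi(m)=m^{(-1)}\otimes m^{(0)}$, such that $\varphi(mh)=\mathsf{s}(h^{(3)})m^{(-1)}h^{(1)}\otimes m^{(0)}h^{(2)}$ and $m^{(0)}m^{(-1)}=m$. Let $\psi:M\to M\otimes M$ be a $k$-linear map that is $H$-linear, $\psi(mh)=\psi(m)\Delta(h)$, and satisfies $(\Delta\otimes\psi)\circ\varphi_M=\varphi_{M\otimes M}\circ\psi$, where $\varphi_{M\otimes M}(m\otimes m')=m^{(-1)}\otimes m'^{(-1)}\otimes m^{(0)}\otimes m'^{(0)}$. Let $C=C(H,M)$ be given by $C^n=M\otimes_H H^{\otimes(n+1)}$ (diagonal action on $H^{\otimes (n+1)}$), with cofaces $\delta_i$ applying $\Delta$ to $h_i$ for $0\le i\le n$, last coface $\delta_{n+1}(m\otimes h_0\otimes\cdots\otimes h_n)=m^{(0)}\otimes h_0^{(2)}\otimes h_1\otimes\cdots\otimes h_n\otimes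 m^{(-1)}h_0^{(1)}$, codegeneracies $\sigma_i$ applying $\varepsilon$ to $h_{i+1}$, and $\tau_n(m\otimes h_0\otimes\cdots\otimes h_n)=m^{(0)}\otimes h_1\otimes\cdots\otimes h_n\otimes m^{(-1)}h_0$. For a cocyclic module $C$, take its normalized mixed complex $\overline C=(\bigcap_i\ker\sigma_i,\,b,\,B)$, where $b=\sum_i(-1)^i\delta_i$ and $B=N\sigma_{n}\tau_{n+1}(1-\lambda):C^{n+1}\to C^n$ with $\lambda=(-1)^n\tau_n$ on $C^n$ and $N=\sum_j\lambda^j$. Let $Tot^n(C)=\bigoplus_{j\ge0}u^j\,\overline C^{\,n-2j}$ with differential $b+B$ (where $B$ raises the power of $u$ by one), let $HC^n$ be its cohomology, and let $S$ be multiplication by $u$. Let $C\times C$ be the diagonal cocyclic module, $(C\times C)^n=C^n\otimes C^n$ with operators $\delta_i\otimes\delta_i$, $\sigma_i\otimes\sigma_i$, $\tau\otimes\tau$, and let $C\otimes C$ be the tensor product mixed complex, $(C\otimes C)^n=\bigoplus_{p+q=n}\overline C^{\,p}\otimes \overline C^{\,q}$ with $b=b\otimes1+(-1)^p\,1\otimes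 b$ and $B=B\otimes1+(-1)^p\,1\otimes B$; $Tot(C\otimes C)$ is formed from it in the same way. Let $\rho_n=\Omega_n\circ(\psi\otimes\Delta^{\otimes(n+1)}):C^n\to C^n\otimes C^n$, where $\Omega_n:(M\otimes M)\otimes_{H\otimes H}(H\otimes H)^{\otimes(n+1)}\to C^n\otimes C^n$ is the map separating the two tensor factors, and let $\varrho=\bigoplus_{i\ge0}\rho_{n-2i}:Tot^n(C)\to Tot^n(C\times C)$. Let $\widetilde{Sh}:Tot^n(C\times C)\to Tot^n(C\otimes C)$ be the map $u^jx\mapsto u^j\,sh(x)+u^{j+1}sh'(x)$, where $sh$ is the shuffle map with components $$sh_{i,j}=\sum_{s}\operatorname{sign}(s)\,\sigma_{s(i+1)-1}\cdots\sigma_{s(i+j)-1}\otimes\sigma_{s(1)-1}\cdots\sigma_{s(i)-1}:C^{i+j}\otimes C^{i+j}\to C^i\otimes C^j,$$ the sum running over the $(i,j)$-shuffles $s$ of $\{1,\dots,i+j\}$, and $sh'$ is the cyclic shuffle map, with components for $i,j\ge1$ $$sh'_{i,j}=(-1)^{i-1}\sum(-1)^{p(i-1)+q(j-1)}\operatorname{sign}(s)\,\sigma_{i-p-1}\tau_i^{p+1}\sigma_{s(i+1)-1}\cdots\sigma_{s(i+j)-1}\otimes\sigma_{j-q-1}\tau_j^{q+1}\sigma_{s(1)-1}\cdots\sigma_{s(i)-1}:C^{i+j}\otimes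 C^{i+j}\to C^{i-1}\otimes C^{j-1},$$ the sum running over $0\le p<i$, $0\le q<j$ and the $(i,j)$-shuffles $s$ with $s(p+1)<s(i+q+1)$. These data $(p,q,s)$ are the $(i,j)$-cyclic shuffles: rotate $(1,\dots,i)$ by $p$ steps and $(i+1,\dots,i+j)$ by $q$ steps, then shuffle by $s$, so that $1$ comes before $i+1$. Let $\mu:Tot(C)\otimes Tot(C)\to Tot(C\otimes C)$ be $u^ax\otimes u^by\mapsto u^{a+b}(x\otimes y)$. Then the following hold. 1. $C$ and its operators are well defined and form a cocyclic module; $Tot(C)$, $Tot(C\times C)$ and $Tot(C\otimes C)$ are complexes; and $\varrho$ and $\widetilde{Sh}$ are well defined maps of these complexes that commute with $S$. Hence $\widetilde{Sh}\circ\varrho$ induces $(\widetilde{Sh}\varrho)^*:HC^n(H,M)\to HC^n(C\otimes C)$. 2. The sequence $$0\to\bigoplus_{p+q=n-2}Tot^p(C)\otimes Tot^q(C)\xrightarrow{S\otimes1-1\otimes S}\bigoplus_{p+q=n}Tot^p(C)\otimes Tot^q(C)\xrightarrow{\ \mu\ }Tot^n(C\otimes C)\to0$$ is a short exact sequence of complexes,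 and $[\alpha]\otimes[\beta]\mapsto[\alpha\otimes\beta]$ identifies the cohomology of $Tot(C)\otimes Tot(C)$ in degree $n$ with $\bigoplus_{p+q=n}HC^p\otimes HC^q$. Let $\partial:HC^n(C\otimes C)\to\bigoplus_{p+q=n-1}HC^p\otimes HC^q$ be the resulting connecting map, and let the cyclic Künneth map be the composite of maps of the long exact cohomology sequence $$\varsigma=\partial\,\mu\,(S\otimes1-1\otimes S)\,\partial:HC^n(C\otimes C)\to\bigoplus_{p+q=n}HC^p(H,M)\otimes HC^q(H,M).$$ 3. The formula $$\sqcup=\varsigma\circ(\widetilde{Sh}\,\varrho)^*:HC^n(H,M)\longrightarrow\bigoplus_{p+q=n}HC^p(H,M)\otimes HC^q(H,M),\qquad n\ge0,$$ gives a well-defined linear map, a coproduct on the Hopf cyclic cohomology of $H$ with coefficients in $M$. -/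

import Mathlib

open scoped TensorProduct

universe u v w w' w''

namespace HopfCyc

section Powers

variable (k : Type u) (H : Type v) [Field k] [Ring H]

/-- The tensor power `H^{⊗(n+1)}`, written as `H ⊗ (H ⊗ (⋯ ⊗ H))`. -/
noncomputable def pow [Algebra k H] : ℕ → ModuleCat.{v} k
  | 0 => ModuleCat.of k H
  | n + 1 => ModuleCat.of k (H ⊗[k] pow n)

/-- `H^{⊗1} = H`. -/
noncomputable def powZero [Algebra k H] : pow k H 0 ≃ₗ[k] H := LinearEquiv.refl k H

/-- `H^{⊗(n+2)} = H ⊗ H^{⊗(n+1)}`. -/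
noncomputable def powSucc [Algebra k H] (n : ℕ) : pow k H (n + 1) ≃ₗ[k] H ⊗[k] pow k H n :=
  LinearEquiv.refl k (H ⊗[k] pow k H n)

variable [Bialgebra k H]

/-- The diagonal left action `h · (h₀ ⊗ ⋯ ⊗ hₙ) = h⁽¹⁾h₀ ⊗ ⋯ ⊗ h⁽ⁿ⁺¹⁾hₙ`. -/
noncomputable def diagAct : (n : ℕ) → H ⊗[k] pow k H n →ₗ[k] pow k H n
  | 0 => (powZero k H).symm.toLinearMap ∘ₗ LinearMap.mul' k H ∘ₗ
      TensorProduct.map LinearMap.id (powZero k H).toLinearMap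
  | n + 1 => (powSucc k H n).symm.toLinearMap ∘ₗ
      TensorProduct.map (LinearMap.mul' k H) (diagAct n) ∘ₗ
      (TensorProduct.tensorTensorTensorComm k H H H (pow k H n)).toLinearMap ∘ₗ
      TensorProduct.map Coalgebra.comul (powSucc k H n).toLinearMap

/-- `h₀ ⊗ ⋯ ⊗ hₙ ↦ h₀ ⊗ ⋯ ⊗ hᵢ⁽¹⁾ ⊗ hᵢ⁽²⁾ ⊗ ⋯ ⊗ hₙ` for `i ≤ n`. -/
noncomputable def dup : (n : ℕ) → ℕ → pow k H n →ₗ[k] pow k H (n + 1)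
  | 0, _ => (powSucc k H 0).symm.toLinearMap ∘ₗ
      TensorProduct.map LinearMap.id (powZero k H).symm.toLinearMap ∘ₗ
      Coalgebra.comul ∘ₗ (powZero k H).toLinearMap
  | n + 1, 0 => (powSucc k H (n + 1)).symm.toLinearMap ∘ₗ
      TensorProduct.map LinearMap.id (powSucc k H n).symm.toLinearMap ∘ₗ
      (TensorProduct.assoc k H H (pow k H n)).toLinearMap ∘ₗ
      TensorProduct.map Coalgebra.comul LinearMap.id ∘ₗ (powSucc k H n).toLinearMap
  | n + 1, i + 1 => (powSucc k H (n + 1)).symm.toLinearMap ∘ₗ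
      TensorProduct.map LinearMap.id (dup n i) ∘ₗ (powSucc k H n).toLinearMap

/-- `h₀ ⊗ ⋯ ⊗ hₙ₊₁ ↦ h₀ ⊗ ⋯ ⊗ ε(hᵢ₊₁) ⊗ ⋯ ⊗ hₙ₊₁` for `i ≤ n`. -/
noncomputable def kill : (n : ℕ) → ℕ → pow k H (n + 1) →ₗ[k] pow k H n
  | 0, _ => (powZero k H).symm.toLinearMap ∘ₗ
      (TensorProduct.rid k H).toLinearMap ∘ₗ
      TensorProduct.map LinearMap.id (Coalgebra.counit ∘ₗ (powZero k H).toLinearMap) ∘ₗ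
      (powSucc k H 0).toLinearMap
  | n + 1, 0 => (powSucc k H n).symm.toLinearMap ∘ₗ
      TensorProduct.map LinearMap.id ((TensorProduct.lid k (pow k H n)).toLinearMap ∘ₗ
        TensorProduct.map Coalgebra.counit LinearMap.id ∘ₗ (powSucc k H n).toLinearMap) ∘ₗ
      (powSucc k H (n + 1)).toLinearMap
  | n + 1, i + 1 => (powSucc k H n).symm.toLinearMap ∘ₗ
      TensorProduct.map LinearMap.id (kill n i) ∘ₗ (powSucc k H (n + 1)).toLinearMap

/-- `(h₀ ⊗ ⋯ ⊗ hₙ) ⊗ g ↦ h₀ ⊗ ⋯ ⊗ hₙ ⊗ g`. -/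
noncomputable def append : (n : ℕ) → pow k H n ⊗[k] H →ₗ[k] pow k H (n + 1)
  | 0 => (powSucc k H 0).symm.toLinearMap ∘ₗ
      TensorProduct.map (powZero k H).toLinearMap (powZero k H).symm.toLinearMap
  | n + 1 => (powSucc k H (n + 1)).symm.toLinearMap ∘ₗ
      TensorProduct.map LinearMap.id (append n) ∘ₗ
      (TensorProduct.assoc k H (pow k H n) H).toLinearMap ∘ₗ
      TensorProduct.map (powSucc k H n).toLinearMap LinearMap.id

/-- `g ⊗ (h₀ ⊗ ⋯ ⊗ hₙ) ↦ h₁ ⊗ ⋯ ⊗ hₙ ⊗ g h₀`. -/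
noncomputable def rot : (n : ℕ) → H ⊗[k] pow k H n →ₗ[k] pow k H n
  | 0 => (powZero k H).symm.toLinearMap ∘ₗ LinearMap.mul' k H ∘ₗ
      TensorProduct.map LinearMap.id (powZero k H).toLinearMap
  | n + 1 => append k H n ∘ₗ
      (TensorProduct.comm k H (pow k H n)).toLinearMap ∘ₗ
      TensorProduct.map (LinearMap.mul' k H) LinearMap.id ∘ₗ
      (TensorProduct.assoc k H H (pow k H n)).symm.toLinearMap ∘ₗ
      TensorProduct.map LinearMap.id (powSucc k H n).toLinearMap


variable {k H}

theorem diagAct_succ_tmul (n : ℕ) (h a : H) (y : pow k H n) :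
    diagAct k H (n + 1) (h ⊗ₜ (powSucc k H n).symm (a ⊗ₜ y)) =
      (powSucc k H n).symm (TensorProduct.map (LinearMap.mulRight k a)
        (diagAct k H n ∘ₗ (TensorProduct.mk k H (pow k H n)).flip y) (Coalgebra.comul h)) := by
  simp only [diagAct, LinearMap.comp_apply, TensorProduct.map_tmul, LinearEquiv.coe_coe,
    LinearEquiv.apply_symm_apply]
  congr 1
  induction (Coalgebra.comul (R := k) h) using TensorProduct.induction_on with
  | zero => simp
  | tmul p q => simp
  | add u v hu hv => rw [TensorProduct.add_tmul, map_add, map_add, map_add, hu, hv]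

theorem diagAct_zero_tmul (h : H) (x : pow k H 0) :
    diagAct k H 0 (h ⊗ₜ x) = (powZero k H).symm (h * powZero k H x) := by
  simp [diagAct]

/-- Two linear maps on `H^{⊗(n+2)}` agree if they agree on pure tensors. -/
theorem pow_ext {n : ℕ} {V : Type w} [AddCommGroup V] [Module k V]
    {f g : pow k H (n + 1) →ₗ[k] V}
    (hfg : ∀ (a : H) (y : pow k H n),
      f ((powSucc k H n).symm (a ⊗ₜ y)) = g ((powSucc k H n).symm (a ⊗ₜ y))) : f = g := by
  have : f ∘ₗ (powSucc k H n).symm.toLinearMap = g ∘ₗ (powSucc k H n).symm.toLinearMap :=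
    TensorProduct.ext' fun a y => hfg a y
  ext x
  simpa using LinearMap.congr_fun this (powSucc k H n x)

/-- A linear map commutes with the diagonal actions. -/
def Equivariant {n m : ℕ} (f : pow k H n →ₗ[k] pow k H m) : Prop :=
  ∀ (h : H) (x : pow k H n), f (diagAct k H n (h ⊗ₜ x)) = diagAct k H m (h ⊗ₜ f x)

theorem equivariant_succ {n m : ℕ} (f : pow k H (n + 1) →ₗ[k] pow k H m)
    (hf : ∀ (h a : H) (y : pow k H n),
      f (diagAct k H (n + 1) (h ⊗ₜ (powSucc k H n).symm (a ⊗ₜ y))) =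
        diagAct k H m (h ⊗ₜ f ((powSucc k H n).symm (a ⊗ₜ y)))) : Equivariant f := by
  intro h x
  have := pow_ext (f := f ∘ₗ diagAct k H (n + 1) ∘ₗ TensorProduct.mk k H (pow k H (n + 1)) h)
    (g := diagAct k H m ∘ₗ TensorProduct.mk k H (pow k H m) h ∘ₗ f) (fun a y => by
      simpa using hf h a y)
  simpa using LinearMap.congr_fun this x

theorem equivariant_cons {n m : ℕ} (f : pow k H n →ₗ[k] pow k H m) (hf : Equivariant f) :
    Equivariant ((powSucc k H m).symm.toLinearMap ∘ₗ
      TensorProduct.map LinearMap.id f ∘ₗ (powSucc k H n).toLinearMap) := by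
  apply equivariant_succ
  intro h a y
  rw [diagAct_succ_tmul]
  simp only [LinearMap.comp_apply, LinearEquiv.coe_coe, LinearEquiv.apply_symm_apply,
    TensorProduct.map_tmul, LinearMap.id_apply]
  rw [diagAct_succ_tmul]
  congr 1
  induction (Coalgebra.comul (R := k) h) using TensorProduct.induction_on with
  | zero => simp
  | tmul p q => simp [hf q y]
  | add u v hu hv => simp only [map_add, hu, hv]

theorem comul_mul_aux (h a : H) :
    (Coalgebra.comul (R := k) (h * a) : H ⊗[k] H) = Coalgebra.comul h * Coalgebra.comul a :=
  Bialgebra.comul_mul h a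

theorem dup_equivariant (n i : ℕ) : Equivariant (dup k H n i) := by
  induction n generalizing i with
  | zero =>
    intro h x
    obtain ⟨a, rfl⟩ := (powZero k H).symm.surjective x
    rw [diagAct_zero_tmul]
    simp only [dup, LinearMap.comp_apply, LinearEquiv.coe_coe, LinearEquiv.apply_symm_apply,
      comul_mul_aux]
    induction (Coalgebra.comul (R := k) a) using TensorProduct.induction_on with
    | zero => simp
    | add u v hu hv => simp only [mul_add, map_add, TensorProduct.tmul_add, hu, hv]
    | tmul a₁ a₂ =>
      simp only [TensorProduct.map_tmul, LinearMap.id_apply, LinearEquiv.coe_coe]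
      rw [diagAct_succ_tmul]
      congr 1
      induction (Coalgebra.comul (R := k) h) using TensorProduct.induction_on with
      | zero => simp
      | add u v hu hv => simp only [add_mul, map_add, hu, hv]
      | tmul p q => simp [diagAct_zero_tmul]
  | succ n ih =>
    cases i with
    | succ i => exact equivariant_cons _ (ih i)
    | zero =>
      apply equivariant_succ
      intro h a y
      rw [diagAct_succ_tmul]
      simp only [dup, LinearMap.comp_apply, LinearEquiv.coe_coe, LinearEquiv.apply_symm_apply,
        TensorProduct.map_tmul, LinearMap.id_apply]
      have key : ∀ v : H ⊗[k] H, 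
          TensorProduct.map LinearMap.id (powSucc k H n).symm.toLinearMap
            (TensorProduct.assoc k H H (pow k H n)
              (TensorProduct.map (LinearMap.mulRight k v ∘ₗ Coalgebra.comul)
                (diagAct k H n ∘ₗ (TensorProduct.mk k H (pow k H n)).flip y)
                  (Coalgebra.comul h))) =
          powSucc k H (n + 1) (diagAct k H (n + 2) (h ⊗ₜ (powSucc k H (n + 1)).symm
            (TensorProduct.map LinearMap.id (powSucc k H n).symm.toLinearMap
              (TensorProduct.assoc k H H (pow k H n) (v ⊗ₜ y))))) := by
        intro v
        induction v using TensorProduct.induction_on with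
        | zero => simp
        | add u v hu hv =>
          have : LinearMap.mulRight k (u + v) = LinearMap.mulRight k u + LinearMap.mulRight k v := by
            ext; simp [mul_add]
          simp only [this, LinearMap.add_comp, TensorProduct.map_add_left, LinearMap.add_apply,
            TensorProduct.add_tmul, TensorProduct.tmul_add, map_add, hu, hv]
        | tmul a₁ a₂ =>
          simp only [TensorProduct.assoc_tmul, TensorProduct.map_tmul, LinearMap.id_apply,
            LinearEquiv.coe_coe]
          rw [diagAct_succ_tmul, LinearEquiv.apply_symm_apply]
          have co := Coalgebra.coassoc_apply (R := k) h
          apply_fun (TensorProduct.map (LinearMap.mulRight k a₁)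
            ((powSucc k H n).symm.toLinearMap ∘ₗ TensorProduct.map (LinearMap.mulRight k a₂)
              (diagAct k H n ∘ₗ (TensorProduct.mk k H (pow k H n)).flip y))) at co
          refine Eq.trans (Eq.trans ?_ co) ?_
          · induction (Coalgebra.comul (R := k) h) using TensorProduct.induction_on with
            | zero => simp
            | add u v hu hv => simp only [map_add, hu, hv]
            | tmul p q =>
              simp only [TensorProduct.map_tmul, LinearMap.comp_apply, LinearMap.rTensor_tmul,
                LinearMap.mulRight_apply]
              induction (Coalgebra.comul (R := k) p) using TensorProduct.induction_on with
              | zero => simp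
              | add u v hu hv => simp only [add_mul, map_add, TensorProduct.add_tmul, hu, hv]
              | tmul p₁ p₂ => simp
          · induction (Coalgebra.comul (R := k) h) using TensorProduct.induction_on with
            | zero => simp
            | add u v hu hv => simp only [map_add, hu, hv]
            | tmul p q =>
              simp [diagAct_succ_tmul]
      apply (powSucc k H (n + 1)).injective
      rw [LinearEquiv.apply_symm_apply, ← key (Coalgebra.comul a)]
      congr 2
      induction (Coalgebra.comul (R := k) h) using TensorProduct.induction_on with
      | zero => simp
      | add u v hu hv => simp only [map_add, hu, hv]
      | tmul p q => simp

theorem kill_equivariant (n i : ℕ) : Equivariant (kill k H n i) := by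
  induction n generalizing i with
  | zero =>
    apply equivariant_succ
    intro h a y
    rw [diagAct_succ_tmul]
    simp only [kill, LinearMap.comp_apply, LinearEquiv.coe_coe, LinearEquiv.apply_symm_apply,
      TensorProduct.map_tmul, LinearMap.id_apply, TensorProduct.rid_tmul]
    rw [diagAct_zero_tmul, LinearEquiv.apply_symm_apply]
    congr 1
    have co := Coalgebra.lTensor_counit_comul (R := k) h
    apply_fun (Coalgebra.counit (R := k) (powZero k H y)) •
      ((TensorProduct.rid k H).toLinearMap ∘ₗ
        TensorProduct.map (LinearMap.mulRight k a) LinearMap.id) at co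
    refine Eq.trans (Eq.trans ?_ co) ?_
    · induction (Coalgebra.comul (R := k) h) using TensorProduct.induction_on with
      | zero => simp
      | add u v hu hv => simp only [map_add, hu, hv]
      | tmul p q => simp [diagAct_zero_tmul, smul_smul, mul_comm]
    · simp
  | succ n ih =>
    cases i with
    | succ i => exact equivariant_cons _ (ih i)
    | zero =>
      apply equivariant_succ
      intro h a y
      obtain ⟨y, rfl⟩ := (powSucc k H n).symm.surjective y
      rw [diagAct_succ_tmul]
      simp only [kill, LinearMap.comp_apply, LinearEquiv.coe_coe, LinearEquiv.apply_symm_apply,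
        TensorProduct.map_tmul, LinearMap.id_apply]
      induction y using TensorProduct.induction_on with
      | zero => simp
      | add y z hy hz =>
        simp only [map_add, TensorProduct.tmul_add, LinearMap.comp_add,
          TensorProduct.map_add_right, LinearMap.add_apply, hy, hz]
      | tmul b y =>
        simp only [TensorProduct.map_tmul, LinearMap.id_apply, TensorProduct.lid_tmul]
        rw [diagAct_succ_tmul]
        congr 1
        induction (Coalgebra.comul (R := k) h) using TensorProduct.induction_on with
        | zero => simp
        | add u v hu hv => simp only [map_add, hu, hv]
        | tmul p q =>
          simp only [TensorProduct.map_tmul, LinearMap.comp_apply, LinearMap.flip_apply,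
            TensorProduct.mk_apply, LinearMap.mulRight_apply, LinearMap.id_apply]
          rw [diagAct_succ_tmul]
          congr 1
          have co := Coalgebra.rTensor_counit_comul (R := k) q
          apply_fun (Coalgebra.counit (R := k) b) •
            ((TensorProduct.lid k (pow k H n)).toLinearMap ∘ₗ
              TensorProduct.map LinearMap.id
                (diagAct k H n ∘ₗ (TensorProduct.mk k H (pow k H n)).flip y)) at co
          refine Eq.trans (Eq.trans ?_ co) ?_
          · induction (Coalgebra.comul (R := k) q) using TensorProduct.induction_on with
            | zero => simp
            | add u v hu hv => simp only [map_add, hu, hv]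
            | tmul p q => simp [smul_smul, mul_comm]
          · simp

theorem append_tmul (n : ℕ) (a b : H) (y : pow k H n) :
    append k H (n + 1) ((powSucc k H n).symm (a ⊗ₜ y) ⊗ₜ b) =
      (powSucc k H (n + 1)).symm (a ⊗ₜ append k H n (y ⊗ₜ b)) := by
  simp [append]

theorem diagAct_append (n : ℕ) (h : H) (y : pow k H n) (b : H) :
    diagAct k H (n + 1) (h ⊗ₜ append k H n (y ⊗ₜ b)) =
      append k H n (TensorProduct.map
        (diagAct k H n ∘ₗ (TensorProduct.mk k H (pow k H n)).flip y)
        (LinearMap.mulRight k b) (Coalgebra.comul h)) := by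
  induction n generalizing h b with
  | zero =>
    obtain ⟨a, rfl⟩ := (powZero k H).symm.surjective y
    simp only [append, LinearMap.comp_apply, TensorProduct.map_tmul, LinearEquiv.coe_coe,
      LinearEquiv.apply_symm_apply]
    rw [diagAct_succ_tmul]
    congr 1
    induction (Coalgebra.comul (R := k) h) using TensorProduct.induction_on with
    | zero => simp
    | add u v hu hv => simp only [map_add, hu, hv]
    | tmul p q => simp [diagAct_zero_tmul]
  | succ n ih =>
    obtain ⟨y, rfl⟩ := (powSucc k H n).symm.surjective y
    induction y using TensorProduct.induction_on with
    | zero => simp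
    | add y z hy hz =>
      simp only [map_add, TensorProduct.add_tmul, TensorProduct.tmul_add, LinearMap.comp_add,
        TensorProduct.map_add_left, LinearMap.add_apply, hy, hz]
    | tmul a y =>
      rw [append_tmul, diagAct_succ_tmul]
      have co := (Coalgebra.coassoc_apply (R := k) h).symm
      apply_fun ((powSucc k H (n + 1)).symm.toLinearMap ∘ₗ
        TensorProduct.map (LinearMap.mulRight k a) (append k H n ∘ₗ TensorProduct.map
          (diagAct k H n ∘ₗ (TensorProduct.mk k H (pow k H n)).flip y)
          (LinearMap.mulRight k b))) at co
      refine Eq.trans (Eq.trans ?_ co) ?_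
      · rw [LinearMap.comp_apply, LinearEquiv.coe_coe]
        congr 1
        induction (Coalgebra.comul (R := k) h) using TensorProduct.induction_on with
        | zero => simp
        | add u v hu hv => simp only [map_add, hu, hv]
        | tmul p q => simp [ih]
      · induction (Coalgebra.comul (R := k) h) using TensorProduct.induction_on with
        | zero => simp
        | add u v hu hv => simp only [map_add, hu, hv]
        | tmul p q =>
          simp only [LinearMap.rTensor_tmul, TensorProduct.map_tmul, LinearMap.comp_apply,
            LinearMap.flip_apply, TensorProduct.mk_apply, LinearMap.mulRight_apply]
          rw [diagAct_succ_tmul]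
          induction (Coalgebra.comul (R := k) p) using TensorProduct.induction_on with
          | zero => simp
          | add u v hu hv => simp only [map_add, TensorProduct.add_tmul, hu, hv]
          | tmul p₁ p₂ => simp [append_tmul]

end Powers

section RelativeTensor

variable {k : Type u} {H : Type v} [Field k] [Ring H] [Bialgebra k H]
  {M : Type w} [AddCommGroup M] [Module k M]

/-- For a right action `a : M ⊗ H → M`, the subspace of `M ⊗ H^{⊗(n+1)}` spanned by the elements
`m h ⊗ x - m ⊗ h · x`. -/
noncomputable def balanced (a : M ⊗[k] H →ₗ[k] M) (n : ℕ) : Submodule k (M ⊗[k] pow k H n) :=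
  LinearMap.range (TensorProduct.map a LinearMap.id -
    TensorProduct.map LinearMap.id (diagAct k H n) ∘ₗ
      (TensorProduct.assoc k M H (pow k H n)).toLinearMap)

/-- `M ⊗_H H^{⊗(n+1)}`, with `H` acting diagonally on `H^{⊗(n+1)}`. -/
abbrev RelTensor (a : M ⊗[k] H →ₗ[k] M) (n : ℕ) : Type (max w v) :=
  (M ⊗[k] pow k H n) ⧸ balanced a n

theorem mk_act_tmul (a : M ⊗[k] H →ₗ[k] M) {n : ℕ} (m : M) (h : H) (x : pow k H n) :
    (balanced a n).mkQ (a (m ⊗ₜ h) ⊗ₜ x) = (balanced a n).mkQ (m ⊗ₜ diagAct k H n (h ⊗ₜ x)) := by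
  rw [← sub_eq_zero, ← map_sub, Submodule.mkQ_apply, Submodule.Quotient.mk_eq_zero]
  exact ⟨(m ⊗ₜ h) ⊗ₜ x, by simp⟩

theorem balanced_le_ker (a : M ⊗[k] H →ₗ[k] M) {n : ℕ} {V : Type w'} [AddCommGroup V] [Module k V]
    (f : M ⊗[k] pow k H n →ₗ[k] V)
    (hf : ∀ (m : M) (h : H) (x : pow k H n),
      f (a (m ⊗ₜ h) ⊗ₜ x) = f (m ⊗ₜ diagAct k H n (h ⊗ₜ x))) :
    balanced a n ≤ LinearMap.ker f := by
  rw [balanced, LinearMap.range_le_ker_iff]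
  refine TensorProduct.ext_threefold fun m h x => ?_
  simp [hf]

theorem balanced_le_comap (a : M ⊗[k] H →ₗ[k] M) {n m : ℕ}
    (f : M ⊗[k] pow k H n →ₗ[k] M ⊗[k] pow k H m)
    (hf : ∀ (x : M) (h : H) (y : pow k H n), (balanced a m).mkQ (f (a (x ⊗ₜ h) ⊗ₜ y)) =
      (balanced a m).mkQ (f (x ⊗ₜ diagAct k H n (h ⊗ₜ y)))) :
    balanced a n ≤ (balanced a m).comap f := by
  have := balanced_le_ker a ((balanced a m).mkQ ∘ₗ f) hf
  rwa [LinearMap.ker_comp, Submodule.ker_mkQ] at this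

/-- The map `m ⊗ x ↦ m ⊗ f x` on `M ⊗_H H^{⊗(n+1)}` for an equivariant `f`. -/
noncomputable def relMap (a : M ⊗[k] H →ₗ[k] M) {n m : ℕ} (f : pow k H n →ₗ[k] pow k H m)
    (hf : Equivariant f) : RelTensor a n →ₗ[k] RelTensor a m :=
  Submodule.mapQ _ _ (TensorProduct.map LinearMap.id f) (balanced_le_comap a _ fun x h y => by
    rw [TensorProduct.map_tmul, TensorProduct.map_tmul, LinearMap.id_apply, LinearMap.id_apply,
      mk_act_tmul, hf])

end RelativeTensor

section SAYD

variable (k : Type u) (H : Type v) (M : Type w) [Field k] [Ring H] [HopfAlgebra k H]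
  [AddCommGroup M] [Module k M]

/-- The right action as a linear map `M ⊗ H → M`, `m ⊗ h ↦ m h`. -/
noncomputable def rightAct [Module Hᵐᵒᵖ M] [IsScalarTower k Hᵐᵒᵖ M] : M ⊗[k] H →ₗ[k] M :=
  TensorProduct.lift (LinearMap.mk₂ k (fun (m : M) (h : H) => MulOpposite.op h • m)
    (fun m m' h => smul_add _ m m')
    (fun c m h => smul_comm _ c m)
    (fun m h h' => by rw [MulOpposite.op_add, add_smul])
    (fun c m h => by rw [MulOpposite.op_smul, smul_assoc]))

/-- `(a ⊗ (b ⊗ c)) ⊗ (g ⊗ m) ↦ S(c) g a ⊗ m b`. -/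
noncomputable def aydMap [Module Hᵐᵒᵖ M] [IsScalarTower k Hᵐᵒᵖ M] :
    (H ⊗[k] (H ⊗[k] H)) ⊗[k] (H ⊗[k] M) →ₗ[k] H ⊗[k] M :=
  TensorProduct.map
      (LinearMap.mul' k H ∘ₗ (TensorProduct.comm k H H).toLinearMap ∘ₗ
        TensorProduct.map LinearMap.id
          (LinearMap.mul' k H ∘ₗ TensorProduct.map (HopfAlgebra.antipode k) LinearMap.id) ∘ₗ
        (TensorProduct.assoc k H H H).toLinearMap)
      (rightAct k H M ∘ₗ (TensorProduct.comm k H M).toLinearMap) ∘ₗ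
    (TensorProduct.tensorTensorTensorComm k (H ⊗[k] H) H H M).toLinearMap ∘ₗ
    TensorProduct.map ((TensorProduct.assoc k H H H).symm.toLinearMap ∘ₗ
      TensorProduct.map LinearMap.id (TensorProduct.comm k H H).toLinearMap) LinearMap.id

theorem rightAct_tmul [Module Hᵐᵒᵖ M] [IsScalarTower k Hᵐᵒᵖ M] (m : M) (h : H) :
    rightAct k H M (m ⊗ₜ h) = MulOpposite.op h • m := rfl

theorem aydMap_tmul [Module Hᵐᵒᵖ M] [IsScalarTower k Hᵐᵒᵖ M] (a b c g : H) (m : M) :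
    aydMap k H M ((a ⊗ₜ (b ⊗ₜ c)) ⊗ₜ (g ⊗ₜ m)) =
      (HopfAlgebra.antipode k c * g * a) ⊗ₜ rightAct k H M (m ⊗ₜ b) := by
  simp [aydMap]

/-- A stable anti-Yetter-Drinfeld module: a right `H`-module and left `H`-comodule `M` with
`(m h)⁽⁻¹⁾ ⊗ (m h)⁽⁰⁾ = S(h⁽³⁾) m⁽⁻¹⁾ h⁽¹⁾ ⊗ m⁽⁰⁾ h⁽²⁾` and `m⁽⁰⁾ m⁽⁻¹⁾ = m`. -/
class SAYDModule [Module Hᵐᵒᵖ M] [IsScalarTower k Hᵐᵒᵖ M] where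
  /-- The left coaction `m ↦ m⁽⁻¹⁾ ⊗ m⁽⁰⁾`. -/
  coact : M →ₗ[k] H ⊗[k] M
  coassoc : (TensorProduct.assoc k H H M).toLinearMap ∘ₗ
    TensorProduct.map Coalgebra.comul LinearMap.id ∘ₗ coact =
      TensorProduct.map LinearMap.id coact ∘ₗ coact
  counit : (TensorProduct.lid k M).toLinearMap ∘ₗ
    TensorProduct.map Coalgebra.counit LinearMap.id ∘ₗ coact = LinearMap.id
  ayd : ∀ (m : M) (h : H), coact (MulOpposite.op h • m) =
    aydMap k H M (TensorProduct.map LinearMap.id Coalgebra.comul (Coalgebra.comul (R := k) h) ⊗ₜ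
      coact m)
  stable : ∀ m : M, rightAct k H M (TensorProduct.comm k H M (coact m)) = m

variable [Module Hᵐᵒᵖ M] [IsScalarTower k Hᵐᵒᵖ M] [SAYDModule k H M]

/-- `(g ⊗ m) ⊗ x ↦ m ⊗ rot (g ⊗ x)`. -/
noncomputable def rotAux (n : ℕ) :
    (H ⊗[k] M) ⊗[k] pow k H n →ₗ[k] M ⊗[k] pow k H n :=
  TensorProduct.map LinearMap.id (rot k H n) ∘ₗ
    (TensorProduct.assoc k M H (pow k H n)).toLinearMap ∘ₗ
    TensorProduct.map (TensorProduct.comm k H M).toLinearMap LinearMap.id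

/-- `m ⊗ h₀ ⊗ ⋯ ⊗ hₙ ↦ m⁽⁰⁾ ⊗ h₁ ⊗ ⋯ ⊗ hₙ ⊗ m⁽⁻¹⁾ h₀`, before passing to `M ⊗_H H^{⊗(n+1)}`. -/
noncomputable def twist (n : ℕ) : M ⊗[k] pow k H n →ₗ[k] M ⊗[k] pow k H n :=
  rotAux k H M n ∘ₗ TensorProduct.map SAYDModule.coact LinearMap.id

variable {k H M}

theorem rot_succ_tmul (n : ℕ) (g a : H) (y : pow k H n) :
    rot k H (n + 1) (g ⊗ₜ (powSucc k H n).symm (a ⊗ₜ y)) = append k H n (y ⊗ₜ (g * a)) := by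
  simp [rot]

theorem rot_zero_tmul (g : H) (x : pow k H 0) :
    rot k H 0 (g ⊗ₜ x) = (powZero k H).symm (g * powZero k H x) := by
  simp [rot]

/-- `∑ h⁽¹⁾⁽¹⁾ ⊗ h⁽¹⁾⁽²⁾ S(h⁽²⁾) = h ⊗ 1`, in a form adapted to the computation below. -/
theorem antipode_cancel {V : Type w'} [AddCommGroup V] [Module k V]
    (F : H ⊗[k] H →ₗ[k] V) (h : H) :
    (F ∘ₗ TensorProduct.map LinearMap.id (LinearMap.mul' k H ∘ₗ
        TensorProduct.map LinearMap.id (HopfAlgebra.antipode k)) ∘ₗ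
      (TensorProduct.assoc k H H H).toLinearMap ∘ₗ
      TensorProduct.map Coalgebra.comul LinearMap.id) (Coalgebra.comul h) = F (h ⊗ₜ 1) := by
  have co := Coalgebra.coassoc_apply (R := k) h
  have c2 := Coalgebra.lTensor_counit_comul (R := k) h
  simp only [LinearMap.comp_apply, LinearEquiv.coe_coe]
  congr 1
  rw [LinearMap.rTensor] at co
  rw [co]
  apply_fun TensorProduct.map LinearMap.id (Algebra.linearMap k H) at c2
  refine Eq.trans ?_ (c2.trans (by simp))
  induction (Coalgebra.comul (R := k) h) using TensorProduct.induction_on with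
  | zero => simp
  | add u v hu hv => simp only [map_add, hu, hv]
  | tmul p q =>
    simp only [LinearMap.lTensor_tmul, TensorProduct.map_tmul, LinearMap.id_apply,
      LinearMap.comp_apply]
    congr 1
    exact HopfAlgebra.mul_antipode_lTensor_comul_apply q

theorem twist_balanced (n : ℕ) (m : M) (h : H) (x : pow k H n) :
    (balanced (rightAct k H M) n).mkQ (twist k H M n (rightAct k H M (m ⊗ₜ h) ⊗ₜ x)) =
      (balanced (rightAct k H M) n).mkQ (twist k H M n (m ⊗ₜ diagAct k H n (h ⊗ₜ x))) := by
  simp only [twist, LinearMap.comp_apply, TensorProduct.map_tmul, LinearMap.id_apply]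
  rw [rightAct_tmul, SAYDModule.ayd (k := k)]
  induction (SAYDModule.coact (k := k) (H := H) m) using TensorProduct.induction_on with
  | zero => simp
  | add u v hu hv => simp only [TensorProduct.add_tmul, TensorProduct.tmul_add, map_add, hu, hv]
  | tmul g m =>
    cases n with
    | zero =>
      obtain ⟨a, rfl⟩ := (powZero k H).symm.surjective x
      rw [diagAct_zero_tmul, LinearEquiv.apply_symm_apply]
      have R : (balanced (rightAct k H M) 0).mkQ (rotAux k H M 0 ((g ⊗ₜ m) ⊗ₜ
          (powZero k H).symm (h * a))) =
          ((balanced (rightAct k H M) 0).mkQ ∘ₗ TensorProduct.mk k M _ m ∘ₗ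
            (powZero k H).symm.toLinearMap ∘ₗ LinearMap.mulLeft k g ∘ₗ LinearMap.mulRight k a ∘ₗ
            (TensorProduct.rid k H).toLinearMap) (h ⊗ₜ 1) := by
        simp [rotAux, rot_zero_tmul]
      rw [R, ← Coalgebra.lTensor_counit_comul]
      induction (Coalgebra.comul (R := k) h) using TensorProduct.induction_on with
      | zero => simp
      | add u v hu hv => simp only [map_add, TensorProduct.add_tmul, hu, hv]
      | tmul p q =>
        have A := HopfAlgebra.mul_antipode_lTensor_comul_apply (R := k) q
        apply_fun (balanced (rightAct k H M) 0).mkQ ∘ₗ TensorProduct.mk k M _ m ∘ₗ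
          (powZero k H).symm.toLinearMap ∘ₗ LinearMap.mulRight k (g * p * a) at A
        refine Eq.trans (Eq.trans ?_ A) ?_
        · simp only [TensorProduct.map_tmul, LinearMap.id_apply]
          induction (Coalgebra.comul (R := k) q) using TensorProduct.induction_on with
          | zero => simp
          | add u v hu hv =>
            simp only [map_add, TensorProduct.add_tmul, TensorProduct.tmul_add, hu, hv]
          | tmul q r =>
            simp only [aydMap_tmul, rotAux, LinearMap.comp_apply, TensorProduct.map_tmul,
              LinearEquiv.coe_coe, TensorProduct.comm_tmul, TensorProduct.assoc_tmul,
              LinearMap.id_apply]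
            rw [mk_act_tmul, rot_zero_tmul, diagAct_zero_tmul]
            simp [mul_assoc]
        · simp [Algebra.algebraMap_eq_smul_one, mul_assoc]
    | succ n =>
      obtain ⟨x, rfl⟩ := (powSucc k H n).symm.surjective x
      induction x using TensorProduct.induction_on with
      | zero => simp
      | add y z hy hz => simp only [map_add, TensorProduct.tmul_add, hy, hz]
      | tmul a y =>
        rw [diagAct_succ_tmul]
        induction (Coalgebra.comul (R := k) h) using TensorProduct.induction_on with
        | zero => simp
        | add u v hu hv => simp only [map_add, TensorProduct.add_tmul, TensorProduct.tmul_add, hu, hv]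
        | tmul p q =>
          simp only [TensorProduct.map_tmul, LinearMap.id_apply, LinearMap.mulRight_apply,
            LinearMap.comp_apply, LinearMap.flip_apply, TensorProduct.mk_apply]
          have R : (balanced (rightAct k H M) (n + 1)).mkQ (rotAux k H M (n + 1) ((g ⊗ₜ m) ⊗ₜ
              (powSucc k H n).symm ((p * a) ⊗ₜ diagAct k H n (q ⊗ₜ y)))) =
              ((balanced (rightAct k H M) (n + 1)).mkQ ∘ₗ TensorProduct.mk k M _ m ∘ₗ
                append k H n ∘ₗ TensorProduct.map
                  (diagAct k H n ∘ₗ (TensorProduct.mk k H (pow k H n)).flip y)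
                  (LinearMap.mulRight k (g * p * a))) (q ⊗ₜ 1) := by
            simp [rotAux, rot_succ_tmul, mul_assoc]
          rw [R, ← antipode_cancel]
          induction (Coalgebra.comul (R := k) q) using TensorProduct.induction_on with
          | zero => simp
          | add u v hu hv => simp only [map_add, TensorProduct.add_tmul, TensorProduct.tmul_add, hu, hv]
          | tmul q r =>
            simp only [aydMap_tmul, rotAux, LinearMap.comp_apply, TensorProduct.map_tmul,
              LinearEquiv.coe_coe, TensorProduct.comm_tmul, TensorProduct.assoc_tmul,
              LinearMap.id_apply]
            rw [mk_act_tmul, rot_succ_tmul, diagAct_append]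
            simp only [TensorProduct.mk_apply]
            congr 2
            induction (Coalgebra.comul (R := k) q) using TensorProduct.induction_on with
            | zero => simp
            | add u v hu hv => simp only [map_add, TensorProduct.add_tmul, hu, hv]
            | tmul q₁ q₂ => simp [mul_assoc]

end SAYD

section Rho

variable {k : Type u} [Field k] {H : Type v} [Ring H] [Bialgebra k H] {K : Type v} [Ring K]
  [Bialgebra k K] {M : Type w} [AddCommGroup M] [Module k M] {N : Type w} [AddCommGroup N]
  [Module k N]

/-- The right action `(m ⊗ n)(h ⊗ g) = m h ⊗ n g` of `H ⊗ K` on `M ⊗ N`. -/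
noncomputable def tensorAct (a : M ⊗[k] H →ₗ[k] M) (b : N ⊗[k] K →ₗ[k] N) :
    (M ⊗[k] N) ⊗[k] (H ⊗[k] K) →ₗ[k] M ⊗[k] N :=
  TensorProduct.map a b ∘ₗ (TensorProduct.tensorTensorTensorComm k M N H K).toLinearMap

/-- The left coaction `m ⊗ n ↦ m⁽⁻¹⁾ ⊗ n⁽⁻¹⁾ ⊗ m⁽⁰⁾ ⊗ n⁽⁰⁾` of `H ⊗ K` on `M ⊗ N`. -/
noncomputable def tensorCoact (φ : M →ₗ[k] H ⊗[k] M) (φ' : N →ₗ[k] K ⊗[k] N) :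
    M ⊗[k] N →ₗ[k] (H ⊗[k] K) ⊗[k] (M ⊗[k] N) :=
  (TensorProduct.tensorTensorTensorComm k H M K N).toLinearMap ∘ₗ TensorProduct.map φ φ'

variable (k H K) in
/-- `(h₀ ⊗ g₀) ⊗ ⋯ ⊗ (hₙ ⊗ gₙ) ↦ (h₀ ⊗ ⋯ ⊗ hₙ) ⊗ (g₀ ⊗ ⋯ ⊗ gₙ)`. -/
noncomputable def unzip : (n : ℕ) → pow k (H ⊗[k] K) n →ₗ[k] pow k H n ⊗[k] pow k K n
  | 0 => TensorProduct.map (powZero k H).symm.toLinearMap (powZero k K).symm.toLinearMap ∘ₗ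
      (powZero k (H ⊗[k] K)).toLinearMap
  | n + 1 => TensorProduct.map (powSucc k H n).symm.toLinearMap (powSucc k K n).symm.toLinearMap ∘ₗ
      (TensorProduct.tensorTensorTensorComm k H K (pow k H n) (pow k K n)).toLinearMap ∘ₗ
      TensorProduct.map LinearMap.id (unzip n) ∘ₗ (powSucc k (H ⊗[k] K) n).toLinearMap

variable (k H) in
/-- `Δ^{⊗(n+1)} : H^{⊗(n+1)} → (H ⊗ H)^{⊗(n+1)}`. -/
noncomputable def comulPow : (n : ℕ) → pow k H n →ₗ[k] pow k (H ⊗[k] H) n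
  | 0 => (powZero k (H ⊗[k] H)).symm.toLinearMap ∘ₗ Coalgebra.comul ∘ₗ (powZero k H).toLinearMap
  | n + 1 => (powSucc k (H ⊗[k] H) n).symm.toLinearMap ∘ₗ
      TensorProduct.map Coalgebra.comul (comulPow n) ∘ₗ (powSucc k H n).toLinearMap

theorem unzip_diagAct (n : ℕ) (h : H) (g : K) (x : pow k (H ⊗[k] K) n) :
    unzip k H K n (diagAct k (H ⊗[k] K) n ((h ⊗ₜ g) ⊗ₜ x)) =
      TensorProduct.map (diagAct k H n ∘ₗ TensorProduct.mk k H (pow k H n) h)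
        (diagAct k K n ∘ₗ TensorProduct.mk k K (pow k K n) g) (unzip k H K n x) := by
  induction n generalizing h g with
  | zero =>
    obtain ⟨x, rfl⟩ := (powZero k (H ⊗[k] K)).symm.surjective x
    rw [diagAct_zero_tmul]
    induction x using TensorProduct.induction_on with
    | zero => simp
    | add x y hx hy => simp only [map_add, mul_add, hx, hy]
    | tmul a b => simp [unzip, diagAct_zero_tmul]
  | succ n ih =>
    obtain ⟨x, rfl⟩ := (powSucc k (H ⊗[k] K) n).symm.surjective x
    induction x using TensorProduct.induction_on with
    | zero => simp
    | add x y hx hy => simp only [map_add, TensorProduct.tmul_add, hx, hy]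
    | tmul c y =>
      induction c using TensorProduct.induction_on with
      | zero => simp
      | add c d hc hd => simp only [map_add, TensorProduct.tmul_add, TensorProduct.add_tmul, hc, hd]
      | tmul a b =>
        rw [diagAct_succ_tmul, TensorProduct.comul_tmul]
        simp only [unzip, LinearMap.comp_apply, LinearEquiv.coe_coe,
          LinearEquiv.apply_symm_apply, TensorProduct.map_tmul, LinearMap.id_apply]
        let L (z : pow k H n ⊗[k] pow k K n) : H ⊗[k] K →ₗ[k] pow k H n ⊗[k] pow k K n :=
          TensorProduct.map (diagAct k H n) (diagAct k K n) ∘ₗ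
            (TensorProduct.tensorTensorTensorComm k H K (pow k H n) (pow k K n)).toLinearMap ∘ₗ
            (TensorProduct.mk k (H ⊗[k] K) _).flip z
        have hL : ∀ z q s, L z (q ⊗ₜ s) =
            TensorProduct.map (diagAct k H n ∘ₗ TensorProduct.mk k H (pow k H n) q)
              (diagAct k K n ∘ₗ TensorProduct.mk k K (pow k K n) s) z := by
          intro z q s
          simp only [L, LinearMap.comp_apply, LinearMap.flip_apply, TensorProduct.mk_apply]
          induction z using TensorProduct.induction_on with
          | zero => simp
          | add x y hx hy => simp only [map_add, TensorProduct.tmul_add, hx, hy]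
          | tmul x y => simp
        have hLadd : ∀ z z', L (z + z') = L z + L z' := by
          intro z z'
          simp only [L, map_add, LinearMap.comp_add]
        have hL0 : L 0 = 0 := by
          simp only [L, map_zero, LinearMap.comp_zero]
        have step : ∀ z, TensorProduct.map (powSucc k H n).symm.toLinearMap
            (powSucc k K n).symm.toLinearMap
              (TensorProduct.tensorTensorTensorComm k H K (pow k H n) (pow k K n)
                (TensorProduct.map (LinearMap.mulRight k (a ⊗ₜ[k] b)) (L z)
                  (TensorProduct.tensorTensorTensorComm k H H K K
                    (Coalgebra.comul h ⊗ₜ Coalgebra.comul g)))) =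
            TensorProduct.map
              (diagAct k H (n + 1) ∘ₗ TensorProduct.mk k H (pow k H (n + 1)) h)
              (diagAct k K (n + 1) ∘ₗ TensorProduct.mk k K (pow k K (n + 1)) g)
              (TensorProduct.map (powSucc k H n).symm.toLinearMap
                (powSucc k K n).symm.toLinearMap
                (TensorProduct.tensorTensorTensorComm k H K (pow k H n) (pow k K n)
                  ((a ⊗ₜ b) ⊗ₜ z))) := by
          intro z
          induction z using TensorProduct.induction_on with
          | zero => simp [hL0]
          | add x y hx hy =>
            simp only [hLadd, TensorProduct.map_add_right, LinearMap.add_apply, map_add,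
              TensorProduct.tmul_add, hx, hy]
          | tmul x y =>
            simp only [TensorProduct.tensorTensorTensorComm_tmul, TensorProduct.map_tmul,
              LinearEquiv.coe_coe, LinearMap.comp_apply, TensorProduct.mk_apply,
              diagAct_succ_tmul]
            induction (Coalgebra.comul (R := k) h) using TensorProduct.induction_on with
            | zero => simp
            | add u v hu hv => simp only [map_add, TensorProduct.add_tmul, hu, hv]
            | tmul p q =>
              induction (Coalgebra.comul (R := k) g) using TensorProduct.induction_on with
              | zero => simp
              | add u v hu hv => simp only [map_add, TensorProduct.tmul_add, hu, hv]
              | tmul r s => simp [hL]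
        rw [← step]
        congr 2
        induction (Coalgebra.comul (R := k) h) using TensorProduct.induction_on with
        | zero => simp
        | add u v hu hv => simp only [map_add, TensorProduct.add_tmul, hu, hv]
        | tmul p q =>
          induction (Coalgebra.comul (R := k) g) using TensorProduct.induction_on with
          | zero => simp
          | add u v hu hv => simp only [map_add, TensorProduct.tmul_add, hu, hv]
          | tmul r s =>
            simp [hL, ih]

theorem comulPow_diagAct [Coalgebra.IsCocomm k H] (n : ℕ) (h : H) (x : pow k H n) :
    comulPow k H n (diagAct k H n (h ⊗ₜ x)) =
      diagAct k (H ⊗[k] H) n (Coalgebra.comul h ⊗ₜ comulPow k H n x) := by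
  induction n generalizing h with
  | zero =>
    obtain ⟨x, rfl⟩ := (powZero k H).symm.surjective x
    rw [diagAct_zero_tmul]
    simp [comulPow, diagAct_zero_tmul]
  | succ n ih =>
    obtain ⟨x, rfl⟩ := (powSucc k H n).symm.surjective x
    induction x using TensorProduct.induction_on with
    | zero => simp
    | add x y hx hy => simp only [map_add, TensorProduct.tmul_add, hx, hy]
    | tmul a y =>
      rw [diagAct_succ_tmul]
      simp only [comulPow, LinearMap.comp_apply, LinearEquiv.coe_coe,
        LinearEquiv.apply_symm_apply, TensorProduct.map_tmul]
      rw [diagAct_succ_tmul]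
      have co := LinearMap.congr_fun (Coalgebra.comulCoalgHom k H).map_comp_comul h
      congr 1
      simp only [LinearMap.comp_apply] at co
      have e : (Coalgebra.comul (R := k) (Coalgebra.comul (R := k) h : H ⊗[k] H)) =
        TensorProduct.map Coalgebra.comul Coalgebra.comul (Coalgebra.comul (R := k) h) := co.symm
      rw [e]
      induction (Coalgebra.comul (R := k) h) using TensorProduct.induction_on with
      | zero => simp
      | add u v hu hv => simp only [map_add, hu, hv]
      | tmul p q => simp [ih]

theorem omega_balanced (a : M ⊗[k] H →ₗ[k] M) (b : N ⊗[k] K →ₗ[k] N) (n : ℕ) :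
    balanced (tensorAct a b) n ≤ LinearMap.ker
      (TensorProduct.map (balanced a n).mkQ (balanced b n).mkQ ∘ₗ
        (TensorProduct.tensorTensorTensorComm k M N (pow k H n) (pow k K n)).toLinearMap ∘ₗ
        TensorProduct.map LinearMap.id (unzip k H K n)) := by
  apply balanced_le_ker
  intro m h x
  induction m using TensorProduct.induction_on with
  | zero => simp
  | add u v hu hv => simp only [map_add, TensorProduct.add_tmul, hu, hv]
  | tmul m m' =>
    induction h using TensorProduct.induction_on with
    | zero => simp
    | add u v hu hv => simp only [map_add, TensorProduct.tmul_add, TensorProduct.add_tmul, hu, hv]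
    | tmul h g =>
      simp only [LinearMap.comp_apply, TensorProduct.map_tmul, unzip_diagAct, LinearMap.id_apply]
      induction (unzip k H K n x) using TensorProduct.induction_on with
      | zero => simp
      | add u v hu hv => simp only [map_add, TensorProduct.tmul_add, hu, hv]
      | tmul y z =>
        simp only [tensorAct, LinearMap.comp_apply, LinearEquiv.coe_coe,
          TensorProduct.tensorTensorTensorComm_tmul, TensorProduct.map_tmul, mk_act_tmul,
          TensorProduct.mk_apply]

/-- `Ω : (M ⊗ N) ⊗_{H⊗K} (H ⊗ K)^{⊗(n+1)} → (M ⊗_H H^{⊗(n+1)}) ⊗ (N ⊗_K K^{⊗(n+1)})`. -/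
noncomputable def omega (a : M ⊗[k] H →ₗ[k] M) (b : N ⊗[k] K →ₗ[k] N) (n : ℕ) :
    RelTensor (tensorAct a b) n →ₗ[k] RelTensor a n ⊗[k] RelTensor b n :=
  (balanced (tensorAct a b) n).liftQ _ (omega_balanced a b n)

/-- `Φ = ψ ⊗ Δ^{⊗(n+1)} : M ⊗_H H^{⊗(n+1)} → (M ⊗ M) ⊗_{H⊗H} (H ⊗ H)^{⊗(n+1)}`. -/
noncomputable def phi [Coalgebra.IsCocomm k H] (a : M ⊗[k] H →ₗ[k] M) (ψ : M →ₗ[k] M ⊗[k] M)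
    (hψ : ψ ∘ₗ a = tensorAct a a ∘ₗ TensorProduct.map ψ Coalgebra.comul) (n : ℕ) :
    RelTensor a n →ₗ[k] RelTensor (tensorAct a a) n :=
  (balanced a n).mapQ _ (TensorProduct.map ψ (comulPow k H n)) (by
    have := balanced_le_ker a ((balanced (tensorAct a a) n).mkQ ∘ₗ
        TensorProduct.map ψ (comulPow k H n)) (fun m h x => by
      have e := LinearMap.congr_fun hψ (m ⊗ₜ h)
      simp only [LinearMap.comp_apply, TensorProduct.map_tmul] at e
      simp only [LinearMap.comp_apply, TensorProduct.map_tmul, e, mk_act_tmul, comulPow_diagAct])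
    rwa [LinearMap.ker_comp, Submodule.ker_mkQ] at this)

/-- `ρ = Ω ∘ (ψ ⊗ Δ^{⊗(n+1)})`. -/
noncomputable def rho [Coalgebra.IsCocomm k H] (a : M ⊗[k] H →ₗ[k] M) (ψ : M →ₗ[k] M ⊗[k] M)
    (hψ : ψ ∘ₗ a = tensorAct a a ∘ₗ TensorProduct.map ψ Coalgebra.comul) (n : ℕ) :
    RelTensor a n →ₗ[k] RelTensor a n ⊗[k] RelTensor a n :=
  omega a a n ∘ₗ phi a ψ hψ n

end Rho

section Graded

/-- Bidegrees `(p, q)` with `p + q + e = n`. -/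
abbrev Idx (e n : ℕ) : Type := {p : ℕ × ℕ // p.1 + p.2 + e = n}

/-- The finite direct sum `⨁_{p + q + e = n} Vᵖ ⊗ W^q`, as a product over its finitely many
bidegrees. -/
abbrev GTens (k : Type u) [Field k] (V W : ℕ → Type w) [∀ n, AddCommGroup (V n)]
    [∀ n, Module k (V n)] [∀ n, AddCommGroup (W n)] [∀ n, Module k (W n)] (e n : ℕ) : Type w :=
  ∀ p : Idx e n, V p.1.1 ⊗[k] W p.1.2

variable {k : Type u} [Field k] {V W : ℕ → Type w} [∀ n, AddCommGroup (V n)]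
  [∀ n, Module k (V n)] [∀ n, AddCommGroup (W n)] [∀ n, Module k (W n)]

/-- The component of `d ⊗ 1` in a given bidegree. -/
noncomputable def raiseLeft (dV : ∀ n, V n →ₗ[k] V (n + 1)) (e n : ℕ) :
    (p : Idx e (n + 1)) → GTens k V W e n →ₗ[k] V p.1.1 ⊗[k] W p.1.2
  | ⟨(0, _), _⟩ => 0
  | ⟨(p + 1, q), h⟩ => TensorProduct.map (dV p) LinearMap.id ∘ₗ
      LinearMap.proj (⟨(p, q), by dsimp only at h ⊢; omega⟩ : Idx e n)

/-- The component of `1 ⊗ d`, with the sign `(-1)ᵖ`, in a given bidegree `(p, q)`. -/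
noncomputable def raiseRight (dW : ∀ n, W n →ₗ[k] W (n + 1)) (e n : ℕ) :
    (p : Idx e (n + 1)) → GTens k V W e n →ₗ[k] V p.1.1 ⊗[k] W p.1.2
  | ⟨(_, 0), _⟩ => 0
  | ⟨(p, q + 1), h⟩ => (-1 : k) ^ p • (TensorProduct.map LinearMap.id (dW q) ∘ₗ
      LinearMap.proj (⟨(p, q), by dsimp only at h ⊢; omega⟩ : Idx e n))

/-- `d ⊗ 1 + (-1)ᵖ 1 ⊗ d` for operators of degree `+1`. -/
noncomputable def raise (dV : ∀ n, V n →ₗ[k] V (n + 1)) (dW : ∀ n, W n →ₗ[k] W (n + 1))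
    (e n : ℕ) : GTens k V W e n →ₗ[k] GTens k V W e (n + 1) :=
  LinearMap.pi fun p => raiseLeft dV e n p + raiseRight dW e n p

/-- `B ⊗ 1 + (-1)ᵖ 1 ⊗ B` for operators of degree `-1`. -/
noncomputable def lower (BV : ∀ n, V (n + 1) →ₗ[k] V n) (BW : ∀ n, W (n + 1) →ₗ[k] W n)
    (n : ℕ) : GTens k V W 0 (n + 1) →ₗ[k] GTens k V W 0 n :=
  LinearMap.pi fun p =>
    TensorProduct.map (BV p.1.1) LinearMap.id ∘ₗ
      LinearMap.proj (⟨(p.1.1 + 1, p.1.2), by have := p.2; dsimp only; omega⟩ : Idx 0 (n + 1)) +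
    (-1 : k) ^ p.1.1 • (TensorProduct.map LinearMap.id (BW p.1.2) ∘ₗ
      LinearMap.proj (⟨(p.1.1, p.1.2 + 1), by have := p.2; dsimp only; omega⟩ : Idx 0 (n + 1)))

/-- The component of `S ⊗ 1` in a given bidegree. -/
noncomputable def shiftLeft (SV : ∀ n, V n →ₗ[k] V (n + 2)) (n : ℕ) :
    (p : Idx 0 n) → GTens k V W 2 n →ₗ[k] V p.1.1 ⊗[k] W p.1.2
  | ⟨(0, _), _⟩ => 0
  | ⟨(1, _), _⟩ => 0
  | ⟨(p + 2, q), h⟩ => TensorProduct.map (SV p) LinearMap.id ∘ₗ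
      LinearMap.proj (⟨(p, q), by dsimp only at h ⊢; omega⟩ : Idx 2 n)

/-- The component of `1 ⊗ S` in a given bidegree. -/
noncomputable def shiftRight (SW : ∀ n, W n →ₗ[k] W (n + 2)) (n : ℕ) :
    (p : Idx 0 n) → GTens k V W 2 n →ₗ[k] V p.1.1 ⊗[k] W p.1.2
  | ⟨(_, 0), _⟩ => 0
  | ⟨(_, 1), _⟩ => 0
  | ⟨(p, q + 2), h⟩ => TensorProduct.map LinearMap.id (SW q) ∘ₗ
      LinearMap.proj (⟨(p, q), by dsimp only at h ⊢; omega⟩ : Idx 2 n)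

/-- `S ⊗ 1 - 1 ⊗ S : ⨁_{p+q=n-2} Vᵖ ⊗ W^q → ⨁_{p+q=n} Vᵖ ⊗ W^q`. -/
noncomputable def shiftDiff (SV : ∀ n, V n →ₗ[k] V (n + 2)) (SW : ∀ n, W n →ₗ[k] W (n + 2))
    (n : ℕ) : GTens k V W 2 n →ₗ[k] GTens k V W 0 n :=
  LinearMap.pi fun p => shiftLeft SV n p - shiftRight SW n p

variable (k V W) in
/-- The identification of `⨁_{p+q+2=n+2}` with `⨁_{p+q=n}`. -/
noncomputable def unshift (n : ℕ) : GTens k V W 2 (n + 2) →ₗ[k] GTens k V W 0 n :=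
  LinearMap.pi fun p => LinearMap.proj (⟨p.1, by have := p.2; omega⟩ : Idx 2 (n + 2))

end Graded

/-- A graded vector space `X` with an operator `d` of degree `+1` and graded subspaces `N`.
It encodes the complex `(N, d)`. -/
structure CochainData (k : Type u) [Field k] where
  X : ℕ → Type w
  [grp : ∀ n, AddCommGroup (X n)]
  [mod : ∀ n, Module k (X n)]
  N : ∀ n, Submodule k (X n)
  d : ∀ n, X n →ₗ[k] X (n + 1)

attribute [instance] CochainData.grp CochainData.mod

namespace CochainData

variable {k : Type u} [Field k]

/-- `(N, d)` is a cochain complex. -/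
def IsComplex (A : CochainData.{u, w} k) : Prop :=
  ∀ n, ∀ x ∈ A.N n, A.d n x ∈ A.N (n + 1) ∧ A.d (n + 1) (A.d n x) = 0

/-- The cocycles of `(N, d)`. -/
def Z (A : CochainData.{u, w} k) (n : ℕ) : Submodule k (A.X n) := A.N n ⊓ LinearMap.ker (A.d n)

/-- The coboundaries of `(N, d)`. -/
def Bd (A : CochainData.{u, w} k) : (n : ℕ) → Submodule k (A.X n)
  | 0 => ⊥
  | n + 1 => (A.N n).map (A.d n)

/-- The cohomology of `(N, d)`: cocycles modulo coboundaries. -/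
abbrev H (A : CochainData.{u, w} k) (n : ℕ) : Type w :=
  A.Z n ⧸ (A.Bd n).comap (A.Z n).subtype

/-- The cohomology class of a cocycle. -/
def cls (A : CochainData.{u, w} k) (n : ℕ) : A.Z n →ₗ[k] A.H n :=
  ((A.Bd n).comap (A.Z n).subtype).mkQ

/-- `F` is the map induced on cohomology by `f`, i.e. `f` sends cocycles to cocycles and
`F [z] = [f z]`. -/
def Induces (A : CochainData.{u, w} k) (B : CochainData.{u, w'} k) {n m : ℕ}
    (f : A.X n →ₗ[k] B.X m) (F : A.H n →ₗ[k] B.H m) : Prop :=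
  ∀ z : A.Z n, ∃ hz : f z ∈ B.Z m, F (A.cls n z) = B.cls m ⟨f z, hz⟩

/-- `f` is a map of complexes `(N_A, d) → (N_B, d)`. -/
def IsCochainMap (A : CochainData.{u, w} k) (B : CochainData.{u, w'} k)
    (f : ∀ n, A.X n →ₗ[k] B.X n) : Prop :=
  ∀ n, ∀ x ∈ A.N n, f n x ∈ B.N n ∧ f (n + 1) (A.d n x) = B.d n (f n x)

/-- `0 → A → B → C → 0` is a short exact sequence of complexes. -/
def IsShortExact (A : CochainData.{u, w} k) (B : CochainData.{u, w'} k)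
    (C : CochainData.{u, w''} k) (i : ∀ n, A.X n →ₗ[k] B.X n) (p : ∀ n, B.X n →ₗ[k] C.X n) : Prop :=
  IsCochainMap A B i ∧ IsCochainMap B C p ∧
    (∀ n, ∀ x ∈ A.N n, i n x = 0 → x = 0) ∧
    (∀ n, ∀ y ∈ B.N n, p n y = 0 ↔ ∃ x ∈ A.N n, i n x = y) ∧
    (∀ n, ∀ z ∈ C.N n, ∃ y ∈ B.N n, p n y = z)

/-- `∂ : Hⁿ(C) → Hⁿ⁺¹(A)` is the connecting morphism of `0 → A → B → C → 0`: if `w` lifts the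
cocycle `z` and `y` is sent to `d w`, then `∂ [z] = [y]`. -/
def IsConnecting (A : CochainData.{u, w} k) (B : CochainData.{u, w'} k)
    (C : CochainData.{u, w''} k) (i : ∀ n, A.X n →ₗ[k] B.X n) (p : ∀ n, B.X n →ₗ[k] C.X n)
    (conn : ∀ n, C.H n →ₗ[k] A.H (n + 1)) : Prop :=
  ∀ n, ∀ z : C.Z n, ∀ w ∈ B.N n, ∀ y : A.Z (n + 1),
    p n w = z → i (n + 1) y = B.d n w → conn n (C.cls n z) = A.cls (n + 1) y

/-- The tensor product complex `A ⊗ B`, raised in degree by `e`: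
in degree `n` it is `⨁_{p + q + e = n} Aᵖ ⊗ B^q`. -/
noncomputable abbrev tensor (e : ℕ) (A B : CochainData.{u, w} k) : CochainData.{u, w} k where
  X := GTens k A.X B.X e
  N _ := Submodule.pi Set.univ fun p =>
    LinearMap.range (TensorProduct.map (A.N p.1.1).subtype (B.N p.1.2).subtype)
  d := raise A.d B.d e

/-- `⨁_{p + q + e = n} Hᵖ(A) ⊗ H^q(B)`. -/
abbrev HTens (e : ℕ) (A B : CochainData.{u, w} k) (n : ℕ) : Type w := GTens k A.H B.H e n

/-- `κ` is the algebraic Künneth isomorphism `[α] ⊗ [β] ↦ [α ⊗ β]`. -/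
def IsKunnethIso (e : ℕ) (A B : CochainData.{u, w} k)
    (κ : ∀ n, HTens e A B n ≃ₗ[k] (tensor e A B).H n) : Prop :=
  ∀ n (p : Idx e n) (α : A.Z p.1.1) (β : B.Z p.1.2),
    ∃ h : (Pi.single p ((α : A.X p.1.1) ⊗ₜ[k] (β : B.X p.1.2)) : GTens k A.X B.X e n) ∈
        (tensor e A B).Z n,
      κ n (Pi.single p (A.cls p.1.1 α ⊗ₜ[k] B.cls p.1.2 β)) =
        (tensor e A B).cls n ⟨Pi.single p ((α : A.X p.1.1) ⊗ₜ[k] (β : B.X p.1.2)), h⟩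

end CochainData

/-- Graded vector space with operators `b` of degree `+1` and `B` of degree `-1` and graded
subspaces `N`. It encodes the mixed complex `(N, b, B)`. -/
structure MixedData (k : Type u) [Field k] where
  X : ℕ → Type w
  [grp : ∀ n, AddCommGroup (X n)]
  [mod : ∀ n, Module k (X n)]
  N : ∀ n, Submodule k (X n)
  b : ∀ n, X n →ₗ[k] X (n + 1)
  B : ∀ n, X (n + 1) →ₗ[k] X n

attribute [instance] MixedData.grp MixedData.mod

/-- Pairs `(m, j)` with `m + 2 j = n`; they index the summands `uʲ Cᵐ` of `Totⁿ`. -/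
abbrev TIdx (n : ℕ) : Type := {r : ℕ × ℕ // r.1 + 2 * r.2 = n}

namespace MixedData

variable {k : Type u} [Field k]

/-- The tensor product of mixed complexes. -/
noncomputable abbrev tensor (A B : MixedData.{u, w} k) : MixedData.{u, w} k where
  X := GTens k A.X B.X 0
  N _ := Submodule.pi Set.univ fun p =>
    LinearMap.range (TensorProduct.map (A.N p.1.1).subtype (B.N p.1.2).subtype)
  b := raise A.b B.b 0
  B := lower A.B B.B

/-- The degree `n` part `⨁_{m + 2j = n} uʲ Cᵐ` of the total complex. -/
abbrev TotX (A : MixedData.{u, w} k) (n : ℕ) : Type w := ∀ r : TIdx n, A.X r.1.1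

/-- The component of `b` on the total complex. -/
noncomputable def totb (A : MixedData.{u, w} k) (n : ℕ) :
    (r : TIdx (n + 1)) → A.TotX n →ₗ[k] A.X r.1.1
  | ⟨(0, _), _⟩ => 0
  | ⟨(m + 1, j), h⟩ => A.b m ∘ₗ
      LinearMap.proj (⟨(m, j), by dsimp only at h ⊢; omega⟩ : TIdx n)

/-- The component of `B` on the total complex, `uʲ x ↦ uʲ⁺¹ B x`. -/
noncomputable def totB (A : MixedData.{u, w} k) (n : ℕ) :
    (r : TIdx (n + 1)) → A.TotX n →ₗ[k] A.X r.1.1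
  | ⟨(_, 0), _⟩ => 0
  | ⟨(m, j + 1), h⟩ => A.B m ∘ₗ
      LinearMap.proj (⟨(m + 1, j), by dsimp only at h ⊢; omega⟩ : TIdx n)

/-- The total complex of the `(b, B)`-bicomplex, with differential `b + B`. -/
noncomputable abbrev tot (A : MixedData.{u, w} k) : CochainData.{u, w} k where
  X := A.TotX
  N _ := Submodule.pi Set.univ fun r => A.N r.1.1
  d n := LinearMap.pi fun r => A.totb n r + A.totB n r

/-- The component of the periodicity map. -/
noncomputable def perComp (A : MixedData.{u, w} k) (n : ℕ) :
    (r : TIdx (n + 2)) → A.TotX n →ₗ[k] A.X r.1.1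
  | ⟨(_, 0), _⟩ => 0
  | ⟨(m, j + 1), h⟩ => LinearMap.proj (⟨(m, j), by dsimp only at h ⊢; omega⟩ : TIdx n)

/-- Connes' periodicity map `S : Totⁿ → Totⁿ⁺²`, `uʲ x ↦ uʲ⁺¹ x`. -/
noncomputable def per (A : MixedData.{u, w} k) (n : ℕ) : A.tot.X n →ₗ[k] A.tot.X (n + 2) :=
  LinearMap.pi fun r => A.perComp n r

/-- The map `μ : ⨁_{p+q=n} Totᵖ(A) ⊗ Tot^q(B) → Totⁿ(A ⊗ B)`,
`uⁱ x ⊗ uʲ y ↦ uⁱ⁺ʲ (x ⊗ y)`. -/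
noncomputable def mu (A B : MixedData.{u, w} k) (n : ℕ) :
    (CochainData.tensor 0 A.tot B.tot).X n →ₗ[k] (tensor A B).tot.X n :=
  LinearMap.pi fun r => LinearMap.pi fun c => ∑ i : Fin (r.1.2 + 1),
    TensorProduct.map
      (LinearMap.proj (⟨(c.1.1, (i : ℕ)), rfl⟩ : TIdx (c.1.1 + 2 * i)))
      (LinearMap.proj (⟨(c.1.2, r.1.2 - i), rfl⟩ : TIdx (c.1.2 + 2 * (r.1.2 - i)))) ∘ₗ
    LinearMap.proj (φ := fun p : Idx 0 n => A.TotX p.1.1 ⊗[k] B.TotX p.1.2)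
      (⟨(c.1.1 + 2 * i, c.1.2 + 2 * (r.1.2 - i)), by
        have h1 := r.2; have h2 := c.2; have h3 := i.2; dsimp only; omega⟩ : Idx 0 n)

end MixedData

/-- A graded vector space with cofaces `δᵢ`, codegeneracies `σᵢ` and cyclic operators `τ`. -/
structure CocyclicData (k : Type u) [Field k] where
  X : ℕ → Type w
  [grp : ∀ n, AddCommGroup (X n)]
  [mod : ∀ n, Module k (X n)]
  δ : ∀ n, Fin (n + 2) → (X n →ₗ[k] X (n + 1))
  σ : ∀ n, Fin (n + 1) → (X (n + 1) →ₗ[k] X n)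
  τ : ∀ n, Module.End k (X n)

attribute [instance] CocyclicData.grp CocyclicData.mod

/-- The identities of a cocyclic module. -/
structure CocyclicData.IsCocyclic {k : Type u} [Field k] (C : CocyclicData.{u, w} k) : Prop where
  δ_δ : ∀ n (i j : Fin (n + 2)), i ≤ j →
    C.δ (n + 1) j.succ ∘ₗ C.δ n i = C.δ (n + 1) i.castSucc ∘ₗ C.δ n j
  σ_σ : ∀ n (i j : Fin (n + 1)), i ≤ j →
    C.σ n j ∘ₗ C.σ (n + 1) i.castSucc = C.σ n i ∘ₗ C.σ (n + 1) j.succ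
  σ_δ_of_le : ∀ n (i : Fin (n + 2)) (j : Fin (n + 1)), i ≤ j.castSucc →
    C.σ (n + 1) j.succ ∘ₗ C.δ (n + 1) i.castSucc = C.δ n i ∘ₗ C.σ n j
  σ_δ_self : ∀ n (i : Fin (n + 1)), C.σ n i ∘ₗ C.δ n i.castSucc = LinearMap.id
  σ_δ_succ : ∀ n (i : Fin (n + 1)), C.σ n i ∘ₗ C.δ n i.succ = LinearMap.id
  σ_δ_of_gt : ∀ n (i : Fin (n + 2)) (j : Fin (n + 1)), j.castSucc < i →
    C.σ (n + 1) j.castSucc ∘ₗ C.δ (n + 1) i.succ = C.δ n i ∘ₗ C.σ n j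
  τ_δ_succ : ∀ n (i : Fin (n + 1)), C.τ (n + 1) ∘ₗ C.δ n i.succ = C.δ n i.castSucc ∘ₗ C.τ n
  τ_δ_zero : ∀ n, C.τ (n + 1) ∘ₗ C.δ n 0 = C.δ n (Fin.last (n + 1))
  τ_σ_succ : ∀ n (i : Fin n), C.τ n ∘ₗ C.σ n i.succ = C.σ n i.castSucc ∘ₗ C.τ (n + 1)
  τ_σ_zero : ∀ n, C.τ n ∘ₗ C.σ n 0 = C.σ n (Fin.last n) ∘ₗ C.τ (n + 1) ∘ₗ C.τ (n + 1)
  τ_pow : ∀ n, C.τ n ^ (n + 1) = 1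

/-- The `(i, j)`-shuffles, as permutations `σ` of `{0, …, i + j - 1}`. -/
def shuffles (i j : ℕ) : Finset (Equiv.Perm (Fin (i + j))) :=
  Finset.univ.filter fun s =>
    (∀ a b : Fin i, a < b → s (Fin.castAdd j a) < s (Fin.castAdd j b)) ∧
    (∀ a b : Fin j, a < b → s (Fin.natAdd i a) < s (Fin.natAdd i b))

namespace CocyclicData

variable {k : Type u} [Field k]

/-- The normalized cochains: the common kernel of the codegeneracies. -/
def normalized (C : CocyclicData.{u, w} k) : (n : ℕ) → Submodule k (C.X n)
  | 0 => ⊤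
  | n + 1 => ⨅ i, LinearMap.ker (C.σ n i)

/-- The Hochschild differential `b = ∑ᵢ (-1)ⁱ δᵢ`. -/
def b (C : CocyclicData.{u, w} k) (n : ℕ) : C.X n →ₗ[k] C.X (n + 1) :=
  ∑ i : Fin (n + 2), (-1 : k) ^ (i : ℕ) • C.δ n i

/-- Connes' differential `B = N σ₋₁ (1 - λ)`, where `λ = (-1)ⁿ τₙ` on `Cⁿ`, `N = ∑ⱼ λʲ` and
`σ₋₁ = σₙ τₙ₊₁ : Cⁿ⁺¹ → Cⁿ`. -/
def B (C : CocyclicData.{u, w} k) (n : ℕ) : C.X (n + 1) →ₗ[k] C.X n :=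
  (∑ j : Fin (n + 1), ((-1 : k) ^ n • C.τ n) ^ (j : ℕ)) ∘ₗ (C.σ n (Fin.last n) ∘ₗ C.τ (n + 1)) ∘ₗ
    (LinearMap.id - (-1 : k) ^ (n + 1) • C.τ (n + 1))

/-- The normalized mixed complex of a cocyclic module. -/
abbrev mixed (C : CocyclicData.{u, w} k) : MixedData.{u, w} k where
  X := C.X
  N := C.normalized
  b := C.b
  B := C.B

/-- The normalized total complex computing cyclic cohomology. -/
noncomputable abbrev tot (C : CocyclicData.{u, w} k) : CochainData.{u, w} k := C.mixed.tot

/-- Cyclic cohomology. -/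
abbrev HC (C : CocyclicData.{u, w} k) (n : ℕ) : Type w := C.tot.H n

/-- The diagonal cocyclic module `C × C'`. -/
noncomputable abbrev diag (C C' : CocyclicData.{u, w} k) : CocyclicData.{u, w} k where
  X n := C.X n ⊗[k] C'.X n
  δ n i := TensorProduct.map (C.δ n i) (C'.δ n i)
  σ n i := TensorProduct.map (C.σ n i) (C'.σ n i)
  τ n := TensorProduct.map (C.τ n) (C'.τ n)

/-- The identity map `Cⁿ → Cᵐ` for `n = m`. -/
def castX (C : CocyclicData.{u, w} k) {n m : ℕ} (h : n = m) : C.X n →ₗ[k] C.X m :=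
  h ▸ LinearMap.id

/-- `σ_{f(0)} σ_{f(1)} ⋯ σ_{f(j-1)} : C^{i+j} → Cⁱ`. -/
def degens (C : CocyclicData.{u, w} k) (i : ℕ) :
    (j : ℕ) → (Fin j → ℕ) → (C.X (i + j) →ₗ[k] C.X i)
  | 0, _ => LinearMap.id
  | j + 1, f => C.degens i j (fun a => f a.castSucc) ∘ₗ
      C.σ (i + j) (Fin.ofNat (i + j + 1) (f (Fin.last j)))

/-- The degeneracies of an `(i, j)`-shuffle on the first factor,
`σ_{s(i+1)} ⋯ σ_{s(i+j)}` in terms of the permuted set `{1, …, i + j}` shifted down by one. -/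
def degensLeft (C : CocyclicData.{u, w} k) {i j : ℕ} (s : Equiv.Perm (Fin (i + j))) :
    C.X (i + j) →ₗ[k] C.X i :=
  C.degens i j fun a => (s (Fin.natAdd i a) : ℕ)

/-- The degeneracies `σ_{s(1)} ⋯ σ_{s(i)}` of an `(i, j)`-shuffle on the second factor. -/
def degensRight (C : CocyclicData.{u, w} k) {i j : ℕ} (s : Equiv.Perm (Fin (i + j))) :
    C.X (i + j) →ₗ[k] C.X j :=
  C.degens j i (fun a => (s (Fin.castAdd j a) : ℕ)) ∘ₗ C.castX (Nat.add_comm i j)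

/-- The shuffle map `sh : Cⁿ ⊗ C'ⁿ → ⨁_{i+j=n} Cⁱ ⊗ C'ʲ`. -/
noncomputable def sh (C C' : CocyclicData.{u, w} k) (n : ℕ) :
    (diag C C').X n →ₗ[k] GTens k C.X C'.X 0 n :=
  LinearMap.pi fun p => ∑ s ∈ shuffles p.1.1 p.1.2, ((Equiv.Perm.sign s : ℤ) : k) •
    TensorProduct.map (C.degensLeft s ∘ₗ C.castX p.2.symm) (C'.degensRight s ∘ₗ C'.castX p.2.symm)

/-- `σ_{a-p} τ^{p+1} : Cᵃ⁺¹ → Cᵃ`, which is `τᵖ` after the extra degeneracy. -/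
def cycDegen (C : CocyclicData.{u, w} k) (a : ℕ) (p : Fin (a + 1)) : C.X (a + 1) →ₗ[k] C.X a :=
  C.σ a p.rev ∘ₗ (C.τ (a + 1) ^ ((p : ℕ) + 1))

/-- The cyclic shuffle map `sh' : Cⁿ⁺² ⊗ C'ⁿ⁺² → ⨁_{a+b=n} Cᵃ ⊗ C'ᵇ`. With `i = a + 1` and
`j = b + 1`, a cyclic shuffle consists of rotations `p` of the first `i` letters and `q` of the
last `j` letters followed by an `(i, j)`-shuffle `s`, such that the first letter of the first
block ends up before the first letter of the second block. Its sign is the sign of the resulting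
permutation. -/
noncomputable def sh' (C C' : CocyclicData.{u, w} k) (n : ℕ) :
    (diag C C').X (n + 2) →ₗ[k] GTens k C.X C'.X 0 n :=
  LinearMap.pi fun c => ∑ p : Fin (c.1.1 + 1), ∑ q : Fin (c.1.2 + 1),
    ∑ s ∈ (shuffles (c.1.1 + 1) (c.1.2 + 1)).filter
        (fun s => s (Fin.castAdd (c.1.2 + 1) p) < s (Fin.natAdd (c.1.1 + 1) q)),
      ((-1 : k) ^ c.1.1 * ((-1 : k) ^ ((p : ℕ) * c.1.1 + (q : ℕ) * c.1.2) *
          ((Equiv.Perm.sign s : ℤ) : k))) •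
        TensorProduct.map
          (C.cycDegen c.1.1 p ∘ₗ C.degensLeft s ∘ₗ
            C.castX (by have := c.2; omega : n + 2 = c.1.1 + 1 + (c.1.2 + 1)))
          (C'.cycDegen c.1.2 q ∘ₗ C'.degensRight s ∘ₗ
            C'.castX (by have := c.2; omega : n + 2 = c.1.1 + 1 + (c.1.2 + 1)))

/-- The mixed complex `C ⊗ C'`. -/
noncomputable abbrev tens (C C' : CocyclicData.{u, w} k) : MixedData.{u, w} k :=
  MixedData.tensor C.mixed C'.mixed

/-- The contribution of `sh'`, `uʲ x ↦ uʲ⁺¹ sh' x`. -/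
noncomputable def shTildeAux (C C' : CocyclicData.{u, w} k) (n : ℕ) :
    (r : TIdx n) → (diag C C').tot.X n →ₗ[k] (tens C C').X r.1.1
  | ⟨(_, 0), _⟩ => 0
  | ⟨(m, j + 1), h⟩ => sh' C C' m ∘ₗ
      LinearMap.proj (φ := fun r : TIdx n => (diag C C').X r.1.1)
        (⟨(m + 2, j), by dsimp only at h ⊢; omega⟩ : TIdx n)

/-- The contribution of `sh`, `uʲ x ↦ uʲ sh x`. -/
noncomputable def shTildeDiag (C C' : CocyclicData.{u, w} k) (n : ℕ) (r : TIdx n) :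
    (diag C C').tot.X n →ₗ[k] (tens C C').X r.1.1 :=
  sh C C' r.1.1 ∘ₗ LinearMap.proj (φ := fun r : TIdx n => (diag C C').X r.1.1) r

/-- The map `Sh~ : Totⁿ(C × C') → Totⁿ(C ⊗ C')` with matrix entries `sh` on the diagonal and
`sh'` above it. -/
noncomputable def shTilde (C C' : CocyclicData.{u, w} k) (n : ℕ) :
    (diag C C').tot.X n →ₗ[k] (tens C C').tot.X n :=
  LinearMap.pi fun r => shTildeDiag C C' n r + shTildeAux C C' n r

/-- A degreewise family of maps `Cᵐ → C'ᵐ`, applied to every summand of the total complex. -/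
noncomputable def totMap (C C' : CocyclicData.{u, w} k) (f : ∀ m, C.X m →ₗ[k] C'.X m) (n : ℕ) :
    C.tot.X n →ₗ[k] C'.tot.X n :=
  LinearMap.pi fun r => f r.1.1 ∘ₗ LinearMap.proj (φ := fun r : TIdx n => C.X r.1.1) r

/-- `f` is an `S`-map: a map of total complexes that commutes with the periodicity map. -/
def IsSMap (A : MixedData.{u, w} k) (A' : MixedData.{u, w'} k)
    (f : ∀ n, A.tot.X n →ₗ[k] A'.tot.X n) : Prop :=
  CochainData.IsCochainMap A.tot A'.tot f ∧
    ∀ n, ∀ x ∈ A.tot.N n, f (n + 2) (A.per n x) = A'.per n (f n x)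

/-- `ς : HCⁿ(C ⊗ C') → ⨁_{p+q=n} HCᵖ(C) ⊗ HC^q(C')` is the cyclic Künneth map
`∂ μ (S ⊗ 1 - 1 ⊗ S) ∂`, formed from the maps of the long exact sequence of
`0 → (Tot(C) ⊗ Tot(C'))[-2] → Tot(C) ⊗ Tot(C') → Tot(C ⊗ C') → 0`, in which the cohomology of
`Tot(C) ⊗ Tot(C')` is identified with the tensor product of the cohomologies. -/
def IsCyclicKunnethMap (C C' : CocyclicData.{u, w} k)
    (ς : ∀ n, (tens C C').tot.H n →ₗ[k] CochainData.HTens 0 C.tot C'.tot n) : Prop :=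
  let i := shiftDiff (k := k) (V := C.tot.X) (W := C'.tot.X) C.mixed.per C'.mixed.per
  let μ := MixedData.mu C.mixed C'.mixed
  CochainData.IsShortExact (CochainData.tensor 2 C.tot C'.tot) (CochainData.tensor 0 C.tot C'.tot)
      (tens C C').tot i μ ∧
  ∃ (S : ∀ n, C.HC n →ₗ[k] C.HC (n + 2)) (S' : ∀ n, C'.HC n →ₗ[k] C'.HC (n + 2))
    (κ₂ : ∀ n, CochainData.HTens 2 C.tot C'.tot n ≃ₗ[k] (CochainData.tensor 2 C.tot C'.tot).H n)
    (κ₀ : ∀ n, CochainData.HTens 0 C.tot C'.tot n ≃ₗ[k] (CochainData.tensor 0 C.tot C'.tot).H n)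
    (μ' : ∀ n, (CochainData.tensor 0 C.tot C'.tot).H n →ₗ[k] (tens C C').tot.H n)
    (conn : ∀ n, (tens C C').tot.H n →ₗ[k] (CochainData.tensor 2 C.tot C'.tot).H (n + 1)),
    (∀ n, CochainData.Induces C.tot C.tot (C.mixed.per n) (S n)) ∧
    (∀ n, CochainData.Induces C'.tot C'.tot (C'.mixed.per n) (S' n)) ∧
    CochainData.IsKunnethIso 2 C.tot C'.tot κ₂ ∧
    CochainData.IsKunnethIso 0 C.tot C'.tot κ₀ ∧
    (∀ n, CochainData.Induces (CochainData.tensor 0 C.tot C'.tot) (tens C C').tot (μ n) (μ' n)) ∧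
    CochainData.IsConnecting (CochainData.tensor 2 C.tot C'.tot)
      (CochainData.tensor 0 C.tot C'.tot) (tens C C').tot i μ conn ∧
    ∀ n, ς n = unshift k C.HC C'.HC n ∘ₗ
      ((κ₂ (n + 2)).symm.toLinearMap ∘ₗ conn (n + 1)) ∘ₗ
      (μ' (n + 1) ∘ₗ (κ₀ (n + 1)).toLinearMap) ∘ₗ
      shiftDiff S S' (n + 1) ∘ₗ
      ((κ₂ (n + 1)).symm.toLinearMap ∘ₗ conn n)

end CocyclicData

section HopfCyclic

variable (k : Type u) (H : Type v) (M : Type w) [Field k] [Ring H] [HopfAlgebra k H]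
  [AddCommGroup M] [Module k M] [Module Hᵐᵒᵖ M] [IsScalarTower k Hᵐᵒᵖ M] [SAYDModule k H M]

/-- The cyclic operator `m ⊗ h₀ ⊗ ⋯ ⊗ hₙ ↦ m⁽⁰⁾ ⊗ h₁ ⊗ ⋯ ⊗ hₙ ⊗ m⁽⁻¹⁾ h₀` on
`M ⊗_H H^{⊗(n+1)}`. -/
noncomputable def cyclicOp (n : ℕ) :
    RelTensor (rightAct k H M) n →ₗ[k] RelTensor (rightAct k H M) n :=
  (balanced (rightAct k H M) n).mapQ _ (twist k H M n)
    (balanced_le_comap _ _ fun m h x => twist_balanced n m h x)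

/-- The cocyclic module `C(H, M)`, `Cⁿ = M ⊗_H H^{⊗(n+1)}`. The coface `δᵢ : Cⁿ → Cⁿ⁺¹` applies
`Δ` to `hᵢ` for `i ≤ n`, and the last one is
`m ⊗ h₀ ⊗ ⋯ ⊗ hₙ ↦ m⁽⁰⁾ ⊗ h₀⁽²⁾ ⊗ h₁ ⊗ ⋯ ⊗ hₙ ⊗ m⁽⁻¹⁾ h₀⁽¹⁾`. -/
noncomputable abbrev hopfCocyclic : CocyclicData.{u, max w v} k where
  X n := RelTensor (rightAct k H M) n
  δ n i := if (i : ℕ) ≤ n then relMap (rightAct k H M) (dup k H n i) (dup_equivariant n i)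
    else cyclicOp k H M (n + 1) ∘ₗ relMap (rightAct k H M) (dup k H n 0) (dup_equivariant n 0)
  σ n i := relMap (rightAct k H M) (kill k H n i) (kill_equivariant n i)
  τ n := cyclicOp k H M n

end HopfCyclic

end HopfCyc

set_option linter.unusedSectionVars false

/-! Four nearly independent facts carry the theorem: `C` is cocyclic, ρ respects all its operators,
`sh` and `sh'` together form a map of total complexes, and the sequence of total complexes is exact
with cohomology computed by the algebraic Künneth theorem over a field. Every ingredient of the
coproduct is determined by its values on representatives, so the final `∃!` reduces to existence and
uniqueness of each ingredient.

Cocyclic structure. The identities hold already on `M ⊗ H^{⊗(n+1)}`, by coassociativity and counits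
of `H` and of the coaction, with one exception. A full turn sends `m ⊗ x` to `m⁽⁰⁾ ⊗ m⁽⁻¹⁾·x`
(`twist_pow`); over `H` this is `m⁽⁰⁾m⁽⁻¹⁾ ⊗ x`, which is `m ⊗ x` by stability. Cocommutativity
makes Δ a coalgebra map, so that ρ commutes with the cofaces (`powComul_dup`); compatibility of ψ
with the coactions gives the cyclic operators (`rho_cyclicOp`).

Mixed complex. All `Cⁿ` are put into one space `Total`, on which the operators carry plain natural
indices. With `s = σₙτₙ₊₁` and `b'` the sum `b` without its last coface, one has `(1 - λ)b = b'(1 -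
λ)`, `N b' = b N` and `s b' + b' s = 1`; these give `bB + Bb = 0` for `B = N s (1 - λ)`. On
normalized cochains `B = N s`, because `s λ = -λ σ₀`.

Shuffles. Let ε be the sign of the left degree and `zₘ = σₘ ⊗ 1 + ε(1 ⊗ σₘ)`. Expanding `z₀ z₁ ⋯
zₙ₋₁` gives a sum over words in two letters, that is, over all shuffles with their signs, up to ε.
The relation `b sh = sh b` then follows from the single commutation rule `dgt_zt` by appending
letters. For the cyclic shuffles there is an operator Γ (`gam`) which, with `∂ = b ⊗ 1 - ε(1 ⊗ b)`
and `z` the product of letters, satisfies `Γ b' = ∂ Γ + z N` (`gam_bl`), `Γ (1 - λ) = ε(1 ⊗ N s) z -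
(N s ⊗ 1) z` (`gam_sub_cy`), `sh' = ε Γ s` (`sn_gam_xs`). Substituting `b' s = 1 - λ - s b` yields
`B sh + b sh' = sh B + sh' b` (`B2_sn_zr_add`). The remaining relations `B sh' = 0` and `sh' B = 0`
hold on normalized cochains because the relevant elements are killed by `s`. The first identity for
Γ is algebra of letters. The other two come from rotating words: Γ is a sum over words with one
marked letter, and a power of the diagonal τ cuts a word and exchanges its two pieces
(`xb_opAt_tw_pow`, `xb_opAt_tw_pow_xs`).

Künneth. A total complex consists of polynomials in `u`; `S ⊗ 1 - 1 ⊗ S` is multiplication by `u -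
u'` and μ sets `u = u'`, so exactness is division by `u - u'`. Over a field each complex retracts
linearly onto its cohomology, and the tensor product of two such retractions is the Künneth
isomorphism. -/

namespace HopfCyc

/-! ### Simplicial relations between the operators on tensor powers of `H`. -/

section PowRelations

variable {k : Type u} {H : Type v} [Field k] [Ring H] [Bialgebra k H]

variable (k H) in
/-- `(a, h₀ ⊗ ⋯ ⊗ hₙ) ↦ a ⊗ h₀ ⊗ ⋯ ⊗ hₙ` as a bilinear map. -/
noncomputable def cons (n : ℕ) : H →ₗ[k] pow k H n →ₗ[k] pow k H (n + 1) :=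
  (TensorProduct.mk k H (pow k H n)).compr₂ (powSucc k H n).symm.toLinearMap

theorem cons_apply (n : ℕ) (a : H) (y : pow k H n) :
    cons k H n a y = (powSucc k H n).symm (a ⊗ₜ y) := rfl

theorem cons_induction {n : ℕ} {P : pow k H (n + 1) → Prop} (x : pow k H (n + 1))
    (h0 : P 0) (hadd : ∀ x y, P x → P y → P (x + y)) (h : ∀ a y, P (cons k H n a y)) : P x := by
  obtain ⟨x, rfl⟩ := (powSucc k H n).symm.surjective x
  induction x using TensorProduct.induction_on with
  | zero => simpa using h0
  | tmul a y => exact h a y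
  | add x y hx hy => rw [map_add]; exact hadd _ _ hx hy

variable (k H) in
/-- `a ↦ a` from `H` to `H^{⊗1}`. -/
noncomputable def single : H →ₗ[k] pow k H 0 := (powZero k H).symm.toLinearMap

theorem single_surjective (x : pow k H 0) : ∃ a, single k H a = x :=
  ⟨powZero k H x, (powZero k H).symm_apply_apply x⟩

@[simp] theorem powZero_single (a : H) : powZero k H (single k H a) = a :=
  (powZero k H).apply_symm_apply a

@[simp] theorem powSucc_cons (n : ℕ) (a : H) (y : pow k H n) :
    powSucc k H n (cons k H n a y) = a ⊗ₜ y :=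
  (powSucc k H n).apply_symm_apply _

theorem dup_zero (i : ℕ) (a : H) : dup k H 0 i (single k H a) =
    TensorProduct.lift ((cons k H 0).compl₂ (single k H)) (Coalgebra.comul (R := k) a) := by
  simp only [dup, LinearMap.comp_apply, LinearEquiv.coe_coe, powZero_single]
  induction (Coalgebra.comul (R := k) a) using TensorProduct.induction_on with
  | zero => simp
  | add u v hu hv => simp only [map_add, hu, hv]
  | tmul p q => rfl

theorem dup_succ_zero (n : ℕ) (a : H) (y : pow k H n) : dup k H (n + 1) 0 (cons k H n a y) =
    TensorProduct.lift ((cons k H (n + 1)).compl₂ ((cons k H n).flip y))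
      (Coalgebra.comul (R := k) a) := by
  simp only [dup, LinearMap.comp_apply, LinearEquiv.coe_coe, powSucc_cons,
    TensorProduct.map_tmul]
  induction (Coalgebra.comul (R := k) a) using TensorProduct.induction_on with
  | zero => simp
  | add u v hu hv => simp only [map_add, hu, hv, TensorProduct.add_tmul]
  | tmul p q => rfl

theorem dup_succ_succ (n i : ℕ) (a : H) (y : pow k H n) :
    dup k H (n + 1) (i + 1) (cons k H n a y) = cons k H (n + 1) a (dup k H n i y) := by
  simp [dup, cons_apply]

theorem kill_zero (i : ℕ) (a b : H) : kill k H 0 i (cons k H 0 a (single k H b)) =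
    Coalgebra.counit (R := k) b • single k H a := by
  simp [kill, single]

theorem kill_succ_zero (n : ℕ) (a b : H) (y : pow k H n) :
    kill k H (n + 1) 0 (cons k H (n + 1) a (cons k H n b y)) =
    Coalgebra.counit (R := k) b • cons k H n a y := by
  simp [kill, cons_apply]

theorem kill_succ_succ (n i : ℕ) (a : H) (y : pow k H (n + 1)) :
    kill k H (n + 1) (i + 1) (cons k H (n + 1) a y) = cons k H n a (kill k H n i y) := by
  simp [kill, cons_apply]

theorem append_zero (a b : H) :
    append k H 0 (single k H a ⊗ₜ b) = cons k H 0 a (single k H b) := by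
  simp [append, single, cons_apply]

theorem append_succ (n : ℕ) (a b : H) (y : pow k H n) :
    append k H (n + 1) (cons k H n a y ⊗ₜ b) = cons k H (n + 1) a (append k H n (y ⊗ₜ b)) :=
  append_tmul n a b y

theorem rot_zero (g a : H) : rot k H 0 (g ⊗ₜ single k H a) = single k H (g * a) := by
  simp [rot, single]

theorem rot_succ (n : ℕ) (g a : H) (y : pow k H n) :
    rot k H (n + 1) (g ⊗ₜ cons k H n a y) = append k H n (y ⊗ₜ (g * a)) := by
  simp [rot]

/-- Coassociativity, applied under a linear map. -/
theorem coassoc_congr {V : Type w} [AddCommGroup V] [Module k V]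
    (F : H ⊗[k] (H ⊗[k] H) →ₗ[k] V) (A B : H ⊗[k] H →ₗ[k] V)
    (hA : ∀ p q, A (p ⊗ₜ q) = F (TensorProduct.assoc k H H H (Coalgebra.comul (R := k) p ⊗ₜ q)))
    (hB : ∀ p q, B (p ⊗ₜ q) = F (p ⊗ₜ Coalgebra.comul (R := k) q)) (a : H) :
    A (Coalgebra.comul (R := k) a) = B (Coalgebra.comul (R := k) a) := by
  have hA' : A = F ∘ₗ (TensorProduct.assoc k H H H).toLinearMap ∘ₗ
      LinearMap.rTensor H Coalgebra.comul := TensorProduct.ext' fun p q => by simp [hA]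
  have hB' : B = F ∘ₗ LinearMap.lTensor H Coalgebra.comul :=
    TensorProduct.ext' fun p q => by simp [hB]
  rw [hA', hB']
  simp only [LinearMap.comp_apply, LinearEquiv.coe_coe, Coalgebra.coassoc_apply]

/-- For use under further operators: the hypothesis is tested on pure tensors, where the two
Sweedler legs are independent, and the counit axiom is applied once at the end. `counit_right_congr`
is the mirror image. -/
theorem counit_left_congr {V : Type w} [AddCommGroup V] [Module k V]
    (F : H →ₗ[k] V) (A : H ⊗[k] H →ₗ[k] V)
    (hA : ∀ p q, A (p ⊗ₜ q) = Coalgebra.counit (R := k) p • F q) (a : H) :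
    A (Coalgebra.comul (R := k) a) = F a := by
  have hA' : A = F ∘ₗ (TensorProduct.lid k H).toLinearMap ∘ₗ
      LinearMap.rTensor H Coalgebra.counit := TensorProduct.ext' fun p q => by simp [hA]
  rw [hA']
  simp [Coalgebra.rTensor_counit_comul]

theorem counit_right_congr {V : Type w} [AddCommGroup V] [Module k V]
    (F : H →ₗ[k] V) (A : H ⊗[k] H →ₗ[k] V)
    (hA : ∀ p q, A (p ⊗ₜ q) = Coalgebra.counit (R := k) q • F p) (a : H) :
    A (Coalgebra.comul (R := k) a) = F a := by
  have hA' : A = F ∘ₗ (TensorProduct.rid k H).toLinearMap ∘ₗ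
      LinearMap.lTensor H Coalgebra.counit := TensorProduct.ext' fun p q => by simp [hA]
  rw [hA']
  simp [Coalgebra.lTensor_counit_comul]

/-- Removing the head factor lowers both indices, so only `i = 0` matters: for `j = 0` this is
coassociativity in the head slot, and for `j > 0` the two operators touch different slots. -/
theorem dup_dup (n : ℕ) : ∀ i j : ℕ, i ≤ j → j ≤ n → ∀ x : pow k H n,
    dup k H (n + 1) (j + 1) (dup k H n i x) = dup k H (n + 1) i (dup k H n j x) := by
  induction n with
  | zero =>
    intro i j hij hj x
    obtain rfl : j = 0 := by omega
    obtain rfl : i = 0 := by omega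
    obtain ⟨a, rfl⟩ := single_surjective x
    rw [dup_zero]
    refine (coassoc_congr (TensorProduct.lift (cons k H 1) ∘ₗ
      LinearMap.lTensor H (TensorProduct.lift ((cons k H 0).compl₂ (single k H))))
      (dup k H 1 0 ∘ₗ TensorProduct.lift ((cons k H 0).compl₂ (single k H)))
      (dup k H 1 1 ∘ₗ TensorProduct.lift ((cons k H 0).compl₂ (single k H))) ?_ ?_ a).symm
    · intro p q
      simp only [LinearMap.comp_apply, TensorProduct.lift.tmul, LinearMap.compl₂_apply,
        dup_succ_zero]
      induction (Coalgebra.comul (R := k) p) using TensorProduct.induction_on with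
      | zero => simp
      | add u v hu hv => simp only [map_add, hu, hv, TensorProduct.add_tmul]
      | tmul p q => simp
    · intro p q
      simp [dup_succ_succ, dup_zero]
  | succ n ih =>
    intro i j hij hj x
    induction x using cons_induction with
    | h0 => simp
    | hadd x y hx hy => simp only [map_add, hx, hy]
    | h a y =>
      rcases i with _ | i
      · rcases j with _ | j
        · rw [dup_succ_zero]
          refine (coassoc_congr (TensorProduct.lift (cons k H (n + 2)) ∘ₗ
            LinearMap.lTensor H (TensorProduct.lift ((cons k H (n + 1)).compl₂ ((cons k H n).flip y))))
            (dup k H (n + 2) 0 ∘ₗ TensorProduct.lift ((cons k H (n + 1)).compl₂ ((cons k H n).flip y)))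
            (dup k H (n + 2) 1 ∘ₗ TensorProduct.lift ((cons k H (n + 1)).compl₂ ((cons k H n).flip y)))
            ?_ ?_ a).symm
          · intro p q
            simp only [LinearMap.comp_apply, TensorProduct.lift.tmul, LinearMap.compl₂_apply,
              dup_succ_zero]
            induction (Coalgebra.comul (R := k) p) using TensorProduct.induction_on with
            | zero => simp
            | add u v hu hv => simp only [map_add, hu, hv, TensorProduct.add_tmul]
            | tmul p q => simp
          · intro p q
            simp [dup_succ_succ, dup_succ_zero]
        · rw [dup_succ_succ, dup_succ_zero, dup_succ_zero]
          induction (Coalgebra.comul (R := k) a) using TensorProduct.induction_on with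
          | zero => simp
          | add u v hu hv => simp only [map_add, hu, hv]
          | tmul p q => simp [dup_succ_succ]
      · rcases j with _ | j
        · omega
        · simp only [dup_succ_succ, ih i j (by omega) (by omega)]

theorem kill_kill (n : ℕ) : ∀ i j : ℕ, i ≤ j → j ≤ n → ∀ x : pow k H (n + 2),
    kill k H n j (kill k H (n + 1) i x) = kill k H n i (kill k H (n + 1) (j + 1) x) := by
  induction n with
  | zero =>
    intro i j hij hj x
    obtain rfl : j = 0 := by omega
    obtain rfl : i = 0 := by omega
    induction x using cons_induction with
    | h0 => simp
    | hadd x y hx hy => simp only [map_add, hx, hy]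
    | h a y =>
      induction y using cons_induction with
      | h0 => simp
      | hadd x y hx hy => simp only [map_add, hx, hy]
      | h b y =>
        obtain ⟨c, rfl⟩ := single_surjective y
        simp [kill_succ_zero, kill_succ_succ, kill_zero, smul_smul, mul_comm]
  | succ n ih =>
    intro i j hij hj x
    induction x using cons_induction with
    | h0 => simp
    | hadd x y hx hy => simp only [map_add, hx, hy]
    | h a y =>
      rcases i with _ | i
      · induction y using cons_induction with
        | h0 => simp
        | hadd x y hx hy => simp only [map_add, hx, hy]
        | h b y =>
          rcases j with _ | j
          · induction y using cons_induction with
            | h0 => simp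
            | hadd x y hx hy => simp only [map_add, hx, hy]
            | h c y => simp [kill_succ_zero, kill_succ_succ, smul_smul, mul_comm]
          · simp [kill_succ_zero, kill_succ_succ]
      · rcases j with _ | j
        · omega
        · simp only [kill_succ_succ, ih i j (by omega) (by omega)]

/-- The factor removed by `ε` is the second leg of `Δ`, so this is the right counit axiom; for
`kill_dup_succ` it is the first leg and the left counit axiom. -/
theorem kill_dup_self (n : ℕ) : ∀ i : ℕ, i ≤ n → ∀ x : pow k H n,
    kill k H n i (dup k H n i x) = x := by
  induction n with
  | zero =>
    intro i hi x
    obtain ⟨a, rfl⟩ := single_surjective x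
    rw [dup_zero]
    exact counit_right_congr (single k H) (kill k H 0 i ∘ₗ TensorProduct.lift _)
      (fun p q => by simp [kill_zero]) a
  | succ n ih =>
    intro i hi x
    induction x using cons_induction with
    | h0 => simp
    | hadd x y hx hy => simp only [map_add, hx, hy]
    | h a y =>
      rcases i with _ | i
      · rw [dup_succ_zero]
        exact counit_right_congr ((cons k H n).flip y) (kill k H (n + 1) 0 ∘ₗ TensorProduct.lift _)
          (fun p q => by simp [kill_succ_zero]) a
      · rw [dup_succ_succ, kill_succ_succ, ih i (by omega)]

theorem kill_dup_succ (n : ℕ) : ∀ i : ℕ, i + 1 ≤ n → ∀ x : pow k H n,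
    kill k H n i (dup k H n (i + 1) x) = x := by
  induction n with
  | zero => intro i hi; omega
  | succ n ih =>
    intro i hi x
    induction x using cons_induction with
    | h0 => simp
    | hadd x y hx hy => simp only [map_add, hx, hy]
    | h a y =>
      rw [dup_succ_succ]
      rcases i with _ | i
      -- The affected factor is the second one, and whether anything follows it decides which
      -- recursion clause of `dup` applies.
      · rcases n with _ | n
        · obtain ⟨b, rfl⟩ := single_surjective y
          rw [dup_zero]
          exact counit_left_congr (cons k H 0 a ∘ₗ single k H)
            (kill k H 1 0 ∘ₗ cons k H 1 a ∘ₗ TensorProduct.lift _)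
            (fun p q => by simp [kill_succ_zero]) b
        · induction y using cons_induction with
          | h0 => simp
          | hadd x y hx hy => simp only [map_add, hx, hy]
          | h b y =>
            rw [dup_succ_zero]
            exact counit_left_congr (cons k H (n + 1) a ∘ₗ (cons k H n).flip y)
              (kill k H (n + 2) 0 ∘ₗ cons k H (n + 2) a ∘ₗ TensorProduct.lift _)
              (fun p q => by simp [kill_succ_zero]) b
      · rcases n with _ | n
        · omega
        · rw [kill_succ_succ, ih i (by omega)]

theorem kill_dup_of_le (n : ℕ) : ∀ i j : ℕ, i ≤ j → j ≤ n → ∀ x : pow k H (n + 1),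
    kill k H (n + 1) (j + 1) (dup k H (n + 1) i x) = dup k H n i (kill k H n j x) := by
  induction n with
  | zero =>
    intro i j hij hj x
    obtain rfl : j = 0 := by omega
    obtain rfl : i = 0 := by omega
    induction x using cons_induction with
    | h0 => simp
    | hadd x y hx hy => simp only [map_add, hx, hy]
    | h a y =>
      obtain ⟨b, rfl⟩ := single_surjective y
      rw [dup_succ_zero, kill_zero, map_smul, dup_zero]
      induction (Coalgebra.comul (R := k) a) using TensorProduct.induction_on with
      | zero => simp
      | add u v hu hv => simp only [map_add, hu, hv, smul_add]
      | tmul p q => simp [kill_succ_succ, kill_zero]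
  | succ n ih =>
    intro i j hij hj x
    induction x using cons_induction with
    | h0 => simp
    | hadd x y hx hy => simp only [map_add, hx, hy]
    | h a y =>
      rcases i with _ | i
      · rcases j with _ | j
        · induction y using cons_induction with
          | h0 => simp
          | hadd x y hx hy => simp only [map_add, hx, hy]
          | h b y =>
            rw [dup_succ_zero, kill_succ_zero, map_smul, dup_succ_zero]
            induction (Coalgebra.comul (R := k) a) using TensorProduct.induction_on with
            | zero => simp
            | add u v hu hv => simp only [map_add, hu, hv, smul_add]
            | tmul p q => simp [kill_succ_succ, kill_succ_zero]
        · rw [dup_succ_zero, kill_succ_succ, dup_succ_zero]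
          induction (Coalgebra.comul (R := k) a) using TensorProduct.induction_on with
          | zero => simp
          | add u v hu hv => simp only [map_add, hu, hv]
          | tmul p q => simp [kill_succ_succ]
      · rcases j with _ | j
        · omega
        · simp only [dup_succ_succ, kill_succ_succ, ih i j (by omega) (by omega)]

theorem kill_dup_of_gt (n : ℕ) : ∀ i j : ℕ, j < i → i ≤ n → ∀ x : pow k H (n + 1),
    kill k H (n + 1) j (dup k H (n + 1) (i + 1) x) = dup k H n i (kill k H n j x) := by
  induction n with
  | zero => intro i j hij hj; omega
  | succ n ih =>
    intro i j hij hj x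
    induction x using cons_induction with
    | h0 => simp
    | hadd x y hx hy => simp only [map_add, hx, hy]
    | h a y =>
      rcases i with _ | i
      · omega
      · rw [dup_succ_succ]
        rcases j with _ | j
        · induction y using cons_induction with
          | h0 => simp
          | hadd x y hx hy => simp only [map_add, hx, hy]
          | h b y => simp [dup_succ_succ, kill_succ_zero]
        · rw [kill_succ_succ, kill_succ_succ, dup_succ_succ, ih i j (by omega) (by omega)]

theorem dup_append (n : ℕ) : ∀ i : ℕ, i ≤ n → ∀ (y : pow k H n) (b : H),
    dup k H (n + 1) i (append k H n (y ⊗ₜ b)) = append k H (n + 1) (dup k H n i y ⊗ₜ b) := by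
  induction n with
  | zero =>
    intro i hi y b
    obtain rfl : i = 0 := by omega
    obtain ⟨a, rfl⟩ := single_surjective y
    rw [append_zero, dup_succ_zero, dup_zero]
    induction (Coalgebra.comul (R := k) a) using TensorProduct.induction_on with
    | zero => simp
    | add u v hu hv => simp only [map_add, hu, hv, TensorProduct.add_tmul]
    | tmul p q => simp [append_succ, append_zero]
  | succ n ih =>
    intro i hi y b
    induction y using cons_induction with
    | h0 => simp
    | hadd x y hx hy => simp only [map_add, hx, hy, TensorProduct.add_tmul]
    | h a y =>
      rw [append_succ]
      rcases i with _ | i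
      · rw [dup_succ_zero, dup_succ_zero]
        induction (Coalgebra.comul (R := k) a) using TensorProduct.induction_on with
        | zero => simp
        | add u v hu hv => simp only [map_add, hu, hv, TensorProduct.add_tmul]
        | tmul p q => simp [append_succ]
      · rw [dup_succ_succ, dup_succ_succ, append_succ, ih i (by omega)]

theorem dup_append_last (n : ℕ) (y : pow k H n) (b : H) :
    dup k H (n + 1) (n + 1) (append k H n (y ⊗ₜ b)) =
      append k H (n + 1) (TensorProduct.map (append k H n) LinearMap.id
        ((TensorProduct.assoc k (pow k H n) H H).symm (y ⊗ₜ Coalgebra.comul (R := k) b))) := by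
  induction n with
  | zero =>
    obtain ⟨a, rfl⟩ := single_surjective y
    rw [append_zero, dup_succ_succ, dup_zero]
    induction (Coalgebra.comul (R := k) b) using TensorProduct.induction_on with
    | zero => simp
    | add u v hu hv => simp only [map_add, hu, hv, TensorProduct.tmul_add]
    | tmul p q => simp [append_succ, append_zero]
  | succ n ih =>
    induction y using cons_induction with
    | h0 => simp
    | hadd x y hx hy => simp only [TensorProduct.add_tmul, map_add, hx, hy]
    | h a y =>
      rw [append_succ, dup_succ_succ, ih]
      induction (Coalgebra.comul (R := k) b) using TensorProduct.induction_on with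
      | zero => simp
      | add u v hu hv => simp only [map_add, hu, hv, TensorProduct.tmul_add]
      | tmul p q => simp [append_succ]

theorem kill_append (n : ℕ) : ∀ i : ℕ, i ≤ n → ∀ (y : pow k H (n + 1)) (b : H),
    kill k H (n + 1) i (append k H (n + 1) (y ⊗ₜ b)) =
      append k H n (kill k H n i y ⊗ₜ b) := by
  induction n with
  | zero =>
    intro i hi y b
    obtain rfl : i = 0 := by omega
    induction y using cons_induction with
    | h0 => simp
    | hadd x y hx hy => simp only [map_add, hx, hy, TensorProduct.add_tmul]
    | h a y =>
      obtain ⟨c, rfl⟩ := single_surjective y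
      simp [append_succ, append_zero, kill_zero, kill_succ_zero, ← TensorProduct.smul_tmul']
  | succ n ih =>
    intro i hi y b
    induction y using cons_induction with
    | h0 => simp
    | hadd x y hx hy => simp only [map_add, hx, hy, TensorProduct.add_tmul]
    | h a y =>
      rw [append_succ]
      rcases i with _ | i
      · induction y using cons_induction with
        | h0 => simp
        | hadd x y hx hy => simp only [map_add, hx, hy, TensorProduct.add_tmul]
        | h c y => simp [append_succ, kill_succ_zero, ← TensorProduct.smul_tmul']
      · rw [kill_succ_succ, kill_succ_succ, append_succ, ih i (by omega)]

theorem kill_append_last (n : ℕ) (y : pow k H n) (b : H) :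
    kill k H n n (append k H n (y ⊗ₜ b)) = Coalgebra.counit (R := k) b • y := by
  induction n with
  | zero =>
    obtain ⟨a, rfl⟩ := single_surjective y
    rw [append_zero, kill_zero]
  | succ n ih =>
    induction y using cons_induction with
    | h0 => simp
    | hadd x y hx hy => simp only [map_add, hx, hy, TensorProduct.add_tmul, smul_add]
    | h a y => rw [append_succ, kill_succ_succ, ih, map_smul]

/-- Splits off the last factor instead of the first. The full turn needs this form, since it treats
the last factor separately. -/
theorem append_induction {n : ℕ} {P : pow k H (n + 1) → Prop} (x : pow k H (n + 1))
    (h0 : P 0) (hadd : ∀ x y, P x → P y → P (x + y))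
    (h : ∀ y b, P (append k H n (y ⊗ₜ b))) : P x := by
  induction n with
  | zero =>
    induction x using cons_induction with
    | h0 => exact h0
    | hadd x y hx hy => exact hadd x y hx hy
    | h a y =>
      obtain ⟨b, rfl⟩ := single_surjective y
      rw [← append_zero]
      exact h _ _
  | succ n ih =>
    induction x using cons_induction with
    | h0 => exact h0
    | hadd x y hx hy => exact hadd x y hx hy
    | h a y =>
      refine ih (P := fun y => P (cons k H (n + 1) a y)) y (by simpa using h0)
        (fun x y hx hy => by rw [map_add]; exact hadd _ _ hx hy) fun y b => ?_
      rw [← append_succ]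
      exact h _ _

end PowRelations
end HopfCyc

namespace HopfCyc

/-! ### Concatenation of blocks of tensor factors, in both orders. -/

section Concat

variable {k : Type u} {H : Type v} [Field k] [Ring H] [Bialgebra k H]

variable (k H) in
/-- The concatenation `(x, y) ↦ x ⊗ y`. -/
noncomputable def cat : (i j n : ℕ) → j + i + 1 = n → pow k H i →ₗ[k] pow k H j →ₗ[k] pow k H n
  | 0, j, _, rfl => cons k H j ∘ₗ (powZero k H).toLinearMap
  | i + 1, j, _, rfl => TensorProduct.lift ((LinearMap.llcomp k _ _ _ ∘ₗ
      cons k H (j + i + 1)).compl₂ (cat i j _ rfl)) ∘ₗ (powSucc k H i).toLinearMap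

variable (k H) in
/-- The concatenation `(x, y) ↦ y ⊗ x`. -/
noncomputable def revCat :
    (i j n : ℕ) → j + i + 1 = n → pow k H i →ₗ[k] pow k H j →ₗ[k] pow k H n
  | 0, j, _, rfl => ((TensorProduct.mk k (pow k H j) H).compr₂ (append k H j)).flip ∘ₗ
      (powZero k H).toLinearMap
  | i + 1, j, n, h => TensorProduct.lift (((LinearMap.llcomp k _ _ _).flip ∘ₗ
      ((TensorProduct.mk k (pow k H j) H).compr₂ (append k H j)).flip).compl₂
      (revCat i (j + 1) n (by omega))) ∘ₗ (powSucc k H i).toLinearMap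

theorem cat_zero (j : ℕ) (a : H) (y : pow k H j) :
    cat k H 0 j (j + 1) rfl (single k H a) y = cons k H j a y := by
  simp [cat]

theorem cat_succ (i j : ℕ) (a : H) (x : pow k H i) (y : pow k H j) :
    cat k H (i + 1) j (j + i + 1 + 1) rfl (cons k H i a x) y =
      cons k H (j + i + 1) a (cat k H i j (j + i + 1) rfl x y) := by
  simp [cat]

theorem revCat_zero (j : ℕ) (a : H) (y : pow k H j) :
    revCat k H 0 j (j + 1) rfl (single k H a) y = append k H j (y ⊗ₜ a) := by
  simp [revCat]

theorem revCat_succ (i j n : ℕ) (h : j + (i + 1) + 1 = n) (a : H) (x : pow k H i)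
    (y : pow k H j) : revCat k H (i + 1) j n h (cons k H i a x) y =
      revCat k H i (j + 1) n (by omega) x (append k H j (y ⊗ₜ a)) := by
  simp [revCat]

theorem append_cat (i j : ℕ) : ∀ (n : ℕ) (h : j + i + 1 = n) (x : pow k H i) (y : pow k H j)
    (b : H), append k H n (cat k H i j n h x y ⊗ₜ b) =
      cat k H i (j + 1) (n + 1) (by omega) x (append k H j (y ⊗ₜ b)) := by
  induction i with
  | zero =>
    rintro _ rfl x y b
    obtain ⟨a, rfl⟩ := single_surjective x
    exact (congrArg _ (congrArg (· ⊗ₜ b) (cat_zero j a y))).trans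
      ((append_succ _ _ _ _).trans (cat_zero (j + 1) a _).symm)
  | succ i ih =>
    rintro _ rfl x y b
    induction x using cons_induction with
    | h0 => simp
    | hadd x y hx hy => simp only [map_add, TensorProduct.add_tmul, LinearMap.add_apply, hx, hy]
    | h a x =>
      -- Restates `cat_succ` for a target degree `m` that is only propositionally equal to the one
      -- produced by the recursion, so that no cast of `pow` appears.
      have e : ∀ (m : ℕ) (h : m = j + 1 + i) (h' : j + 1 + (i + 1) + 1 = m + 1 + 1)
          (h'' : j + 1 + i + 1 = m + 1)  (z : pow k H (j + 1)),
          cat k H (i + 1) (j + 1) (m + 1 + 1) h' (cons k H i a x) z =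
            cons k H (m + 1) a (cat k H i (j + 1) (m + 1) h'' x z) := by
        rintro m rfl h' h'' z
        exact cat_succ i (j + 1) a x z
      refine (congrArg _ (congrArg (· ⊗ₜ b) (cat_succ i j a x y))).trans
        ((append_succ _ _ _ _).trans ((congrArg (cons k H (j + i + 1 + 1) a)
          (ih (j + i + 1) rfl x y b)).trans (e (j + i + 1) (by omega) _ (by omega) _).symm))

theorem rot_cat_succ (i j n : ℕ) (h : j + (i + 1) + 1 = n) (g a : H) (x : pow k H i)
    (y : pow k H j) : rot k H n (g ⊗ₜ cat k H (i + 1) j n h (cons k H i a x) y) =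
      cat k H i (j + 1) n (by omega) x (append k H j (y ⊗ₜ (g * a))) := by
  subst h
  exact (congrArg (fun z => rot k H _ (g ⊗ₜ z)) (cat_succ i j a x y)).trans
    ((rot_succ _ _ _ _).trans (append_cat _ _ _ _ _ _ _))

theorem rot_cat_zero (j n : ℕ) (h : j + 0 + 1 = n) (g a : H) (y : pow k H j) :
    rot k H n (g ⊗ₜ cat k H 0 j n h (single k H a) y) =
      revCat k H 0 j n h (single k H (g * a)) y := by
  subst h
  exact (congrArg (fun z => rot k H _ (g ⊗ₜ z)) (cat_zero j a y)).trans
    ((rot_succ _ _ _ _).trans (revCat_zero _ _ _).symm)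

theorem append_eq_cat (n : ℕ) (h : 0 + n + 1 = n + 1) (x : pow k H n) (b : H) :
    append k H n (x ⊗ₜ b) = cat k H n 0 (n + 1) h x (single k H b) := by
  induction n with
  | zero =>
    obtain ⟨a, rfl⟩ := single_surjective x
    rw [append_zero, cat_zero]
  | succ n ih =>
    induction x using cons_induction with
    | h0 => simp
    | hadd x y hx hy => simp only [map_add, TensorProduct.add_tmul, LinearMap.add_apply, hx, hy]
    | h a x =>
      have e : ∀ (m : ℕ) (h : m = 0 + n) (h' : 0 + (n + 1) + 1 = m + 1 + 1)
          (h'' : 0 + n + 1 = m + 1), cat k H (n + 1) 0 (m + 1 + 1) h' (cons k H n a x)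
            (single k H b) = cons k H (m + 1) a (cat k H n 0 (m + 1) h'' x (single k H b)) := by
        rintro m rfl h' h''
        exact cat_succ n 0 a x _
      rw [append_succ, ih (by omega), e n (by omega)]

theorem revCat_cons (i : ℕ) : ∀ (j n : ℕ) (h : j + i + 1 = n) (b : H) (x : pow k H i)
    (y : pow k H j), revCat k H i (j + 1) (n + 1) (by omega) x (cons k H j b y) =
      cons k H n b (revCat k H i j n h x y) := by
  induction i with
  | zero =>
    rintro j _ rfl b x y
    obtain ⟨a, rfl⟩ := single_surjective x
    exact (revCat_zero _ _ _).trans ((append_succ _ _ _ _).trans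
      (congrArg _ (revCat_zero _ _ _).symm))
  | succ i ih =>
    intro j n h b x y
    induction x using cons_induction with
    | h0 => simp
    | hadd x y hx hy => simp only [map_add, LinearMap.add_apply, hx, hy]
    | h a x =>
      rw [revCat_succ, append_succ, ih (j + 1) n (by omega), revCat_succ]

theorem revCat_single (n : ℕ) (h : 0 + n + 1 = n + 1) (x : pow k H n) (b : H) :
    revCat k H n 0 (n + 1) h x (single k H b) = cons k H n b x := by
  induction n generalizing b with
  | zero =>
    obtain ⟨a, rfl⟩ := single_surjective x
    exact (revCat_zero _ _ _).trans (append_zero _ _)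
  | succ n ih =>
    induction x using cons_induction with
    | h0 => simp
    | hadd x y hx hy => simp only [map_add, LinearMap.add_apply, hx, hy]
    | h a x => rw [revCat_succ, append_zero, revCat_cons n 0 (n + 1) (by omega), ih (by omega)]

end Concat

/-! ### Identities of the cyclic operator before passing to the tensor product over `H`. -/

section Twist

variable {k : Type u} {H : Type v} {M : Type w} [Field k] [Ring H] [HopfAlgebra k H]
  [AddCommGroup M] [Module k M] [Module Hᵐᵒᵖ M] [IsScalarTower k Hᵐᵒᵖ M] [SAYDModule k H M]

/-- Coassociativity of the coaction under a linear map `F`: one side comultiplies the `H` leg, the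
other coacts again on the `M` leg, and each side need only be known on pure tensors. -/
theorem coact_congr {V : Type w'} [AddCommGroup V] [Module k V]
    (F : H ⊗[k] (H ⊗[k] M) →ₗ[k] V) (A B : H ⊗[k] M →ₗ[k] V)
    (hA : ∀ p q, A (p ⊗ₜ q) = F (TensorProduct.assoc k H H M (Coalgebra.comul (R := k) p ⊗ₜ q)))
    (hB : ∀ p q, B (p ⊗ₜ q) = F (p ⊗ₜ SAYDModule.coact (k := k) (H := H) q)) (m : M) :
    A (SAYDModule.coact (k := k) (H := H) m) = B (SAYDModule.coact (k := k) (H := H) m) := by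
  have hA' : A = F ∘ₗ (TensorProduct.assoc k H H M).toLinearMap ∘ₗ
      TensorProduct.map Coalgebra.comul LinearMap.id := TensorProduct.ext' fun p q => by simp [hA]
  have hB' : B = F ∘ₗ TensorProduct.map LinearMap.id SAYDModule.coact :=
    TensorProduct.ext' fun p q => by simp [hB]
  have := LinearMap.congr_fun (SAYDModule.coassoc (k := k) (H := H) (M := M)) m
  rw [hA', hB']
  simp only [LinearMap.comp_apply] at this ⊢
  rw [this]

theorem coact_counit_congr {V : Type w'} [AddCommGroup V] [Module k V]
    (F : M →ₗ[k] V) (A : H ⊗[k] M →ₗ[k] V)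
    (hA : ∀ p q, A (p ⊗ₜ q) = Coalgebra.counit (R := k) p • F q) (m : M) :
    A (SAYDModule.coact (k := k) (H := H) m) = F m := by
  have hA' : A = F ∘ₗ (TensorProduct.lid k M).toLinearMap ∘ₗ
      TensorProduct.map Coalgebra.counit LinearMap.id :=
    TensorProduct.ext' fun p q => by simp [hA]
  have := LinearMap.congr_fun (SAYDModule.counit (k := k) (H := H) (M := M)) m
  rw [hA']
  simp only [LinearMap.comp_apply, LinearMap.id_apply] at this ⊢
  rw [this]

theorem rotAux_tmul (n : ℕ) (g : H) (m : M) (x : pow k H n) :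
    rotAux k H M n ((g ⊗ₜ m) ⊗ₜ x) = m ⊗ₜ rot k H n (g ⊗ₜ x) := by
  simp [rotAux]

theorem twist_tmul (n : ℕ) (m : M) (x : pow k H n) : twist k H M n (m ⊗ₜ x) =
    rotAux k H M n (SAYDModule.coact (k := k) (H := H) m ⊗ₜ x) := by
  simp [twist]

theorem twist_dup_succ (n i : ℕ) (hi : i + 1 ≤ n) (m : M) (x : pow k H n) :
    twist k H M (n + 1) (m ⊗ₜ dup k H n (i + 1) x) =
      TensorProduct.map LinearMap.id (dup k H n i) (twist k H M n (m ⊗ₜ x)) := by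
  rcases n with _ | n
  · omega
  rw [twist_tmul, twist_tmul]
  induction (SAYDModule.coact (k := k) (H := H) m) using TensorProduct.induction_on with
  | zero => simp
  | add u v hu hv => simp only [map_add, TensorProduct.add_tmul, hu, hv]
  | tmul g m =>
    rw [rotAux_tmul, rotAux_tmul, TensorProduct.map_tmul]
    induction x using cons_induction with
    | h0 => simp
    | hadd x y hx hy => simp only [map_add, TensorProduct.tmul_add, hx, hy]
    | h a y => rw [dup_succ_succ, rot_succ, rot_succ, dup_append n i (by omega)]; rfl

theorem twist_kill_succ (n i : ℕ) (hi : i < n) (m : M) (x : pow k H (n + 1)) :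
    twist k H M n (m ⊗ₜ kill k H n (i + 1) x) =
      TensorProduct.map LinearMap.id (kill k H n i) (twist k H M (n + 1) (m ⊗ₜ x)) := by
  rcases n with _ | n
  · omega
  rw [twist_tmul, twist_tmul]
  induction (SAYDModule.coact (k := k) (H := H) m) using TensorProduct.induction_on with
  | zero => simp
  | add u v hu hv => simp only [map_add, TensorProduct.add_tmul, hu, hv]
  | tmul g m =>
    rw [rotAux_tmul, rotAux_tmul, TensorProduct.map_tmul]
    induction x using cons_induction with
    | h0 => simp
    | hadd x y hx hy => simp only [map_add, TensorProduct.tmul_add, hx, hy]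
    | h a y => rw [kill_succ_succ, rot_succ, rot_succ, kill_append n i (by omega)]; rfl

/-- After a turn the last slot holds `m⁽⁻¹⁾ b`; since `ε` is multiplicative, the counit of the
coaction restores `m` and leaves `ε(b)`. Thus the extra degeneracy discards the head factor. -/
theorem kill_last_twist (n : ℕ) (m : M) (b : H) (z : pow k H n) :
    TensorProduct.map LinearMap.id (kill k H n n) (twist k H M (n + 1) (m ⊗ₜ cons k H n b z)) =
      Coalgebra.counit (R := k) b • (m ⊗ₜ[k] z) := by
  rw [twist_tmul]
  refine coact_counit_congr (k := k) (H := H) (Coalgebra.counit (R := k) b •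
    (TensorProduct.mk k M (pow k H n)).flip z) (TensorProduct.map LinearMap.id (kill k H n n) ∘ₗ
      rotAux k H M (n + 1) ∘ₗ (TensorProduct.mk k _ _).flip (cons k H n b z)) (fun p q => ?_) m
  simp [rotAux_tmul, rot_succ, kill_append_last, smul_smul, mul_comm]

/-- The slot that is killed holds `m⁽⁻¹⁾ h₀⁽¹⁾`, so the left counit axiom for `h₀` finishes the
computation. -/
theorem kill_twist_dup (n : ℕ) (m : M) (x : pow k H n) :
    TensorProduct.map LinearMap.id (kill k H n n)
      (twist k H M (n + 1) (m ⊗ₜ dup k H n 0 x)) = m ⊗ₜ x := by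
  rcases n with _ | n
  · obtain ⟨a, rfl⟩ := single_surjective x
    rw [dup_zero]
    exact counit_left_congr (TensorProduct.mk k M _ m ∘ₗ single k H)
      (TensorProduct.map LinearMap.id (kill k H 0 0) ∘ₗ twist k H M 1 ∘ₗ
        TensorProduct.mk k M _ m ∘ₗ TensorProduct.lift _)
      (fun p q => by simp [kill_last_twist]) a
  · induction x using cons_induction with
    | h0 => simp
    | hadd x y hx hy => simp only [map_add, TensorProduct.tmul_add, hx, hy]
    | h a y =>
      rw [dup_succ_zero]
      exact counit_left_congr (TensorProduct.mk k M _ m ∘ₗ (cons k H n).flip y)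
        (TensorProduct.map LinearMap.id (kill k H (n + 1) (n + 1)) ∘ₗ twist k H M (n + 2) ∘ₗ
          TensorProduct.mk k M _ m ∘ₗ TensorProduct.lift _)
        (fun p q => by simp [kill_last_twist]) a

/-- The first of the two turns on the right brings `h₁` to the head, where the second turn followed
by the last codegeneracy discards it. -/
theorem twist_kill_zero (n : ℕ) (m : M) (x : pow k H (n + 1)) :
    twist k H M n (m ⊗ₜ kill k H n 0 x) = TensorProduct.map LinearMap.id (kill k H n n)
      (twist k H M (n + 1) (twist k H M (n + 1) (m ⊗ₜ x))) := by
  induction x using cons_induction with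
  | h0 => simp
  | hadd x y hx hy => simp only [map_add, TensorProduct.tmul_add, hx, hy]
  | h a y =>
    rcases n with _ | n
    · obtain ⟨b, rfl⟩ := single_surjective y
      rw [kill_zero, twist_tmul, twist_tmul]
      induction (SAYDModule.coact (k := k) (H := H) m) using TensorProduct.induction_on with
      | zero => simp
      | add u v hu hv => simp only [map_add, TensorProduct.add_tmul, hu, hv]
      | tmul g m =>
        rw [rotAux_tmul, rotAux_tmul, rot_succ, append_zero, kill_last_twist]
        simp [rot_zero]
    · induction y using cons_induction with
      | h0 => simp
      | hadd x y hx hy => simp only [map_add, TensorProduct.tmul_add, hx, hy]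
      | h b y =>
        rw [kill_succ_zero, twist_tmul, twist_tmul]
        induction (SAYDModule.coact (k := k) (H := H) m) using TensorProduct.induction_on with
        | zero => simp
        | add u v hu hv => simp only [map_add, TensorProduct.add_tmul, hu, hv]
        | tmul g m =>
          rw [rotAux_tmul, rotAux_tmul, rot_succ, append_succ, kill_last_twist]
          simp [rot_succ]

/-- Two turns carry both legs of `Δ(h₀)` to the end, each multiplied by one leg of the iterated
coaction. By coassociativity those legs are `Δ(m⁽⁻¹⁾)`, and `Δ` is multiplicative. -/
theorem twist_twist_dup (n : ℕ) (m : M) (x : pow k H n) :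
    twist k H M (n + 1) (twist k H M (n + 1) (m ⊗ₜ dup k H n 0 x)) =
      TensorProduct.map LinearMap.id (dup k H n n) (twist k H M n (m ⊗ₜ x)) := by
  rw [twist_tmul, twist_tmul]
  rcases n with _ | n
  · obtain ⟨a, rfl⟩ := single_surjective x
    refine (coact_congr (k := k) (H := H) (TensorProduct.map LinearMap.id
      (TensorProduct.lift ((cons k H 0).compl₂ (single k H)) ∘ₗ
        LinearMap.mulRight k (Coalgebra.comul (R := k) a)) ∘ₗ
        (TensorProduct.comm k _ M).toLinearMap ∘ₗ (TensorProduct.assoc k H H M).symm.toLinearMap)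
      (TensorProduct.map LinearMap.id (dup k H 0 0) ∘ₗ rotAux k H M 0 ∘ₗ
        (TensorProduct.mk k _ _).flip (single k H a))
      (twist k H M 1 ∘ₗ rotAux k H M 1 ∘ₗ
        (TensorProduct.mk k _ _).flip (dup k H 0 0 (single k H a))) ?_ ?_ m).symm
    · intro g m
      simp [rotAux_tmul, rot_zero, dup_zero]
    · intro g m
      simp only [LinearMap.comp_apply, LinearMap.flip_apply, TensorProduct.mk_apply, rotAux_tmul,
        dup_zero, twist_tmul]
      induction (Coalgebra.comul (R := k) a) using TensorProduct.induction_on with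
      | zero => simp
      | add u v hu hv =>
        have e : LinearMap.mulRight k (u + v) = LinearMap.mulRight k u + LinearMap.mulRight k v := by
          ext; simp [mul_add]
        simp only [map_add, TensorProduct.tmul_add, hu, hv, e, LinearMap.comp_add,
          TensorProduct.map_add_right, LinearMap.add_apply]
      | tmul p q =>
        induction (SAYDModule.coact (k := k) (H := H) m) using TensorProduct.induction_on with
        | zero => simp
        | add u v hu hv => simp only [map_add, TensorProduct.add_tmul, TensorProduct.tmul_add, hu, hv]
        | tmul g' m => simp [rot_succ, rotAux_tmul, append_zero]
  · induction x using cons_induction with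
    | h0 => simp
    | hadd x y hx hy => simp only [map_add, TensorProduct.tmul_add, hx, hy]
    | h a y =>
      refine (coact_congr (k := k) (H := H) (TensorProduct.map LinearMap.id
        (append k H (n + 1) ∘ₗ TensorProduct.map (append k H n) LinearMap.id ∘ₗ
          (TensorProduct.assoc k (pow k H n) H H).symm.toLinearMap ∘ₗ TensorProduct.mk k _ _ y ∘ₗ
          LinearMap.mulRight k (Coalgebra.comul (R := k) a)) ∘ₗ
          (TensorProduct.comm k _ M).toLinearMap ∘ₗ (TensorProduct.assoc k H H M).symm.toLinearMap)
        (TensorProduct.map LinearMap.id (dup k H (n + 1) (n + 1)) ∘ₗ rotAux k H M (n + 1) ∘ₗ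
          (TensorProduct.mk k _ _).flip (cons k H n a y))
        (twist k H M (n + 2) ∘ₗ rotAux k H M (n + 2) ∘ₗ
          (TensorProduct.mk k _ _).flip (dup k H (n + 1) 0 (cons k H n a y))) ?_ ?_ m).symm
      · intro g m
        simp [rotAux_tmul, rot_succ, dup_append_last]
      · intro g m
        simp only [LinearMap.comp_apply, LinearMap.flip_apply, TensorProduct.mk_apply, rotAux_tmul,
          dup_succ_zero, twist_tmul]
        induction (Coalgebra.comul (R := k) a) using TensorProduct.induction_on with
        | zero => simp
        | add u v hu hv =>
          have e : LinearMap.mulRight k (u + v) =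
              LinearMap.mulRight k u + LinearMap.mulRight k v := by
            ext; simp [mul_add]
          simp only [map_add, TensorProduct.tmul_add, hu, hv, e, LinearMap.comp_add,
            TensorProduct.map_add_right, LinearMap.add_apply]
        | tmul p q =>
          induction (SAYDModule.coact (k := k) (H := H) m) using TensorProduct.induction_on with
          | zero => simp
          | add u v hu hv =>
            simp only [map_add, TensorProduct.add_tmul, TensorProduct.tmul_add, hu, hv]
          | tmul g' m => simp [rot_succ, rotAux_tmul, append_succ]

/-- Each turn moves the head of `x` behind `y` and multiplies it by a fresh leg of the coaction;
coassociativity collects these legs into the diagonal action of `m⁽⁻¹⁾` on the whole block. In the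
induction the block `y` grows by the factor just moved, hence `j` is arbitrary. -/
theorem twist_iterate_cat (i : ℕ) : ∀ (j n : ℕ) (h : j + i + 1 = n) (m : M) (x : pow k H i)
    (y : pow k H j), (twist k H M n ^ (i + 1)) (m ⊗ₜ cat k H i j n h x y) =
      TensorProduct.map LinearMap.id ((revCat k H i j n h).flip y ∘ₗ diagAct k H i ∘ₗ
        (TensorProduct.mk k _ _).flip x)
        (TensorProduct.comm k H M (SAYDModule.coact (k := k) (H := H) m)) := by
  induction i with
  | zero =>
    intro j n h m x y
    obtain ⟨a, rfl⟩ := single_surjective x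
    rw [pow_one, twist_tmul]
    induction (SAYDModule.coact (k := k) (H := H) m) using TensorProduct.induction_on with
    | zero => simp
    | add u v hu hv => simp only [map_add, TensorProduct.add_tmul, hu, hv]
    | tmul g m =>
      simp only [rotAux_tmul, rot_cat_zero, TensorProduct.comm_tmul, TensorProduct.map_tmul,
        LinearMap.comp_apply, LinearMap.flip_apply, TensorProduct.mk_apply, diagAct_zero_tmul,
        powZero_single, LinearMap.id_apply]
      rfl
  | succ i ih =>
    intro j n h m x y
    induction x using cons_induction with
    | h0 => simp
    | hadd x x' hx hx' =>
      simp only [map_add, LinearMap.add_apply, TensorProduct.tmul_add, hx, hx', LinearMap.comp_add,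
        TensorProduct.map_add_right]
    | h a x =>
      rw [pow_succ, Module.End.mul_apply, twist_tmul]
      refine (coact_congr (k := k) (H := H) (TensorProduct.map LinearMap.id
        (TensorProduct.lift ((revCat k H i (j + 1) n (by omega)).flip.compl₁₂
          (append k H j ∘ₗ TensorProduct.mk k _ _ y ∘ₗ LinearMap.mulRight k a)
          (diagAct k H i ∘ₗ (TensorProduct.mk k _ _).flip x))) ∘ₗ
          (TensorProduct.comm k _ M).toLinearMap ∘ₗ (TensorProduct.assoc k H H M).symm.toLinearMap)
        (TensorProduct.map LinearMap.id ((revCat k H (i + 1) j n h).flip y ∘ₗ diagAct k H (i + 1) ∘ₗ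
          (TensorProduct.mk k _ _).flip (cons k H i a x)) ∘ₗ (TensorProduct.comm k H M).toLinearMap)
        ((twist k H M n ^ (i + 1)) ∘ₗ rotAux k H M n ∘ₗ
          (TensorProduct.mk k _ _).flip (cat k H (i + 1) j n h (cons k H i a x) y)) ?_ ?_ m).symm
      · intro g m
        simp only [LinearMap.comp_apply, LinearEquiv.coe_coe, TensorProduct.comm_tmul,
          TensorProduct.map_tmul, LinearMap.flip_apply, TensorProduct.mk_apply, LinearMap.id_apply,
          cons_apply, diagAct_succ_tmul, LinearEquiv.symm_apply_apply]
        induction (Coalgebra.comul (R := k) g) using TensorProduct.induction_on with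
        | zero => simp
        | add u v hu hv =>
          simp only [map_add, LinearMap.add_apply, TensorProduct.tmul_add, hu, hv]
        | tmul p q =>
          simp only [TensorProduct.map_tmul, ← cons_apply, revCat_succ]
          simp
      · intro g m
        simp only [LinearMap.comp_apply, LinearMap.flip_apply, TensorProduct.mk_apply, rotAux_tmul,
          rot_cat_succ, ih]
        induction (SAYDModule.coact (k := k) (H := H) m) using TensorProduct.induction_on with
        | zero => simp
        | add u v hu hv => simp only [map_add, TensorProduct.tmul_add, hu, hv]
        | tmul g' m => simp

/-- Both blocks of `cat` are nonempty, so for more than one factor the turn is done in two stages: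
all factors except the last move as a block, and one further turn moves the last factor. -/
theorem twist_pow (n : ℕ) (m : M) (x : pow k H n) :
    (twist k H M n ^ (n + 1)) (m ⊗ₜ x) =
      TensorProduct.map LinearMap.id (diagAct k H n ∘ₗ (TensorProduct.mk k _ _).flip x)
        (TensorProduct.comm k H M (SAYDModule.coact (k := k) (H := H) m)) := by
  rcases n with _ | n
  · obtain ⟨a, rfl⟩ := single_surjective x
    rw [zero_add, pow_one, twist_tmul]
    induction (SAYDModule.coact (k := k) (H := H) m) using TensorProduct.induction_on with
    | zero => simp
    | add u v hu hv => simp only [map_add, TensorProduct.add_tmul, hu, hv]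
    | tmul g m =>
      simp only [rotAux_tmul, rot_zero, TensorProduct.comm_tmul, TensorProduct.map_tmul,
        LinearMap.comp_apply, LinearMap.flip_apply, TensorProduct.mk_apply, diagAct_zero_tmul,
        powZero_single, LinearMap.id_apply]
      rfl
  · induction x using append_induction with
    | h0 => simp
    | hadd x x' hx hx' =>
      simp only [map_add, TensorProduct.tmul_add, hx, hx', LinearMap.comp_add,
        TensorProduct.map_add_right, LinearMap.add_apply]
    | h x b =>
      rw [pow_succ', Module.End.mul_apply]
      have e := append_eq_cat n (by omega) x b
      rw [congrArg (fun z => (twist k H M (n + 1) ^ (n + 1)) (m ⊗ₜ z)) e, twist_iterate_cat]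
      refine (coact_congr (k := k) (H := H) (TensorProduct.map LinearMap.id
        (append k H n ∘ₗ TensorProduct.map (diagAct k H n ∘ₗ (TensorProduct.mk k _ _).flip x)
          (LinearMap.mulRight k b)) ∘ₗ
          (TensorProduct.comm k _ M).toLinearMap ∘ₗ (TensorProduct.assoc k H H M).symm.toLinearMap)
        (TensorProduct.map LinearMap.id (diagAct k H (n + 1) ∘ₗ
          (TensorProduct.mk k _ _).flip (append k H n (x ⊗ₜ b))) ∘ₗ
          (TensorProduct.comm k H M).toLinearMap)
        (twist k H M (n + 1) ∘ₗ TensorProduct.map LinearMap.id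
          ((revCat k H n 0 (n + 1) (by omega)).flip (single k H b) ∘ₗ diagAct k H n ∘ₗ
            (TensorProduct.mk k _ _).flip x) ∘ₗ (TensorProduct.comm k H M).toLinearMap)
        ?_ ?_ m).symm
      · intro g m
        simp only [LinearMap.comp_apply, LinearEquiv.coe_coe, TensorProduct.comm_tmul,
          TensorProduct.map_tmul, LinearMap.flip_apply, TensorProduct.mk_apply, LinearMap.id_apply,
          diagAct_append]
        induction (Coalgebra.comul (R := k) g) using TensorProduct.induction_on with
        | zero => simp
        | add u v hu hv =>
          simp only [map_add, TensorProduct.add_tmul, TensorProduct.tmul_add, hu, hv]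
        | tmul p q => simp
      · intro g m
        simp only [LinearMap.comp_apply, LinearEquiv.coe_coe, TensorProduct.comm_tmul,
          TensorProduct.map_tmul, LinearMap.flip_apply, TensorProduct.mk_apply, LinearMap.id_apply,
          revCat_single, twist_tmul]
        induction (SAYDModule.coact (k := k) (H := H) m) using TensorProduct.induction_on with
        | zero => simp
        | add u v hu hv => simp only [map_add, TensorProduct.add_tmul, TensorProduct.tmul_add, hu, hv]
        | tmul g' m => simp [rotAux_tmul, rot_succ]

end Twist
end HopfCyc

namespace HopfCyc

/-! ### The cocyclic identities for `C(H, M)`. -/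

section RelTensor

variable {k : Type u} {H : Type v} {M : Type w} [Field k] [Ring H] [Bialgebra k H]
  [AddCommGroup M] [Module k M]

theorem relTensor_ext {a : M ⊗[k] H →ₗ[k] M} {n : ℕ}
    {V : Type w'} [AddCommGroup V] [Module k V] {f g : RelTensor a n →ₗ[k] V}
    (h : ∀ (m : M) (x : pow k H n), f ((balanced a n).mkQ (m ⊗ₜ x)) =
      g ((balanced a n).mkQ (m ⊗ₜ x))) : f = g :=
  Submodule.linearMap_qext _ (TensorProduct.ext' h)

theorem relMap_mk (a : M ⊗[k] H →ₗ[k] M) {n m : ℕ} (f : pow k H n →ₗ[k] pow k H m)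
    (hf : Equivariant f) (z : M ⊗[k] pow k H n) :
    relMap a f hf ((balanced a n).mkQ z) =
      (balanced a m).mkQ (TensorProduct.map LinearMap.id f z) := rfl

end RelTensor

section Cocyclic

variable {k : Type u} {H : Type v} {M : Type w} [Field k] [Ring H] [HopfAlgebra k H]
  [AddCommGroup M] [Module k M] [Module Hᵐᵒᵖ M] [IsScalarTower k Hᵐᵒᵖ M] [SAYDModule k H M]

theorem cyclicOp_mk (n : ℕ) (z : M ⊗[k] pow k H n) :
    cyclicOp k H M n ((balanced (rightAct k H M) n).mkQ z) =
      (balanced (rightAct k H M) n).mkQ (twist k H M n z) := rfl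

theorem cyclicOp_pow_mk (n j : ℕ) (z : M ⊗[k] pow k H n) :
    (cyclicOp k H M n ^ j) ((balanced (rightAct k H M) n).mkQ z) =
      (balanced (rightAct k H M) n).mkQ ((twist k H M n ^ j) z) := by
  induction j with
  | zero => rfl
  | succ j ih => rw [pow_succ', pow_succ', Module.End.mul_apply, Module.End.mul_apply, ih,
      cyclicOp_mk]

variable (k H M) in
/-- The coface applying `Δ` to `hᵢ`. -/
noncomputable abbrev coface (n i : ℕ) :
    RelTensor (rightAct k H M) n →ₗ[k] RelTensor (rightAct k H M) (n + 1) :=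
  relMap (rightAct k H M) (dup k H n i) (dup_equivariant n i)

variable (k H M) in
/-- The codegeneracy applying `ε` to `hᵢ₊₁`. -/
noncomputable abbrev codegen (n i : ℕ) :
    RelTensor (rightAct k H M) (n + 1) →ₗ[k] RelTensor (rightAct k H M) n :=
  relMap (rightAct k H M) (kill k H n i) (kill_equivariant n i)

theorem coface_coface (n i j : ℕ) (hij : i ≤ j) (hj : j ≤ n) :
    coface k H M (n + 1) (j + 1) ∘ₗ coface k H M n i =
      coface k H M (n + 1) i ∘ₗ coface k H M n j :=
  relTensor_ext fun m x => by simp [relMap_mk, dup_dup n i j hij hj, -Submodule.mkQ_apply]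

theorem codegen_codegen (n i j : ℕ) (hij : i ≤ j) (hj : j ≤ n) :
    codegen k H M n j ∘ₗ codegen k H M (n + 1) i =
      codegen k H M n i ∘ₗ codegen k H M (n + 1) (j + 1) :=
  relTensor_ext fun m x => by simp [relMap_mk, kill_kill n i j hij hj, -Submodule.mkQ_apply]

theorem codegen_coface_of_le (n i j : ℕ) (hij : i ≤ j) (hj : j ≤ n) :
    codegen k H M (n + 1) (j + 1) ∘ₗ coface k H M (n + 1) i =
      coface k H M n i ∘ₗ codegen k H M n j :=
  relTensor_ext fun m x => by simp [relMap_mk, kill_dup_of_le n i j hij hj, -Submodule.mkQ_apply]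

theorem codegen_coface_of_gt (n i j : ℕ) (hij : j < i) (hi : i ≤ n) :
    codegen k H M (n + 1) j ∘ₗ coface k H M (n + 1) (i + 1) =
      coface k H M n i ∘ₗ codegen k H M n j :=
  relTensor_ext fun m x => by simp [relMap_mk, kill_dup_of_gt n i j hij hi, -Submodule.mkQ_apply]

theorem codegen_coface_self (n i : ℕ) (hi : i ≤ n) :
    codegen k H M n i ∘ₗ coface k H M n i = LinearMap.id :=
  relTensor_ext fun m x => by simp [relMap_mk, kill_dup_self n i hi, -Submodule.mkQ_apply]

theorem codegen_coface_succ (n i : ℕ) (hi : i + 1 ≤ n) :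
    codegen k H M n i ∘ₗ coface k H M n (i + 1) = LinearMap.id :=
  relTensor_ext fun m x => by simp [relMap_mk, kill_dup_succ n i hi, -Submodule.mkQ_apply]

theorem cyclicOp_coface_succ (n i : ℕ) (hi : i + 1 ≤ n) :
    cyclicOp k H M (n + 1) ∘ₗ coface k H M n (i + 1) =
      coface k H M n i ∘ₗ cyclicOp k H M n :=
  relTensor_ext fun m x => by
    simp only [LinearMap.comp_apply, relMap_mk, cyclicOp_mk, TensorProduct.map_tmul,
      LinearMap.id_apply, twist_dup_succ n i hi]

theorem cyclicOp_cyclicOp_coface (n : ℕ) :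
    cyclicOp k H M (n + 1) ∘ₗ cyclicOp k H M (n + 1) ∘ₗ coface k H M n 0 =
      coface k H M n n ∘ₗ cyclicOp k H M n :=
  relTensor_ext fun m x => by
    simp only [LinearMap.comp_apply, relMap_mk, cyclicOp_mk, TensorProduct.map_tmul,
      LinearMap.id_apply, twist_twist_dup n]

theorem cyclicOp_codegen_succ (n i : ℕ) (hi : i < n) :
    cyclicOp k H M n ∘ₗ codegen k H M n (i + 1) =
      codegen k H M n i ∘ₗ cyclicOp k H M (n + 1) :=
  relTensor_ext fun m x => by
    simp only [LinearMap.comp_apply, relMap_mk, cyclicOp_mk, TensorProduct.map_tmul,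
      LinearMap.id_apply, twist_kill_succ n i hi]

theorem cyclicOp_codegen_zero (n : ℕ) :
    cyclicOp k H M n ∘ₗ codegen k H M n 0 =
      codegen k H M n n ∘ₗ cyclicOp k H M (n + 1) ∘ₗ cyclicOp k H M (n + 1) :=
  relTensor_ext fun m x => by
    simp only [LinearMap.comp_apply, relMap_mk, cyclicOp_mk, TensorProduct.map_tmul,
      LinearMap.id_apply, twist_kill_zero n]

theorem codegen_cyclicOp_coface (n : ℕ) :
    codegen k H M n n ∘ₗ cyclicOp k H M (n + 1) ∘ₗ coface k H M n 0 = LinearMap.id :=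
  relTensor_ext fun m x => by
    simp only [LinearMap.comp_apply, relMap_mk, cyclicOp_mk, TensorProduct.map_tmul,
      LinearMap.id_apply, kill_twist_dup n]

/-- The one cocyclic identity that uses the relation `m h ⊗ x = m ⊗ h·x`: it moves `m⁽⁻¹⁾` back onto
`m⁽⁰⁾`, where stability applies. -/
theorem cyclicOp_pow (n : ℕ) : cyclicOp k H M n ^ (n + 1) = 1 :=
  relTensor_ext fun m x => by
    rw [cyclicOp_pow_mk, twist_pow, Module.End.one_apply]
    conv_rhs => rw [← SAYDModule.stable (k := k) (H := H) m]
    induction (SAYDModule.coact (k := k) (H := H) m) using TensorProduct.induction_on with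
    | zero => simp
    | add u v hu hv => simp only [map_add, TensorProduct.add_tmul, hu, hv]
    | tmul g m =>
      rw [TensorProduct.comm_tmul, mk_act_tmul]
      simp

/-- Identities involving the last coface are deduced from the others, since that coface is `τ δ₀`
and the commutation of `τ` with the remaining operators is known. -/
theorem hopfCocyclic_isCocyclic : (hopfCocyclic k H M).IsCocyclic where
  δ_δ n i j hij := by
    have hi := i.2
    have hj := j.2
    have hij' : (i : ℕ) ≤ j := hij
    simp only [Fin.val_succ, Fin.val_castSucc]
    rw [if_pos (by omega : (i : ℕ) ≤ n + 1)]
    by_cases h : (j : ℕ) ≤ n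
    · rw [if_pos (by omega), if_pos (by omega), if_pos h]
      exact coface_coface n i j hij' h
    · rw [if_neg (by omega), if_neg h]
      by_cases h' : (i : ℕ) ≤ n
      · rw [if_pos h', LinearMap.comp_assoc, ← coface_coface n 0 i (by omega) h',
          ← LinearMap.comp_assoc, ← LinearMap.comp_assoc, cyclicOp_coface_succ _ _ (by omega)]
      · obtain h'' : (i : ℕ) = n + 1 := by omega
        rw [if_neg h']
        simp only [h'']
        -- Both cofaces are last ones. Moving the turns outwards makes the two sides `τ² δ₁ δ₀` and
        -- `τ² δ₀ δ₀`.
        rw [← LinearMap.comp_assoc (coface k H M n 0) _ (coface k H M (n + 1) (n + 1)),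
          ← cyclicOp_cyclicOp_coface, LinearMap.comp_assoc,
          ← LinearMap.comp_assoc (coface k H M n 0) _ (coface k H M (n + 1) 0),
          ← cyclicOp_coface_succ (n + 1) 0 (by omega)]
        simp only [LinearMap.comp_assoc]
        rw [coface_coface n 0 0 le_rfl (by omega)]
  σ_σ n i j hij := codegen_codegen n i j hij (by omega)
  σ_δ_of_le n i j hij := by
    have hij' : (i : ℕ) ≤ j := hij
    simp only [Fin.val_succ, Fin.val_castSucc]
    rw [if_pos (by omega), if_pos (by omega)]
    exact codegen_coface_of_le n i j hij' (by omega)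
  σ_δ_self n i := by
    simp only [Fin.val_castSucc]
    rw [if_pos (by omega)]
    exact codegen_coface_self n i (by omega)
  σ_δ_succ n i := by
    simp only [Fin.val_succ]
    split_ifs with h
    · exact codegen_coface_succ n i h
    · obtain h' : (i : ℕ) = n := by omega
      simp only [h']
      exact codegen_cyclicOp_coface n
  σ_δ_of_gt n i j hij := by
    have hij' : (j : ℕ) < i := hij
    simp only [Fin.val_succ, Fin.val_castSucc]
    by_cases h : (i : ℕ) ≤ n
    · rw [if_pos (by omega), if_pos h]
      exact codegen_coface_of_gt n i j hij' h
    · rw [if_neg (by omega), if_neg h, LinearMap.comp_assoc,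
        ← codegen_coface_of_le n 0 j (by omega) (by omega), ← LinearMap.comp_assoc,
        ← LinearMap.comp_assoc, cyclicOp_codegen_succ _ _ (by omega)]
  τ_δ_succ n i := by
    simp only [Fin.val_succ, Fin.val_castSucc]
    rw [if_pos (by omega : (i : ℕ) ≤ n)]
    split_ifs with h
    · exact cyclicOp_coface_succ n i h
    · obtain h' : (i : ℕ) = n := by omega
      simp only [h']
      exact cyclicOp_cyclicOp_coface n
  τ_δ_zero n := by simp
  τ_σ_succ n i := cyclicOp_codegen_succ n i i.2
  τ_σ_zero n := cyclicOp_codegen_zero n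
  τ_pow n := cyclicOp_pow n

end Cocyclic

/-! ### Compatibility of the factorwise coproduct with cofaces, codegeneracies and rotation. -/

section Comultiplication

variable {k : Type u} {H : Type v} {M : Type w} [Field k] [Ring H] [Bialgebra k H]
  [AddCommGroup M] [Module k M]

variable (k H) in
/-- The coproduct `h₀ ⊗ ⋯ ⊗ hₙ ↦ (h₀⁽¹⁾ ⊗ ⋯ ⊗ hₙ⁽¹⁾) ⊗ (h₀⁽²⁾ ⊗ ⋯ ⊗ hₙ⁽²⁾)`. -/
noncomputable def powComul (n : ℕ) : pow k H n →ₗ[k] pow k H n ⊗[k] pow k H n :=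
  unzip k H H n ∘ₗ comulPow k H n

theorem powComul_single (a : H) : powComul k H 0 (single k H a) =
    TensorProduct.map (single k H) (single k H) (Coalgebra.comul (R := k) a) := by
  simp [powComul, unzip, comulPow, single]

theorem powComul_cons (n : ℕ) (a : H) (y : pow k H n) : powComul k H (n + 1) (cons k H n a y) =
    TensorProduct.map (TensorProduct.lift (cons k H n)) (TensorProduct.lift (cons k H n))
      (TensorProduct.tensorTensorTensorComm k H H (pow k H n) (pow k H n)
        (Coalgebra.comul (R := k) a ⊗ₜ powComul k H n y)) := by
  have e : TensorProduct.lift (cons k H n) = (powSucc k H n).symm.toLinearMap :=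
    TensorProduct.ext' fun a y => rfl
  simp [powComul, unzip, comulPow, e]

/-- Mirrors `powComul_cons` at the other end; needed because a rotation takes from the head and
appends at the tail. -/
theorem powComul_append (n : ℕ) (y : pow k H n) (b : H) :
    powComul k H (n + 1) (append k H n (y ⊗ₜ b)) =
    TensorProduct.map (append k H n) (append k H n)
      (TensorProduct.tensorTensorTensorComm k (pow k H n) (pow k H n) H H
        (powComul k H n y ⊗ₜ Coalgebra.comul (R := k) b)) := by
  induction n with
  | zero =>
    obtain ⟨a, rfl⟩ := single_surjective y
    rw [append_zero, powComul_cons, powComul_single, powComul_single]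
    induction (Coalgebra.comul (R := k) a) using TensorProduct.induction_on with
    | zero => simp
    | add u v hu hv => simp only [map_add, TensorProduct.add_tmul, hu, hv]
    | tmul p q =>
      induction (Coalgebra.comul (R := k) b) using TensorProduct.induction_on with
      | zero => simp
      | add u v hu hv => simp only [map_add, TensorProduct.tmul_add, hu, hv]
      | tmul r s => simp [append_zero]
  | succ n ih =>
    induction y using cons_induction with
    | h0 => simp
    | hadd x y hx hy => simp only [map_add, TensorProduct.add_tmul, hx, hy]
    | h a y =>
      rw [append_succ, powComul_cons, ih, powComul_cons]
      induction (Coalgebra.comul (R := k) a) using TensorProduct.induction_on with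
      | zero => simp
      | add u v hu hv => simp only [map_add, TensorProduct.add_tmul, hu, hv]
      | tmul p q =>
        induction (Coalgebra.comul (R := k) b) using TensorProduct.induction_on with
        | zero => simp
        | add u v hu hv => simp only [map_add, TensorProduct.tmul_add, hu, hv]
        | tmul r s =>
          induction (powComul k H n y) using TensorProduct.induction_on with
          | zero => simp
          | add u v hu hv =>
            simp only [map_add, TensorProduct.tmul_add, TensorProduct.add_tmul, hu, hv]
          | tmul z t => simp [append_succ]

theorem powComul_rot (n : ℕ) (g : H) (x : pow k H n) :
    powComul k H n (rot k H n (g ⊗ₜ x)) =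
    TensorProduct.map (rot k H n) (rot k H n)
      (TensorProduct.tensorTensorTensorComm k H H (pow k H n) (pow k H n)
        (Coalgebra.comul (R := k) g ⊗ₜ powComul k H n x)) := by
  rcases n with _ | n
  · obtain ⟨a, rfl⟩ := single_surjective x
    rw [rot_zero, powComul_single, powComul_single, comul_mul_aux]
    induction (Coalgebra.comul (R := k) g) using TensorProduct.induction_on with
    | zero => simp
    | add u v hu hv => simp only [map_add, TensorProduct.add_tmul, add_mul, hu, hv]
    | tmul p q =>
      induction (Coalgebra.comul (R := k) a) using TensorProduct.induction_on with
      | zero => simp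
      | add u v hu hv => simp only [map_add, TensorProduct.tmul_add, mul_add, hu, hv]
      | tmul r s => simp [rot_zero]
  · induction x using cons_induction with
    | h0 => simp
    | hadd x y hx hy => simp only [map_add, TensorProduct.tmul_add, hx, hy]
    | h a y =>
      rw [rot_succ, powComul_append, powComul_cons, comul_mul_aux]
      induction (Coalgebra.comul (R := k) g) using TensorProduct.induction_on with
      | zero => simp
      | add u v hu hv =>
        simp only [map_add, TensorProduct.add_tmul, TensorProduct.tmul_add, add_mul, hu, hv]
      | tmul p q =>
        induction (Coalgebra.comul (R := k) a) using TensorProduct.induction_on with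
        | zero => simp
        | add u v hu hv =>
          simp only [map_add, TensorProduct.tmul_add, TensorProduct.add_tmul, mul_add, hu, hv]
        | tmul r s =>
          induction (powComul k H n y) using TensorProduct.induction_on with
          | zero => simp
          | add u v hu hv =>
            simp only [map_add, TensorProduct.tmul_add, TensorProduct.add_tmul, hu, hv]
          | tmul z t => simp [rot_succ]

/-- For a cocommutative coalgebra `Δ` is itself a coalgebra map, so exchanging the two middle legs
of the fourfold coproduct changes nothing. -/
theorem comul_comul [Coalgebra.IsCocomm k H] (a : H) :
    TensorProduct.map Coalgebra.comul Coalgebra.comul (Coalgebra.comul (R := k) a) =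
      TensorProduct.tensorTensorTensorComm k H H H H (TensorProduct.map Coalgebra.comul
        Coalgebra.comul (Coalgebra.comul (R := k) a)) := by
  have co := LinearMap.congr_fun (Coalgebra.comulCoalgHom k H).map_comp_comul a
  simp only [LinearMap.comp_apply] at co
  refine Eq.trans co ?_
  rw [TensorProduct.comul_def]
  rfl

/-- Comultiplying before or after doubling a slot gives the four legs of that slot in orders
differing by the middle exchange; cocommutativity enters through `comul_comul`. -/
theorem powComul_dup [Coalgebra.IsCocomm k H] (n : ℕ) : ∀ i ≤ n, ∀ x : pow k H n,
    powComul k H (n + 1) (dup k H n i x) =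
      TensorProduct.map (dup k H n i) (dup k H n i) (powComul k H n x) := by
  induction n with
  | zero =>
    intro i hi x
    obtain ⟨a, rfl⟩ := single_surjective x
    have e := congrArg (TensorProduct.map (TensorProduct.lift ((cons k H 0).compl₂ (single k H)))
      (TensorProduct.lift ((cons k H 0).compl₂ (single k H)))) (comul_comul (k := k) a)
    rw [dup_zero, powComul_single]
    refine Eq.trans ?_ (e.symm.trans ?_)
    · induction (Coalgebra.comul (R := k) a) using TensorProduct.induction_on with
      | zero => simp
      | add u v hu hv => simp only [map_add, hu, hv]
      | tmul p q =>
        simp only [TensorProduct.lift.tmul, LinearMap.compl₂_apply, powComul_cons,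
          powComul_single, TensorProduct.map_tmul]
        induction (Coalgebra.comul (R := k) p) using TensorProduct.induction_on with
        | zero => simp
        | add u v hu hv => simp only [map_add, TensorProduct.add_tmul, hu, hv]
        | tmul p p' =>
          induction (Coalgebra.comul (R := k) q) using TensorProduct.induction_on with
          | zero => simp
          | add u v hu hv => simp only [map_add, TensorProduct.tmul_add, hu, hv]
          | tmul q q' => simp
    · induction (Coalgebra.comul (R := k) a) using TensorProduct.induction_on with
      | zero => simp
      | add u v hu hv => simp only [map_add, hu, hv]
      | tmul p q => simp [dup_zero]
  | succ n ih =>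
    intro i hi x
    induction x using cons_induction with
    | h0 => simp
    | hadd x y hx hy => simp only [map_add, hx, hy]
    | h a y =>
      rcases i with _ | i
      · let P (m : ℕ) := TensorProduct.map (TensorProduct.lift (cons k H m))
          (TensorProduct.lift (cons k H m)) ∘ₗ
            (TensorProduct.tensorTensorTensorComm k H H (pow k H m) (pow k H m)).toLinearMap
        -- Separating the fourfold coproduct of the head from the coproduct `Y` of the tail lets
        -- `comul_comul` be applied to the head alone, and `Q` is additive in `Y`.
        let Q (Y : pow k H n ⊗[k] pow k H n) :=
          P (n + 1) ∘ₗ TensorProduct.map LinearMap.id (P n ∘ₗ (TensorProduct.mk k _ _).flip Y)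
        have hl : powComul k H (n + 2) (dup k H (n + 1) 0 (cons k H n a y)) =
            Q (powComul k H n y) (TensorProduct.map Coalgebra.comul Coalgebra.comul
              (Coalgebra.comul (R := k) a)) := by
          rw [dup_succ_zero]
          induction (Coalgebra.comul (R := k) a) using TensorProduct.induction_on with
          | zero => simp
          | add u v hu hv => simp only [map_add, hu, hv]
          | tmul p q => simp [powComul_cons, Q, P]
        rw [hl, comul_comul, powComul_cons]
        induction (powComul k H n y) using TensorProduct.induction_on with
        | zero => simp [Q]
        | add u v hu hv =>
          have e : Q (u + v) = Q u + Q v := by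
            simp only [Q, map_add, LinearMap.comp_add, TensorProduct.map_add_right]
          simp only [e, LinearMap.add_apply, hu, hv, TensorProduct.tmul_add, map_add]
        | tmul z t =>
          induction (Coalgebra.comul (R := k) a) using TensorProduct.induction_on with
          | zero => simp
          | add u v hu hv => simp only [map_add, TensorProduct.add_tmul, hu, hv]
          | tmul p q =>
            simp only [TensorProduct.tensorTensorTensorComm_tmul, TensorProduct.map_tmul,
              TensorProduct.lift.tmul, dup_succ_zero]
            induction (Coalgebra.comul (R := k) p) using TensorProduct.induction_on with
            | zero => simp
            | add u v hu hv => simp only [map_add, TensorProduct.add_tmul, hu, hv]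
            | tmul p p' =>
              induction (Coalgebra.comul (R := k) q) using TensorProduct.induction_on with
              | zero => simp
              | add u v hu hv => simp only [map_add, TensorProduct.tmul_add, hu, hv]
              | tmul q q' => simp [Q, P]
      · rw [dup_succ_succ, powComul_cons, ih i (by omega), powComul_cons]
        induction (Coalgebra.comul (R := k) a) using TensorProduct.induction_on with
        | zero => simp
        | add u v hu hv => simp only [map_add, TensorProduct.add_tmul, hu, hv]
        | tmul p q =>
          induction (powComul k H n y) using TensorProduct.induction_on with
          | zero => simp
          | add u v hu hv => simp only [map_add, TensorProduct.tmul_add, hu, hv]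
          | tmul z t => simp [dup_succ_succ]

theorem powComul_kill (n : ℕ) : ∀ i ≤ n, ∀ x : pow k H (n + 1),
    powComul k H n (kill k H n i x) =
      TensorProduct.map (kill k H n i) (kill k H n i) (powComul k H (n + 1) x) := by
  -- The killed slot contributes both its legs, and `(ε ⊗ ε)Δ = ε`.
  have hc : ∀ b : H, TensorProduct.map (Coalgebra.counit (R := k)) (Coalgebra.counit (R := k))
      (Coalgebra.comul (R := k) b) = Coalgebra.counit (R := k) b ⊗ₜ[k] 1 := fun b => by
    have := congrArg (LinearMap.rTensor k (Coalgebra.counit (R := k)))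
      (Coalgebra.lTensor_counit_comul (R := k) b)
    rw [← LinearMap.comp_apply, LinearMap.rTensor_comp_lTensor] at this
    simpa using this
  induction n with
  | zero =>
    intro i hi x
    induction x using cons_induction with
    | h0 => simp
    | hadd x y hx hy => simp only [map_add, hx, hy]
    | h a y =>
      obtain ⟨b, rfl⟩ := single_surjective y
      rw [kill_zero, map_smul, powComul_cons, powComul_single, powComul_single]
      induction (Coalgebra.comul (R := k) a) using TensorProduct.induction_on with
      | zero => simp
      | add u v hu hv => simp only [map_add, TensorProduct.add_tmul, smul_add, hu, hv]
      | tmul p q =>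
        have e := congrArg (TensorProduct.map ((LinearMap.lsmul k _).flip (single k H p))
          ((LinearMap.lsmul k _).flip (single k H q))) (hc b)
        refine Eq.trans ?_ (e.symm.trans ?_)
        · simp [TensorProduct.smul_tmul']
        · induction (Coalgebra.comul (R := k) b) using TensorProduct.induction_on with
          | zero => simp
          | add u v hu hv => simp only [map_add, TensorProduct.tmul_add, hu, hv]
          | tmul r s => simp [kill_zero]
  | succ n ih =>
    intro i hi x
    induction x using cons_induction with
    | h0 => simp
    | hadd x y hx hy => simp only [map_add, hx, hy]
    | h a y =>
      rcases i with _ | i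
      · induction y using cons_induction with
        | h0 => simp
        | hadd x y hx hy => simp only [map_add, hx, hy]
        | h b y =>
          rw [kill_succ_zero, map_smul, powComul_cons, powComul_cons, powComul_cons]
          induction (Coalgebra.comul (R := k) a) using TensorProduct.induction_on with
          | zero => simp
          | add u v hu hv => simp only [map_add, TensorProduct.add_tmul, smul_add, hu, hv]
          | tmul p q =>
            induction (powComul k H n y) using TensorProduct.induction_on with
            | zero => simp
            | add u v hu hv => simp only [map_add, TensorProduct.tmul_add, smul_add, hu, hv]
            | tmul z t =>
              have e := congrArg (TensorProduct.map ((LinearMap.lsmul k _).flip (cons k H n p z))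
                ((LinearMap.lsmul k _).flip (cons k H n q t))) (hc b)
              refine Eq.trans ?_ (e.symm.trans ?_)
              · simp [TensorProduct.smul_tmul']
              · induction (Coalgebra.comul (R := k) b) using TensorProduct.induction_on with
                | zero => simp
                | add u v hu hv =>
                  simp only [map_add, TensorProduct.tmul_add, TensorProduct.add_tmul, hu, hv]
                | tmul r s => simp [kill_succ_zero]
      · rw [kill_succ_succ, powComul_cons, ih i (by omega), powComul_cons]
        induction (Coalgebra.comul (R := k) a) using TensorProduct.induction_on with
        | zero => simp
        | add u v hu hv => simp only [map_add, TensorProduct.add_tmul, hu, hv]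
        | tmul p q =>
          induction (powComul k H (n + 1) y) using TensorProduct.induction_on with
          | zero => simp
          | add u v hu hv => simp only [map_add, TensorProduct.tmul_add, hu, hv]
          | tmul z t => simp [kill_succ_succ]

theorem rho_mk [Coalgebra.IsCocomm k H] (a : M ⊗[k] H →ₗ[k] M) (ψ : M →ₗ[k] M ⊗[k] M)
    (hψ : ψ ∘ₗ a = tensorAct a a ∘ₗ TensorProduct.map ψ Coalgebra.comul) (n : ℕ) (m : M)
    (x : pow k H n) : rho a ψ hψ n ((balanced a n).mkQ (m ⊗ₜ x)) =
      TensorProduct.map (balanced a n).mkQ (balanced a n).mkQ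
        (TensorProduct.tensorTensorTensorComm k M M (pow k H n) (pow k H n)
          (ψ m ⊗ₜ powComul k H n x)) := by
  simp [rho, omega, phi, powComul]

theorem rho_relMap [Coalgebra.IsCocomm k H] (a : M ⊗[k] H →ₗ[k] M) (ψ : M →ₗ[k] M ⊗[k] M)
    (hψ : ψ ∘ₗ a = tensorAct a a ∘ₗ TensorProduct.map ψ Coalgebra.comul) {n m : ℕ}
    (f : pow k H n →ₗ[k] pow k H m) (hf : Equivariant f)
    (h : ∀ x, powComul k H m (f x) = TensorProduct.map f f (powComul k H n x)) :
    rho a ψ hψ m ∘ₗ relMap a f hf =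
      TensorProduct.map (relMap a f hf) (relMap a f hf) ∘ₗ rho a ψ hψ n := by
  refine relTensor_ext fun x y => ?_
  rw [LinearMap.comp_apply, LinearMap.comp_apply, relMap_mk, TensorProduct.map_tmul,
    LinearMap.id_apply, rho_mk, rho_mk, h]
  induction (ψ x) using TensorProduct.induction_on with
  | zero => simp
  | add u v hu hv => simp only [map_add, TensorProduct.add_tmul, hu, hv]
  | tmul p q =>
    induction (powComul k H n y) using TensorProduct.induction_on with
    | zero => simp
    | add u v hu hv => simp only [map_add, TensorProduct.tmul_add, hu, hv]
    | tmul z t => simp [relMap_mk, -Submodule.mkQ_apply]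

end Comultiplication

/-! ### The map ρ commutes with the cocyclic operators. -/

section Rho

variable {k : Type u} {H : Type v} {M : Type w} [Field k] [Ring H] [HopfAlgebra k H]
  [Coalgebra.IsCocomm k H] [AddCommGroup M] [Module k M] [Module Hᵐᵒᵖ M]
  [IsScalarTower k Hᵐᵒᵖ M] [SAYDModule k H M] (ψ : M →ₗ[k] M ⊗[k] M)
  (hψ : ψ ∘ₗ rightAct k H M =
    tensorAct (rightAct k H M) (rightAct k H M) ∘ₗ TensorProduct.map ψ Coalgebra.comul)

theorem rho_cyclicOp (hψ' : TensorProduct.map Coalgebra.comul ψ ∘ₗ SAYDModule.coact =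
      tensorCoact (SAYDModule.coact (k := k) (H := H)) (SAYDModule.coact (k := k) (H := H)) ∘ₗ ψ)
    (n : ℕ) : rho (rightAct k H M) ψ hψ n ∘ₗ cyclicOp k H M n =
      TensorProduct.map (cyclicOp k H M n) (cyclicOp k H M n) ∘ₗ rho (rightAct k H M) ψ hψ n := by
  refine relTensor_ext fun m x => ?_
  rw [LinearMap.comp_apply, LinearMap.comp_apply, cyclicOp_mk, rho_mk, twist_tmul]
  -- `P Y` does everything that follows the coactions: it rotates both copies of `H^{⊗(n+1)}` by the
  -- two `H` legs and passes to the quotients. Compatibility of ψ with the coactions is the equality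
  -- of its two arguments.
  let P (Y : pow k H n ⊗[k] pow k H n) : (H ⊗[k] H) ⊗[k] (M ⊗[k] M) →ₗ[k]
      RelTensor (rightAct k H M) n ⊗[k] RelTensor (rightAct k H M) n :=
    TensorProduct.map (balanced (rightAct k H M) n).mkQ (balanced (rightAct k H M) n).mkQ ∘ₗ
      (TensorProduct.tensorTensorTensorComm k M M (pow k H n) (pow k H n)).toLinearMap ∘ₗ
      TensorProduct.map LinearMap.id (TensorProduct.map (rot k H n) (rot k H n) ∘ₗ
        (TensorProduct.tensorTensorTensorComm k H H (pow k H n) (pow k H n)).toLinearMap ∘ₗ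
        (TensorProduct.mk k _ _).flip Y) ∘ₗ
      (TensorProduct.comm k (H ⊗[k] H) (M ⊗[k] M)).toLinearMap
  have e := congrArg (P (powComul k H n x)) (LinearMap.congr_fun hψ' m)
  simp only [LinearMap.comp_apply] at e
  refine Eq.trans ?_ (e.trans ?_)
  · induction (SAYDModule.coact (k := k) (H := H) m) using TensorProduct.induction_on with
    | zero => simp
    | add u v hu hv => simp only [map_add, TensorProduct.add_tmul, hu, hv]
    | tmul g m => rw [rotAux_tmul, rho_mk, powComul_rot]; simp [P]
  · induction (powComul k H n x) using TensorProduct.induction_on with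
    | zero => simp [P]
    | add u v hu hv =>
      have e : P (u + v) = P u + P v := by
        simp only [P, map_add, LinearMap.comp_add, LinearMap.add_comp, TensorProduct.map_add_right]
      simp only [e, LinearMap.add_apply, hu, hv, TensorProduct.tmul_add, map_add]
    | tmul y z =>
      induction (ψ m) using TensorProduct.induction_on with
      | zero => simp
      | add u v hu hv => simp only [map_add, TensorProduct.add_tmul, hu, hv]
      | tmul p q =>
        simp only [tensorCoact, LinearMap.comp_apply, TensorProduct.map_tmul,
          LinearEquiv.coe_coe, TensorProduct.tensorTensorTensorComm_tmul, cyclicOp_mk, twist_tmul]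
        induction (SAYDModule.coact (k := k) (H := H) p) using TensorProduct.induction_on with
        | zero => simp
        | add u v hu hv => simp only [map_add, TensorProduct.add_tmul, hu, hv]
        | tmul g p =>
          induction (SAYDModule.coact (k := k) (H := H) q) using TensorProduct.induction_on with
          | zero => simp
          | add u v hu hv => simp only [map_add, TensorProduct.add_tmul, TensorProduct.tmul_add, hu, hv]
          | tmul h q => simp [P, rotAux_tmul, -Submodule.mkQ_apply]

theorem rho_δ (hψ' : TensorProduct.map Coalgebra.comul ψ ∘ₗ SAYDModule.coact =
      tensorCoact (SAYDModule.coact (k := k) (H := H)) (SAYDModule.coact (k := k) (H := H)) ∘ₗ ψ)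
    (n : ℕ) (i : Fin (n + 2)) :
    rho (rightAct k H M) ψ hψ (n + 1) ∘ₗ (hopfCocyclic k H M).δ n i =
      TensorProduct.map ((hopfCocyclic k H M).δ n i) ((hopfCocyclic k H M).δ n i) ∘ₗ
        rho (rightAct k H M) ψ hψ n := by
  have h : ∀ i ≤ n, rho (rightAct k H M) ψ hψ (n + 1) ∘ₗ coface k H M n i =
      TensorProduct.map (coface k H M n i) (coface k H M n i) ∘ₗ rho (rightAct k H M) ψ hψ n :=
    fun i hi => rho_relMap _ _ _ _ (dup_equivariant n i) (powComul_dup n i hi)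
  simp only
  split_ifs with hi
  · exact h i hi
  · rw [← LinearMap.comp_assoc, rho_cyclicOp ψ hψ hψ', LinearMap.comp_assoc, h 0 (by omega),
      ← LinearMap.comp_assoc, TensorProduct.map_comp]

theorem rho_σ (n : ℕ) (i : Fin (n + 1)) :
    rho (rightAct k H M) ψ hψ n ∘ₗ (hopfCocyclic k H M).σ n i =
      TensorProduct.map ((hopfCocyclic k H M).σ n i) ((hopfCocyclic k H M).σ n i) ∘ₗ
        rho (rightAct k H M) ψ hψ (n + 1) :=
  rho_relMap _ _ _ _ (kill_equivariant n i) (powComul_kill n i (by omega))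

end Rho
end HopfCyc

namespace HopfCyc

/-! ### Tensor products of subspaces, and finiteness of the index types. -/

section SubTens

variable {k : Type u} [Field k] {V : Type*} {W : Type*} {V' : Type*} {W' : Type*}
  [AddCommGroup V] [Module k V] [AddCommGroup W] [Module k W]
  [AddCommGroup V'] [Module k V'] [AddCommGroup W'] [Module k W']

/-- The subspace `P ⊗ Q` of `V ⊗ W`. -/
abbrev subTens (P : Submodule k V) (Q : Submodule k W) : Submodule k (V ⊗[k] W) :=
  LinearMap.range (TensorProduct.map P.subtype Q.subtype)

theorem tmul_mem_subTens {P : Submodule k V} {Q : Submodule k W} {x : V} {y : W}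
    (hx : x ∈ P) (hy : y ∈ Q) : x ⊗ₜ[k] y ∈ subTens P Q :=
  ⟨(⟨x, hx⟩ : P) ⊗ₜ (⟨y, hy⟩ : Q), by simp⟩

theorem subTens_induction {P : Submodule k V} {Q : Submodule k W} {p : V ⊗[k] W → Prop}
    (h0 : p 0) (hadd : ∀ x y, p x → p y → p (x + y)) (ht : ∀ x ∈ P, ∀ y ∈ Q, p (x ⊗ₜ y))
    {z : V ⊗[k] W} (hz : z ∈ subTens P Q) : p z := by
  obtain ⟨z, rfl⟩ := hz
  induction z using TensorProduct.induction_on with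
  | zero => simpa using h0
  | add x y hx hy => rw [map_add]; exact hadd _ _ hx hy
  | tmul x y => exact ht _ x.2 _ y.2

theorem map_mem_subTens {P : Submodule k V} {Q : Submodule k W} {P' : Submodule k V'}
    {Q' : Submodule k W'} {f : V →ₗ[k] V'} {g : W →ₗ[k] W'} (hf : ∀ x ∈ P, f x ∈ P')
    (hg : ∀ y ∈ Q, g y ∈ Q') {z : V ⊗[k] W} (hz : z ∈ subTens P Q) :
    TensorProduct.map f g z ∈ subTens P' Q' :=
  subTens_induction (p := fun z => TensorProduct.map f g z ∈ subTens P' Q')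
    (by rw [map_zero]; exact zero_mem _) (fun x y hx hy => by rw [map_add]; exact add_mem hx hy)
    (fun x hx y hy => tmul_mem_subTens (hf x hx) (hg y hy)) hz

/-- Many identities hold only on a subspace (normalized elements, or elements of large enough
degree); this transfers them to one tensor factor. -/
theorem map_congr_subTens {P : Submodule k V} {Q : Submodule k W}
    {f f' : V →ₗ[k] V'} {g g' : W →ₗ[k] W'} (hf : ∀ x ∈ P, f x = f' x)
    (hg : ∀ y ∈ Q, g y = g' y) {z : V ⊗[k] W} (hz : z ∈ subTens P Q) :
    TensorProduct.map f g z = TensorProduct.map f' g' z :=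
  subTens_induction (p := fun z => TensorProduct.map f g z = TensorProduct.map f' g' z)
    (by rw [map_zero, map_zero]) (fun x y hx hy => by rw [map_add, map_add, hx, hy])
    (fun x hx y hy => by simp [hf x hx, hg y hy]) hz

end SubTens

section GTens

variable {k : Type u} [Field k] {V W : ℕ → Type w} [∀ n, AddCommGroup (V n)]
  [∀ n, Module k (V n)] [∀ n, AddCommGroup (W n)] [∀ n, Module k (W n)]

instance (e n : ℕ) : Finite (Idx e n) :=
  Finite.of_injective (β := Fin (n + 1) × Fin (n + 1))
    (fun p => (⟨p.1.1, by have := p.2; omega⟩, ⟨p.1.2, by have := p.2; omega⟩))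
    (fun p q h => by simpa [Subtype.ext_iff, Prod.ext_iff] using h)

instance (n : ℕ) : Finite (TIdx n) :=
  Finite.of_injective (β := Fin (n + 1) × Fin (n + 1))
    (fun p => (⟨p.1.1, by have := p.2; omega⟩, ⟨p.1.2, by have := p.2; omega⟩))
    (fun p q h => by simpa [Subtype.ext_iff, Prod.ext_iff] using h)

theorem gtens_ext {e n : ℕ} {U : Type*} [AddCommGroup U] [Module k U]
    {f g : GTens k V W e n →ₗ[k] U}
    (h : ∀ (p : Idx e n) (x : V p.1.1) (y : W p.1.2),
      f (Pi.single p (x ⊗ₜ y)) = g (Pi.single p (x ⊗ₜ y))) : f = g :=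
  LinearMap.pi_ext' fun p => TensorProduct.ext' fun x y => h p x y

end GTens

/-! ### Induced maps, connecting morphisms, and linear retractions onto cohomology. -/

namespace CochainData

variable {k : Type u} [Field k]

theorem cls_surjective (A : CochainData.{u, w} k) (n : ℕ) : Function.Surjective (A.cls n) :=
  Submodule.mkQ_surjective _

theorem cls_eq_zero (A : CochainData.{u, w} k) {n : ℕ} (z : A.Z n) :
    A.cls n z = 0 ↔ (z : A.X n) ∈ A.Bd n :=
  (Submodule.Quotient.mk_eq_zero _).trans Iff.rfl

theorem cls_eq_cls (A : CochainData.{u, w} k) {n : ℕ} (z z' : A.Z n) :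
    A.cls n z = A.cls n z' ↔ (z : A.X n) - z' ∈ A.Bd n := by
  rw [← sub_eq_zero, ← map_sub, cls_eq_zero, AddSubgroupClass.coe_sub]

theorem IsComplex.d_mem_Z {A : CochainData.{u, w} k} (hA : A.IsComplex) {n : ℕ} {x : A.X n}
    (hx : x ∈ A.N n) : A.d n x ∈ A.Z (n + 1) :=
  ⟨(hA n x hx).1, (hA n x hx).2⟩

theorem exists_induces {A : CochainData.{u, w} k} {B : CochainData.{u, w'} k} {n m : ℕ}
    (f : A.X n →ₗ[k] B.X m) (hZ : ∀ z ∈ A.Z n, f z ∈ B.Z m) (hB : ∀ z ∈ A.Bd n, f z ∈ B.Bd m) :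
    ∃ F : A.H n →ₗ[k] B.H m, Induces A B f F :=
  ⟨Submodule.mapQ _ _ (f.restrict hZ) fun z hz => hB z hz, fun z => ⟨hZ z z.2, rfl⟩⟩

theorem Induces.unique {A : CochainData.{u, w} k} {B : CochainData.{u, w'} k} {n m : ℕ}
    {f : A.X n →ₗ[k] B.X m} {F G : A.H n →ₗ[k] B.H m} (hF : Induces A B f F)
    (hG : Induces A B f G) : F = G := by
  refine LinearMap.ext fun x => ?_
  obtain ⟨z, rfl⟩ := A.cls_surjective n x
  obtain ⟨h, e⟩ := hF z
  obtain ⟨h', e'⟩ := hG z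
  rw [e, e']

theorem IsCochainMap.map_Z {A : CochainData.{u, w} k} {B : CochainData.{u, w'} k}
    {f : ∀ n, A.X n →ₗ[k] B.X n} (hf : IsCochainMap A B f) {n : ℕ} {z : A.X n} (hz : z ∈ A.Z n) :
    f n z ∈ B.Z n :=
  ⟨(hf n z hz.1).1, by
    have : A.d n z = 0 := hz.2
    change B.d n (f n z) = 0
    rw [← (hf n z hz.1).2, this, map_zero]⟩

theorem IsCochainMap.map_Bd {A : CochainData.{u, w} k} {B : CochainData.{u, w'} k}
    {f : ∀ n, A.X n →ₗ[k] B.X n} (hf : IsCochainMap A B f) {n : ℕ} {z : A.X n} (hz : z ∈ A.Bd n) :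
    f n z ∈ B.Bd n := by
  rcases n with _ | n
  · obtain rfl := (Submodule.mem_bot k).1 hz
    simp [Bd]
  · obtain ⟨x, hx, rfl⟩ := hz
    exact ⟨f n x, (hf n x hx).1, ((hf n x hx).2).symm⟩

theorem IsCochainMap.exists_induces {A : CochainData.{u, w} k} {B : CochainData.{u, w'} k}
    {f : ∀ n, A.X n →ₗ[k] B.X n} (hf : IsCochainMap A B f) (n : ℕ) :
    ∃ F : A.H n →ₗ[k] B.H n, Induces A B (f n) F :=
  CochainData.exists_induces (f n) (fun _ hz => hf.map_Z hz) (fun _ hz => hf.map_Bd hz)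

theorem IsCochainMap.comp {A : CochainData.{u, w} k} {B : CochainData.{u, w'} k}
    {C : CochainData.{u, w''} k} {f : ∀ n, A.X n →ₗ[k] B.X n} {g : ∀ n, B.X n →ₗ[k] C.X n}
    (hg : IsCochainMap B C g) (hf : IsCochainMap A B f) :
    IsCochainMap A C fun n => g n ∘ₗ f n := fun n x hx => by
  obtain ⟨h1, h2⟩ := hf n x hx
  obtain ⟨h3, h4⟩ := hg n _ h1
  exact ⟨h3, by rw [LinearMap.comp_apply, h2, h4, LinearMap.comp_apply]⟩

section Connecting

variable {A : CochainData.{u, w} k} {B : CochainData.{u, w'} k} {C : CochainData.{u, w''} k}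
  {i : ∀ n, A.X n →ₗ[k] B.X n} {p : ∀ n, B.X n →ₗ[k] C.X n}

theorem IsShortExact.exists_lift (h : IsShortExact A B C i p) (hA : A.IsComplex)
    (hB : B.IsComplex) (n : ℕ) (z : C.Z n) : ∃ w ∈ B.N n, ∃ y : A.Z (n + 1),
      p n w = z ∧ i (n + 1) y = B.d n w := by
  obtain ⟨hi, hp, hinj, hex, hsurj⟩ := h
  obtain ⟨w, hw, e⟩ := hsurj n z z.2.1
  have hz : C.d n z = 0 := z.2.2
  obtain ⟨y, hy, e'⟩ := (hex (n + 1) (B.d n w) (hB n w hw).1).1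
    (by rw [(hp n w hw).2, e, hz])
  refine ⟨w, hw, ⟨y, hy, ?_⟩, e, e'⟩
  refine hinj _ _ (hA _ y hy).1 ?_
  rw [(hi _ y hy).2, e', (hB n w hw).2]

/-- If `p w` is a coboundary, some cocycle `w'` has the same image, so `w - w'` comes from `A` and
its preimage bounds `y`. In degree 0 the coboundaries vanish and `w' = 0` serves. -/
theorem IsShortExact.lift_mem_Bd (h : IsShortExact A B C i p) (hA : A.IsComplex)
    (hB : B.IsComplex) {n : ℕ} {w : B.X n} (hw : w ∈ B.N n) {y : A.X (n + 1)} (hy : y ∈ A.N (n + 1))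
    (hz : p n w ∈ C.Bd n) (e : i (n + 1) y = B.d n w) : y ∈ A.Bd (n + 1) := by
  obtain ⟨hi, hp, hinj, hex, hsurj⟩ := h
  obtain ⟨w', hw', hd, e'⟩ : ∃ w' ∈ B.N n, B.d n w' = 0 ∧ p n w' = p n w := by
    rcases n with _ | n
    · exact ⟨0, zero_mem _, map_zero _, by rw [(Submodule.mem_bot k).1 hz, map_zero]⟩
    · obtain ⟨x, hx, e'⟩ := hz
      obtain ⟨t, ht, rfl⟩ := hsurj n x hx
      exact ⟨B.d n t, (hB n t ht).1, (hB n t ht).2, by rw [(hp n t ht).2, e']⟩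
  obtain ⟨x, hx, e''⟩ := (hex n (w - w') (sub_mem hw hw')).1 (by rw [map_sub, e', sub_self])
  refine ⟨x, hx, ?_⟩
  rw [← sub_eq_zero]
  refine hinj _ _ (sub_mem (hA n x hx).1 hy) ?_
  rw [map_sub, (hi n x hx).2, e'', map_sub, hd, e, sub_zero, sub_self]

theorem IsShortExact.exists_isConnecting (h : IsShortExact A B C i p) (hA : A.IsComplex)
    (hB : B.IsComplex) :
    ∃ conn : ∀ n, C.H n →ₗ[k] A.H (n + 1), IsConnecting A B C i p conn := by
  suffices hs : ∀ n, ∃ c : C.H n →ₗ[k] A.H (n + 1), ∀ z : C.Z n, ∀ w ∈ B.N n,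
      ∀ y : A.Z (n + 1), p n w = z → i (n + 1) y = B.d n w → c (C.cls n z) = A.cls (n + 1) y by
    choose c hc using hs
    exact ⟨c, hc⟩
  intro n
  choose w hw y hwz hyw using h.exists_lift hA hB n
  -- Independence of the lift, with `p w'` equal to `z` only up to a coboundary. This one statement
  -- gives additivity, homogeneity, vanishing on coboundaries and the characterizing property.
  have key : ∀ (z : C.Z n) (w' : B.X n) (_ : w' ∈ B.N n) (y' : A.Z (n + 1)),
      p n w' - z ∈ C.Bd n → i (n + 1) y' = B.d n w' → A.cls (n + 1) (y z) = A.cls (n + 1) y' := by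
    intro z w' hw' y' hz e
    rw [cls_eq_cls]
    refine h.lift_mem_Bd hA hB (w := w z - w') (sub_mem (hw z) hw') (sub_mem (y z).2.1 y'.2.1) ?_ ?_
    · rw [map_sub, hwz, ← neg_sub]
      exact neg_mem hz
    · rw [map_sub, map_sub, hyw, e]
  let L : C.Z n →ₗ[k] A.H (n + 1) :=
    { toFun := fun z => A.cls (n + 1) (y z)
      map_add' := fun z z' => by
        rw [← map_add]
        refine key _ (w z + w z') (add_mem (hw z) (hw z')) _ ?_ ?_
        · rw [map_add, hwz, hwz, Submodule.coe_add, sub_self]; exact zero_mem _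
        · rw [Submodule.coe_add, map_add, map_add, hyw, hyw]
      map_smul' := fun r z => by
        rw [RingHom.id_apply, ← map_smul]
        refine key _ (r • w z) (Submodule.smul_mem _ _ (hw z)) _ ?_ ?_
        · rw [map_smul, hwz, Submodule.coe_smul, sub_self]; exact zero_mem _
        · rw [Submodule.coe_smul, map_smul, map_smul, hyw] }
  refine ⟨Submodule.liftQ _ L ?_, ?_⟩
  · intro z hz
    have hz' : (z : C.X n) ∈ C.Bd n := hz
    change A.cls (n + 1) (y z) = 0
    rw [key z 0 (zero_mem _) 0 (by rw [map_zero, zero_sub]; exact neg_mem hz') (by simp), map_zero]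
  · intro z w' hw' y' e e'
    exact key z w' hw' y' (by rw [e, sub_self]; exact zero_mem _) e'

theorem IsConnecting.unique (h : IsShortExact A B C i p) (hA : A.IsComplex)
    (hB : B.IsComplex) {c c' : ∀ n, C.H n →ₗ[k] A.H (n + 1)} (hc : IsConnecting A B C i p c)
    (hc' : IsConnecting A B C i p c') : c = c' := by
  funext n
  refine LinearMap.ext fun x => ?_
  obtain ⟨z, rfl⟩ := C.cls_surjective n x
  obtain ⟨w, hw, y, e, e'⟩ := h.exists_lift hA hB n z
  rw [hc n z w hw y e e', hc' n z w hw y e e']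

end Connecting

section Contraction

variable (A : CochainData.{u, w} k)

/-- Linear maps exhibiting the cohomology of a complex as a deformation retract of it. -/
structure Contraction where
  i : ∀ n, A.H n →ₗ[k] A.X n
  p : ∀ n, A.X n →ₗ[k] A.H n
  h : ∀ n, A.X (n + 1) →ₗ[k] A.X n
  i_mem : ∀ n x, i n x ∈ A.Z n
  cls_i : ∀ n x, A.cls n ⟨i n x, i_mem n x⟩ = x
  p_cls : ∀ n (z : A.Z n), p n z = A.cls n z
  p_d : ∀ n, ∀ x ∈ A.N n, p (n + 1) (A.d n x) = 0
  h_mem : ∀ n x, h n x ∈ A.N n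
  h_zero : ∀ x ∈ A.N 0, h 0 (A.d 0 x) = x - i 0 (p 0 x)
  h_succ : ∀ n, ∀ x ∈ A.N (n + 1),
    A.d n (h n x) + h (n + 1) (A.d (n + 1) x) = x - i (n + 1) (p (n + 1) x)

variable {A}

/-- Over a field choose a linear section `i` of `Z → H`, a linear extension `p` of the class map,
and a section `s` of `d` onto the coboundaries. The projections `q` onto cocycles and `r` onto
coboundaries built from them give the homotopy `h = s r`. -/
theorem IsComplex.nonempty_contraction (hA : A.IsComplex) : Nonempty A.Contraction := by
  have hi : ∀ n, ∃ i : A.H n →ₗ[k] A.Z n, A.cls n ∘ₗ i = LinearMap.id := fun n =>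
    LinearMap.exists_rightInverse_of_surjective _
      (LinearMap.range_eq_top.2 (A.cls_surjective n))
  have hp : ∀ n, ∃ p : A.X n →ₗ[k] A.H n, p ∘ₗ (A.Z n).subtype = A.cls n := fun n =>
    LinearMap.exists_extend _
  have hs : ∀ n, ∃ s : A.X (n + 1) →ₗ[k] A.N n, ∀ y ∈ A.Bd (n + 1), A.d n (s y) = y := by
    intro n
    let D : A.N n →ₗ[k] A.Bd (n + 1) :=
      LinearMap.restrict (A.d n) (fun x hx => ⟨x, hx, rfl⟩)
    have hD : Function.Surjective D := by
      rintro ⟨_, x, hx, rfl⟩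
      exact ⟨⟨x, hx⟩, rfl⟩
    obtain ⟨s, hs⟩ := LinearMap.exists_rightInverse_of_surjective D (LinearMap.range_eq_top.2 hD)
    obtain ⟨t, ht⟩ := LinearMap.exists_extend s
    refine ⟨t, fun y hy => ?_⟩
    have e1 := LinearMap.congr_fun ht ⟨y, hy⟩
    have e2 := congrArg Subtype.val (LinearMap.congr_fun hs ⟨y, hy⟩)
    simp only [LinearMap.comp_apply, Submodule.subtype_apply] at e1
    rw [e1]
    exact e2
  choose i hi using hi
  choose p hp using hp
  choose s hs using hs
  -- Subtracting `s d x` makes `q x` a cocycle, and removing a representative of its class makes `r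
  -- x` a coboundary. Since `r` is the identity on coboundaries, `d h + h d = r + s d = 1 - i p q`.
  let q (n : ℕ) : A.X n →ₗ[k] A.X n := LinearMap.id - (A.N n).subtype ∘ₗ s n ∘ₗ A.d n
  let r (n : ℕ) : A.X n →ₗ[k] A.X n :=
    q n - (A.Z n).subtype ∘ₗ i n ∘ₗ p n ∘ₗ q n
  have hpc : ∀ n (z : A.X n) (hz : z ∈ A.Z n), p n z = A.cls n ⟨z, hz⟩ := fun n z hz =>
    LinearMap.congr_fun (hp n) ⟨z, hz⟩
  have hcl : ∀ n x, A.cls n (i n x) = x := fun n x => LinearMap.congr_fun (hi n) x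
  have hq : ∀ n, ∀ x ∈ A.N n, q n x ∈ A.Z n := by
    intro n x hx
    refine ⟨sub_mem hx (s n _).2, ?_⟩
    change A.d n (q n x) = 0
    simp only [q, LinearMap.sub_apply, LinearMap.id_apply, LinearMap.comp_apply,
      Submodule.subtype_apply, map_sub]
    rw [hs n _ ⟨x, hx, rfl⟩, sub_self]
  have hqz : ∀ n (z : A.X n), A.d n z = 0 → q n z = z := by
    intro n z hz
    simp [q, hz]
  have hr : ∀ n, ∀ x ∈ A.N n, r n x ∈ A.Bd n := by
    intro n x hx
    have := (A.cls_eq_cls ⟨q n x, hq n x hx⟩ (i n (p n (q n x)))).1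
      (by rw [hcl, hpc n _ (hq n x hx)])
    exact this
  have hpd : ∀ n, ∀ x ∈ A.N n, p (n + 1) (A.d n x) = 0 := by
    intro n x hx
    rw [hpc _ _ (hA.d_mem_Z hx), cls_eq_zero]
    exact ⟨x, hx, rfl⟩
  have hrd : ∀ n, ∀ x ∈ A.N n, r (n + 1) (A.d n x) = A.d n x := by
    intro n x hx
    simp only [r, LinearMap.sub_apply, LinearMap.comp_apply, hqz _ _ (hA n x hx).2, hpd n x hx]
    simp
  refine ⟨{ i := fun n => (A.Z n).subtype ∘ₗ i n
            p := fun n => p n ∘ₗ q n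
            h := fun n => (A.N n).subtype ∘ₗ s n ∘ₗ r (n + 1)
            i_mem := fun n x => (i n x).2
            cls_i := hcl
            p_cls := ?_
            p_d := ?_
            h_mem := fun n x => (s n _).2
            h_zero := ?_
            h_succ := ?_ }⟩
  · intro n z
    rw [LinearMap.comp_apply, hqz n z z.2.2, hpc n z z.2]
  · intro n x hx
    rw [LinearMap.comp_apply, hqz _ _ (hA n x hx).2, hpd n x hx]
  · intro x hx
    have e := (Submodule.mem_bot k).1 (hr 0 x hx)
    simp only [LinearMap.comp_apply, hrd 0 x hx]
    simp only [r, q, LinearMap.sub_apply, LinearMap.comp_apply, LinearMap.id_apply] at e ⊢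
    rw [sub_eq_zero] at e
    rw [← e]
    abel
  · intro n x hx
    simp only [LinearMap.comp_apply, hrd _ x hx, Submodule.subtype_apply, hs n _ (hr _ x hx)]
    simp only [r, q, LinearMap.sub_apply, LinearMap.comp_apply, LinearMap.id_apply,
      Submodule.subtype_apply]
    abel

theorem Contraction.p_i (c : A.Contraction) (n : ℕ) (x : A.H n) : c.p n (c.i n x) = x := by
  rw [c.p_cls n ⟨c.i n x, c.i_mem n x⟩, c.cls_i]

theorem Contraction.d_i (c : A.Contraction) (n : ℕ) (x : A.H n) : A.d n (c.i n x) = 0 :=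
  (c.i_mem n x).2

end Contraction

end CochainData
end HopfCyc

namespace HopfCyc
-- The algebraic Künneth theorem over a field.
namespace CochainData

variable {k : Type u} [Field k] {A B : CochainData.{u, w} k}

theorem mem_tensor_N {e n : ℕ} {x : GTens k A.X B.X e n} :
    x ∈ (tensor e A B).N n ↔ ∀ p, x p ∈ subTens (A.N p.1.1) (B.N p.1.2) := by
  simp [Submodule.mem_pi]

theorem tensor_N_apply {e n : ℕ} {x : GTens k A.X B.X e n} (hx : x ∈ (tensor e A B).N n)
    (p q : ℕ) (h : p + q + e = n) : x ⟨(p, q), h⟩ ∈ subTens (A.N p) (B.N q) :=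
  mem_tensor_N.1 hx ⟨(p, q), h⟩

theorem map_sub_left' {V W V' W' : Type*} [AddCommGroup V] [Module k V]
    [AddCommGroup W] [Module k W] [AddCommGroup V'] [Module k V'] [AddCommGroup W'] [Module k W']
    (f f' : V →ₗ[k] V') (g : W →ₗ[k] W') :
    TensorProduct.map (f - f') g = TensorProduct.map f g - TensorProduct.map f' g :=
  TensorProduct.ext' fun x y => by simp [TensorProduct.sub_tmul]

theorem map_sub_right' {V W V' W' : Type*} [AddCommGroup V] [Module k V]
    [AddCommGroup W] [Module k W] [AddCommGroup V'] [Module k V'] [AddCommGroup W'] [Module k W']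
    (f : V →ₗ[k] V') (g g' : W →ₗ[k] W') :
    TensorProduct.map f (g - g') = TensorProduct.map f g - TensorProduct.map f g' :=
  TensorProduct.ext' fun x y => by simp [TensorProduct.tmul_sub]

theorem raise_mem_N (hA : A.IsComplex) (hB : B.IsComplex) {e n : ℕ} {x : GTens k A.X B.X e n}
    (hx : x ∈ (tensor e A B).N n) : raise A.d B.d e n x ∈ (tensor e A B).N (n + 1) := by
  rw [mem_tensor_N]
  rintro ⟨⟨p, q⟩, h⟩
  have hx := tensor_N_apply hx
  refine add_mem ?_ ?_
  · rcases p with _ | p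
    · exact zero_mem _
    · exact map_mem_subTens (z := x ⟨(p, q), by dsimp only at h; omega⟩)
        (fun x hx => (hA p x hx).1) (fun y hy => hy) (hx _ _ _)
  · rcases q with _ | q
    · exact zero_mem _
    · exact Submodule.smul_mem _ _
        (map_mem_subTens (z := x ⟨(p, q), by dsimp only at h; omega⟩)
          (fun x hx => hx) (fun y hy => (hB q y hy).1) (hx _ _ _))

theorem map_zero_left_subTens {V W V' W' : Type*} [AddCommGroup V] [Module k V]
    [AddCommGroup W] [Module k W] [AddCommGroup V'] [Module k V'] [AddCommGroup W'] [Module k W']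
    {P : Submodule k V} {Q : Submodule k W} {f : V →ₗ[k] V'} (g : W →ₗ[k] W')
    (hf : ∀ x ∈ P, f x = 0) {z : V ⊗[k] W} (hz : z ∈ subTens P Q) : TensorProduct.map f g z = 0 := by
  rw [map_congr_subTens (f' := 0) (g' := g) hf (fun _ _ => rfl) hz, TensorProduct.map_zero_left,
    LinearMap.zero_apply]

theorem map_zero_right_subTens {V W V' W' : Type*} [AddCommGroup V] [Module k V]
    [AddCommGroup W] [Module k W] [AddCommGroup V'] [Module k V'] [AddCommGroup W'] [Module k W']
    {P : Submodule k V} {Q : Submodule k W} (f : V →ₗ[k] V') {g : W →ₗ[k] W'}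
    (hg : ∀ x ∈ Q, g x = 0) {z : V ⊗[k] W} (hz : z ∈ subTens P Q) : TensorProduct.map f g z = 0 := by
  rw [map_congr_subTens (f' := f) (g' := 0) (fun _ _ => rfl) hg hz, TensorProduct.map_zero_right,
    LinearMap.zero_apply]

/-- The cross terms cancel by the sign `(-1)ᵖ`. The terms `d²` vanish only on the subspaces `N`, so
they are removed by `map_zero_left_subTens` and its mirror. -/
theorem raise_raise (hA : A.IsComplex) (hB : B.IsComplex) {e n : ℕ} {x : GTens k A.X B.X e n}
    (hx : x ∈ (tensor e A B).N n) : raise A.d B.d e (n + 1) (raise A.d B.d e n x) = 0 := by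
  have hx := tensor_N_apply hx
  have hl : ∀ (p q : ℕ) (h : p + q + e = n),
      TensorProduct.map (A.d (p + 1) ∘ₗ A.d p) (LinearMap.id (M := B.X q)) (x ⟨(p, q), h⟩) = 0 :=
    fun p q h => map_zero_left_subTens _ (fun y hy => (hA p y hy).2) (hx p q h)
  have hr : ∀ (p q : ℕ) (h : p + q + e = n),
      TensorProduct.map (LinearMap.id (M := A.X p)) (B.d (q + 1) ∘ₗ B.d q) (x ⟨(p, q), h⟩) = 0 :=
    fun p q h => map_zero_right_subTens _ (fun y hy => (hB q y hy).2) (hx p q h)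
  funext ⟨⟨p, q⟩, h⟩
  rcases p with _ | _ | p <;> rcases q with _ | _ | q <;>
    simp [raise, raiseLeft, raiseRight, TensorProduct.map_map, hl, hr, pow_succ]

theorem tensor_isComplex (hA : A.IsComplex) (hB : B.IsComplex) (e : ℕ) :
    (tensor e A B).IsComplex :=
  fun _ _ hx => ⟨raise_mem_N hA hB hx, raise_raise hA hB hx⟩

section Homotopy

variable (a : A.Contraction) (b : B.Contraction)

/-- The inclusion of the tensor product of the cohomologies. -/
noncomputable def kunnethIncl (e n : ℕ) : HTens e A B n →ₗ[k] GTens k A.X B.X e n :=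
  LinearMap.pi fun p => TensorProduct.map (a.i p.1.1) (b.i p.1.2) ∘ₗ LinearMap.proj p

/-- The projection to the tensor product of the cohomologies. -/
noncomputable def kunnethProj (e n : ℕ) : GTens k A.X B.X e n →ₗ[k] HTens e A B n :=
  LinearMap.pi fun p => TensorProduct.map (a.p p.1.1) (b.p p.1.2) ∘ₗ LinearMap.proj p

/-- The homotopy `h ⊗ 1 ± i p ⊗ h`. -/
noncomputable def kunnethHtpy (e n : ℕ) : GTens k A.X B.X e (n + 1) →ₗ[k] GTens k A.X B.X e n :=
  LinearMap.pi fun p =>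
    TensorProduct.map (a.h p.1.1) LinearMap.id ∘ₗ
      LinearMap.proj (⟨(p.1.1 + 1, p.1.2), by have := p.2; dsimp only; omega⟩ : Idx e (n + 1)) +
    (-1 : k) ^ p.1.1 • (TensorProduct.map (a.i p.1.1 ∘ₗ a.p p.1.1) (b.h p.1.2) ∘ₗ
      LinearMap.proj (⟨(p.1.1, p.1.2 + 1), by have := p.2; dsimp only; omega⟩ : Idx e (n + 1)))

theorem kunnethHtpy_mem {e n : ℕ} {x : GTens k A.X B.X e (n + 1)}
    (hx : x ∈ (tensor e A B).N (n + 1)) : kunnethHtpy a b e n x ∈ (tensor e A B).N n := by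
  rw [mem_tensor_N]
  rintro ⟨⟨p, q⟩, h⟩
  have hx := tensor_N_apply hx
  refine add_mem ?_ (Submodule.smul_mem _ _ ?_)
  · exact map_mem_subTens (fun x _ => a.h_mem p x) (fun y hy => hy)
      (hx (p + 1) q (by dsimp only at h; omega))
  · exact map_mem_subTens (f := a.i p ∘ₗ a.p p) (fun x _ => (a.i_mem p _).1)
      (fun y _ => b.h_mem q y) (hx p (q + 1) (by dsimp only at h; omega))

theorem kunnethIncl_mem {e n : ℕ} (x : HTens e A B n) :
    kunnethIncl a b e n x ∈ (tensor e A B).N n := by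
  rw [mem_tensor_N]
  intro p
  exact map_mem_subTens (P := ⊤) (Q := ⊤) (fun x _ => (a.i_mem _ x).1) (fun y _ => (b.i_mem _ y).1)
    (by rw [subTens, LinearMap.range_eq_top.2
          (TensorProduct.map_surjective (fun x => ⟨⟨x, trivial⟩, rfl⟩)
            (fun x => ⟨⟨x, trivial⟩, rfl⟩))]; trivial)

theorem raise_kunnethIncl {e n : ℕ} (x : HTens e A B n) :
    raise A.d B.d e n (kunnethIncl a b e n x) = 0 := by
  have ha : ∀ n, A.d n ∘ₗ a.i n = 0 := fun n => LinearMap.ext fun x => a.d_i n x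
  have hb : ∀ n, B.d n ∘ₗ b.i n = 0 := fun n => LinearMap.ext fun x => b.d_i n x
  funext ⟨⟨p, q⟩, h⟩
  rcases p with _ | p <;> rcases q with _ | q <;>
    simp [raise, raiseLeft, raiseRight, kunnethIncl, TensorProduct.map_map, ha, hb]

theorem kunnethProj_raise {e n : ℕ} {x : GTens k A.X B.X e n} (hx : x ∈ (tensor e A B).N n) :
    kunnethProj a b e (n + 1) (raise A.d B.d e n x) = 0 := by
  have hx := tensor_N_apply hx
  have hl : ∀ (p q : ℕ) (h : p + q + e = n),
      TensorProduct.map (a.p (p + 1) ∘ₗ A.d p) (b.p q) (x ⟨(p, q), h⟩) = 0 :=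
    fun p q h => map_zero_left_subTens _ (fun y hy => a.p_d p y hy) (hx p q h)
  have hr : ∀ (p q : ℕ) (h : p + q + e = n),
      TensorProduct.map (a.p p) (b.p (q + 1) ∘ₗ B.d q) (x ⟨(p, q), h⟩) = 0 :=
    fun p q h => map_zero_right_subTens _ (fun y hy => b.p_d q y hy) (hx p q h)
  funext ⟨⟨p, q⟩, h⟩
  rcases p with _ | p <;> rcases q with _ | q <;>
    simp [raise, raiseLeft, raiseRight, kunnethProj, TensorProduct.map_map, hl, hr]

theorem kunnethProj_kunnethIncl {e n : ℕ} (x : HTens e A B n) :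
    kunnethProj a b e n (kunnethIncl a b e n x) = x := by
  have ha : ∀ n, a.p n ∘ₗ a.i n = LinearMap.id := fun n => LinearMap.ext fun x => a.p_i n x
  have hb : ∀ n, b.p n ∘ₗ b.i n = LinearMap.id := fun n => LinearMap.ext fun x => b.p_i n x
  funext p
  simp [kunnethIncl, kunnethProj, TensorProduct.map_map, ha, hb]

theorem kunnethProj_single {e n : ℕ} (p : Idx e n) (α : A.Z p.1.1) (β : B.Z p.1.2) :
    kunnethProj a b e n (Pi.single p ((α : A.X p.1.1) ⊗ₜ[k] (β : B.X p.1.2))) =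
      Pi.single p (A.cls _ α ⊗ₜ B.cls _ β) := by
  classical
  funext p'
  by_cases h : p' = p
  · subst h
    simp [kunnethProj, a.p_cls, b.p_cls]
  · simp [kunnethProj, Pi.single_eq_of_ne h]

/-- This and the next three lemmas are the contraction identities applied in one tensor factor, in
the form used to eliminate `d h` (in degree 0, `h d`) from the homotopy computation. -/
theorem map_contraction_zero {q : ℕ} {z : A.X 0 ⊗[k] B.X q} (hz : z ∈ subTens (A.N 0) (B.N q)) :
    TensorProduct.map (a.h 0 ∘ₗ A.d 0) LinearMap.id z =
      z - TensorProduct.map (a.i 0 ∘ₗ a.p 0) LinearMap.id z := by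
  rw [map_congr_subTens (f' := LinearMap.id - a.i 0 ∘ₗ a.p 0) (g' := LinearMap.id)
    (fun x hx => a.h_zero x hx) (fun _ _ => rfl) hz, map_sub_left']
  simp

theorem map_contraction_succ {p q : ℕ} {z : A.X (p + 1) ⊗[k] B.X q}
    (hz : z ∈ subTens (A.N (p + 1)) (B.N q)) :
    TensorProduct.map (A.d p ∘ₗ a.h p) LinearMap.id z =
      z - TensorProduct.map (a.i (p + 1) ∘ₗ a.p (p + 1)) LinearMap.id z -
        TensorProduct.map (a.h (p + 1) ∘ₗ A.d (p + 1)) LinearMap.id z := by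
  rw [map_congr_subTens
    (f' := LinearMap.id - a.i (p + 1) ∘ₗ a.p (p + 1) - a.h (p + 1) ∘ₗ A.d (p + 1))
    (g' := LinearMap.id) (fun x hx => eq_sub_of_add_eq (a.h_succ p x hx)) (fun _ _ => rfl) hz,
    map_sub_left', map_sub_left']
  simp

theorem map_contraction_zero_right {p : ℕ} {z : A.X p ⊗[k] B.X 0}
    (hz : z ∈ subTens (A.N p) (B.N 0)) :
    TensorProduct.map (a.i p ∘ₗ a.p p) (b.h 0 ∘ₗ B.d 0) z =
      TensorProduct.map (a.i p ∘ₗ a.p p) LinearMap.id z -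
        TensorProduct.map (a.i p ∘ₗ a.p p) (b.i 0 ∘ₗ b.p 0) z := by
  rw [map_congr_subTens (f' := a.i p ∘ₗ a.p p) (g' := LinearMap.id - b.i 0 ∘ₗ b.p 0)
    (fun _ _ => rfl) (fun x hx => b.h_zero x hx) hz, map_sub_right']
  simp

theorem map_contraction_succ_right {p q : ℕ} {z : A.X p ⊗[k] B.X (q + 1)}
    (hz : z ∈ subTens (A.N p) (B.N (q + 1))) :
    TensorProduct.map (a.i p ∘ₗ a.p p) (B.d q ∘ₗ b.h q) z =
      TensorProduct.map (a.i p ∘ₗ a.p p) LinearMap.id z -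
        TensorProduct.map (a.i p ∘ₗ a.p p) (b.i (q + 1) ∘ₗ b.p (q + 1)) z -
        TensorProduct.map (a.i p ∘ₗ a.p p) (b.h (q + 1) ∘ₗ B.d (q + 1)) z := by
  rw [map_congr_subTens (f' := a.i p ∘ₗ a.p p)
    (g' := LinearMap.id - b.i (q + 1) ∘ₗ b.p (q + 1) - b.h (q + 1) ∘ₗ B.d (q + 1))
    (fun _ _ => rfl) (fun x hx => eq_sub_of_add_eq (b.h_succ q x hx)) hz,
    map_sub_right', map_sub_right']
  simp

/-- The operator `K = h ⊗ 1 ± i p ⊗ h` satisfies `d K + K d = 1 - (i p) ⊗ (i p)`: the first summand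
contributes `1 - i p ⊗ 1`, the second `i p ⊗ (1 - i p)`. On a cocycle the term `K d` vanishes. -/
theorem sub_mem_Bd {e n : ℕ} {x : GTens k A.X B.X e n} (hx : x ∈ (tensor e A B).Z n) :
    x - kunnethIncl a b e n (kunnethProj a b e n x) ∈ (tensor e A B).Bd n := by
  obtain ⟨hN, hd⟩ := hx
  have hd : raise A.d B.d e n x = 0 := hd
  have hK : kunnethHtpy a b e n (raise A.d B.d e n x) = 0 := by rw [hd, map_zero]
  have hN' := tensor_N_apply hN
  have ha : ∀ n, A.d n ∘ₗ a.i n ∘ₗ a.p n = 0 := fun n => LinearMap.ext fun x => a.d_i n _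
  have hpd : ∀ (p q q' : ℕ) (h : p + q + e = n) (f : B.X q →ₗ[k] B.X q'),
      TensorProduct.map ((a.i (p + 1) ∘ₗ a.p (p + 1)) ∘ₗ A.d p) f (x ⟨(p, q), h⟩) = 0 :=
    fun p q q' h f => map_zero_left_subTens _ (fun y hy => by
      simp [a.p_d p y hy]) (hN' p q h)
  rcases n with _ | n
  -- In degree 0 there are no coboundaries, and `K d x = 0` says directly that `x` is its own
  -- representative.
  · have : x - kunnethIncl a b e 0 (kunnethProj a b e 0 x) = 0 := by
      funext ⟨⟨p, q⟩, h⟩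
      obtain rfl : p = 0 := by dsimp only at h; omega
      obtain rfl : q = 0 := by dsimp only at h; omega
      have e := congrFun hK ⟨(0, 0), h⟩
      simp only [kunnethHtpy, raise, raiseLeft, raiseRight, LinearMap.pi_apply,
        LinearMap.add_apply, LinearMap.comp_apply, LinearMap.proj_apply, TensorProduct.map_map,
        add_zero, zero_add, Pi.zero_apply, LinearMap.comp_id, map_contraction_zero a (hN' 0 0 h),
        map_contraction_zero_right a b (hN' 0 0 h), pow_zero, one_smul] at e
      simp only [kunnethIncl, kunnethProj, Pi.sub_apply, LinearMap.pi_apply, LinearMap.comp_apply,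
        LinearMap.proj_apply, TensorProduct.map_map, Pi.zero_apply]
      rw [← e]
      abel
    rw [this]
    exact zero_mem _
  · refine ⟨kunnethHtpy a b e n x, kunnethHtpy_mem a b hN, ?_⟩
    -- The mixed terms `d ⊗ h` and `h ⊗ d` cancel by sign or vanish because `d i p = 0` and `i p d =
    -- 0`; each bidegree with zero entries loses the terms that would leave the quadrant.
    have : raise A.d B.d e n (kunnethHtpy a b e n x) +
        kunnethHtpy a b e (n + 1) (raise A.d B.d e (n + 1) x) =
        x - kunnethIncl a b e (n + 1) (kunnethProj a b e (n + 1) x) := by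
      funext ⟨⟨p, q⟩, h⟩
      rcases p with _ | p <;> rcases q with _ | q <;>
      simp only [kunnethHtpy, kunnethIncl, kunnethProj, raise, raiseLeft, raiseRight,
        Pi.add_apply, Pi.sub_apply, LinearMap.pi_apply, LinearMap.add_apply, LinearMap.comp_apply,
        LinearMap.proj_apply, TensorProduct.map_map, LinearMap.smul_apply, LinearMap.zero_apply,
        add_zero, zero_add, map_smul, map_add, smul_add, smul_smul, LinearMap.comp_id,
        LinearMap.id_comp, ha, hpd, TensorProduct.map_zero_left, smul_zero,
        map_contraction_zero a (hN' _ _ _), map_contraction_succ a (hN' _ _ _),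
        map_contraction_zero_right a b (hN' _ _ _),
        map_contraction_succ_right a b (hN' _ _ _)] <;> simp only [pow_zero, pow_succ, smul_sub,
        mul_neg, neg_mul, mul_one, neg_smul, ← mul_pow, neg_neg, one_pow, one_smul] <;> abel
    rw [hK] at this
    simpa using this

end Homotopy

theorem single_mem_Z {e n : ℕ} (p : Idx e n) (α : A.Z p.1.1) (β : B.Z p.1.2) :
    (Pi.single p ((α : A.X p.1.1) ⊗ₜ[k] (β : B.X p.1.2)) : GTens k A.X B.X e n) ∈
      (tensor e A B).Z n := by
  have hl : ∀ p' : Idx e n, TensorProduct.map (A.d p'.1.1) (LinearMap.id (M := B.X p'.1.2))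
      ((Pi.single p ((α : A.X p.1.1) ⊗ₜ[k] (β : B.X p.1.2)) : GTens k A.X B.X e n) p') = 0 := by
    intro p'
    by_cases h : p' = p
    · subst h
      have : A.d p'.1.1 (α : A.X p'.1.1) = 0 := α.2.2
      simp [this]
    · simp [Pi.single_eq_of_ne h]
  have hr : ∀ p' : Idx e n, TensorProduct.map (LinearMap.id (M := A.X p'.1.1)) (B.d p'.1.2)
      ((Pi.single p ((α : A.X p.1.1) ⊗ₜ[k] (β : B.X p.1.2)) : GTens k A.X B.X e n) p') = 0 := by
    intro p'
    by_cases h : p' = p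
    · subst h
      have : B.d p'.1.2 (β : B.X p'.1.2) = 0 := β.2.2
      simp [this]
    · simp [Pi.single_eq_of_ne h]
  refine ⟨mem_tensor_N.2 fun p' => ?_, ?_⟩
  · by_cases h : p' = p
    · subst h
      rw [Pi.single_eq_same]
      exact tmul_mem_subTens α.2.1 β.2.1
    · rw [Pi.single_eq_of_ne h]
      exact zero_mem _
  · change raise A.d B.d e n _ = 0
    funext ⟨⟨p', q'⟩, h⟩
    refine (congrArg₂ (· + ·) ?_ ?_).trans (add_zero 0)
    · rcases p' with _ | p'
      · rfl
      · exact hl ⟨(p', q'), by dsimp only at h ⊢; omega⟩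
    · rcases q' with _ | q'
      · rfl
      · exact (congrArg ((-1 : k) ^ p' • ·) (hr ⟨(p', q'), by dsimp only at h ⊢; omega⟩)).trans
          (smul_zero _)

/-- The inclusion of representatives and the projection to classes descend to mutually inverse maps:
one composite is the identity already on cochains, the other differs from it by the coboundary of
`sub_mem_Bd`. -/
theorem exists_isKunnethIso (hA : A.IsComplex) (hB : B.IsComplex) (e : ℕ) :
    ∃ κ, IsKunnethIso e A B κ := by
  obtain ⟨a⟩ := hA.nonempty_contraction
  obtain ⟨b⟩ := hB.nonempty_contraction
  have hZ : ∀ n x, kunnethIncl a b e n x ∈ (tensor e A B).Z n := fun n x =>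
    ⟨kunnethIncl_mem a b x, raise_kunnethIncl a b x⟩
  have hBd : ∀ n, ∀ z ∈ (tensor e A B).Bd n, kunnethProj a b e n z = 0 := by
    intro n z hz
    rcases n with _ | n
    · rw [(Submodule.mem_bot k).1 hz, map_zero]
    · obtain ⟨x, hx, rfl⟩ := hz
      exact kunnethProj_raise a b hx
  let F (n : ℕ) : HTens e A B n →ₗ[k] (tensor e A B).H n :=
    (tensor e A B).cls n ∘ₗ LinearMap.codRestrict _ (kunnethIncl a b e n) (hZ n)
  let G (n : ℕ) : (tensor e A B).H n →ₗ[k] HTens e A B n :=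
    Submodule.liftQ _ (kunnethProj a b e n ∘ₗ ((tensor e A B).Z n).subtype) fun z hz => hBd n z hz
  have hFG : ∀ n (z : (tensor e A B).Z n),
      F n (kunnethProj a b e n z) = (tensor e A B).cls n z := by
    intro n z
    refine (cls_eq_cls _ _ _).2 ?_
    rw [← neg_sub]
    exact neg_mem (sub_mem_Bd a b z.2)
  refine ⟨fun n => LinearEquiv.ofLinearMap (F n) (G n) ?_ ?_, ?_⟩
  · refine LinearMap.ext fun x => ?_
    obtain ⟨z, rfl⟩ := cls_surjective _ n x
    exact hFG n z
  · exact LinearMap.ext fun x => kunnethProj_kunnethIncl a b x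
  · intro n p α β
    refine ⟨single_mem_Z p α β, ?_⟩
    rw [← kunnethProj_single a b]
    exact hFG n ⟨_, single_mem_Z p α β⟩

/-- The prescribed values determine the isomorphism because the classes `[α] ⊗ [β]` span. -/
theorem IsKunnethIso.unique {e : ℕ}
    {κ κ' : ∀ n, HTens e A B n ≃ₗ[k] (tensor e A B).H n} (h : IsKunnethIso e A B κ)
    (h' : IsKunnethIso e A B κ') : κ = κ' := by
  funext n
  refine LinearEquiv.toLinearMap_injective (gtens_ext fun p x y => ?_)
  obtain ⟨α, rfl⟩ := cls_surjective _ _ x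
  obtain ⟨β, rfl⟩ := cls_surjective _ _ y
  obtain ⟨_, e1⟩ := h n p α β
  obtain ⟨_, e2⟩ := h' n p α β
  exact e1.trans e2.symm

end CochainData
end HopfCyc

namespace HopfCyc

/-! ### Tensor products of mixed complexes, total complexes and periodicity. -/

section Graded

variable {k : Type u} [Field k] {V W : ℕ → Type w} [∀ n, AddCommGroup (V n)]
  [∀ n, Module k (V n)] [∀ n, AddCommGroup (W n)] [∀ n, Module k (W n)]

theorem raise_comp_raise {dV : ∀ n, V n →ₗ[k] V (n + 1)} {dW : ∀ n, W n →ₗ[k] W (n + 1)}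
    (hV : ∀ n, dV (n + 1) ∘ₗ dV n = 0) (hW : ∀ n, dW (n + 1) ∘ₗ dW n = 0) (e n : ℕ)
    (x : GTens k V W e n) : raise dV dW e (n + 1) (raise dV dW e n x) = 0 := by
  funext ⟨⟨p, q⟩, h⟩
  rcases p with _ | _ | p <;> rcases q with _ | _ | q <;>
    simp [raise, raiseLeft, raiseRight, TensorProduct.map_map, hV, hW, pow_succ]

theorem lower_lower {BV : ∀ n, V (n + 1) →ₗ[k] V n} {BW : ∀ n, W (n + 1) →ₗ[k] W n}
    (hV : ∀ n, BV n ∘ₗ BV (n + 1) = 0) (hW : ∀ n, BW n ∘ₗ BW (n + 1) = 0) (n : ℕ)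
    (x : GTens k V W 0 (n + 2)) : lower BV BW n (lower BV BW (n + 1) x) = 0 := by
  funext ⟨⟨p, q⟩, h⟩
  simp [lower, TensorProduct.map_map, hV, hW, pow_succ]

theorem lower_raise_zero {dV : ∀ n, V n →ₗ[k] V (n + 1)} {dW : ∀ n, W n →ₗ[k] W (n + 1)}
    {BV : ∀ n, V (n + 1) →ₗ[k] V n} {BW : ∀ n, W (n + 1) →ₗ[k] W n}
    (hV : BV 0 ∘ₗ dV 0 = 0) (hW : BW 0 ∘ₗ dW 0 = 0) (x : GTens k V W 0 0) :
    lower BV BW 0 (raise dV dW 0 0 x) = 0 := by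
  funext ⟨⟨p, q⟩, h⟩
  obtain rfl : p = 0 := by dsimp only at h; omega
  obtain rfl : q = 0 := by dsimp only at h; omega
  simp [raise, raiseLeft, raiseRight, lower, TensorProduct.map_map, hV, hW]

/-- The cross terms cancel by sign, and the others are `bB + Bb` in one factor. Degree 0 carries no
outgoing `B`, so there `B b` has no partner and has to vanish by itself; this is the purpose of
`hV0` and `hW0`. -/
theorem raise_lower {dV : ∀ n, V n →ₗ[k] V (n + 1)} {dW : ∀ n, W n →ₗ[k] W (n + 1)}
    {BV : ∀ n, V (n + 1) →ₗ[k] V n} {BW : ∀ n, W (n + 1) →ₗ[k] W n}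
    (hV0 : BV 0 ∘ₗ dV 0 = 0) (hW0 : BW 0 ∘ₗ dW 0 = 0)
    (hV : ∀ n, dV n ∘ₗ BV n = - (BV (n + 1) ∘ₗ dV (n + 1)))
    (hW : ∀ n, dW n ∘ₗ BW n = - (BW (n + 1) ∘ₗ dW (n + 1))) (n : ℕ)
    (x : GTens k V W 0 (n + 1)) :
    raise dV dW 0 n (lower BV BW n x) + lower BV BW (n + 1) (raise dV dW 0 (n + 1) x) = 0 := by
  have neg_left : ∀ {p q p' q'} (f : V p →ₗ[k] V p') (g : W q →ₗ[k] W q') z,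
      TensorProduct.map (-f) g z = - TensorProduct.map f g z := fun f g z => by
    rw [← neg_one_smul k f, TensorProduct.map_smul_left]; simp
  have neg_right : ∀ {p q p' q'} (f : V p →ₗ[k] V p') (g : W q →ₗ[k] W q') z,
      TensorProduct.map f (-g) z = - TensorProduct.map f g z := fun f g z => by
    rw [← neg_one_smul k g, TensorProduct.map_smul_right]; simp
  funext ⟨⟨p, q⟩, h⟩
  rcases p with _ | p <;> rcases q with _ | q <;>
    simp only [raise, raiseLeft, raiseRight, lower, TensorProduct.map_map, hV, hW, hV0, hW0,
      pow_succ, pow_zero, LinearMap.pi_apply, Pi.add_apply, LinearMap.add_apply,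
      LinearMap.comp_apply, LinearMap.proj_apply, LinearMap.zero_apply, LinearMap.smul_apply,
      map_add, map_smul, map_neg, map_zero, smul_zero, smul_add, smul_smul, neg_left, neg_right,
      LinearMap.comp_id,
      LinearMap.id_comp, TensorProduct.map_zero_left, TensorProduct.map_zero_right, Pi.zero_apply,
      one_smul, mul_neg, neg_mul, mul_one, neg_smul, smul_neg, neg_neg, ← mul_pow, one_pow] <;>
    abel

/-- `S` has even degree, so no sign arises when it passes the differential of the other factor. -/
theorem raise_shiftDiff {dV : ∀ n, V n →ₗ[k] V (n + 1)} {dW : ∀ n, W n →ₗ[k] W (n + 1)}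
    {SV : ∀ n, V n →ₗ[k] V (n + 2)} {SW : ∀ n, W n →ₗ[k] W (n + 2)}
    (hV : ∀ n, dV (n + 2) ∘ₗ SV n = SV (n + 1) ∘ₗ dV n)
    (hW : ∀ n, dW (n + 2) ∘ₗ SW n = SW (n + 1) ∘ₗ dW n) (n : ℕ) (x : GTens k V W 2 n) :
    shiftDiff SV SW (n + 1) (raise dV dW 2 n x) = raise dV dW 0 n (shiftDiff SV SW n x) := by
  funext ⟨⟨p, q⟩, h⟩
  rcases p with _ | _ | _ | p <;> rcases q with _ | _ | _ | q <;>
    simp [raise, raiseLeft, raiseRight, shiftDiff, shiftLeft, shiftRight, TensorProduct.map_map,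
      hV, hW, pow_succ, smul_sub] <;> abel

end Graded

namespace MixedData

variable {k : Type u} [Field k]

/-- The identities of a mixed complex. -/
structure IsMixed (A : MixedData.{u, w} k) : Prop where
  b_mem : ∀ n, ∀ x ∈ A.N n, A.b n x ∈ A.N (n + 1)
  B_mem : ∀ n, ∀ x ∈ A.N (n + 1), A.B n x ∈ A.N n
  b_b : ∀ n, A.b (n + 1) ∘ₗ A.b n = 0
  B_B : ∀ n, A.B n ∘ₗ A.B (n + 1) = 0
  B_b_zero : A.B 0 ∘ₗ A.b 0 = 0
  b_B : ∀ n, A.b n ∘ₗ A.B n = - (A.B (n + 1) ∘ₗ A.b (n + 1))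

variable {A B : MixedData.{u, w} k}

theorem IsMixed.tensor (hA : A.IsMixed) (hB : B.IsMixed) : (MixedData.tensor A B).IsMixed where
  b_mem n x hx := by
    have hx : ∀ (p q : ℕ) (h : p + q + 0 = n), x ⟨(p, q), h⟩ ∈ subTens (A.N p) (B.N q) :=
      fun p q h => (Submodule.mem_pi.1 hx) ⟨(p, q), h⟩ trivial
    refine Submodule.mem_pi.2 ?_
    rintro ⟨⟨p, q⟩, h⟩ -
    refine add_mem ?_ ?_
    · rcases p with _ | p
      · exact zero_mem _
      · exact map_mem_subTens (z := x ⟨(p, q), by dsimp only at h; omega⟩)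
          (fun x hx => hA.b_mem p x hx) (fun y hy => hy) (hx _ _ _)
    · rcases q with _ | q
      · exact zero_mem _
      · exact Submodule.smul_mem _ _
          (map_mem_subTens (z := x ⟨(p, q), by dsimp only at h; omega⟩)
            (fun x hx => hx) (fun y hy => hB.b_mem q y hy) (hx _ _ _))
  B_mem n x hx := by
    have hx : ∀ (p q : ℕ) (h : p + q + 0 = n + 1), x ⟨(p, q), h⟩ ∈ subTens (A.N p) (B.N q) :=
      fun p q h => (Submodule.mem_pi.1 hx) ⟨(p, q), h⟩ trivial
    refine Submodule.mem_pi.2 ?_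
    rintro ⟨⟨p, q⟩, h⟩ -
    refine add_mem ?_ (Submodule.smul_mem _ _ ?_)
    · exact map_mem_subTens (z := x ⟨(p + 1, q), by dsimp only at h; omega⟩)
          (fun x hx => hA.B_mem p x hx) (fun y hy => hy) (hx _ _ _)
    · exact map_mem_subTens (z := x ⟨(p, q + 1), by dsimp only at h; omega⟩)
            (fun x hx => hx) (fun y hy => hB.B_mem q y hy) (hx _ _ _)
  b_b n := LinearMap.ext fun x => raise_comp_raise hA.b_b hB.b_b 0 n x
  B_B n := LinearMap.ext fun x => lower_lower hA.B_B hB.B_B n x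
  B_b_zero := LinearMap.ext fun x => lower_raise_zero hA.B_b_zero hB.B_b_zero x
  b_B n := LinearMap.ext fun x => eq_neg_of_add_eq_zero_left
    (raise_lower hA.B_b_zero hB.B_b_zero hA.b_B hB.b_B n x)

theorem mem_tot_N {n : ℕ} {x : A.TotX n} : x ∈ A.tot.N n ↔ ∀ r, x r ∈ A.N r.1.1 := by
  simp [Submodule.mem_pi]

theorem tot_N_apply {n : ℕ} {x : A.TotX n} (hx : x ∈ A.tot.N n) (m j : ℕ) (h : m + 2 * j = n) :
    x ⟨(m, j), h⟩ ∈ A.N m := mem_tot_N.1 hx ⟨(m, j), h⟩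

theorem IsMixed.tot_isComplex (hA : A.IsMixed) : A.tot.IsComplex := by
  have h1 : ∀ n x, A.b (n + 1) (A.b n x) = 0 := fun n x => LinearMap.congr_fun (hA.b_b n) x
  have h2 : ∀ n x, A.B n (A.B (n + 1) x) = 0 := fun n x => LinearMap.congr_fun (hA.B_B n) x
  have h3 : ∀ x, A.B 0 (A.b 0 x) = 0 := fun x => LinearMap.congr_fun hA.B_b_zero x
  have h4 : ∀ n x, A.b n (A.B n x) = - A.B (n + 1) (A.b (n + 1) x) :=
    fun n x => LinearMap.congr_fun (hA.b_B n) x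
  refine fun n x hx => ⟨mem_tot_N.2 ?_, ?_⟩
  · rintro ⟨⟨m, j⟩, h⟩
    have hx := tot_N_apply hx
    refine add_mem ?_ ?_
    · rcases m with _ | m
      · exact zero_mem _
      · exact hA.b_mem _ _ (hx m j _)
    · rcases j with _ | j
      · exact zero_mem _
      · exact hA.B_mem _ _ (hx (m + 1) j _)
  · funext ⟨⟨m, j⟩, h⟩
    refine Eq.trans (b := 0) ?_ rfl
    rcases m with _ | _ | m <;> rcases j with _ | _ | j <;>
      simp [totb, totB, h1, h2, h3, h4]

theorem per_mem {n : ℕ} {x : A.TotX n} (hx : x ∈ A.tot.N n) : A.per n x ∈ A.tot.N (n + 2) := by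
  refine mem_tot_N.2 ?_
  rintro ⟨⟨m, j⟩, h⟩
  rcases j with _ | j
  · exact zero_mem _
  · exact tot_N_apply hx m j _

theorem d_per (n : ℕ) : A.tot.d (n + 2) ∘ₗ A.per n = A.per (n + 1) ∘ₗ A.tot.d n := by
  refine LinearMap.ext fun x => ?_
  funext ⟨⟨m, j⟩, h⟩
  rcases m with _ | m <;> rcases j with _ | _ | j <;> simp [totb, totB, per, perComp]

theorem exists_induces_per (A : MixedData.{u, w} k) :
    ∃ S : ∀ n, A.tot.H n →ₗ[k] A.tot.H (n + 2),
      ∀ n, CochainData.Induces A.tot A.tot (A.per n) (S n) := by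
  have hd : ∀ n x, A.tot.d (n + 2) (A.per n x) = A.per (n + 1) (A.tot.d n x) :=
    fun n x => LinearMap.congr_fun (A.d_per n) x
  have : ∀ n, ∃ F, CochainData.Induces A.tot A.tot (A.per n) F := by
    intro n
    refine CochainData.exists_induces _ (fun z hz => ⟨per_mem hz.1, ?_⟩) fun z hz => ?_
    · have : A.tot.d n z = 0 := hz.2
      change A.tot.d (n + 2) (A.per n z) = 0
      rw [hd, this, map_zero]
    · rcases n with _ | n
      · rw [(Submodule.mem_bot k).1 hz, map_zero]
        exact zero_mem _
      · obtain ⟨x, hx, rfl⟩ := hz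
        exact ⟨A.per n x, per_mem hx, hd n x⟩
  choose S hS using this
  exact ⟨S, hS⟩

end MixedData
end HopfCyc

namespace HopfCyc
-- Exactness of the sequence with `S ⊗ 1 - 1 ⊗ S` and μ, as polynomial division by `u - u'`.
namespace MixedData

variable {k : Type u} [Field k] {A B : MixedData.{u, w} k}

/-- Resolves a tensor of two finite products into its matrix of components, so that equality and
membership can be tested on each `uᵃ Aᵐ ⊗ uᵇ Bᵐ'`. -/
theorem sum_sum_map_single {ι κ : Type*} [Fintype ι] [Fintype κ] [DecidableEq ι] [DecidableEq κ]
    {V : ι → Type*} {W : κ → Type*} [∀ i, AddCommGroup (V i)] [∀ i, Module k (V i)]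
    [∀ i, AddCommGroup (W i)] [∀ i, Module k (W i)] (z : (∀ i, V i) ⊗[k] (∀ j, W j)) :
    ∑ i, ∑ j, TensorProduct.map (LinearMap.single k V i) (LinearMap.single k W j)
      (TensorProduct.map (LinearMap.proj i) (LinearMap.proj j) z) = z := by
  induction z using TensorProduct.induction_on with
  | zero => simp
  | add x y hx hy => simp only [map_add, Finset.sum_add_distrib, hx, hy]
  | tmul x y =>
    conv_rhs => rw [← Finset.univ_sum_single x, ← Finset.univ_sum_single y,
      TensorProduct.sum_tmul]
    simp [LinearMap.single_apply, TensorProduct.tmul_sum]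

theorem map_proj_sum_map_single {ι κ : Type*} [Fintype ι] [Fintype κ] [DecidableEq ι]
    [DecidableEq κ] {V : ι → Type*} {W : κ → Type*} [∀ i, AddCommGroup (V i)] [∀ i, Module k (V i)]
    [∀ i, AddCommGroup (W i)] [∀ i, Module k (W i)] (c : ∀ i j, V i ⊗[k] W j) (i : ι) (j : κ) :
    TensorProduct.map (LinearMap.proj i) (LinearMap.proj j)
      (∑ r, ∑ s, TensorProduct.map (LinearMap.single k V r) (LinearMap.single k W s) (c r s)) =
        c i j := by
  simp only [map_sum, TensorProduct.map_map]
  rw [Finset.sum_eq_single i, Finset.sum_eq_single j]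
  · simp [LinearMap.proj_comp_single_same]
  · intro s _ hs
    simp [LinearMap.proj_comp_single_ne k W j s hs.symm]
  · simp
  · intro r _ hr
    simp [LinearMap.proj_comp_single_ne k V i r hr.symm]
  · simp

/-- The component of an element of `⨁ Totᵖ(A) ⊗ Tot^q(B)` along `uᵃ Aᵐ ⊗ uᵇ Bᵐ'`. -/
noncomputable def coord (A B : MixedData.{u, w} k) (e n : ℕ) (p q : ℕ) (h : p + q + e = n)
    (r : TIdx p) (s : TIdx q) : GTens k A.TotX B.TotX e n →ₗ[k] A.X r.1.1 ⊗[k] B.X s.1.1 :=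
  TensorProduct.map (LinearMap.proj r) (LinearMap.proj s) ∘ₗ
    LinearMap.proj (φ := fun p : Idx e n => A.TotX p.1.1 ⊗[k] B.TotX p.1.2) ⟨(p, q), h⟩

/-- The component along `uᵃ Aᵐ ⊗ uᵇ Bᵐ'`. -/
noncomputable def coo {e n : ℕ} (x : GTens k A.TotX B.TotX e n) (m a m' b : ℕ)
    (h : m + 2 * a + (m' + 2 * b) + e = n) : A.X m ⊗[k] B.X m' :=
  coord A B e n (m + 2 * a) (m' + 2 * b) h ⟨(m, a), rfl⟩ ⟨(m', b), rfl⟩ x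

/-- Case distinctions on degrees produce `p` together with a proof of `m + 2a = p`; this transports
such a component to the form `coo`, where the degree is literally `m + 2a`. -/
theorem coord_eq_coo {e n : ℕ} (x : GTens k A.TotX B.TotX e n) (p q : ℕ) (h : p + q + e = n)
    (m a m' b : ℕ) (hr : m + 2 * a = p) (hs : m' + 2 * b = q) :
    coord A B e n p q h ⟨(m, a), hr⟩ ⟨(m', b), hs⟩ x =
      coo x m a m' b (by subst hr hs; exact h) := by
  subst hr hs
  rfl

theorem coo_congr {e n : ℕ} (x : GTens k A.TotX B.TotX e n) {m a m' b a' b' : ℕ}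
    (h : m + 2 * a + (m' + 2 * b) + e = n) (ha : a = a') (hb : b = b') :
    coo x m a m' b h = coo x m a' m' b' (by subst ha hb; exact h) := by
  subst ha hb
  rfl

theorem coo_ext {e n : ℕ} {x y : GTens k A.TotX B.TotX e n}
    (h : ∀ m a m' b h, coo x m a m' b h = coo y m a m' b h) : x = y := by
  classical
  have := Fintype.ofFinite
  funext ⟨⟨p, q⟩, hpq⟩
  rw [← sum_sum_map_single (x ⟨(p, q), hpq⟩), ← sum_sum_map_single (y ⟨(p, q), hpq⟩)]
  refine Finset.sum_congr rfl fun r _ => Finset.sum_congr rfl fun s _ => congrArg _ ?_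
  have key : ∀ (p q : ℕ) (hpq : p + q + e = n) (r : TIdx p) (s : TIdx q),
      coord A B e n p q hpq r s x = coord A B e n p q hpq r s y := by
    rintro _ _ hpq ⟨⟨m, a⟩, rfl⟩ ⟨⟨m', b⟩, rfl⟩
    exact h m a m' b hpq
  exact key p q hpq r s

theorem mem_tensor_tot_N {e n : ℕ} {x : GTens k A.TotX B.TotX e n} :
    x ∈ (CochainData.tensor e A.tot B.tot).N n ↔
      ∀ m a m' b h, coo x m a m' b h ∈ subTens (A.N m) (B.N m') := by
  classical
  have := Fintype.ofFinite
  rw [CochainData.mem_tensor_N]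
  constructor
  · intro hx m a m' b h
    exact map_mem_subTens (P := A.tot.N (m + 2 * a)) (Q := B.tot.N (m' + 2 * b))
      (fun x hx => mem_tot_N.1 hx ⟨(m, a), rfl⟩) (fun x hx => mem_tot_N.1 hx ⟨(m', b), rfl⟩)
      (hx ⟨(m + 2 * a, m' + 2 * b), h⟩)
  · rintro hx ⟨⟨p, q⟩, h⟩
    rw [← sum_sum_map_single (x ⟨(p, q), h⟩)]
    refine sum_mem fun r _ => sum_mem fun s _ => ?_
    have hs : ∀ (D : MixedData.{u, w} k) (p : ℕ) (r : TIdx p), ∀ x ∈ D.N r.1.1,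
        LinearMap.single k (fun r : TIdx p => D.X r.1.1) r x ∈ D.tot.N p := by
      intro D p r x hx
      refine mem_tot_N.2 fun r' => ?_
      by_cases h : r' = r
      · subst h; simpa using hx
      · simp [Pi.single_eq_of_ne h]
    have key : ∀ (p q : ℕ) (h : p + q + e = n) (r : TIdx p) (s : TIdx q),
        coord A B e n p q h r s x ∈ subTens (A.N r.1.1) (B.N s.1.1) := by
      rintro _ _ h ⟨⟨m, a⟩, rfl⟩ ⟨⟨m', b⟩, rfl⟩
      exact hx m a m' b h
    exact map_mem_subTens (hs A p r) (hs B q s) (key p q h r s)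

/-- The element with prescribed components. -/
noncomputable def ofCoo {e n : ℕ} (c : ∀ m a m' b : ℕ, m + 2 * a + (m' + 2 * b) + e = n →
    A.X m ⊗[k] B.X m') : GTens k A.TotX B.TotX e n := fun p =>
  letI := Classical.decEq (TIdx p.1.1)
  letI := Classical.decEq (TIdx p.1.2)
  letI := Fintype.ofFinite (TIdx p.1.1)
  letI := Fintype.ofFinite (TIdx p.1.2)
  ∑ r : TIdx p.1.1, ∑ s : TIdx p.1.2,
    TensorProduct.map (LinearMap.single k (fun r : TIdx p.1.1 => A.X r.1.1) r)
      (LinearMap.single k (fun s : TIdx p.1.2 => B.X s.1.1) s)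
      (c r.1.1 r.1.2 s.1.1 s.1.2 (by rw [r.2, s.2]; exact p.2))

theorem coo_ofCoo {e n : ℕ} (c : ∀ m a m' b : ℕ, m + 2 * a + (m' + 2 * b) + e = n →
    A.X m ⊗[k] B.X m') (m a m' b : ℕ) (h : m + 2 * a + (m' + 2 * b) + e = n) :
    coo (ofCoo c) m a m' b h = c m a m' b h := by
  let r : TIdx (m + 2 * a) := ⟨(m, a), rfl⟩
  let s : TIdx (m' + 2 * b) := ⟨(m', b), rfl⟩
  let _ := Classical.decEq (TIdx (m + 2 * a))
  let _ := Classical.decEq (TIdx (m' + 2 * b))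
  let _ := Fintype.ofFinite (TIdx (m + 2 * a))
  let _ := Fintype.ofFinite (TIdx (m' + 2 * b))
  exact map_proj_sum_map_single (V := fun r : TIdx (m + 2 * a) => A.X r.1.1)
    (W := fun s : TIdx (m' + 2 * b) => B.X s.1.1) (fun r s => c r.1.1 r.1.2 s.1.1 s.1.2
      (by rw [r.2, s.2]; exact h)) r s

theorem coo_zero {e n : ℕ} (m a m' b h) :
    coo (0 : GTens k A.TotX B.TotX e n) m a m' b h = 0 := map_zero _

/-- The components of `S ⊗ 1`. -/
noncomputable def cooShiftLeft {n : ℕ} (x : GTens k A.TotX B.TotX 2 n) (m : ℕ) : (a m' b : ℕ) →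
    m + 2 * a + (m' + 2 * b) + 0 = n → A.X m ⊗[k] B.X m'
  | 0, _, _, _ => 0
  | a + 1, m', b, h => coo x m a m' b (by omega)

/-- The components of `1 ⊗ S`. -/
noncomputable def cooShiftRight {n : ℕ} (x : GTens k A.TotX B.TotX 2 n) (m a m' : ℕ) : (b : ℕ) →
    m + 2 * a + (m' + 2 * b) + 0 = n → A.X m ⊗[k] B.X m'
  | 0, _ => 0
  | b + 1, h => coo x m a m' b (by omega)

theorem coo_shiftDiff {n : ℕ} (x : GTens k A.TotX B.TotX 2 n) (m a m' b h) :
    coo (shiftDiff A.per B.per n x) m a m' b h =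
      cooShiftLeft x m a m' b h - cooShiftRight x m a m' b h := by
  have hl : ∀ (p q : ℕ) (h : p + q + 0 = n) (m a m' b : ℕ) (hr : m + 2 * a = p)
      (hs : m' + 2 * b = q),
      TensorProduct.map (LinearMap.proj (⟨(m, a), hr⟩ : TIdx p))
        (LinearMap.proj (⟨(m', b), hs⟩ : TIdx q)) (shiftLeft A.per n ⟨(p, q), h⟩ x) =
      cooShiftLeft x m a m' b (by subst hr hs; exact h) := by
    intro p q h m a m' b hr hs
    rcases p with _ | _ | p
    · obtain rfl : a = 0 := by omega
      exact map_zero _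
    · obtain rfl : a = 0 := by omega
      exact map_zero _
    · simp only [shiftLeft, LinearMap.comp_apply, TensorProduct.map_map, LinearMap.comp_id]
      rcases a with _ | a
      · have e : LinearMap.proj (⟨(m, 0), hr⟩ : TIdx (p + 2)) ∘ₗ A.per p = 0 := rfl
        rw [e, TensorProduct.map_zero_left]
        rfl
      · exact coord_eq_coo x p q (by omega) m a m' b (by omega) hs
  have hr' : ∀ (p q : ℕ) (h : p + q + 0 = n) (m a m' b : ℕ) (hr : m + 2 * a = p)
      (hs : m' + 2 * b = q),
      TensorProduct.map (LinearMap.proj (⟨(m, a), hr⟩ : TIdx p))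
        (LinearMap.proj (⟨(m', b), hs⟩ : TIdx q)) (shiftRight B.per n ⟨(p, q), h⟩ x) =
      cooShiftRight x m a m' b (by subst hr hs; exact h) := by
    intro p q h m a m' b hr hs
    rcases q with _ | _ | q
    · obtain rfl : b = 0 := by omega
      exact map_zero _
    · obtain rfl : b = 0 := by omega
      exact map_zero _
    · simp only [shiftRight, LinearMap.comp_apply, TensorProduct.map_map, LinearMap.comp_id]
      rcases b with _ | b
      · have e : LinearMap.proj (⟨(m', 0), hs⟩ : TIdx (q + 2)) ∘ₗ B.per q = 0 := rfl
        rw [e, TensorProduct.map_zero_right]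
        rfl
      · exact coord_eq_coo x p q (by omega) m a m' b hr (by omega)
  rw [← hl _ _ h m a m' b rfl rfl, ← hr' _ _ h m a m' b rfl rfl, ← map_sub]
  rfl

theorem mu_apply {n : ℕ} (x : GTens k A.TotX B.TotX 0 n) (M j m m' : ℕ) (h : M + 2 * j = n)
    (hm : m + m' + 0 = M) : mu A B n x ⟨(M, j), h⟩ ⟨(m, m'), hm⟩ =
      ∑ i : Fin (j + 1), coo x m i m' (j - i) (by omega) := by
  simp only [mu, LinearMap.pi_apply, LinearMap.sum_apply]
  rfl

theorem cooShiftLeft_mem {n : ℕ} {x : GTens k A.TotX B.TotX 2 n}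
    (hx : x ∈ (CochainData.tensor 2 A.tot B.tot).N n) (m a m' b h) :
    cooShiftLeft x m a m' b h ∈ subTens (A.N m) (B.N m') := by
  rcases a with _ | a
  · exact zero_mem _
  · exact mem_tensor_tot_N.1 hx m a m' b _

theorem cooShiftRight_mem {n : ℕ} {x : GTens k A.TotX B.TotX 2 n}
    (hx : x ∈ (CochainData.tensor 2 A.tot B.tot).N n) (m a m' b h) :
    cooShiftRight x m a m' b h ∈ subTens (A.N m) (B.N m') := by
  rcases b with _ | b
  · exact zero_mem _
  · exact mem_tensor_tot_N.1 hx m a m' b _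

theorem isCochainMap_shiftDiff : CochainData.IsCochainMap (CochainData.tensor 2 A.tot B.tot)
    (CochainData.tensor 0 A.tot B.tot) (shiftDiff A.per B.per) := by
  refine fun n x hx => ⟨mem_tensor_tot_N.2 fun m a m' b h => ?_, ?_⟩
  · rw [coo_shiftDiff]
    exact sub_mem (cooShiftLeft_mem hx _ _ _ _ _) (cooShiftRight_mem hx _ _ _ _ _)
  · exact raise_shiftDiff A.d_per B.d_per n x

/-- If `(u - u') x = 0` then `x_{a-1,b+1} = x_{a,b}`, and the coefficients with `a = 0` vanish;
induct on the exponent of the first variable. -/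
theorem shiftDiff_injective {n : ℕ} {x : GTens k A.TotX B.TotX 2 n}
    (hx : shiftDiff A.per B.per n x = 0) : x = 0 := by
  refine coo_ext fun m a m' b h => ?_
  rw [coo_zero]
  have key : ∀ m a m' b h, cooShiftLeft x m a m' b h = cooShiftRight x m a m' b h := by
    intro m a m' b h
    rw [← sub_eq_zero, ← coo_shiftDiff, hx, coo_zero]
  induction a generalizing b with
  | zero => exact (key m 0 m' (b + 1) (by omega)).symm
  | succ a ih => exact (key m (a + 1) m' (b + 1) (by omega)).symm.trans (ih (b + 1) (by omega))

/-- Setting `u = u'` kills `u - u'`: in each component the sum telescopes, and the two end terms lie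
outside the range of exponents. -/
theorem mu_shiftDiff {n : ℕ} (x : GTens k A.TotX B.TotX 2 n) :
    mu A B n (shiftDiff A.per B.per n x) = 0 := by
  funext ⟨⟨M, j⟩, h⟩ ⟨⟨m, m'⟩, hm⟩
  rw [mu_apply]
  simp only [coo_shiftDiff, Finset.sum_sub_distrib]
  rw [Fin.sum_univ_succ, Fin.sum_univ_castSucc (n := j)
    (f := fun i : Fin (j + 1) => cooShiftRight x m i m' (j - i) _)]
  have e1 : ∀ h', cooShiftLeft x m (0 : Fin (j + 1)) m' (j - (0 : Fin (j + 1))) h' = 0 :=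
    fun _ => rfl
  have e2 : ∀ (b : ℕ) (hb : b = 0) h', cooShiftRight x m (Fin.last j) m' b h' = 0 := by
    rintro b rfl h'
    rfl
  rw [e1, e2 _ (by simp), zero_add, add_zero]
  refine sub_eq_zero.2 (Finset.sum_congr rfl fun i _ => ?_)
  have e3 : ∀ (b : ℕ) (hb : b = (j - (i + 1)) + 1) h', cooShiftRight x m i m' b h' =
      coo x m i m' (j - (i + 1)) (by omega) := by
    rintro b rfl h'
    rfl
  exact (e3 _ (by simp only [Fin.val_castSucc]; omega) _).symm

/-- For fixed `m` and `m'` this is division of a homogeneous polynomial by `u - u'`, the vanishing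
of μ being the vanishing of the remainder. -/
theorem exists_shiftDiff_eq {n : ℕ} {y : GTens k A.TotX B.TotX 0 n}
    (hy : y ∈ (CochainData.tensor 0 A.tot B.tot).N n) (h0 : mu A B n y = 0) :
    ∃ x ∈ (CochainData.tensor 2 A.tot B.tot).N n, shiftDiff A.per B.per n x = y := by
  -- The coefficient of `uᵗ u'^(j-t)`, extended by zero to `t > j` so that sums over `range` carry
  -- no side conditions.
  let Y (m m' t j : ℕ) (h : m + m' + 2 * j = n) : A.X m ⊗[k] B.X m' :=
    if ht : t ≤ j then coo y m t m' (j - t) (by omega) else 0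
  have hY : ∀ m m' t j h, Y m m' t j h ∈ subTens (A.N m) (B.N m') := by
    intro m m' t j h
    dsimp only [Y]
    split_ifs
    · exact mem_tensor_tot_N.1 hy _ _ _ _ _
    · exact zero_mem _
  have hsum : ∀ m m' j h, ∑ t ∈ Finset.range (j + 1), Y m m' t j h = 0 := by
    intro m m' j h
    have := congrFun (congrFun h0 ⟨(m + m', j), h⟩) ⟨(m, m'), rfl⟩
    rw [mu_apply] at this
    rw [Finset.sum_range]
    refine Eq.trans (Finset.sum_congr rfl fun i _ => ?_) this
    exact dif_pos (by omega)
  -- The quotient of the division: solving `x_{a-1,b} - x_{a,b-1} = y_{a,b}` upwards from `a = 0`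
  -- gives these negated partial sums. At `b = 0` the equation is the vanishing of the full sum.
  let x : GTens k A.TotX B.TotX 2 n := ofCoo fun m a m' b h =>
    - ∑ t ∈ Finset.range (a + 1), Y m m' t (a + b + 1) (by omega)
  have hx : ∀ m a m' b h, coo x m a m' b h =
      - ∑ t ∈ Finset.range (a + 1), Y m m' t (a + b + 1) (by omega) := coo_ofCoo _
  refine ⟨x, mem_tensor_tot_N.2 fun m a m' b h => ?_, coo_ext fun m a m' b h => ?_⟩
  · rw [hx]
    exact neg_mem (sum_mem fun t _ => hY _ _ _ _ (by omega))
  · have hj : ∀ j (hj : j = a + b), Y m m' a j (by omega) = coo y m a m' b h := by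
      rintro j rfl
      refine (dif_pos (by omega)).trans (coo_congr _ _ rfl (by omega))
    have hYc : ∀ t j j' h (hj : j = j'), Y m m' t j h = Y m m' t j' (by omega) := by
      rintro t j _ h rfl; rfl
    rw [coo_shiftDiff]
    rcases a with _ | a <;> rcases b with _ | b
    · have := hsum m m' 0 (by omega)
      rw [Finset.sum_range_one, hj 0 rfl] at this
      simp [cooShiftLeft, cooShiftRight, this]
    · simp only [cooShiftLeft, cooShiftRight, hx]
      rw [Finset.sum_range_one, zero_sub, neg_neg, hj _ (by omega)]
    · simp only [cooShiftLeft, cooShiftRight, hx]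
      have := hsum m m' (a + 1) (by omega)
      rw [Finset.sum_range_succ, hj _ (by omega)] at this
      rw [sub_zero, neg_eq_of_add_eq_zero_right]
      exact this
    · have h' : m + m' + 2 * (a + 1 + b + 1) = n := by omega
      simp only [cooShiftLeft, cooShiftRight, hx]
      rw [Finset.sum_range_succ _ (a + 1), hj _ (by omega), neg_sub_neg, 
        Finset.sum_congr rfl fun t _ => hYc t (a + 1 + b + 1) (a + (b + 1) + 1) h' (by omega)]
      abel

theorem exists_mu_eq {n : ℕ} {z : (tensor A B).TotX n} (hz : z ∈ (tensor A B).tot.N n) :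
    ∃ y ∈ (CochainData.tensor 0 A.tot B.tot).N n, mu A B n y = z := by
  have hz' : ∀ M j m m' h h', z ⟨(M, j), h⟩ ⟨(m, m'), h'⟩ ∈ subTens (A.N m) (B.N m') :=
    fun M j m m' h h' => (Submodule.mem_pi.1 (tot_N_apply hz M j h)) ⟨(m, m'), h'⟩ trivial
  -- Every power of `u` is placed on the second factor.
  let y : GTens k A.TotX B.TotX 0 n := ofCoo fun m a m' b h =>
    if ha : a = 0 then z ⟨(m + m', b), by omega⟩ ⟨(m, m'), rfl⟩ else 0
  have hy : ∀ m a m' b h, coo y m a m' b h =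
    if ha : a = 0 then z ⟨(m + m', b), by omega⟩ ⟨(m, m'), rfl⟩ else 0 := coo_ofCoo _
  refine ⟨y, mem_tensor_tot_N.2 fun m a m' b h => ?_, ?_⟩
  · rw [hy]
    split_ifs
    · exact hz' _ _ _ _ _ _
    · exact zero_mem _
  · funext ⟨⟨M, j⟩, h⟩ ⟨⟨m, m'⟩, hm⟩
    rw [mu_apply, Finset.sum_eq_single 0]
    · rw [hy]
      refine (dif_pos rfl).trans ?_
      obtain rfl : m + m' = M := hm
      rfl
    · intro i _ hi
      rw [hy, dif_neg]
      exact fun h => hi (Fin.ext h)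
    · exact fun h => absurd (Finset.mem_univ _) h

/-- The components of `b ⊗ 1`. -/
noncomputable def coobLeft {e n : ℕ} (x : GTens k A.TotX B.TotX e n) : (m a m' b : ℕ) →
    m + 2 * a + (m' + 2 * b) + e = n + 1 → A.X m ⊗[k] B.X m'
  | 0, _, _, _, _ => 0
  | m + 1, a, m', b, h => TensorProduct.map (A.b m) LinearMap.id (coo x m a m' b (by omega))

/-- The components of `B ⊗ 1`. -/
noncomputable def cooBLeft {e n : ℕ} (x : GTens k A.TotX B.TotX e n) (m : ℕ) : (a m' b : ℕ) →
    m + 2 * a + (m' + 2 * b) + e = n + 1 → A.X m ⊗[k] B.X m'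
  | 0, _, _, _ => 0
  | a + 1, m', b, h => TensorProduct.map (A.B m) LinearMap.id (coo x (m + 1) a m' b (by omega))

/-- The components of `1 ⊗ b`, without sign. -/
noncomputable def coobRight {e n : ℕ} (x : GTens k A.TotX B.TotX e n) (m a : ℕ) : (m' b : ℕ) →
    m + 2 * a + (m' + 2 * b) + e = n + 1 → A.X m ⊗[k] B.X m'
  | 0, _, _ => 0
  | m' + 1, b, h => TensorProduct.map LinearMap.id (B.b m') (coo x m a m' b (by omega))

/-- The components of `1 ⊗ B`, without sign. -/
noncomputable def cooBRight {e n : ℕ} (x : GTens k A.TotX B.TotX e n) (m a m' : ℕ) : (b : ℕ) →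
    m + 2 * a + (m' + 2 * b) + e = n + 1 → A.X m ⊗[k] B.X m'
  | 0, _ => 0
  | b + 1, h => TensorProduct.map LinearMap.id (B.B m') (coo x m a (m' + 1) b (by omega))

/-- The differential of the tensor product of total complexes in coordinates: `b` and `B` of either
factor, where `B` also raises the exponent of that factor. -/
theorem coo_raise {e n : ℕ} (x : GTens k A.TotX B.TotX e n) (m a m' b h) :
    coo (raise A.tot.d B.tot.d e n x) m a m' b h = coobLeft x m a m' b h + cooBLeft x m a m' b h +
      (-1 : k) ^ m • (coobRight x m a m' b h + cooBRight x m a m' b h) := by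
  have hl : ∀ (p q : ℕ) (h : p + q + e = n + 1) (m a m' b : ℕ) (hr : m + 2 * a = p)
      (hs : m' + 2 * b = q),
      TensorProduct.map (LinearMap.proj (⟨(m, a), hr⟩ : TIdx p))
        (LinearMap.proj (⟨(m', b), hs⟩ : TIdx q)) (raiseLeft A.tot.d e n ⟨(p, q), h⟩ x) =
      coobLeft x m a m' b (by subst hr hs; exact h) +
        cooBLeft x m a m' b (by subst hr hs; exact h) := by
    intro p q h m a m' b hr hs
    rcases p with _ | p
    · obtain rfl : a = 0 := by omega
      obtain rfl : m = 0 := by omega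
      exact (map_zero _).trans (add_zero 0).symm
    · have e1 : LinearMap.proj (⟨(m, a), hr⟩ : TIdx (p + 1)) ∘ₗ A.tot.d p =
        A.totb p ⟨(m, a), hr⟩ + A.totB p ⟨(m, a), hr⟩ := rfl
      simp only [raiseLeft, LinearMap.comp_apply, TensorProduct.map_map, LinearMap.comp_id]
      rw [e1, TensorProduct.map_add_left, LinearMap.add_apply]
      congr 1
      · rcases m with _ | m
        · exact LinearMap.congr_fun (TensorProduct.map_zero_left _) _
        · simp only [totb, coobLeft]
          rw [← coord_eq_coo x p q (by omega) m a m' b (by omega) hs]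
          simp [coord, TensorProduct.map_map]
      · rcases a with _ | a
        · exact LinearMap.congr_fun (TensorProduct.map_zero_left _) _
        · simp only [totB, cooBLeft]
          rw [← coord_eq_coo x p q (by omega) (m + 1) a m' b (by omega) hs]
          simp [coord, TensorProduct.map_map]
  have hr' : ∀ (p q : ℕ) (h : p + q + e = n + 1) (m a m' b : ℕ) (hr : m + 2 * a = p)
      (hs : m' + 2 * b = q),
      TensorProduct.map (LinearMap.proj (⟨(m, a), hr⟩ : TIdx p))
        (LinearMap.proj (⟨(m', b), hs⟩ : TIdx q)) (raiseRight B.tot.d e n ⟨(p, q), h⟩ x) =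
      (-1 : k) ^ m • (coobRight x m a m' b (by subst hr hs; exact h) +
        cooBRight x m a m' b (by subst hr hs; exact h)) := by
    intro p q h m a m' b hr hs
    rcases q with _ | q
    · obtain rfl : b = 0 := by omega
      obtain rfl : m' = 0 := by omega
      exact (map_zero _).trans ((smul_zero _).symm.trans (congrArg _ (add_zero 0).symm))
    · have e1 : LinearMap.proj (⟨(m', b), hs⟩ : TIdx (q + 1)) ∘ₗ B.tot.d q =
        B.totb q ⟨(m', b), hs⟩ + B.totB q ⟨(m', b), hs⟩ := rfl
      -- The total degree `p` and the degree `m` differ by `2a`, so the Koszul signs of the two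
      -- complexes agree.
      have e2 : (-1 : k) ^ p = (-1) ^ m := by
        rw [← hr, pow_add, pow_mul, neg_one_sq, one_pow, mul_one]
      simp only [raiseRight, LinearMap.smul_apply, map_smul, LinearMap.comp_apply,
        TensorProduct.map_map, LinearMap.comp_id]
      rw [e1, e2, TensorProduct.map_add_right, LinearMap.add_apply]
      congr 2
      · rcases m' with _ | m'
        · exact LinearMap.congr_fun (TensorProduct.map_zero_right _) _
        · simp only [totb, coobRight]
          rw [← coord_eq_coo x p q (by omega) m a m' b hr (by omega)]
          simp [coord, TensorProduct.map_map]
      · rcases b with _ | b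
        · exact LinearMap.congr_fun (TensorProduct.map_zero_right _) _
        · simp only [totB, cooBRight]
          rw [← coord_eq_coo x p q (by omega) m a (m' + 1) b hr (by omega)]
          simp [coord, TensorProduct.map_map]
  rw [← hl _ _ h m a m' b rfl rfl, ← hr' _ _ h m a m' b rfl rfl, ← map_add]
  rfl

/-- Summing the coordinate formula over all splittings of the exponent. For the terms with `B` one
end of the sum drops out, because `B` never produces the exponent 0; this shifts the range by one.
-/
theorem mu_d {n : ℕ} (x : GTens k A.TotX B.TotX 0 n) :
    mu A B (n + 1) (raise A.tot.d B.tot.d 0 n x) = (tensor A B).tot.d n (mu A B n x) := by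
  funext ⟨⟨M, j⟩, h⟩ ⟨⟨m, m'⟩, hm⟩
  rw [mu_apply]
  have hm' : m + m' = M := hm
  have h' : M + 2 * j = n + 1 := h
  have eb : (tensor A B).totb n ⟨(M, j), h⟩ (mu A B n x) ⟨(m, m'), hm⟩ =
      ∑ i : Fin (j + 1), coobLeft x m i m' (j - i) (by omega) +
        (-1 : k) ^ m • ∑ i : Fin (j + 1), coobRight x m i m' (j - i) (by omega) := by
    rcases M with _ | M
    · obtain rfl : m = 0 := by dsimp only at hm; omega
      obtain rfl : m' = 0 := by dsimp only at hm; omega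
      simp only [totb, coobLeft, coobRight, Finset.sum_const_zero, smul_zero, add_zero]
      rfl
    · have em : ∀ m m' (hm : m + m' = M), mu A B n x ⟨(M, j), by dsimp only; omega⟩
          ⟨(m, m'), hm⟩ = ∑ i : Fin (j + 1), coo x m i m' (j - i) (by omega) :=
        fun m m' hm => mu_apply x M j m m' (by omega) hm
      have ea : ∀ m (hm : m + m' = M), TensorProduct.map (A.b m) (LinearMap.id (M := B.X m'))
          (mu A B n x ⟨(M, j), by dsimp only; omega⟩ ⟨(m, m'), hm⟩) =
          ∑ i : Fin (j + 1), TensorProduct.map (A.b m) LinearMap.id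
            (coo x m i m' (j - i) (by omega)) := fun m hm => by rw [em m m' hm, map_sum]
      have ec : ∀ m' (hm : m + m' = M), TensorProduct.map (LinearMap.id (M := A.X m)) (B.b m')
          (mu A B n x ⟨(M, j), by dsimp only; omega⟩ ⟨(m, m'), hm⟩) =
          ∑ i : Fin (j + 1), TensorProduct.map LinearMap.id (B.b m')
            (coo x m i m' (j - i) (by omega)) := fun m' hm => by rw [em m m' hm, map_sum]
      rcases m with _ | m <;> rcases m' with _ | m' <;>
        simp only [totb, raise, raiseLeft, raiseRight, coobLeft, coobRight, LinearMap.comp_apply,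
          LinearMap.pi_apply, LinearMap.add_apply, LinearMap.smul_apply, LinearMap.proj_apply,
          LinearMap.zero_apply, Finset.sum_const_zero, smul_zero, add_zero, zero_add]
      · exact congrArg _ (ec m' (by omega))
      · exact ea m (by omega)
      · exact congrArg₂ (· + ·) (ea m (by omega)) (congrArg _ (ec m' (by omega)))
  have eB : (tensor A B).totB n ⟨(M, j), h⟩ (mu A B n x) ⟨(m, m'), hm⟩ =
      ∑ i : Fin (j + 1), cooBLeft x m i m' (j - i) (by omega) +
        (-1 : k) ^ m • ∑ i : Fin (j + 1), cooBRight x m i m' (j - i) (by omega) := by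
    have e0 : ∀ (b : ℕ) (hb : b = 0) h', cooBRight x m (Fin.last j) m' b h' = 0 := by
      rintro b rfl h'
      rfl
    rw [Fin.sum_univ_succ, Fin.sum_univ_castSucc (n := j)
      (f := fun i : Fin (j + 1) => cooBRight x m i m' (j - i) _), e0 _ (by simp)]
    have e1 : ∀ h', cooBLeft x m (0 : Fin (j + 1)) m' (j - (0 : Fin (j + 1))) h' = 0 :=
      fun _ => rfl
    rw [e1]
    simp only [zero_add, add_zero]
    rcases j with _ | j
    · simp only [totB, Finset.univ_eq_empty, Finset.sum_empty, smul_zero, add_zero]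
      rfl
    · have e2 : ∀ (i b : ℕ) (hb : b = (j - i) + 1) (hi : i ≤ j) h', cooBRight x m i m' b h' =
          TensorProduct.map LinearMap.id (B.B m') (coo x m i (m' + 1) (j - i) (by omega)) := by
        rintro i b rfl hi h'
        rfl
      have e3 : ∀ (i b : ℕ) (hb : b = j - i) (hi : i ≤ j) h', cooBLeft x m (i + 1) m' b h' =
          TensorProduct.map (A.B m) LinearMap.id (coo x (m + 1) i m' (j - i) (by omega)) := by
        rintro i b rfl hi h'
        rfl
      simp only [totB, LinearMap.comp_apply, LinearMap.proj_apply, lower, LinearMap.pi_apply,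
        LinearMap.add_apply, LinearMap.smul_apply]
      rw [mu_apply x _ j (m + 1) m' _ (by dsimp only at hm ⊢; omega),
        mu_apply x _ j m (m' + 1) _ (by dsimp only at hm ⊢; omega), map_sum, map_sum]
      congr 1
      · refine Finset.sum_congr rfl fun i _ => (e3 i _ ?_ (by omega) _).symm
        simp only [Fin.val_succ]
        omega
      · refine congrArg _ (Finset.sum_congr rfl fun i _ => (e2 i _ ?_ (by omega) _).symm)
        simp only [Fin.val_castSucc]
        omega
  refine Eq.trans ?_ (congrArg₂ (· + ·) eb eB).symm
  have : ∀ i : Fin (j + 1), ∀ h', coo (raise A.tot.d B.tot.d 0 n x) m i m' (j - i) h' = _ :=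
    fun i h' => coo_raise x m i m' (j - i) h'
  rw [Finset.sum_congr rfl fun i _ => this i (by omega)]
  simp only [Finset.sum_add_distrib, ← Finset.smul_sum, smul_add]
  abel

theorem isCochainMap_mu : CochainData.IsCochainMap (CochainData.tensor 0 A.tot B.tot)
    (tensor A B).tot (mu A B) := by
  refine fun n x hx => ⟨mem_tot_N.2 ?_, mu_d x⟩
  rintro ⟨⟨M, j⟩, h⟩
  refine Submodule.mem_pi.2 ?_
  rintro ⟨⟨m, m'⟩, hm⟩ -
  rw [mu_apply]
  exact sum_mem fun i _ => mem_tensor_tot_N.1 hx _ _ _ _ _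

theorem isShortExact_mu : CochainData.IsShortExact (CochainData.tensor 2 A.tot B.tot)
    (CochainData.tensor 0 A.tot B.tot) (tensor A B).tot (shiftDiff A.per B.per) (mu A B) :=
  ⟨isCochainMap_shiftDiff, isCochainMap_mu, fun _ _ _ h => shiftDiff_injective h,
    fun _ _ hy => ⟨exists_shiftDiff_eq hy, fun ⟨x, _, e⟩ => e ▸ mu_shiftDiff x⟩,
    fun _ _ hz => exists_mu_eq hz⟩

end MixedData
end HopfCyc

namespace HopfCyc
namespace CocyclicData

/-! ### All degrees of a cocyclic module in one space. -/

section Total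

variable {k : Type u} [Field k] (C : CocyclicData.{u, w} k)

/-- The direct sum of all `Cⁿ`. -/
abbrev Total : Type w := DirectSum ℕ C.X

/-- The inclusion of `Cⁿ`. -/
noncomputable def inc (n : ℕ) : C.X n →ₗ[k] C.Total := DirectSum.lof k ℕ C.X n

/-- The codegeneracy `σᵢ` in all degrees, zero where it is not defined. -/
noncomputable def sg (i : ℕ) : Module.End k C.Total :=
  DirectSum.toModule k ℕ _ fun n => match n with
    | 0 => 0
    | n + 1 => if h : i < n + 1 then C.inc n ∘ₗ C.σ n ⟨i, h⟩ else 0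

/-- The coface `δᵢ` in all degrees, zero where it is not defined. -/
noncomputable def dl (i : ℕ) : Module.End k C.Total :=
  DirectSum.toModule k ℕ _ fun n => if h : i < n + 2 then C.inc (n + 1) ∘ₗ C.δ n ⟨i, h⟩ else 0

/-- The cyclic operator in all degrees. -/
noncomputable def tw : Module.End k C.Total := DirectSum.toModule k ℕ _ fun n => C.inc n ∘ₗ C.τ n

/-- The sign operator `(-1)ⁿ`. -/
noncomputable def ep : Module.End k C.Total :=
  DirectSum.toModule k ℕ _ fun n => (-1 : k) ^ n • C.inc n

/-- The extra degeneracy `σₙ τₙ₊₁`. -/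
noncomputable def xs : Module.End k C.Total :=
  DirectSum.toModule k ℕ _ fun n => match n with
    | 0 => 0
    | n + 1 => C.inc n ∘ₗ C.σ n (Fin.last n) ∘ₗ C.τ (n + 1)

/-- The signed cyclic operator `λ`. -/
noncomputable def cy : Module.End k C.Total := C.ep * C.tw

/-- The elements all of whose components have degree at least `n`. -/
noncomputable def ge (n : ℕ) : Submodule k C.Total := ⨆ m, LinearMap.range (C.inc (n + m))

variable {C}

theorem sg_inc_zero (i : ℕ) (x : C.X 0) : C.sg i (C.inc 0 x) = 0 := by
  simp [sg, inc]

theorem sg_inc_succ (i n : ℕ) (x : C.X (n + 1)) : C.sg i (C.inc (n + 1) x) =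
    if h : i < n + 1 then C.inc n (C.σ n ⟨i, h⟩ x) else 0 := by
  rw [sg, inc, DirectSum.toModule_lof]
  dsimp only
  split_ifs <;> rfl

theorem dl_inc (i n : ℕ) (x : C.X n) : C.dl i (C.inc n x) =
    if h : i < n + 2 then C.inc (n + 1) (C.δ n ⟨i, h⟩ x) else 0 := by
  rw [dl, inc, DirectSum.toModule_lof]
  split_ifs <;> rfl

theorem tw_inc (n : ℕ) (x : C.X n) : C.tw (C.inc n x) = C.inc n (C.τ n x) := by
  rw [tw, inc, DirectSum.toModule_lof]
  rfl

theorem ep_inc (n : ℕ) (x : C.X n) : C.ep (C.inc n x) = (-1 : k) ^ n • C.inc n x := by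
  rw [ep, inc, DirectSum.toModule_lof]
  rfl

theorem xs_inc_zero (x : C.X 0) : C.xs (C.inc 0 x) = 0 := by
  simp [xs, inc]

theorem xs_inc_succ (n : ℕ) (x : C.X (n + 1)) : C.xs (C.inc (n + 1) x) =
    C.inc n (C.σ n (Fin.last n) (C.τ (n + 1) x)) := by
  rw [xs, inc, DirectSum.toModule_lof]
  rfl

theorem cy_apply (a : C.Total) : C.cy a = C.ep (C.tw a) := rfl

theorem cy_inc (n : ℕ) (x : C.X n) : C.cy (C.inc n x) = C.inc n (((-1 : k) ^ n • C.τ n) x) := by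
  rw [cy_apply, tw_inc, ep_inc, LinearMap.smul_apply, map_smul]

theorem inc_injective (n : ℕ) : Function.Injective (C.inc n) := DirectSum.of_injective n

theorem total_induction {p : C.Total → Prop} (hadd : ∀ x y, p x → p y → p (x + y))
    (hi : ∀ n x, p (C.inc n x)) (a : C.Total) : p a :=
  DirectSum.induction_on a (by simpa using hi 0 0) hi hadd

theorem total_ext {V : Type*} [AddCommGroup V] [Module k V] {f g : C.Total →ₗ[k] V}
    (h : ∀ n x, f (C.inc n x) = g (C.inc n x)) (a : C.Total) : f a = g a :=
  total_induction (p := fun a => f a = g a) (fun x y hx hy => by rw [map_add, map_add, hx, hy]) h a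

theorem inc_mem_ge {n m : ℕ} (h : n ≤ m) (x : C.X m) : C.inc m x ∈ C.ge n := by
  obtain ⟨j, rfl⟩ := Nat.exists_eq_add_of_le h
  exact Submodule.mem_iSup_of_mem j ⟨x, rfl⟩

theorem ge_induction {n : ℕ} {p : C.Total → Prop} (hadd : ∀ x y, p x → p y → p (x + y))
    (hi : ∀ m x, n ≤ m → p (C.inc m x)) {a : C.Total} (ha : a ∈ C.ge n) : p a := by
  refine Submodule.iSup_induction _ (motive := p) ha ?_ ?_ hadd
  · rintro i _ ⟨x, rfl⟩
    exact hi _ _ (by omega)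
  · simpa using hi n 0 le_rfl

/-- Degree bounds replace the dependent index ranges of the cocyclic identities: an identity whose
operators exist only from degree `n` on is stated for elements of `C.ge n`. -/
theorem ge_ext {n : ℕ} {V : Type*} [AddCommGroup V] [Module k V] {f g : C.Total →ₗ[k] V}
    (h : ∀ m x, n ≤ m → f (C.inc m x) = g (C.inc m x)) {a : C.Total} (ha : a ∈ C.ge n) :
    f a = g a :=
  ge_induction (p := fun a => f a = g a) (fun x y hx hy => by rw [map_add, map_add, hx, hy]) h ha

theorem ge_mono {m n : ℕ} (h : m ≤ n) : C.ge n ≤ C.ge m := fun _ ha =>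
  ge_induction (p := (· ∈ C.ge m)) (fun _ _ => add_mem) (fun _ x hj => inc_mem_ge (h.trans hj) x) ha

theorem mem_ge_zero (a : C.Total) : a ∈ C.ge 0 :=
  total_induction (p := (· ∈ C.ge 0)) (fun _ _ => add_mem) (fun _ x => inc_mem_ge (Nat.zero_le _) x) a

theorem map_mem_ge {n m : ℕ} {f : C.Total →ₗ[k] C.Total}
    (h : ∀ j x, n ≤ j → f (C.inc j x) ∈ C.ge m) {a : C.Total} (ha : a ∈ C.ge n) : f a ∈ C.ge m :=
  ge_induction (p := fun a => f a ∈ C.ge m)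
    (fun x y hx hy => by rw [map_add]; exact add_mem hx hy) h ha

theorem sg_mem_ge (i : ℕ) {n : ℕ} {a : C.Total} (ha : a ∈ C.ge (n + 1)) : C.sg i a ∈ C.ge n := by
  refine map_mem_ge (fun j x hj => ?_) ha
  obtain ⟨j, rfl⟩ : ∃ j', j = j' + 1 := ⟨j - 1, by omega⟩
  rw [sg_inc_succ]
  split_ifs
  · exact inc_mem_ge (by omega) _
  · exact zero_mem _

theorem dl_mem_ge (i : ℕ) {n : ℕ} {a : C.Total} (ha : a ∈ C.ge n) : C.dl i a ∈ C.ge (n + 1) := by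
  refine map_mem_ge (fun j x hj => ?_) ha
  rw [dl_inc]
  split_ifs
  · exact inc_mem_ge (by omega) _
  · exact zero_mem _

theorem xs_mem_ge {n : ℕ} {a : C.Total} (ha : a ∈ C.ge (n + 1)) : C.xs a ∈ C.ge n := by
  refine map_mem_ge (fun j x hj => ?_) ha
  obtain ⟨j, rfl⟩ : ∃ j', j = j' + 1 := ⟨j - 1, by omega⟩
  rw [xs_inc_succ]
  exact inc_mem_ge (by omega) _

theorem tw_mem_ge {n : ℕ} {a : C.Total} (ha : a ∈ C.ge n) : C.tw a ∈ C.ge n :=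
  map_mem_ge (fun j x hj => by rw [tw_inc]; exact inc_mem_ge hj _) ha

theorem ep_mem_ge {n : ℕ} {a : C.Total} (ha : a ∈ C.ge n) : C.ep a ∈ C.ge n :=
  map_mem_ge (fun j x hj => by rw [ep_inc]; exact Submodule.smul_mem _ _ (inc_mem_ge hj _)) ha

theorem cy_mem_ge {n : ℕ} {a : C.Total} (ha : a ∈ C.ge n) : C.cy a ∈ C.ge n :=
  ep_mem_ge (tw_mem_ge ha)

theorem ep_ep (a : C.Total) : C.ep (C.ep a) = a :=
  total_ext (f := C.ep ∘ₗ C.ep) (g := LinearMap.id) (fun n x => by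
    simp [ep_inc, smul_smul, ← mul_pow]) a

theorem ep_sg (i : ℕ) (a : C.Total) : C.ep (C.sg i a) = - C.sg i (C.ep a) :=
  total_ext (f := C.ep ∘ₗ C.sg i) (g := - (C.sg i ∘ₗ C.ep)) (fun n x => by
    rcases n with _ | n
    · simp [ep_inc, sg_inc_zero]
    · simp only [LinearMap.comp_apply, LinearMap.neg_apply, ep_inc, map_smul, sg_inc_succ]
      split_ifs <;> simp [ep_inc, pow_succ]) a

theorem ep_dl (i : ℕ) (a : C.Total) : C.ep (C.dl i a) = - C.dl i (C.ep a) :=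
  total_ext (f := C.ep ∘ₗ C.dl i) (g := - (C.dl i ∘ₗ C.ep)) (fun n x => by
    simp only [LinearMap.comp_apply, LinearMap.neg_apply, ep_inc, map_smul, dl_inc]
    split_ifs <;> simp [ep_inc, pow_succ]) a

theorem ep_xs (a : C.Total) : C.ep (C.xs a) = - C.xs (C.ep a) :=
  total_ext (f := C.ep ∘ₗ C.xs) (g := - (C.xs ∘ₗ C.ep)) (fun n x => by
    rcases n with _ | n <;> simp [ep_inc, xs_inc_zero, xs_inc_succ, pow_succ]) a


end Total
end CocyclicData
end HopfCyc

namespace HopfCyc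
namespace CocyclicData

/-! ### The cocyclic identities with natural number indices, and the extra degeneracy. -/

section Identities

variable {k : Type u} [Field k] {C : CocyclicData.{u, w} k}

theorem sg_inc_of_lt {i n : ℕ} (h : i < n + 1) (x : C.X (n + 1)) :
    C.sg i (C.inc (n + 1) x) = C.inc n (C.σ n ⟨i, h⟩ x) := by
  rw [sg_inc_succ, dif_pos h]

theorem sg_inc_of_le {i n : ℕ} (h : n ≤ i) (x : C.X n) : C.sg i (C.inc n x) = 0 := by
  rcases n with _ | n
  · exact sg_inc_zero _ _
  · rw [sg_inc_succ, dif_neg (by omega)]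

theorem dl_inc_of_lt {i n : ℕ} (h : i < n + 2) (x : C.X n) :
    C.dl i (C.inc n x) = C.inc (n + 1) (C.δ n ⟨i, h⟩ x) := by
  rw [dl_inc, dif_pos h]

theorem dl_inc_of_le {i n : ℕ} (h : n + 2 ≤ i) (x : C.X n) : C.dl i (C.inc n x) = 0 := by
  rw [dl_inc, dif_neg (by omega)]

/-- No degree bound is needed: as soon as an index is out of range, both sides are zero. The same
holds for `dl_dl`, `sg_dl_lt` and `sg_dl_gt`. -/
theorem sg_sg (hC : C.IsCocyclic) {i j : ℕ} (h : i ≤ j) (a : C.Total) :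
    C.sg j (C.sg i a) = C.sg i (C.sg (j + 1) a) := by
  refine total_ext (f := C.sg j ∘ₗ C.sg i) (g := C.sg i ∘ₗ C.sg (j + 1)) (fun n x => ?_) a
  rw [LinearMap.comp_apply, LinearMap.comp_apply]
  by_cases hj : j + 1 < n
  · obtain ⟨n, rfl⟩ : ∃ m, n = m + 2 := ⟨n - 2, by omega⟩
    rw [sg_inc_of_lt (by omega), sg_inc_of_lt (by omega), sg_inc_of_lt (by omega),
      sg_inc_of_lt (by omega)]
    exact congrArg _ (LinearMap.congr_fun (hC.σ_σ n ⟨i, by omega⟩ ⟨j, by omega⟩ h) x)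
  · rw [sg_inc_of_le (i := j + 1) (by omega), map_zero]
    rcases n with _ | n
    · rw [sg_inc_zero, map_zero]
    · rw [sg_inc_succ]
      split_ifs
      · exact sg_inc_of_le (by omega) _
      · exact map_zero _

theorem dl_dl (hC : C.IsCocyclic) {i j : ℕ} (h : i ≤ j) (a : C.Total) :
    C.dl (j + 1) (C.dl i a) = C.dl i (C.dl j a) := by
  refine total_ext (f := C.dl (j + 1) ∘ₗ C.dl i) (g := C.dl i ∘ₗ C.dl j) (fun n x => ?_) a
  rw [LinearMap.comp_apply, LinearMap.comp_apply]
  by_cases hj : j < n + 2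
  · rw [dl_inc_of_lt (by omega), dl_inc_of_lt (by omega), dl_inc_of_lt (by omega),
      dl_inc_of_lt (by omega)]
    exact congrArg _ (LinearMap.congr_fun (hC.δ_δ n ⟨i, by omega⟩ ⟨j, by omega⟩ h) x)
  · rw [dl_inc_of_le (i := j) (by omega), map_zero, dl_inc]
    split_ifs
    · exact dl_inc_of_le (by omega) _
    · exact map_zero _

theorem sg_dl_lt (hC : C.IsCocyclic) {i j : ℕ} (h : i ≤ j) (a : C.Total) :
    C.sg (j + 1) (C.dl i a) = C.dl i (C.sg j a) := by
  refine total_ext (f := C.sg (j + 1) ∘ₗ C.dl i) (g := C.dl i ∘ₗ C.sg j) (fun n x => ?_) a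
  rw [LinearMap.comp_apply, LinearMap.comp_apply]
  by_cases hj : j < n
  · obtain ⟨n, rfl⟩ : ∃ m, n = m + 1 := ⟨n - 1, by omega⟩
    rw [dl_inc_of_lt (by omega), sg_inc_of_lt (by omega), sg_inc_of_lt (by omega),
      dl_inc_of_lt (by omega)]
    exact congrArg _ (LinearMap.congr_fun (hC.σ_δ_of_le n ⟨i, by omega⟩ ⟨j, by omega⟩ h) x)
  · rw [sg_inc_of_le (i := j) (by omega), map_zero, dl_inc]
    split_ifs
    · exact sg_inc_of_le (by omega) _
    · exact map_zero _

theorem sg_dl_gt (hC : C.IsCocyclic) {i j : ℕ} (h : j < i) (a : C.Total) :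
    C.sg j (C.dl (i + 1) a) = C.dl i (C.sg j a) := by
  refine total_ext (f := C.sg j ∘ₗ C.dl (i + 1)) (g := C.dl i ∘ₗ C.sg j) (fun n x => ?_) a
  rw [LinearMap.comp_apply, LinearMap.comp_apply]
  by_cases hj : i < n + 1
  · obtain ⟨n, rfl⟩ : ∃ m, n = m + 1 := ⟨n - 1, by omega⟩
    rw [dl_inc_of_lt (by omega), sg_inc_of_lt (by omega), sg_inc_of_lt (by omega),
      dl_inc_of_lt (by omega)]
    exact congrArg _ (LinearMap.congr_fun (hC.σ_δ_of_gt n ⟨i, by omega⟩ ⟨j, by omega⟩ h) x)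
  · rw [dl_inc_of_le (i := i + 1) (by omega), map_zero]
    rcases n with _ | n
    · rw [sg_inc_zero, map_zero]
    · rw [sg_inc_succ]
      split_ifs
      · exact (dl_inc_of_le (by omega) _).symm
      · exact (map_zero _).symm

theorem sg_dl_self (hC : C.IsCocyclic) {i : ℕ} {a : C.Total} (ha : a ∈ C.ge i) :
    C.sg i (C.dl i a) = a := by
  refine ge_ext (f := C.sg i ∘ₗ C.dl i) (g := LinearMap.id) (fun n x hn => ?_) ha
  rw [LinearMap.comp_apply, dl_inc_of_lt (by omega), sg_inc_of_lt (by omega)]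
  exact congrArg _ (LinearMap.congr_fun (hC.σ_δ_self n ⟨i, by omega⟩) x)

theorem sg_dl_succ (hC : C.IsCocyclic) {i : ℕ} {a : C.Total} (ha : a ∈ C.ge i) :
    C.sg i (C.dl (i + 1) a) = a := by
  refine ge_ext (f := C.sg i ∘ₗ C.dl (i + 1)) (g := LinearMap.id) (fun n x hn => ?_) ha
  rw [LinearMap.comp_apply, dl_inc_of_lt (by omega), sg_inc_of_lt (by omega)]
  exact congrArg _ (LinearMap.congr_fun (hC.σ_δ_succ n ⟨i, by omega⟩) x)

theorem tw_dl (hC : C.IsCocyclic) {i : ℕ} {a : C.Total} (ha : a ∈ C.ge i) :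
    C.tw (C.dl (i + 1) a) = C.dl i (C.tw a) := by
  refine ge_ext (f := C.tw ∘ₗ C.dl (i + 1)) (g := C.dl i ∘ₗ C.tw) (fun n x hn => ?_) ha
  rw [LinearMap.comp_apply, LinearMap.comp_apply, dl_inc_of_lt (by omega), tw_inc, tw_inc,
    dl_inc_of_lt (by omega)]
  exact congrArg _ (LinearMap.congr_fun (hC.τ_δ_succ n ⟨i, by omega⟩) x)

theorem tw_sg (hC : C.IsCocyclic) {i : ℕ} {a : C.Total} (ha : a ∈ C.ge (i + 2)) :
    C.tw (C.sg (i + 1) a) = C.sg i (C.tw a) := by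
  refine ge_ext (f := C.tw ∘ₗ C.sg (i + 1)) (g := C.sg i ∘ₗ C.tw) (fun n x hn => ?_) ha
  obtain ⟨n, rfl⟩ : ∃ m, n = m + 1 := ⟨n - 1, by omega⟩
  rw [LinearMap.comp_apply, LinearMap.comp_apply, sg_inc_of_lt (by omega), tw_inc, tw_inc,
    sg_inc_of_lt (by omega)]
  exact congrArg _ (LinearMap.congr_fun (hC.τ_σ_succ n ⟨i, by omega⟩) x)

/-- The extra degeneracy behaves like a codegeneracy of index -1: here `σ₋₁ δ₀ = 1`, and
`xs_dl_succ`, `xs_sg_succ`, `xs_sg_zero` continue the pattern. -/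
theorem xs_dl_zero (hC : C.IsCocyclic) (a : C.Total) : C.xs (C.dl 0 a) = a := by
  refine total_ext (f := C.xs ∘ₗ C.dl 0) (g := LinearMap.id) (fun n x => ?_) a
  rw [LinearMap.comp_apply, dl_inc_of_lt (by omega), xs_inc_succ]
  have h1 := LinearMap.congr_fun (hC.τ_δ_zero n) x
  have h2 := LinearMap.congr_fun (hC.σ_δ_succ n (Fin.last n)) x
  rw [LinearMap.comp_apply] at h1 h2
  rw [Fin.succ_last] at h2
  exact congrArg _ ((congrArg _ h1).trans h2)

theorem xs_dl_succ (hC : C.IsCocyclic) {i : ℕ} {a : C.Total} (ha : a ∈ C.ge (i + 1)) :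
    C.xs (C.dl (i + 1) a) = C.dl i (C.xs a) := by
  refine ge_ext (f := C.xs ∘ₗ C.dl (i + 1)) (g := C.dl i ∘ₗ C.xs) (fun n x hn => ?_) ha
  obtain ⟨n, rfl⟩ : ∃ m, n = m + 1 := ⟨n - 1, by omega⟩
  rw [LinearMap.comp_apply, LinearMap.comp_apply, dl_inc_of_lt (by omega), xs_inc_succ,
    xs_inc_succ, dl_inc_of_lt (by omega)]
  have h1 := LinearMap.congr_fun (hC.τ_δ_succ (n + 1) ⟨i, by omega⟩) x
  have h2 := LinearMap.congr_fun (hC.σ_δ_of_le n ⟨i, by omega⟩ (Fin.last n)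
    (by simp only [Fin.le_def, Fin.val_castSucc, Fin.val_last]; omega)) (C.τ (n + 1) x)
  rw [LinearMap.comp_apply] at h1 h2
  rw [Fin.succ_last] at h2
  exact congrArg _ ((congrArg _ h1).trans h2)

/-- The last coface is the exception to `s δᵢ₊₁ = δᵢ s`; it is the source of the term `λ` in
`xs_bt`. -/
theorem xs_dl_last (hC : C.IsCocyclic) (n : ℕ) (x : C.X n) :
    C.xs (C.dl (n + 1) (C.inc n x)) = C.tw (C.inc n x) := by
  rw [dl_inc_of_lt (by omega), xs_inc_succ, tw_inc]
  have h1 := LinearMap.congr_fun (hC.τ_δ_succ n (Fin.last n)) x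
  have h2 := LinearMap.congr_fun (hC.σ_δ_self n (Fin.last n)) (C.τ n x)
  rw [LinearMap.comp_apply] at h1 h2
  rw [Fin.succ_last] at h1
  exact congrArg _ ((congrArg _ h1).trans h2)

theorem xs_sg_succ (hC : C.IsCocyclic) (i : ℕ) (a : C.Total) :
    C.xs (C.sg (i + 1) a) = C.sg i (C.xs a) := by
  refine total_ext (f := C.xs ∘ₗ C.sg (i + 1)) (g := C.sg i ∘ₗ C.xs) (fun n x => ?_) a
  rw [LinearMap.comp_apply, LinearMap.comp_apply]
  by_cases hi : i + 1 < n
  · obtain ⟨n, rfl⟩ : ∃ m, n = m + 2 := ⟨n - 2, by omega⟩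
    rw [sg_inc_of_lt (by omega), xs_inc_succ, xs_inc_succ, sg_inc_of_lt (by omega)]
    have h1 := LinearMap.congr_fun (hC.τ_σ_succ (n + 1) ⟨i, by omega⟩) x
    have h2 := LinearMap.congr_fun (hC.σ_σ n ⟨i, by omega⟩ (Fin.last n)
      (Fin.mk_le_mk.2 (by omega))) (C.τ (n + 2) x)
    rw [LinearMap.comp_apply] at h1 h2
    rw [Fin.succ_last] at h2
    exact congrArg _ ((congrArg _ h1).trans h2)
  · rw [sg_inc_of_le (by omega), map_zero]
    rcases n with _ | n
    · rw [xs_inc_zero, map_zero]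
    · rw [xs_inc_succ, sg_inc_of_le (by omega)]

theorem xs_sg_zero (hC : C.IsCocyclic) (a : C.Total) : C.xs (C.sg 0 a) = C.xs (C.xs a) := by
  refine total_ext (f := C.xs ∘ₗ C.sg 0) (g := C.xs ∘ₗ C.xs) (fun n x => ?_) a
  rw [LinearMap.comp_apply, LinearMap.comp_apply]
  rcases n with _ | _ | n
  · rw [sg_inc_zero, xs_inc_zero]
  · rw [sg_inc_of_lt (by omega), xs_inc_succ, xs_inc_zero, xs_inc_zero]
  · rw [sg_inc_of_lt (by omega), xs_inc_succ, xs_inc_succ, xs_inc_succ]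
    have h1 := LinearMap.congr_fun (hC.τ_σ_zero (n + 1)) x
    have h2 := LinearMap.congr_fun (hC.τ_σ_succ (n + 1) (Fin.last n)) (C.τ (n + 2) x)
    have h3 := LinearMap.congr_fun (hC.σ_σ n (Fin.last n) (Fin.last n) le_rfl)
      (C.τ (n + 2) (C.τ (n + 2) x))
    rw [LinearMap.comp_apply] at h1 h2 h3
    rw [Fin.succ_last] at h2 h3
    exact congrArg _ ((congrArg _ h1).trans (h3.symm.trans (congrArg _ h2.symm)))

theorem xs_tw (hC : C.IsCocyclic) (a : C.Total) : C.xs (C.tw a) = C.tw (C.sg 0 a) := by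
  refine total_ext (f := C.xs ∘ₗ C.tw) (g := C.tw ∘ₗ C.sg 0) (fun n x => ?_) a
  rw [LinearMap.comp_apply, LinearMap.comp_apply, tw_inc]
  rcases n with _ | n
  · rw [xs_inc_zero, sg_inc_zero, map_zero]
  · rw [xs_inc_succ, sg_inc_of_lt (by omega), tw_inc]
    exact congrArg _ (LinearMap.congr_fun (hC.τ_σ_zero n) x).symm

theorem sg_last_tw (n : ℕ) (x : C.X (n + 1)) :
    C.sg n (C.tw (C.inc (n + 1) x)) = C.xs (C.inc (n + 1) x) := by
  rw [tw_inc, sg_inc_of_lt (by omega), xs_inc_succ]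
  rfl

theorem tw_dl_zero (hC : C.IsCocyclic) (n : ℕ) (x : C.X n) :
    C.tw (C.dl 0 (C.inc n x)) = C.dl (n + 1) (C.inc n x) := by
  rw [dl_inc_of_lt (by omega), tw_inc, dl_inc_of_lt (by omega)]
  exact congrArg _ (LinearMap.congr_fun (hC.τ_δ_zero n) x)

theorem tw_pow_inc (n j : ℕ) (x : C.X n) : (C.tw ^ j) (C.inc n x) = C.inc n ((C.τ n ^ j) x) := by
  induction j with
  | zero => rfl
  | succ j ih => rw [pow_succ', pow_succ', Module.End.mul_apply, ih, tw_inc]; rfl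

theorem cy_pow_inc (n j : ℕ) (x : C.X n) :
    (C.cy ^ j) (C.inc n x) = C.inc n ((((-1 : k) ^ n • C.τ n) ^ j) x) := by
  induction j with
  | zero => rfl
  | succ j ih => rw [pow_succ', pow_succ', Module.End.mul_apply, ih, cy_inc]; rfl

theorem tw_pow_self (hC : C.IsCocyclic) (n : ℕ) (x : C.X n) :
    (C.tw ^ (n + 1)) (C.inc n x) = C.inc n x := by
  rw [tw_pow_inc, hC.τ_pow]
  rfl

theorem cy_pow_self (hC : C.IsCocyclic) (n : ℕ) (x : C.X n) :
    (C.cy ^ (n + 1)) (C.inc n x) = C.inc n x := by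
  rw [cy_pow_inc, smul_pow, hC.τ_pow, ← pow_mul, (Nat.even_mul_succ_self n).neg_one_pow, one_smul]
  rfl

theorem cy_dl_succ (hC : C.IsCocyclic) {i : ℕ} {a : C.Total} (ha : a ∈ C.ge i) :
    C.cy (C.dl (i + 1) a) = - C.dl i (C.cy a) := by
  rw [cy_apply, tw_dl hC ha, ep_dl, cy_apply]

theorem cy_dl_zero (hC : C.IsCocyclic) (n : ℕ) (x : C.X n) :
    C.cy (C.dl 0 (C.inc n x)) = (-1 : k) ^ (n + 1) • C.dl (n + 1) (C.inc n x) := by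
  rw [cy_apply, tw_dl_zero hC, dl_inc_of_lt (by omega), ep_inc]

theorem cy_sg (hC : C.IsCocyclic) {i : ℕ} {a : C.Total} (ha : a ∈ C.ge (i + 2)) :
    C.cy (C.sg (i + 1) a) = - C.sg i (C.cy a) := by
  rw [cy_apply, tw_sg hC ha, ep_sg, cy_apply]

theorem xs_cy (hC : C.IsCocyclic) (a : C.Total) : C.xs (C.cy a) = - C.cy (C.sg 0 a) := by
  rw [cy_apply, cy_apply, ← xs_tw hC, ep_xs, neg_neg]

end Identities
end CocyclicData
end HopfCyc

namespace HopfCyc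
namespace CocyclicData

/-! ### Hochschild and Connes differentials of a cocyclic module and their normalization. -/

section MixedComplex

variable {k : Type u} [Field k] (C : CocyclicData.{u, w} k)

/-- The partial sum `∑_{i < m} (-1)ⁱ δᵢ`. -/
noncomputable def bl (m : ℕ) : Module.End k C.Total :=
  ∑ i ∈ Finset.range m, (-1 : k) ^ i • C.dl i

/-- The partial sum `∑_{j < m} λʲ`. -/
noncomputable def nl (m : ℕ) : Module.End k C.Total := ∑ j ∈ Finset.range m, C.cy ^ j

/-- The Hochschild differential in all degrees. -/
noncomputable def bt : Module.End k C.Total :=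
  DirectSum.toModule k ℕ _ fun n => C.bl (n + 2) ∘ₗ C.inc n

/-- The norm operator in all degrees. -/
noncomputable def nt : Module.End k C.Total :=
  DirectSum.toModule k ℕ _ fun n => C.nl (n + 1) ∘ₗ C.inc n

/-- The elements annihilated by all codegeneracies. -/
noncomputable def normTotal : Submodule k C.Total := ⨅ i, LinearMap.ker (C.sg i)

variable {C}

theorem bl_succ (m : ℕ) (a : C.Total) : C.bl (m + 1) a = C.bl m a + (-1 : k) ^ m • C.dl m a := by
  rw [bl, Finset.sum_range_succ]
  rfl

theorem bl_zero (a : C.Total) : C.bl 0 a = 0 := rfl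

theorem nl_succ (m : ℕ) (a : C.Total) : C.nl (m + 1) a = C.nl m a + (C.cy ^ m) a := by
  rw [nl, Finset.sum_range_succ]
  rfl

theorem nl_zero (a : C.Total) : C.nl 0 a = 0 := rfl

theorem nl_succ' (m : ℕ) (a : C.Total) : C.nl (m + 1) a = a + C.cy (C.nl m a) := by
  induction m with
  | zero => simp [nl_succ, nl_zero]
  | succ m ih =>
    calc C.nl (m + 1 + 1) a = C.nl (m + 1) a + (C.cy ^ (m + 1)) a := nl_succ _ _
      _ = a + C.cy (C.nl m a) + C.cy ((C.cy ^ m) a) := by rw [ih, pow_succ']; rfl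
      _ = a + C.cy (C.nl (m + 1) a) := by rw [nl_succ, map_add, add_assoc]

theorem nl_cy (m : ℕ) (a : C.Total) : C.nl m (C.cy a) = C.cy (C.nl m a) := by
  induction m with
  | zero => simp [nl_zero]
  | succ m ih =>
    rw [nl_succ, nl_succ, map_add, ih, ← Module.End.mul_apply (C.cy ^ m), ← pow_succ, pow_succ',
      Module.End.mul_apply]

theorem bt_inc (n : ℕ) (x : C.X n) : C.bt (C.inc n x) = C.bl (n + 2) (C.inc n x) := by
  rw [bt, inc, DirectSum.toModule_lof]
  rfl

theorem nt_inc (n : ℕ) (x : C.X n) : C.nt (C.inc n x) = C.nl (n + 1) (C.inc n x) := by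
  rw [nt, inc, DirectSum.toModule_lof]
  rfl

theorem bl_inc (n m : ℕ) (x : C.X n) (hm : n + 2 ≤ m) :
    C.bl m (C.inc n x) = C.bt (C.inc n x) := by
  rw [bt_inc]
  induction m, hm using Nat.le_induction with
  | base => rfl
  | succ m hm ih => rw [bl_succ, ih, dl_inc_of_le hm, smul_zero, add_zero]

theorem mem_normTotal {a : C.Total} : a ∈ C.normTotal ↔ ∀ i, C.sg i a = 0 := by
  simp [normTotal, Submodule.mem_iInf]

theorem inc_mem_normTotal {n : ℕ} {x : C.X n} : C.inc n x ∈ C.normTotal ↔ x ∈ C.normalized n := by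
  rw [mem_normTotal]
  rcases n with _ | n
  · simp [normalized, sg_inc_zero]
  · simp only [normalized, Submodule.mem_iInf, LinearMap.mem_ker]
    constructor
    · intro h i
      have := h i
      rw [sg_inc_of_lt i.2] at this
      exact C.inc_injective n (this.trans (map_zero _).symm)
    · intro h i
      rw [sg_inc_succ]
      split_ifs with hi
      · rw [h, map_zero]
      · rfl

theorem inc_b (n : ℕ) (x : C.X n) : C.inc (n + 1) (C.b n x) = C.bt (C.inc n x) := by
  rw [bt_inc, b, bl, LinearMap.sum_apply, LinearMap.sum_apply, map_sum,
    Finset.sum_range]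
  refine Finset.sum_congr rfl fun i _ => ?_
  rw [LinearMap.smul_apply, LinearMap.smul_apply, map_smul, dl_inc_of_lt i.2]

theorem inc_B (n : ℕ) (x : C.X (n + 1)) : C.inc n (C.B n x) =
    C.nt (C.xs (C.inc (n + 1) x - C.cy (C.inc (n + 1) x))) := by
  rw [cy_inc, ← map_sub, xs_inc_succ, nt_inc, nl, B, LinearMap.comp_apply, LinearMap.sum_apply,
    LinearMap.sum_apply, map_sum, Finset.sum_range]
  refine Finset.sum_congr rfl fun i _ => ?_
  rw [cy_pow_inc]
  rfl

theorem dl_bl (hC : C.IsCocyclic) {m r : ℕ} (hr : r ≤ m + 1) (a : C.Total) :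
    C.dl (m + 1) (C.bl r a) = C.bl r (C.dl m a) := by
  induction r with
  | zero => simp [bl_zero]
  | succ r ih => rw [bl_succ, bl_succ, map_add, ih (by omega), map_smul, dl_dl hC (by omega)]

/-- Working with partial sums turns `b² = 0` into an induction: each new coface cancels against the
new term of the inner sum. -/
theorem bl_succ_bl (hC : C.IsCocyclic) (m : ℕ) (a : C.Total) : C.bl (m + 1) (C.bl m a) = 0 := by
  induction m with
  | zero => simp [bl_zero]
  | succ m ih =>
    rw [bl_succ (m + 1), dl_bl hC le_rfl, bl_succ m a, map_add, ih, map_smul, zero_add, pow_succ,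
      mul_neg_one, neg_smul, add_neg_cancel]

theorem bt_bt (hC : C.IsCocyclic) (a : C.Total) : C.bt (C.bt a) = 0 := by
  refine total_ext (f := C.bt ∘ₗ C.bt) (g := 0) (fun n x => ?_) a
  rw [LinearMap.comp_apply, ← inc_b, bt_inc, inc_b, bt_inc]
  exact bl_succ_bl hC _ _

theorem cy_bl_succ (hC : C.IsCocyclic) {m : ℕ} {a : C.Total} (ha : a ∈ C.ge (m - 1)) :
    C.cy (C.bl (m + 1) a) = C.bl m (C.cy a) + C.cy (C.dl 0 a) := by
  induction m with
  | zero => simp [bl_zero, bl_succ]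
  | succ m ih =>
    rw [bl_succ (m + 1), map_add, ih (ge_mono (by omega) ha), map_smul, cy_dl_succ hC (by simpa using ha),
      bl_succ m, pow_succ]
    module

theorem cy_bt (hC : C.IsCocyclic) {n : ℕ} (x : C.X n) :
    C.cy (C.bt (C.inc n x)) =
      C.bl (n + 1) (C.cy (C.inc n x)) + (-1 : k) ^ (n + 1) • C.dl (n + 1) (C.inc n x) := by
  rw [bt_inc, cy_bl_succ hC (inc_mem_ge (by omega) _), cy_dl_zero hC]

/-- This is `(1 - λ) b = b' (1 - λ)`, where `b'` on degree `n` is the partial sum of `n + 1`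
cofaces. -/
theorem sub_cy_bt (hC : C.IsCocyclic) {n : ℕ} (x : C.X n) :
    C.bt (C.inc n x) - C.cy (C.bt (C.inc n x)) = C.bl (n + 1) (C.inc n x - C.cy (C.inc n x)) := by
  rw [cy_bt hC, bt_inc, bl_succ (n + 1), map_sub]
  abel

theorem nl_inc_mem (n m : ℕ) (x : C.X n) : ∃ y, C.nl m (C.inc n x) = C.inc n y := by
  induction m with
  | zero => exact ⟨0, by simp [nl_zero]⟩
  | succ m ih =>
    obtain ⟨y, hy⟩ := ih
    exact ⟨y + _, by rw [nl_succ, hy, cy_pow_inc, ← map_add]⟩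

/-- Interpolates between `b'` and `N b' = b N`: for `m = 0` both sides are `b'`, and for `r = 0` the
correction disappears. The intermediate cases are needed again in `gam_bl`, where each word uses a
partial norm. -/
theorem nl_bl (hC : C.IsCocyclic) {n : ℕ} (x : C.X n) {m r : ℕ} (hm : m + r = n + 1) :
    C.nl (m + 1) (C.bl (n + 1) (C.inc n x)) =
      C.bt (C.nl m (C.inc n x)) + C.bl r ((C.cy ^ m) (C.inc n x)) := by
  induction m generalizing r with
  | zero =>
    obtain rfl : r = n + 1 := by omega
    simp [nl_zero, nl_succ]
  | succ m ih =>
    obtain ⟨y, hy⟩ := nl_inc_mem n m x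
    obtain ⟨y', hy'⟩ := nl_inc_mem n (m + 1) x
    have e1 := nl_succ' m (C.inc n x)
    have e2 := nl_succ m (C.inc n x)
    rw [hy, hy'] at e1 e2
    rw [nl_succ', ih (r := r + 1) (by omega), map_add, hy, hy', cy_bt hC, cy_pow_inc,
      cy_bl_succ hC (inc_mem_ge (by omega) _), cy_dl_zero hC, bt_inc, bl_succ (n + 1),
      ← cy_pow_inc]
    nth_rewrite 2 [e2]
    rw [e1, pow_succ' _ m, Module.End.mul_apply, map_add, map_add, smul_add]
    abel

theorem cy_nl_self (hC : C.IsCocyclic) (n : ℕ) (x : C.X n) :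
    C.cy (C.nl (n + 1) (C.inc n x)) = C.nl (n + 1) (C.inc n x) := by
  have h := (nl_succ (n + 1) (C.inc n x)).symm.trans (nl_succ' (n + 1) _)
  rw [cy_pow_self hC, add_comm] at h
  exact (add_left_cancel h).symm

theorem cy_nt (hC : C.IsCocyclic) (a : C.Total) : C.cy (C.nt a) = C.nt a := by
  refine total_ext (f := C.cy ∘ₗ C.nt) (g := C.nt) (fun n x => ?_) a
  rw [LinearMap.comp_apply, nt_inc, cy_nl_self hC]

theorem nt_cy (hC : C.IsCocyclic) (a : C.Total) : C.nt (C.cy a) = C.nt a := by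
  refine total_ext (f := C.nt ∘ₗ C.cy) (g := C.nt) (fun n x => ?_) a
  rw [LinearMap.comp_apply, cy_inc, nt_inc, nt_inc, ← cy_inc, nl_cy, cy_nl_self hC]

theorem nt_bl (hC : C.IsCocyclic) {n : ℕ} (x : C.X n) :
    C.nt (C.bl (n + 1) (C.inc n x)) = C.bt (C.nt (C.inc n x)) := by
  have h : ∃ y, C.bl (n + 1) (C.inc n x) = C.inc (n + 1) y := by
    have h := (bl_succ (n + 1) (C.inc n x)).symm.trans (bt_inc n x).symm
    rw [← inc_b, dl_inc_of_lt (by omega), ← map_smul] at h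
    exact ⟨_, (eq_sub_of_add_eq h).trans (map_sub _ _ _).symm⟩
  obtain ⟨y, hy⟩ := h
  have := nl_bl hC x (m := n + 1) (r := 0) rfl
  rw [hy] at this
  rw [hy, nt_inc, this, nt_inc, bl_zero, add_zero]

/-- This is the contracting homotopy `s b' + b' s = 1`, valid for partial sums. -/
theorem xs_bl_succ (hC : C.IsCocyclic) {m : ℕ} {a : C.Total} (ha : a ∈ C.ge m) :
    C.xs (C.bl (m + 1) a) = a - C.bl m (C.xs a) := by
  induction m with
  | zero => simp [bl_zero, bl_succ, xs_dl_zero hC]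
  | succ m ih =>
    rw [bl_succ (m + 1), map_add, ih (ge_mono (by omega) ha), map_smul, xs_dl_succ hC ha,
      bl_succ m, pow_succ]
    module

theorem xs_bt (hC : C.IsCocyclic) {n : ℕ} (x : C.X n) : C.xs (C.bt (C.inc n x)) =
    C.inc n x - C.bl n (C.xs (C.inc n x)) - C.cy (C.inc n x) := by
  rw [bt_inc, bl_succ (n + 1), map_add, xs_bl_succ hC (inc_mem_ge le_rfl _), map_smul,
    xs_dl_last hC, tw_inc, cy_inc, LinearMap.smul_apply, map_smul, pow_succ]
  module

/-- `b N s (1 - λ) = N b' s (1 - λ) = N (1 - s b')(1 - λ) = -N s (1 - λ) b`, where `N (1 - λ) = 0`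
removes the middle term. No normalization is needed. -/
theorem bt_nt_xs (hC : C.IsCocyclic) (a : C.Total) :
    C.bt (C.nt (C.xs (a - C.cy a))) = - C.nt (C.xs (C.bt a - C.cy (C.bt a))) := by
  refine total_ext (f := C.bt ∘ₗ C.nt ∘ₗ C.xs ∘ₗ (LinearMap.id - C.cy))
    (g := - (C.nt ∘ₗ C.xs ∘ₗ (LinearMap.id - C.cy) ∘ₗ C.bt)) (fun n x => ?_) a
  simp only [LinearMap.comp_apply, LinearMap.neg_apply, LinearMap.sub_apply, LinearMap.id_apply]
  rw [sub_cy_bt hC, cy_inc, ← map_sub, xs_bl_succ hC (inc_mem_ge le_rfl _), map_sub (C.nt)]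
  have h0 : C.nt (C.inc n (x - ((-1 : k) ^ n • C.τ n) x)) = 0 := by
    rw [map_sub, ← cy_inc, map_sub, nt_cy hC, sub_self]
  rw [h0, zero_sub, neg_neg]
  rcases n with _ | n
  · rw [xs_inc_zero]; simp
  · rw [xs_inc_succ, nt_bl hC]

/-- On a normalized element `σⱼ` meets only `δⱼ` and `δⱼ₊₁`, whose contributions are opposite. A
partial sum is therefore killed unless it stops exactly between the two. -/
theorem sg_bl_normTotal (hC : C.IsCocyclic) {a : C.Total} (h : a ∈ C.normTotal) {j m : ℕ}
    (ha : a ∈ C.ge j) : C.sg j (C.bl m a) = if m = j + 1 then (-1 : k) ^ j • a else 0 := by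
  rw [mem_normTotal] at h
  induction m with
  | zero => simp [bl_zero]
  | succ m ih =>
    rw [bl_succ, map_add, ih, map_smul]
    rcases lt_trichotomy m j with hm | rfl | hm
    · obtain ⟨j, rfl⟩ : ∃ j', j = j' + 1 := ⟨j - 1, by omega⟩
      rw [sg_dl_lt hC (by omega), h, map_zero, if_neg (by omega), if_neg (by omega)]
      simp
    · rw [sg_dl_self hC ha]
      simp
    · obtain ⟨m, rfl⟩ : ∃ j', m = j' + 1 := ⟨m - 1, by omega⟩
      rcases Nat.lt_succ_iff_lt_or_eq.1 hm with hm | rfl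
      · rw [sg_dl_gt hC hm, h, map_zero, if_neg (by omega), if_neg (by omega)]
        simp
      · rw [sg_dl_succ hC ha]
        simp [pow_succ]

theorem normTotal_bt (hC : C.IsCocyclic) {n : ℕ} {x : C.X n} (h : C.inc n x ∈ C.normTotal) :
    C.bt (C.inc n x) ∈ C.normTotal := by
  rw [mem_normTotal]
  intro j
  by_cases hj : j ≤ n
  · rw [bt_inc, sg_bl_normTotal hC h (inc_mem_ge hj _), if_neg (by omega)]
  · rw [← inc_b, sg_inc_of_le (by omega)]

/-- The elements annihilated by all codegeneracies and by the extra degeneracy. -/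
noncomputable def extraNormTotal (C : CocyclicData.{u, w} k) : Submodule k C.Total :=
  C.normTotal ⊓ LinearMap.ker C.xs

theorem xs_mem_extraNormTotal (hC : C.IsCocyclic) {a : C.Total} (h : a ∈ C.normTotal) :
    C.xs a ∈ C.extraNormTotal := by
  rw [mem_normTotal] at h
  refine ⟨mem_normTotal.2 fun i => ?_, ?_⟩
  · rw [← xs_sg_succ hC, h, map_zero]
  · rw [SetLike.mem_coe, LinearMap.mem_ker, ← xs_sg_zero hC, h, map_zero]

/-- `λ` lowers the index of a codegeneracy by one; the last codegeneracy becomes the extra one and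
the extra one becomes `σ₀`. Thus the common kernel of all of them is cyclically invariant. -/
theorem cy_mem_extraNormTotal (hC : C.IsCocyclic) {n : ℕ} {x : C.X n}
    (h : C.inc n x ∈ C.extraNormTotal) : C.cy (C.inc n x) ∈ C.extraNormTotal := by
  obtain ⟨h, hs⟩ := h
  rw [SetLike.mem_coe, mem_normTotal] at h
  rw [SetLike.mem_coe, LinearMap.mem_ker] at hs
  refine ⟨mem_normTotal.2 fun i => ?_, ?_⟩
  · rcases lt_trichotomy (i + 1) n with hi | rfl | hi
    · rw [← neg_eq_iff_eq_neg.2 (cy_sg hC (inc_mem_ge (by omega) x)), h, map_zero, neg_zero]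
    · rw [cy_inc, LinearMap.smul_apply, map_smul, map_smul, ← tw_inc, sg_last_tw, hs, smul_zero]
    · rw [cy_inc, sg_inc_of_le (by omega)]
  · rw [SetLike.mem_coe, LinearMap.mem_ker, xs_cy hC, h, map_zero, neg_zero]

theorem nl_mem_extraNormTotal (hC : C.IsCocyclic) {n : ℕ} {x : C.X n}
    (h : C.inc n x ∈ C.extraNormTotal) (m : ℕ) : C.nl m (C.inc n x) ∈ C.extraNormTotal := by
  induction m with
  | zero => exact zero_mem _
  | succ m ih =>
    obtain ⟨y, hy⟩ := nl_inc_mem n m x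
    rw [nl_succ', hy]
    rw [hy] at ih
    exact add_mem h (cy_mem_extraNormTotal hC ih)

theorem nt_xs_mem_extraNormTotal (hC : C.IsCocyclic) {n : ℕ} {x : C.X n}
    (h : C.inc n x ∈ C.normTotal) : C.nt (C.xs (C.inc n x)) ∈ C.extraNormTotal := by
  have h' := xs_mem_extraNormTotal hC h
  rcases n with _ | n
  · rw [xs_inc_zero, map_zero]; exact zero_mem _
  · rw [xs_inc_succ] at h' ⊢
    rw [nt_inc]
    exact nl_mem_extraNormTotal hC h' _

/-- `s λ = -λ σ₀` vanishes on normalized elements, so the factor `1 - λ` is invisible there. -/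
theorem inc_B_normalized (hC : C.IsCocyclic) {n : ℕ} {x : C.X (n + 1)}
    (h : C.inc (n + 1) x ∈ C.normTotal) : C.inc n (C.B n x) = C.nt (C.xs (C.inc (n + 1) x)) := by
  rw [inc_B, map_sub, xs_cy hC, mem_normTotal.1 h, map_zero, neg_zero, sub_zero]

theorem mixed_isMixed (hC : C.IsCocyclic) : C.mixed.IsMixed where
  b_mem n x hx := by
    rw [← inc_mem_normTotal] at hx ⊢
    rw [inc_b]
    exact normTotal_bt hC hx
  B_mem n x hx := by
    rw [← inc_mem_normTotal] at hx ⊢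
    rw [inc_B_normalized hC hx]
    exact (nt_xs_mem_extraNormTotal hC hx).1
  b_b n := by
    ext x
    refine C.inc_injective _ ?_
    rw [LinearMap.comp_apply, inc_b, inc_b, bt_bt hC]
    simp
  B_B n := by
    ext x
    refine C.inc_injective _ ?_
    rw [LinearMap.comp_apply, inc_B, inc_B, cy_nt hC, sub_self]
    simp
  B_b_zero := by
    ext x
    refine C.inc_injective _ ?_
    rw [LinearMap.comp_apply, inc_B, inc_b, ← neg_eq_iff_eq_neg.2 (bt_nt_xs hC _), cy_inc,
      ← map_sub, xs_inc_zero]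
    simp
  b_B n := by
    ext x
    refine C.inc_injective _ ?_
    rw [LinearMap.comp_apply, inc_b, inc_B, bt_nt_xs hC, LinearMap.neg_apply, map_neg,
      LinearMap.comp_apply, inc_B, inc_b]

end MixedComplex

section Diagonal

variable {k : Type u} [Field k] {C : CocyclicData.{u, w} k} {C' : CocyclicData.{u, w} k}

theorem IsCocyclic.diag (hC : C.IsCocyclic) (hC' : C'.IsCocyclic) : (diag C C').IsCocyclic where
  δ_δ n i j h := by
    simp only [← TensorProduct.map_comp, hC.δ_δ n i j h, hC'.δ_δ n i j h]
  σ_σ n i j h := by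
    simp only [← TensorProduct.map_comp, hC.σ_σ n i j h, hC'.σ_σ n i j h]
  σ_δ_of_le n i j h := by
    simp only [← TensorProduct.map_comp, hC.σ_δ_of_le n i j h, hC'.σ_δ_of_le n i j h]
  σ_δ_self n i := by
    simp only [← TensorProduct.map_comp, hC.σ_δ_self n i, hC'.σ_δ_self n i, TensorProduct.map_id]
  σ_δ_succ n i := by
    simp only [← TensorProduct.map_comp, hC.σ_δ_succ n i, hC'.σ_δ_succ n i, TensorProduct.map_id]
  σ_δ_of_gt n i j h := by
    simp only [← TensorProduct.map_comp, hC.σ_δ_of_gt n i j h, hC'.σ_δ_of_gt n i j h]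
  τ_δ_succ n i := by
    simp only [← TensorProduct.map_comp, hC.τ_δ_succ n i, hC'.τ_δ_succ n i]
  τ_δ_zero n := by
    simp only [← TensorProduct.map_comp, hC.τ_δ_zero n, hC'.τ_δ_zero n]
  τ_σ_succ n i := by
    simp only [← TensorProduct.map_comp, hC.τ_σ_succ n i, hC'.τ_σ_succ n i]
  τ_σ_zero n := by
    simp only [← TensorProduct.map_comp, hC.τ_σ_zero n, hC'.τ_σ_zero n]
  τ_pow n := by
    simp only [TensorProduct.map_pow, hC.τ_pow n, hC'.τ_pow n]
    exact TensorProduct.map_id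

end Diagonal
end CocyclicData
end HopfCyc

namespace HopfCyc

/-! ### Operators acting on one factor of a tensor product. -/

section TensorActions

variable {k : Type u} [Field k] {V W : Type*} [AddCommGroup V] [Module k V] [AddCommGroup W]
  [Module k W]

/-- An endomorphism of the left factor acting on `V ⊗ W`. -/
noncomputable def actL (f : Module.End k V) : Module.End k (V ⊗[k] W) :=
  TensorProduct.map f LinearMap.id

/-- An endomorphism of the right factor acting on `V ⊗ W`. -/
noncomputable def actR (g : Module.End k W) : Module.End k (V ⊗[k] W) :=
  TensorProduct.map LinearMap.id g

theorem actL_tmul (f : Module.End k V) (x : V) (y : W) : actL f (x ⊗ₜ[k] y) = f x ⊗ₜ y := rfl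

theorem actR_tmul (g : Module.End k W) (x : V) (y : W) : actR g (x ⊗ₜ[k] y) = x ⊗ₜ g y := rfl

theorem actR_actL (f : Module.End k V) (g : Module.End k W) (z : V ⊗[k] W) :
    actR g (actL f z) = actL f (actR g z) :=
  LinearMap.congr_fun (f := actR g ∘ₗ actL f) (g := actL f ∘ₗ actR g)
    (TensorProduct.ext' fun _ _ => rfl) z

theorem actL_mul (f f' : Module.End k V) (z : V ⊗[k] W) :
    actL (f * f') z = actL f (actL f' z) := by
  rw [actL, Module.End.mul_eq_comp, ← LinearMap.id_comp LinearMap.id, TensorProduct.map_comp]; rfl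

theorem actR_mul (f f' : Module.End k W) (z : V ⊗[k] W) :
    actR (f * f') z = actR f (actR f' z) := by
  rw [actR, Module.End.mul_eq_comp, ← LinearMap.id_comp LinearMap.id, TensorProduct.map_comp]; rfl

theorem actL_add (f f' : Module.End k V) (z : V ⊗[k] W) :
    actL (f + f') z = actL f z + actL f' z := by
  rw [actL, TensorProduct.map_add_left]; rfl

theorem actR_add (f f' : Module.End k W) (z : V ⊗[k] W) :
    actR (f + f') z = actR f z + actR f' z := by
  rw [actR, TensorProduct.map_add_right]; rfl

theorem actL_smul (c : k) (f : Module.End k V) (z : V ⊗[k] W) :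
    actL (c • f) z = c • actL f z := by
  rw [actL, TensorProduct.map_smul_left]; rfl

theorem actR_smul (c : k) (f : Module.End k W) (z : V ⊗[k] W) :
    actR (c • f) z = c • actR f z := by
  rw [actR, TensorProduct.map_smul_right]; rfl

theorem actL_neg (f : Module.End k V) (z : V ⊗[k] W) : actL (-f) z = - actL f z := by
  rw [← neg_one_smul k, actL_smul, neg_one_smul]

theorem actR_neg (f : Module.End k W) (z : V ⊗[k] W) : actR (-f) z = - actR f z := by
  rw [← neg_one_smul k, actR_smul, neg_one_smul]

theorem actL_one (z : V ⊗[k] W) : actL (1 : Module.End k V) z = z :=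
  LinearMap.congr_fun TensorProduct.map_id z

theorem actR_one (z : V ⊗[k] W) : actR (1 : Module.End k W) z = z :=
  LinearMap.congr_fun TensorProduct.map_id z

theorem actL_congr {P : Submodule k V} {Q : Submodule k W} {f f' : Module.End k V}
    (h : ∀ a ∈ P, f a = f' a) {z : V ⊗[k] W} (hz : z ∈ subTens P Q) : actL f z = actL f' z :=
  map_congr_subTens h (fun _ _ => rfl) hz

theorem actR_congr {P : Submodule k V} {Q : Submodule k W} {f f' : Module.End k W}
    (h : ∀ a ∈ Q, f a = f' a) {z : V ⊗[k] W} (hz : z ∈ subTens P Q) : actR f z = actR f' z :=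
  map_congr_subTens (fun _ _ => rfl) h hz

theorem actL_mem {P P' : Submodule k V} {Q : Submodule k W} {f : Module.End k V}
    (h : ∀ a ∈ P, f a ∈ P') {z : V ⊗[k] W} (hz : z ∈ subTens P Q) : actL f z ∈ subTens P' Q :=
  map_mem_subTens h (fun _ h => h) hz

theorem actR_mem {P : Submodule k V} {Q Q' : Submodule k W} {f : Module.End k W}
    (h : ∀ a ∈ Q, f a ∈ Q') {z : V ⊗[k] W} (hz : z ∈ subTens P Q) : actR f z ∈ subTens P Q' :=
  map_mem_subTens (fun _ h => h) h hz

theorem subTens_mono {P P' : Submodule k V} {Q Q' : Submodule k W} (h : P ≤ P') (h' : Q ≤ Q') :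
    subTens P Q ≤ subTens P' Q' := fun _ hz =>
  subTens_induction (p := (· ∈ subTens P' Q')) (zero_mem _) (fun _ _ => add_mem)
    (fun _ hx _ hy => tmul_mem_subTens (h hx) (h' hy)) hz

end TensorActions

namespace CocyclicData

/-! ### Tails of the Hochschild differential. -/

section Alternating

variable {k : Type u} [Field k] (C : CocyclicData.{u, w} k)

/-- The tail `∑_{i ≥ m} (-1)ⁱ δᵢ` of the Hochschild differential. -/
noncomputable def bge (m : ℕ) : Module.End k C.Total := C.bt - C.bl m

variable {C}

theorem bge_zero : C.bge 0 = C.bt := by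
  ext1; simp [bge, bl]

theorem bge_eq (m : ℕ) (a : C.Total) :
    C.bge m a = (-1 : k) ^ m • C.dl m a + C.bge (m + 1) a := by
  rw [bge, bge, LinearMap.sub_apply, LinearMap.sub_apply, bl_succ]
  abel

/-- An element has finitely many components, so on it `b` is a finite partial sum, and statements
about tails can be proved for finite sums. -/
theorem exists_bt_eq_bl (a : C.Total) : ∃ r, ∀ s, r ≤ s → C.bt a = C.bl s a := by
  refine total_induction (p := fun a => ∃ r, ∀ s, r ≤ s → C.bt a = C.bl s a) ?_ ?_ a
  · rintro x y ⟨r, hr⟩ ⟨s, hs⟩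
    refine ⟨max r s, fun t ht => ?_⟩
    rw [map_add, map_add, hr t (le_of_max_le_left ht), hs t (le_of_max_le_right ht)]
  · exact fun n x => ⟨n + 2, fun s hs => (bl_inc n s x hs).symm⟩

/-- Every coface of index at least `m + 2` passes `σₘ` with its index lowered by one, which changes
its sign. -/
theorem bge_sg (hC : C.IsCocyclic) (m : ℕ) (a : C.Total) :
    C.bge (m + 1) (C.sg m a) = - C.sg m (C.bge (m + 2) a) := by
  have key : ∀ r, C.bl (m + 1 + r) (C.sg m a) - C.bl (m + 1) (C.sg m a) =
      - C.sg m (C.bl (m + 2 + r) a - C.bl (m + 2) a) := by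
    intro r
    induction r with
    | zero => simp
    | succ r ih =>
      rw [← add_assoc, ← add_assoc, bl_succ (m + 1 + r), bl_succ (m + 2 + r), add_sub_right_comm, ih, add_sub_right_comm,
        map_add (C.sg m), map_smul, show m + 2 + r = m + 1 + r + 1 by omega,
        sg_dl_gt hC (by omega), pow_succ]
      module
  obtain ⟨r, hr⟩ := exists_bt_eq_bl (C.sg m a)
  obtain ⟨s, hs⟩ := exists_bt_eq_bl a
  rw [bge, bge, LinearMap.sub_apply, LinearMap.sub_apply, hr (m + 1 + max r s) (by omega),
    hs (m + 2 + max r s) (by omega), key]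

theorem ep_bl (m : ℕ) (a : C.Total) : C.ep (C.bl m a) = - C.bl m (C.ep a) := by
  induction m with
  | zero => simp [bl_zero]
  | succ m ih => rw [bl_succ, bl_succ, map_add, map_smul, ih, ep_dl]; module

theorem ep_bge (m : ℕ) (a : C.Total) : C.ep (C.bge m a) = - C.bge m (C.ep a) := by
  obtain ⟨r, hr⟩ := exists_bt_eq_bl a
  obtain ⟨s, hs⟩ := exists_bt_eq_bl (C.ep a)
  rw [bge, LinearMap.sub_apply, LinearMap.sub_apply, hr (max r s) (by omega),
    hs (max r s) (by omega), map_sub, ep_bl, ep_bl]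
  abel

theorem bge_inc_self (n : ℕ) (x : C.X n) :
    C.bge (n + 1) (C.inc n x) = (-1 : k) ^ (n + 1) • C.dl (n + 1) (C.inc n x) := by
  rw [bge, LinearMap.sub_apply, bt_inc, bl_succ (n + 1)]
  abel

/-- The relation between `s` and `b` with `δ₀` split off; the last summand records the last coface
of the lower degree, written through `δ₁`. It starts the induction in `dgt_qt`. -/
theorem xs_bge_one (hC : C.IsCocyclic) {a : C.Total} (ha : a ∈ C.ge 1) :
    C.bt (C.xs a) = - C.xs (C.bge 1 a) - C.cy a + C.cy (C.xs (C.dl 1 a)) := by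
  refine ge_ext (f := C.bt ∘ₗ C.xs)
    (g := - (C.xs ∘ₗ C.bge 1) - C.cy + C.cy ∘ₗ C.xs ∘ₗ C.dl 1) (fun n x hn => ?_) ha
  obtain ⟨n, rfl⟩ : ∃ m, n = m + 1 := ⟨n - 1, by omega⟩
  simp only [LinearMap.comp_apply, LinearMap.neg_apply, LinearMap.sub_apply, LinearMap.add_apply]
  rw [bge, LinearMap.sub_apply, map_sub, xs_bt hC, xs_dl_succ hC (inc_mem_ge hn _), xs_inc_succ,
    cy_dl_zero hC, bl_succ 0, bl_zero, zero_add, pow_zero, one_smul, xs_dl_zero hC, bt_inc,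
    bl_succ (n + 1)]
  abel

/-- `b` and `λ` fail to commute only through the last coface, which up to sign is `λ δ₀`. -/
theorem bt_cy (hC : C.IsCocyclic) (a : C.Total) :
    C.bt (C.cy a) = C.cy (C.bt a) + C.cy (C.dl 0 (C.cy a)) - C.cy (C.dl 0 a) := by
  refine total_ext (f := C.bt ∘ₗ C.cy)
    (g := C.cy ∘ₗ C.bt + C.cy ∘ₗ C.dl 0 ∘ₗ C.cy - C.cy ∘ₗ C.dl 0) (fun n x => ?_) a
  simp only [LinearMap.comp_apply, LinearMap.add_apply, LinearMap.sub_apply]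
  rw [cy_bt hC, cy_inc, bt_inc, bl_succ (n + 1), cy_dl_zero hC, cy_dl_zero hC]
  abel

end Alternating

/-! ### The shuffle map as a product of letters, and its commutation with the Hochschild
differentials. -/

section TensorOperators

variable {k : Type u} [Field k] (C C' : CocyclicData.{u, w} k)

/-- The tensor product of the totals of two cocyclic modules. -/
abbrev Total2 : Type w := C.Total ⊗[k] C'.Total

/-- The tensors with components in degrees `≥ p` and `≥ q`. -/
noncomputable abbrev ge2 (p q : ℕ) : Submodule k (Total2 C C') := subTens (C.ge p) (C'.ge q)

/-- The sign of the left degree. -/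
noncomputable def sn : Module.End k (Total2 C C') := actL C.ep

/-- The letter `σₘ ⊗ 1 + ε (1 ⊗ σₘ)` of the shuffle map. -/
noncomputable def zt (m : ℕ) : Module.End k (Total2 C C') :=
  actL (C.sg m) + sn C C' * actR (C'.sg m)

/-- The signed diagonal coface. -/
noncomputable def dD (a : ℕ) : Module.End k (Total2 C C') :=
  (-1 : k) ^ a • (actL (C.dl a) * actR (C'.dl a) * sn C C')

/-- The partial sums of the signed diagonal cofaces. -/
noncomputable def Db (m : ℕ) : Module.End k (Total2 C C') := ∑ a ∈ Finset.range m, dD C C' a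

/-- The tail of the opposite tensor product differential. -/
noncomputable def dgt (m : ℕ) : Module.End k (Total2 C C') :=
  actL (C.bge m) - sn C C' * actR (C'.bge m)

/-- The product `zₗ zₗ₊₁ ⋯ z_{l+r-1}` of letters. -/
noncomputable def zr (l : ℕ) : ℕ → Module.End k (Total2 C C')
  | 0 => 1
  | r + 1 => zr l r * zt C C' (l + r)

variable {C C'}

theorem sn_sn (z : Total2 C C') : sn C C' (sn C C' z) = z := by
  rw [sn, ← actL_mul]
  exact (LinearMap.congr_fun (congrArg _ (LinearMap.ext fun a => ep_ep a)) z).trans (actL_one z)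

theorem actR_sn (g : Module.End k C'.Total) (z : Total2 C C') :
    actR g (sn C C' z) = sn C C' (actR g z) := actR_actL _ _ _

/-- An operator of odd degree on the left factor anticommutes with ε; this produces all Koszul
signs. -/
theorem actL_sn_of {f : Module.End k C.Total} (h : ∀ a, C.ep (f a) = - f (C.ep a))
    (z : Total2 C C') : actL f (sn C C' z) = - sn C C' (actL f z) := by
  rw [sn, ← actL_mul, ← actL_mul, ← actL_neg]
  exact LinearMap.congr_fun (congrArg _ (LinearMap.ext fun a => by
    rw [LinearMap.neg_apply, Module.End.mul_apply, Module.End.mul_apply, h, neg_neg])) z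

theorem actL_sg_sn (i : ℕ) (z : Total2 C C') :
    actL (C.sg i) (sn C C' z) = - sn C C' (actL (C.sg i) z) := actL_sn_of (ep_sg i) z

theorem actL_dl_sn (i : ℕ) (z : Total2 C C') :
    actL (C.dl i) (sn C C' z) = - sn C C' (actL (C.dl i) z) := actL_sn_of (ep_dl i) z

theorem actL_xs_sn (z : Total2 C C') :
    actL C.xs (sn C C' z) = - sn C C' (actL C.xs z) := actL_sn_of ep_xs z

theorem actL_bge_sn (i : ℕ) (z : Total2 C C') :
    actL (C.bge i) (sn C C' z) = - sn C C' (actL (C.bge i) z) := actL_sn_of (ep_bge i) z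

theorem zt_apply (m : ℕ) (z : Total2 C C') :
    zt C C' m z = actL (C.sg m) z + sn C C' (actR (C'.sg m) z) := rfl

theorem dD_apply (a : ℕ) (z : Total2 C C') :
    dD C C' a z = (-1 : k) ^ a • actL (C.dl a) (actR (C'.dl a) (sn C C' z)) := rfl

theorem dgt_apply (m : ℕ) (z : Total2 C C') :
    dgt C C' m z = actL (C.bge m) z - sn C C' (actR (C'.bge m) z) := rfl

theorem zr_zero (l : ℕ) (z : Total2 C C') : zr C C' l 0 z = z := rfl

theorem zr_succ (l r : ℕ) (z : Total2 C C') :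
    zr C C' l (r + 1) z = zr C C' l r (zt C C' (l + r) z) := rfl

theorem Db_zero (z : Total2 C C') : Db C C' 0 z = 0 := rfl

theorem Db_succ (m : ℕ) (z : Total2 C C') : Db C C' (m + 1) z = Db C C' m z + dD C C' m z := by
  rw [Db, Finset.sum_range_succ]; rfl

theorem actL_bge_sg (hC : C.IsCocyclic) (m : ℕ) (z : Total2 C C') :
    actL (C.bge (m + 1)) (actL (C.sg m) z) = - actL (C.sg m) (actL (C.bge (m + 2)) z) := by
  rw [← actL_mul, ← actL_mul, ← actL_neg]
  exact LinearMap.congr_fun (congrArg _ (LinearMap.ext fun a => bge_sg hC m a)) z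

theorem actR_bge_sg (hC' : C'.IsCocyclic) (m : ℕ) (z : Total2 C C') :
    actR (C'.bge (m + 1)) (actR (C'.sg m) z) = - actR (C'.sg m) (actR (C'.bge (m + 2)) z) := by
  rw [← actR_mul, ← actR_mul, ← actR_neg]
  exact LinearMap.congr_fun (congrArg _ (LinearMap.ext fun a => bge_sg hC' m a)) z

theorem actL_bge_eq (m : ℕ) (z : Total2 C C') : actL (C.bge m) z =
    (-1 : k) ^ m • actL (C.dl m) z + actL (C.bge (m + 1)) z := by
  rw [← actL_smul, ← actL_add]
  exact LinearMap.congr_fun (congrArg _ (LinearMap.ext fun a => bge_eq m a)) z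

theorem actR_bge_eq (m : ℕ) (z : Total2 C C') : actR (C'.bge m) z =
    (-1 : k) ^ m • actR (C'.dl m) z + actR (C'.bge (m + 1)) z := by
  rw [← actR_smul, ← actR_add]
  exact LinearMap.congr_fun (congrArg _ (LinearMap.ext fun a => bge_eq m a)) z

theorem actL_sg_dl_self (hC : C.IsCocyclic) {i p q : ℕ} (h : i ≤ p) {z : Total2 C C'}
    (hz : z ∈ ge2 C C' p q) : actL (C.sg i) (actL (C.dl i) z) = z := by
  rw [← actL_mul]
  exact (actL_congr (f' := 1) (fun a ha => sg_dl_self hC (ge_mono h ha)) hz).trans (actL_one z)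

theorem actR_sg_dl_self (hC' : C'.IsCocyclic) {i p q : ℕ} (h : i ≤ q) {z : Total2 C C'}
    (hz : z ∈ ge2 C C' p q) : actR (C'.sg i) (actR (C'.dl i) z) = z := by
  rw [← actR_mul]
  exact (actR_congr (f' := 1) (fun a ha => sg_dl_self hC' (ge_mono h ha)) hz).trans (actR_one z)

theorem actL_sg_dl_succ (hC : C.IsCocyclic) {i p q : ℕ} (h : i ≤ p) {z : Total2 C C'}
    (hz : z ∈ ge2 C C' p q) : actL (C.sg i) (actL (C.dl (i + 1)) z) = z := by
  rw [← actL_mul]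
  exact (actL_congr (f' := 1) (fun a ha => sg_dl_succ hC (ge_mono h ha)) hz).trans (actL_one z)

theorem actR_sg_dl_succ (hC' : C'.IsCocyclic) {i p q : ℕ} (h : i ≤ q) {z : Total2 C C'}
    (hz : z ∈ ge2 C C' p q) : actR (C'.sg i) (actR (C'.dl (i + 1)) z) = z := by
  rw [← actR_mul]
  exact (actR_congr (f' := 1) (fun a ha => sg_dl_succ hC' (ge_mono h ha)) hz).trans (actR_one z)

theorem actL_sg_dl_lt (hC : C.IsCocyclic) {i j : ℕ} (h : i ≤ j) (z : Total2 C C') :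
    actL (C.sg (j + 1)) (actL (C.dl i) z) = actL (C.dl i) (actL (C.sg j) z) := by
  rw [← actL_mul, ← actL_mul]
  exact LinearMap.congr_fun (congrArg _ (LinearMap.ext fun a => sg_dl_lt hC h a)) z

theorem actR_sg_dl_lt (hC' : C'.IsCocyclic) {i j : ℕ} (h : i ≤ j) (z : Total2 C C') :
    actR (C'.sg (j + 1)) (actR (C'.dl i) z) = actR (C'.dl i) (actR (C'.sg j) z) := by
  rw [← actR_mul, ← actR_mul]
  exact LinearMap.congr_fun (congrArg _ (LinearMap.ext fun a => sg_dl_lt hC' h a)) z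

theorem ge2_mono {p q p' q' : ℕ} (hp : p ≤ p') (hq : q ≤ q') : ge2 C C' p' q' ≤ ge2 C C' p q :=
  subTens_mono (ge_mono hp) (ge_mono hq)

theorem sn_mem {p q : ℕ} {z : Total2 C C'} (hz : z ∈ ge2 C C' p q) : sn C C' z ∈ ge2 C C' p q :=
  actL_mem (fun _ ha => ep_mem_ge ha) hz

theorem zt_mem (m : ℕ) {p q : ℕ} {z : Total2 C C'} (hz : z ∈ ge2 C C' (p + 1) (q + 1)) :
    zt C C' m z ∈ ge2 C C' p q :=
  add_mem (actL_mem (fun _ ha => sg_mem_ge m ha) (ge2_mono le_rfl (Nat.le_succ _) hz))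
    (sn_mem (actR_mem (fun _ ha => sg_mem_ge m ha) (ge2_mono (Nat.le_succ _) le_rfl hz)))

/-- Both halves of the letter pass a diagonal coface of small index, and the sign is uniform because
of ε. -/
theorem zt_dD (hC : C.IsCocyclic) (hC' : C'.IsCocyclic) {a m : ℕ} (h : a ≤ m)
    (z : Total2 C C') : zt C C' (m + 1) (dD C C' a z) = - dD C C' a (zt C C' m z) := by
  simp only [zt_apply, dD_apply, map_add, map_smul, actR_sn, actR_actL, actL_sg_dl_lt hC h,
    actR_sg_dl_lt hC' h, actL_sg_sn, actL_dl_sn, map_neg, sn_sn]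
  module

theorem zt_Db (hC : C.IsCocyclic) (hC' : C'.IsCocyclic) {a m : ℕ} (h : a ≤ m + 1)
    (z : Total2 C C') : zt C C' (m + 1) (Db C C' a z) = - Db C C' a (zt C C' m z) := by
  induction a with
  | zero => simp [Db_zero]
  | succ a ih => rw [Db_succ, Db_succ, map_add, ih (by omega), zt_dD hC hC' (by omega), neg_add]

/-- Equal indices: each half of the letter cancels one of the two cofaces and leaves the other one.
-/
theorem zt_dD_self (hC : C.IsCocyclic) (hC' : C'.IsCocyclic) {m : ℕ} {z : Total2 C C'}
    (hz : z ∈ ge2 C C' m m) :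
    zt C C' m (dD C C' m z) =
      (-1 : k) ^ m • (sn C C' (actR (C'.dl m) z) - actL (C.dl m) z) := by
  simp only [zt_apply, dD_apply, map_smul, actR_sn, actR_actL]
  rw [actL_sg_dl_self hC le_rfl (sn_mem (actR_mem (fun a ha => dl_mem_ge m ha) hz)),
    actR_sg_dl_self hC' le_rfl hz, actL_dl_sn, map_neg, sn_sn]
  module

theorem zt_dD_succ (hC : C.IsCocyclic) (hC' : C'.IsCocyclic) {m : ℕ} {z : Total2 C C'}
    (hz : z ∈ ge2 C C' m m) :
    zt C C' m (dD C C' (m + 1) z) =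
      (-1 : k) ^ m • (actL (C.dl (m + 1)) z - sn C C' (actR (C'.dl (m + 1)) z)) := by
  simp only [zt_apply, dD_apply, map_smul, actR_sn, actR_actL]
  rw [actL_sg_dl_succ hC le_rfl (sn_mem (actR_mem (fun a ha => dl_mem_ge (m + 1) ha) hz)),
    actR_sg_dl_succ hC' le_rfl hz, actL_dl_sn, map_neg, sn_sn, pow_succ]
  module

/-- The only commutation rule behind `b sh = sh b`. The one-sided cofaces `δₘ₊₁` missing from the
shorter tail are supplied by the next letter meeting a diagonal coface (`zt_dD_self`). -/
theorem dgt_zt (hC : C.IsCocyclic) (hC' : C'.IsCocyclic) {m : ℕ} {z : Total2 C C'}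
    (hz : z ∈ ge2 C C' (m + 1) (m + 1)) :
    dgt C C' (m + 1) (zt C C' m z) =
      - zt C C' m (dgt C C' (m + 2) z) + zt C C' m (zt C C' (m + 1) (dD C C' (m + 1) z)) := by
  have hz' := ge2_mono (Nat.le_succ m) (Nat.le_succ m) hz
  rw [zt_dD_self hC hC' hz]
  simp only [zt_apply, dgt_apply, map_add, map_sub, map_smul, actR_sn, actR_actL, actL_bge_sg hC,
    actR_bge_sg hC', actL_bge_sn, actL_sg_sn, sn_sn, map_neg, actR_sg_dl_succ hC' le_rfl hz',
    actL_sg_dl_succ hC le_rfl hz']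
  rw [actL_bge_eq (m + 1), actR_bge_eq (m + 1)]
  simp only [map_add, map_smul, pow_succ]
  module

/-- Appending letters to a family of operators whose commutator with the differential is known. -/
theorem dgt_family (hC : C.IsCocyclic) (hC' : C'.IsCocyclic) {X Y : ℕ → Module.End k (Total2 C C')}
    {m c c' : ℕ} (hc : c ≤ m + 1) (hc' : c' ≤ m + 1) (s : k)
    (hX : ∀ j, m ≤ j → ∀ z, X (j + 1) z = X j (zt C C' j z))
    (hY : ∀ j, m + 1 ≤ j → ∀ z, Y (j + 1) z = Y j (zt C C' j z))
    (h0 : ∀ z ∈ ge2 C C' m m, dgt C C' 0 (X m z) = s • (X m (dgt C C' (m + 1) z) -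
      X (m + 1) (Db C C' (m + 1) z - Db C C' c z) - Y (m + 1) (Db C C' c' z)))
    (r : ℕ) {z : Total2 C C'} (hz : z ∈ ge2 C C' (m + r) (m + r)) :
    dgt C C' 0 (X (m + r) z) = ((-1 : k) ^ r * s) • (X (m + r) (dgt C C' (m + r + 1) z) -
      X (m + r + 1) (Db C C' (m + r + 1) z - Db C C' c z) - Y (m + r + 1) (Db C C' c' z)) := by
  induction r generalizing z with
  | zero => simpa using h0 z hz
  | succ r ih =>
    rw [← add_assoc] at hz ⊢
    rw [hX _ (by omega) z, ih (zt_mem _ hz), dgt_zt hC hC' hz, hX (m + r + 1) (by omega),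
      hY (m + r + 1) (by omega), hX (m + r) (by omega) (dgt _ _ _ _), Db_succ (m + r + 1)]
    simp only [map_add, map_sub, map_neg, zt_Db hC hC' (show m + r + 1 ≤ m + r + 1 by omega),
      zt_Db hC hC' (show c ≤ m + r + 1 by omega), zt_Db hC hC' (show c' ≤ m + r + 1 by omega),
      hX (m + r) (by omega), pow_succ]
    module

variable (C C') in
/-- The tensors of bidegree `(n, n)`. -/
noncomputable abbrev deg2 (n : ℕ) : Submodule k (Total2 C C') :=
  subTens (LinearMap.range (C.inc n)) (LinearMap.range (C'.inc n))

theorem deg2_le (n : ℕ) : deg2 C C' n ≤ ge2 C C' n n :=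
  subTens_mono (by rintro _ ⟨x, rfl⟩; exact inc_mem_ge le_rfl x)
    (by rintro _ ⟨x, rfl⟩; exact inc_mem_ge le_rfl x)

/-- In bidegree `(n, n)` only the two last cofaces are left in the tail, and a letter applied to the
last diagonal coface produces their difference. -/
theorem dgt_deg2 (hC : C.IsCocyclic) (hC' : C'.IsCocyclic) {n : ℕ} {z : Total2 C C'}
    (hz : z ∈ deg2 C C' n) : dgt C C' (n + 1) z = - zt C C' n (dD C C' (n + 1) z) := by
  rw [zt_dD_succ hC hC' (deg2_le n hz), dgt_apply,
    actL_congr (f' := (-1 : k) ^ (n + 1) • C.dl (n + 1))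
      (by rintro _ ⟨x, rfl⟩; exact bge_inc_self n x) hz,
    actR_congr (f' := (-1 : k) ^ (n + 1) • C'.dl (n + 1))
      (by rintro _ ⟨x, rfl⟩; exact bge_inc_self n x) hz, actL_smul, actR_smul, map_smul, pow_succ]
  module

/-- With all letters appended, `dgt_deg2` absorbs the remaining tail, so the sum reaches all `m + r
+ 2` diagonal cofaces. -/
theorem dgt_family_deg2 (hC : C.IsCocyclic) (hC' : C'.IsCocyclic)
    {X Y : ℕ → Module.End k (Total2 C C')}
    {m c c' : ℕ} (hc : c ≤ m + 1) (hc' : c' ≤ m + 1) (s : k)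
    (hX : ∀ j, m ≤ j → ∀ z, X (j + 1) z = X j (zt C C' j z))
    (hY : ∀ j, m + 1 ≤ j → ∀ z, Y (j + 1) z = Y j (zt C C' j z))
    (h0 : ∀ z ∈ ge2 C C' m m, dgt C C' 0 (X m z) = s • (X m (dgt C C' (m + 1) z) -
      X (m + 1) (Db C C' (m + 1) z - Db C C' c z) - Y (m + 1) (Db C C' c' z)))
    (r : ℕ) {z : Total2 C C'} (hz : z ∈ deg2 C C' (m + r)) :
    dgt C C' 0 (X (m + r) z) = -(((-1 : k) ^ r * s) •
      (X (m + r + 1) (Db C C' (m + r + 2) z - Db C C' c z) + Y (m + r + 1) (Db C C' c' z))) := by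
  rw [dgt_family hC hC' hc hc' s hX hY h0 r (deg2_le _ hz), dgt_deg2 hC hC' hz,
    Db_succ (m + r + 1), map_neg, ← hX (m + r) (by omega)]
  simp only [map_add, map_sub]
  module

/-- The plain product of letters is the family with no marked position: `Y = 0` and `c = c' = 0`,
started from the empty product. -/
theorem dgt_zr (hC : C.IsCocyclic) (hC' : C'.IsCocyclic) {n : ℕ} {z : Total2 C C'}
    (hz : z ∈ deg2 C C' n) :
    dgt C C' 0 (zr C C' 0 n z) = -((-1 : k) ^ n • zr C C' 0 (n + 1) (Db C C' (n + 2) z)) := by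
  have := dgt_family_deg2 hC hC' (X := zr C C' 0) (Y := 0) (m := 0) (c := 0) (c' := 0)
    (Nat.zero_le _) (Nat.zero_le _) 1 (fun j _ z => by rw [zr_succ, zero_add])
    (fun _ _ _ => by simp) (fun z hz => ?_) n (by simpa using hz)
  · simpa [Db_zero] using this
  · rw [zr_zero, zr_succ, zr_zero, zr_zero, Db_zero, Db_succ, Db_zero, sub_zero,
      map_add, map_zero, zero_add, zt_dD_self hC hC' hz, dgt_apply, dgt_apply, actL_bge_eq 0, actR_bge_eq 0]
    simp only [map_zero, map_add, map_smul, pow_zero, zero_add]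
    module

end TensorOperators

end CocyclicData
end HopfCyc

namespace HopfCyc
namespace CocyclicData

/-! ### The operators `Q_l`, which place the extra degeneracy and rotate the right factor. -/

section CyclicLetters

variable {k : Type u} [Field k] {C C' : CocyclicData.{u, w} k}

variable (C C') in
/-- The operators `Q₀ = ε (1 ⊗ s)`, `Q_{l+1} = (1 ⊗ λ) Q_l (σ_l ⊗ 1) + Q_l ε (1 ⊗ σ_l)`. -/
noncomputable def qt : ℕ → Module.End k (Total2 C C')
  | 0 => sn C C' * actR C'.xs
  | l + 1 => actR C'.cy * qt l * actL (C.sg l) + qt l * (sn C C' * actR (C'.sg l))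

theorem qt_zero (z : Total2 C C') : qt C C' 0 z = sn C C' (actR C'.xs z) := rfl

theorem qt_succ (l : ℕ) (z : Total2 C C') : qt C C' (l + 1) z =
    actR C'.cy (qt C C' l (actL (C.sg l) z)) + qt C C' l (sn C C' (actR (C'.sg l) z)) := rfl

theorem actL_sg_Db (hC : C.IsCocyclic) {a m : ℕ} (h : a ≤ m + 1) (z : Total2 C C') :
    actL (C.sg (m + 1)) (Db C C' a z) = - Db C C' a (actL (C.sg m) z) := by
  induction a with
  | zero => simp [Db_zero]
  | succ a ih =>
    rw [Db_succ, Db_succ, map_add, ih (by omega), dD_apply, dD_apply, map_smul,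
      actL_sg_dl_lt hC (by omega)]
    simp only [actR_sn, actR_actL, actL_sg_sn, map_neg]
    module

theorem sn_actR_sg_Db (hC' : C'.IsCocyclic) {a m : ℕ} (h : a ≤ m + 1) (z : Total2 C C') :
    sn C C' (actR (C'.sg (m + 1)) (Db C C' a z)) =
      - Db C C' a (sn C C' (actR (C'.sg m) z)) := by
  induction a with
  | zero => simp [Db_zero]
  | succ a ih =>
    rw [Db_succ, Db_succ, map_add, map_add, ih (by omega), dD_apply, dD_apply, map_smul, map_smul,
      actR_actL, actR_sg_dl_lt hC' (by omega)]
    simp only [actR_sn, sn_sn, actL_dl_sn, map_neg]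
    module

/-- A single half of a letter passes the tail up to one coface of the other factor. In `dgt_zt` the
two leftovers combine into a diagonal coface; here they must be carried along separately. -/
theorem dgt_actL_sg (hC : C.IsCocyclic) (l : ℕ) (z : Total2 C C') :
    dgt C C' (l + 1) (actL (C.sg l) z) = - actL (C.sg l) (dgt C C' (l + 2) z) +
      (-1 : k) ^ (l + 1) • actL (C.sg l) (sn C C' (actR (C'.dl (l + 1)) z)) := by
  rw [dgt_apply, dgt_apply, actL_bge_sg hC, actR_actL, actR_bge_eq (l + 1), map_sub]
  simp only [map_add, map_smul, actL_sg_sn]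
  module

theorem dgt_sn_actR_sg (hC' : C'.IsCocyclic) (l : ℕ) (z : Total2 C C') :
    dgt C C' (l + 1) (sn C C' (actR (C'.sg l) z)) = - sn C C' (actR (C'.sg l) (dgt C C' (l + 2) z)) -
      (-1 : k) ^ (l + 1) • sn C C' (actR (C'.sg l) (actL (C.dl (l + 1)) z)) := by
  rw [dgt_apply, dgt_apply, actL_bge_sn, actR_sn, sn_sn, actR_bge_sg hC', ← actR_actL,
    actL_bge_eq (l + 1), map_sub, map_sub, actR_sn, sn_sn]
  simp only [map_add, map_smul]
  module

theorem dgt_actR_cy (hC' : C'.IsCocyclic) (z : Total2 C C') :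
    dgt C C' 0 (actR C'.cy z) = actR C'.cy (dgt C C' 0 z) -
      sn C C' (actR C'.cy (actR (C'.dl 0) (actR C'.cy z))) +
      sn C C' (actR C'.cy (actR (C'.dl 0) z)) := by
  have h : actR C'.bt (actR C'.cy z) = actR C'.cy (actR C'.bt z) +
      actR C'.cy (actR (C'.dl 0) (actR C'.cy z)) - actR C'.cy (actR (C'.dl 0) z) := by
    simp only [← actR_mul]
    rw [← actR_add, sub_eq_add_neg, ← actR_neg, ← actR_add]
    exact LinearMap.congr_fun (congrArg _ (LinearMap.ext fun a => by
      simpa [sub_eq_add_neg] using bt_cy hC' a)) z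
  rw [dgt_apply, dgt_apply, bge_zero, bge_zero, h]
  simp only [map_sub, map_add, actR_sn, actR_actL]
  abel

theorem actR_cy_dl_succ (hC' : C'.IsCocyclic) {i p q : ℕ} (h : i ≤ q) {z : Total2 C C'}
    (hz : z ∈ ge2 C C' p q) :
    actR C'.cy (actR (C'.dl (i + 1)) z) = - actR (C'.dl i) (actR C'.cy z) := by
  rw [← actR_mul, ← actR_mul, ← actR_neg]
  exact actR_congr (fun a ha => cy_dl_succ hC' (ge_mono h ha)) hz

theorem actR_xs_dl_succ (hC' : C'.IsCocyclic) {i p q : ℕ} (h : i + 1 ≤ q) {z : Total2 C C'}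
    (hz : z ∈ ge2 C C' p q) :
    actR C'.xs (actR (C'.dl (i + 1)) z) = actR (C'.dl i) (actR C'.xs z) := by
  rw [← actR_mul, ← actR_mul]
  exact actR_congr (fun a ha => xs_dl_succ hC' (ge_mono h ha)) hz

theorem actR_xs_dl_zero (hC' : C'.IsCocyclic) (z : Total2 C C') :
    actR C'.xs (actR (C'.dl 0) z) = z := by
  rw [← actR_mul]
  exact (LinearMap.congr_fun (congrArg _ (LinearMap.ext fun a => xs_dl_zero hC' a)) z).trans
    (actR_one z)

theorem actR_sg_dl_gt (hC' : C'.IsCocyclic) {i j : ℕ} (h : j < i) (z : Total2 C C') :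
    actR (C'.sg j) (actR (C'.dl (i + 1)) z) = actR (C'.dl i) (actR (C'.sg j) z) := by
  rw [← actR_mul, ← actR_mul]
  exact LinearMap.congr_fun (congrArg _ (LinearMap.ext fun a => sg_dl_gt hC' h a)) z

theorem actL_sg_mem (i : ℕ) {p q : ℕ} {z : Total2 C C'} (hz : z ∈ ge2 C C' (p + 1) q) :
    actL (C.sg i) z ∈ ge2 C C' p q := actL_mem (fun _ ha => sg_mem_ge i ha) hz

theorem actL_sg_mem_zero (i : ℕ) {q : ℕ} {z : Total2 C C'} (hz : z ∈ ge2 C C' 0 q) :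
    actL (C.sg i) z ∈ ge2 C C' 0 q := actL_mem (fun _ _ => mem_ge_zero _) hz

theorem actR_sg_mem (i : ℕ) {p q : ℕ} {z : Total2 C C'} (hz : z ∈ ge2 C C' p (q + 1)) :
    actR (C'.sg i) z ∈ ge2 C C' p q := actR_mem (fun _ ha => sg_mem_ge i ha) hz

theorem actR_cy_mem {p q : ℕ} {z : Total2 C C'} (hz : z ∈ ge2 C C' p q) :
    actR C'.cy z ∈ ge2 C C' p q := actR_mem (fun _ ha => cy_mem_ge ha) hz

theorem qt_mem {l q : ℕ} {z : Total2 C C'} (hz : z ∈ ge2 C C' 0 (q + l + 1)) :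
    qt C C' l z ∈ ge2 C C' 0 q := by
  induction l generalizing q z with
  | zero => exact sn_mem (actR_mem (fun _ ha => xs_mem_ge ha) hz)
  | succ l ih =>
    exact add_mem
      (actR_cy_mem (ih (actL_sg_mem_zero _ (ge2_mono le_rfl (by omega) hz))))
      (ih (sn_mem (actR_sg_mem _ hz)))

/-- Passing a coface inside lifts its index by `l + 1`: once for `s` and once for each of the `l`
steps, where either `λ` or a codegeneracy of smaller index shifts it. -/
theorem sn_dl_qt (hC' : C'.IsCocyclic) {l j q : ℕ} {z : Total2 C C'}
    (hz : z ∈ ge2 C C' 0 q) (h : l + 1 + j ≤ q) :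
    sn C C' (actR (C'.dl j) (qt C C' l z)) = qt C C' l (sn C C' (actR (C'.dl (l + 1 + j)) z)) := by
  induction l generalizing j q z with
  | zero =>
    rw [qt_zero, qt_zero, actR_sn, actR_sn, sn_sn, sn_sn, zero_add, add_comm,
      actR_xs_dl_succ hC' (by omega) hz]
  | succ l ih =>
    have hz' := actL_sg_mem_zero (C := C) l hz
    obtain ⟨q, rfl⟩ : ∃ q', q = q' + 1 := ⟨q - 1, by omega⟩
    have h1 : qt C C' l (actL (C.sg l) z) ∈ ge2 C C' 0 j :=
      qt_mem (ge2_mono le_rfl (by omega) hz')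
    have h2 := actR_cy_dl_succ hC' le_rfl h1
    have h3 := ih (j := j) (sn_mem (actR_sg_mem l hz)) (by omega)
    have h4 := ih (j := j + 1) hz' (by omega)
    rw [qt_succ, map_add, map_add, ← neg_eq_iff_eq_neg.2 h2, h3, map_neg, ← actR_sn, h4, qt_succ]
    simp only [actL_sg_sn, actR_sn, sn_sn, actR_actL, map_neg]
    rw [show l + 1 + 1 + j = l + 1 + j + 1 by omega, actR_sg_dl_gt hC' (by omega)]
    rfl

theorem qt_dD_succ (hC : C.IsCocyclic) (hC' : C'.IsCocyclic) {l : ℕ} {z : Total2 C C'}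
    (hz : z ∈ ge2 C C' (l + 1) (l + 1)) :
    qt C C' (l + 2) (dD C C' (l + 1) z) = (-1 : k) ^ (l + 1) •
      (actR C'.cy (actR C'.cy (qt C C' l (actL (C.sg l) (actR (C'.dl (l + 1)) (sn C C' z))))) -
        qt C C' l (sn C C' (actR (C'.sg l) (actL (C.dl (l + 1)) z)))) := by
  have hz' := ge2_mono (Nat.le_succ l) (Nat.le_succ l) hz
  have h1 : actL (C.sg (l + 1)) (dD C C' (l + 1) z) =
      (-1 : k) ^ (l + 1) • actR (C'.dl (l + 1)) (sn C C' z) := by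
    rw [dD_apply, map_smul, actL_sg_dl_self hC le_rfl
      (actR_mem (fun a ha => dl_mem_ge (l + 1) ha) (sn_mem hz))]
  have h2 : sn C C' (actR (C'.sg (l + 1)) (dD C C' (l + 1) z)) =
      -((-1 : k) ^ (l + 1) • actL (C.dl (l + 1)) z) := by
    rw [dD_apply, map_smul, actR_actL, actR_sg_dl_self hC' le_rfl (sn_mem hz), actL_dl_sn,
      map_smul, map_neg, sn_sn, smul_neg]
  rw [qt_succ, h1, h2, map_neg, map_smul, map_smul, map_smul, qt_succ, qt_succ,
    actR_sg_dl_succ hC' le_rfl (sn_mem hz'), sn_sn, actL_sg_dl_succ hC le_rfl hz', map_add]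
  module

/-- By induction along the recursion for `Q_l`. The last term starts as the extra term of
`xs_bge_one`, and the failure of `λ` to commute with `b` reproduces it at each step (`e9`, `e10`).
-/
theorem dgt_qt (hC : C.IsCocyclic) (hC' : C'.IsCocyclic) {l : ℕ} {z : Total2 C C'}
    (hz : z ∈ ge2 C C' l (l + 1)) :
    dgt C C' 0 (qt C C' l z) = (-1 : k) ^ (l + 1) • (qt C C' l (dgt C C' (l + 1) z) -
      qt C C' (l + 1) (Db C C' (l + 1) z)) -
      actR C'.cy (qt C C' l (sn C C' (actR (C'.dl (l + 1)) z))) := by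
  induction l generalizing z with
  | zero =>
    have h : actR C'.bt (actR C'.xs z) = - actR C'.xs (actR (C'.bge 1) z) - actR C'.cy z +
        actR C'.cy (actR C'.xs (actR (C'.dl 1) z)) := by
      simp only [← actR_mul]
      rw [sub_eq_add_neg, ← actR_neg, ← actR_neg, ← actR_add, ← actR_add]
      exact actR_congr (fun a ha => by simpa [sub_eq_add_neg] using xs_bge_one hC' ha) hz
    simp only [zero_add, Db_succ, Db_zero]
    rw [dgt_apply, dgt_apply, qt_zero, qt_zero, qt_zero, qt_succ,
      qt_zero, qt_zero, dD_apply, pow_zero, one_smul, actL_bge_sn, actR_sn, sn_sn, bge_zero, bge_zero, h,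
      actL_sg_dl_self hC le_rfl (actR_mem (fun a ha => dl_mem_ge 0 ha) (sn_mem hz)),
      actR_actL, actR_sg_dl_self hC' (Nat.zero_le _) (sn_mem hz), actR_xs_dl_zero hC', sn_sn,
      actR_sn, sn_sn, actL_dl_sn, ← bge_zero (C := C), actL_bge_eq 0]
    simp only [map_sub, map_add, map_neg, actR_sn, sn_sn, actR_actL, map_smul]
    module
  | succ l ih =>
    have e1 := ih (actL_sg_mem l (ge2_mono le_rfl (Nat.le_succ _) hz))
    have e2 := ih (sn_mem (actR_sg_mem l (ge2_mono (Nat.le_succ l) le_rfl hz)))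
    rw [dgt_actL_sg hC] at e1
    rw [dgt_sn_actR_sg hC'] at e2
    have hz0 : actL (C.sg l) z ∈ ge2 C C' 0 (l + 2) := actL_sg_mem_zero (C := C) l (ge2_mono (q' := l + 2) (Nat.zero_le _) le_rfl hz)
    have h1 : qt C C' l (actL (C.sg l) z) ∈ ge2 C C' 0 0 :=
      qt_mem (q := 0) (ge2_mono (q' := l + 2) le_rfl (by omega) hz0)
    have e3 := sn_dl_qt (l := l) (j := 1) (q := l + 2) hC' hz0 (by omega)
    have e4 := sn_dl_qt (l := l) (j := 0) (q := l + 2) hC' hz0 (by omega)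
    have e5 := actR_cy_dl_succ hC' le_rfl h1
    have e6 := qt_dD_succ hC hC' (ge2_mono le_rfl (Nat.le_succ _) hz)
    have e7 : qt C C' (l + 2) (Db C C' (l + 1) z) = - actR C'.cy (qt C C' (l + 1)
        (Db C C' (l + 1) (actL (C.sg l) z))) - qt C C' (l + 1) (Db C C' (l + 1)
          (sn C C' (actR (C'.sg l) z))) := by
      rw [qt_succ, actL_sg_Db hC le_rfl, sn_actR_sg_Db hC' le_rfl, map_neg, map_neg, map_neg]
      rfl
    have e6' := (congrArg (qt C C' (l + 2)) (Db_succ (l + 1) z)).trans (map_add _ _ _)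
    rw [e6, e7] at e6'
    have e8 : qt C C' (l + 1) (sn C C' (actR (C'.dl (l + 2)) z)) =
        - actR C'.cy (qt C C' l (sn C C' (actR (C'.dl (l + 2)) (actL (C.sg l) z)))) +
          qt C C' l (actR (C'.dl (l + 1)) (actR (C'.sg l) z)) := by
      rw [qt_succ, actL_sg_sn, actR_sn, sn_sn, actR_sg_dl_gt hC' (by omega), actR_actL, map_neg,
        map_neg]
    have e9 : sn C C' (actR C'.cy (actR (C'.dl 0) (actR C'.cy (qt C C' l (actL (C.sg l) z))))) =
        - actR C'.cy (actR C'.cy (qt C C' l (sn C C' (actR (C'.dl (l + 2)) (actL (C.sg l) z))))) := by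
      rw [← neg_eq_iff_eq_neg.2 e5, map_neg, map_neg, ← actR_sn, ← actR_sn, e3]
    have e10 : sn C C' (actR C'.cy (actR (C'.dl 0) (qt C C' l (actL (C.sg l) z)))) =
        actR C'.cy (qt C C' l (sn C C' (actR (C'.dl (l + 1)) (actL (C.sg l) z)))) := by
      rw [← actR_sn, e4]
    rw [qt_succ l z, map_add, dgt_actR_cy hC', e9, e10, e1, e2, e6', e8, qt_succ l (dgt C C' (l + 2) z)]
    simp only [map_sub, map_add, map_neg, map_smul, actR_sn, sn_sn, actR_actL, actL_sg_sn]
    rw [pow_succ _ (l + 1)]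
    rcases neg_one_pow_eq_or k (l + 1) with h | h <;> simp only [h] <;> module

end CyclicLetters

end CocyclicData
end HopfCyc

namespace HopfCyc
namespace CocyclicData

/-! ### The operator Γ and its commutator with the differential. -/

section CyclicFamily

variable {k : Type u} [Field k] {C C' : CocyclicData.{u, w} k}

variable (C C') in
/-- The operators `M_l = Q_l (σ_l ⊗ 1) z_{l+1} ⋯ z_{l+r}`. -/
noncomputable def mt (l r : ℕ) : Module.End k (Total2 C C') :=
  qt C C' l * actL (C.sg l) * zr C C' (l + 1) r

theorem mt_apply (l r : ℕ) (z : Total2 C C') :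
    mt C C' l r z = qt C C' l (actL (C.sg l) (zr C C' (l + 1) r z)) := rfl

theorem mt_succ (l r : ℕ) (z : Total2 C C') :
    mt C C' l (r + 1) z = mt C C' l r (zt C C' (l + 1 + r) z) := rfl

/-- The one-sided cofaces left over by `dgt_qt` and `dgt_actL_sg` are supplied by the diagonal
coface of index `l + 1`, which enters both for the mark at `l` and for the mark at `l + 1`. -/
theorem dgt_mt_zero (hC : C.IsCocyclic) (hC' : C'.IsCocyclic) {l : ℕ} {z : Total2 C C'}
    (hz : z ∈ ge2 C C' (l + 1) (l + 1)) :
    dgt C C' 0 (mt C C' l 0 z) = (-1 : k) ^ l • (mt C C' l 0 (dgt C C' (l + 2) z) -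
      mt C C' l 1 (Db C C' (l + 2) z - Db C C' (l + 1) z) -
      mt C C' (l + 1) 0 (Db C C' (l + 2) z)) := by
  have hz' := ge2_mono (Nat.le_succ l) (Nat.le_succ l) hz
  have h1 : actL (C.sg (l + 1)) (dD C C' (l + 1) z) =
      (-1 : k) ^ (l + 1) • actR (C'.dl (l + 1)) (sn C C' z) := by
    rw [dD_apply, map_smul, actL_sg_dl_self hC le_rfl
      (actR_mem (fun a ha => dl_mem_ge (l + 1) ha) (sn_mem hz))]
  have h2 : zt C C' (l + 1) (dD C C' (l + 1) z) = _ := zt_dD_self hC hC' hz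
  have h3 : actL (C.sg (l + 1)) (Db C C' (l + 1) z) = _ := actL_sg_Db hC le_rfl z
  have h4 := qt_succ l (actR (C'.dl (l + 1)) (sn C C' z))
  rw [actR_sg_dl_succ hC' le_rfl (sn_mem hz'), sn_sn] at h4
  rw [mt_succ, mt_apply, mt_apply, mt_apply, mt_apply, zr_zero, zr_zero, zr_zero, zr_zero,
    dgt_qt hC hC' (actL_sg_mem l hz), dgt_actL_sg hC, Db_succ (l + 1), add_sub_cancel_left, add_zero,
    h2, map_add (actL _), h1, h3, map_add (qt C C' (l + 1)), map_smul (qt C C' (l + 1)), h4]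
  simp only [map_sub, map_add, map_neg, map_smul, actL_sg_dl_succ hC le_rfl hz', actR_sn, actR_actL,
    actL_sg_sn]
  rw [pow_succ _ l]
  rcases neg_one_pow_eq_or k l with h | h <;> simp only [h] <;> module

/-- Cofaces of index at least `l + 1` act behind the marked position and leave it in place; those of
index at most `l + 1` push it to `l + 1`. The index `l + 1` occurs in both groups. -/
theorem dgt_mt (hC : C.IsCocyclic) (hC' : C'.IsCocyclic) (l r : ℕ) {z : Total2 C C'}
    (hz : z ∈ deg2 C C' (l + 1 + r)) :
    dgt C C' 0 (mt C C' l r z) = (-1 : k) ^ (l + 1 + r) •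
      (mt C C' l (r + 1) (Db C C' (l + 1 + r + 2) z - Db C C' (l + 1) z) +
        mt C C' (l + 1) r (Db C C' (l + 2) z)) := by
  have := dgt_family_deg2 hC hC' (X := fun j => mt C C' l (j - (l + 1)))
    (Y := fun j => mt C C' (l + 1) (j - (l + 2))) (m := l + 1) (c := l + 1) (c' := l + 2)
    (by omega) (by omega) ((-1 : k) ^ l) (fun j hj z => ?_) (fun j hj z => ?_) (fun z hz => ?_) r hz
  · simp only [Nat.add_sub_cancel_left] at this
    rw [this, show l + 1 + r + 1 - (l + 1) = r + 1 by omega,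
      show l + 1 + r + 1 - (l + 2) = r by omega, pow_add, pow_succ]
    module
  · obtain ⟨i, rfl⟩ := Nat.exists_eq_add_of_le hj
    rw [add_assoc (l + 1), Nat.add_sub_cancel_left, Nat.add_sub_cancel_left, mt_succ]
  · obtain ⟨i, rfl⟩ := Nat.exists_eq_add_of_le hj
    rw [add_assoc (l + 1 + 1), Nat.add_sub_cancel_left, Nat.add_sub_cancel_left, mt_succ]
  · simpa using dgt_mt_zero hC hC' hz

variable (C C') in
/-- The inclusion of the total of the diagonal cocyclic module. -/
noncomputable def jd : (diag C C').Total →ₗ[k] Total2 C C' :=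
  DirectSum.toModule k ℕ _ fun n => TensorProduct.map (C.inc n) (C'.inc n)

theorem jd_inc (n : ℕ) (x : (diag C C').X n) :
    jd C C' ((diag C C').inc n x) = TensorProduct.map (C.inc n) (C'.inc n) x := by
  rw [jd, inc, DirectSum.toModule_lof]

theorem jd_inc_mem (n : ℕ) (x : (diag C C').X n) :
    jd C C' ((diag C C').inc n x) ∈ deg2 C C' n := by
  rw [jd_inc]
  induction x using TensorProduct.induction_on with
  | zero => rw [map_zero]; exact zero_mem _
  | tmul x y => exact tmul_mem_subTens ⟨x, rfl⟩ ⟨y, rfl⟩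
  | add x y hx hy => rw [map_add]; exact add_mem hx hy

theorem jd_ext {V : Type*} [AddCommGroup V] [Module k V] {f g : (diag C C').Total →ₗ[k] V}
    (h : ∀ n (x : C.X n) (y : C'.X n),
      f ((diag C C').inc n (x ⊗ₜ y)) = g ((diag C C').inc n (x ⊗ₜ y)))
    (a : (diag C C').Total) : f a = g a :=
  total_ext (fun n x => LinearMap.congr_fun
    (f := f ∘ₗ (diag C C').inc n) (g := g ∘ₗ (diag C C').inc n) (TensorProduct.ext' (h n)) x) a

theorem jd_dl (i : ℕ) (a : (diag C C').Total) :
    jd C C' ((diag C C').dl i a) = actL (C.dl i) (actR (C'.dl i) (jd C C' a)) := by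
  refine jd_ext (f := jd C C' ∘ₗ (diag C C').dl i)
    (g := actL (C.dl i) ∘ₗ actR (C'.dl i) ∘ₗ jd C C') (fun n x y => ?_) a
  simp only [LinearMap.comp_apply]
  rw [dl_inc, jd_inc, TensorProduct.map_tmul, actR_tmul, actL_tmul, dl_inc, dl_inc]
  split_ifs
  · rw [jd_inc]; rfl
  · simp

theorem jd_sg (i : ℕ) (a : (diag C C').Total) :
    jd C C' ((diag C C').sg i a) = actL (C.sg i) (actR (C'.sg i) (jd C C' a)) := by
  refine jd_ext (f := jd C C' ∘ₗ (diag C C').sg i)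
    (g := actL (C.sg i) ∘ₗ actR (C'.sg i) ∘ₗ jd C C') (fun n x y => ?_) a
  simp only [LinearMap.comp_apply]
  rw [jd_inc, TensorProduct.map_tmul, actR_tmul, actL_tmul]
  rcases n with _ | n
  · rw [sg_inc_zero, sg_inc_zero]; simp
  · rw [sg_inc_succ, sg_inc_succ, sg_inc_succ]
    split_ifs
    · rw [jd_inc]; rfl
    · simp

theorem jd_tw (a : (diag C C').Total) :
    jd C C' ((diag C C').tw a) = actL C.tw (actR C'.tw (jd C C' a)) := by
  refine jd_ext (f := jd C C' ∘ₗ (diag C C').tw)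
    (g := actL C.tw ∘ₗ actR C'.tw ∘ₗ jd C C') (fun n x y => ?_) a
  simp only [LinearMap.comp_apply]
  rw [jd_inc, TensorProduct.map_tmul, actR_tmul, actL_tmul, tw_inc, tw_inc, tw_inc, jd_inc]
  rfl

theorem sn_jd (a : (diag C C').Total) : sn C C' (jd C C' a) = jd C C' ((diag C C').ep a) := by
  refine jd_ext (f := sn C C' ∘ₗ jd C C') (g := jd C C' ∘ₗ (diag C C').ep) (fun n x y => ?_) a
  simp only [LinearMap.comp_apply]
  rw [ep_inc, map_smul, jd_inc, TensorProduct.map_tmul, sn, actL_tmul, ep_inc,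
    TensorProduct.smul_tmul']

theorem sn_jd_inc (n : ℕ) (x : (diag C C').X n) : sn C C' (jd C C' ((diag C C').inc n x)) =
    (-1 : k) ^ n • jd C C' ((diag C C').inc n x) := by
  rw [sn_jd, ep_inc, map_smul]

theorem Db_jd_inc (m n : ℕ) (x : (diag C C').X n) : Db C C' m (jd C C' ((diag C C').inc n x)) =
    (-1 : k) ^ n • jd C C' ((diag C C').bl m ((diag C C').inc n x)) := by
  induction m with
  | zero => rw [bl_zero, Db_zero, map_zero, smul_zero]
  | succ m ih =>
    rw [Db_succ, ih, bl_succ, map_add, dD_apply, sn_jd_inc, map_smul, map_smul, map_smul, jd_dl]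
    module

theorem dgt_zr_jd (hC : C.IsCocyclic) (hC' : C'.IsCocyclic) (n : ℕ) (x : (diag C C').X n) :
    dgt C C' 0 (zr C C' 0 n (jd C C' ((diag C C').inc n x))) =
      - zr C C' 0 (n + 1) (jd C C' ((diag C C').bt ((diag C C').inc n x))) := by
  rw [dgt_zr hC hC' (jd_inc_mem n x), Db_jd_inc, ← bt_inc, map_smul, smul_smul, ← mul_pow]
  simp

theorem dgt_mt_jd (hC : C.IsCocyclic) (hC' : C'.IsCocyclic) {l r n : ℕ} (h : l + 1 + r = n)
    (x : (diag C C').X n) :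
    dgt C C' 0 (mt C C' l r (jd C C' ((diag C C').inc n x))) =
      mt C C' l (r + 1) (jd C C' ((diag C C').bt ((diag C C').inc n x) -
        (diag C C').bl (l + 1) ((diag C C').inc n x))) +
      mt C C' (l + 1) r (jd C C' ((diag C C').bl (l + 2) ((diag C C').inc n x))) := by
  subst h
  rw [dgt_mt hC hC' l r (jd_inc_mem _ x), Db_jd_inc, Db_jd_inc, Db_jd_inc, ← bt_inc]
  simp only [map_sub, map_smul, smul_add, smul_sub, smul_smul, ← mul_pow]
  simp

theorem mem_ge2_zero (z : Total2 C C') : z ∈ ge2 C C' 0 0 := by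
  induction z using TensorProduct.induction_on with
  | zero => exact zero_mem _
  | tmul x y => exact tmul_mem_subTens (mem_ge_zero x) (mem_ge_zero y)
  | add x y hx hy => exact add_mem hx hy

/-- With the mark in front, `δ₀` is undone by `σ₀` on the left and by `s` on the right, and the
unmarked product of letters remains. This is the source of `sh N` in `gam_bl`. -/
theorem mt_zero_jd (hC : C.IsCocyclic) (hC' : C'.IsCocyclic) (n : ℕ) (x : (diag C C').X n) :
    mt C C' 0 n (jd C C' ((diag C C').dl 0 ((diag C C').inc n x))) =
      zr C C' 0 n (jd C C' ((diag C C').inc n x)) := by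
  have h : ∀ r (y : Total2 C C'), zr C C' 1 r (dD C C' 0 y) =
      (-1 : k) ^ r • dD C C' 0 (zr C C' 0 r y) := by
    intro r
    induction r with
    | zero => intro y; simp [zr_zero]
    | succ r ih =>
      intro y
      rw [zr_succ, zr_succ, add_comm 1 r, zt_dD hC hC' (Nat.zero_le _), map_neg, ih, pow_succ,
        zero_add]
      module
  have h' : jd C C' ((diag C C').dl 0 ((diag C C').inc n x)) =
      dD C C' 0 ((-1 : k) ^ n • jd C C' ((diag C C').inc n x)) := by
    rw [dD_apply, jd_dl, map_smul, sn_jd_inc, smul_smul, ← mul_pow]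
    simp
  rw [h', mt_apply, zero_add, h]
  simp only [map_smul, smul_smul, ← mul_pow]
  rw [dD_apply, pow_zero, one_smul, actL_sg_dl_self hC le_rfl (mem_ge2_zero _), qt_zero,
    actR_xs_dl_zero hC', sn_sn]
  simp

variable (C C') in
/-- The cyclic shuffle operator before the extra degeneracy. -/
noncomputable def gam (N : ℕ) : (diag C C').Total →ₗ[k] Total2 C C' :=
  ∑ l ∈ Finset.range N, mt C C' l (N - 1 - l) ∘ₗ jd C C' ∘ₗ (diag C C').nl (N - l)

/-- Combining `dgt_mt` with `nl_bl`, the terms with the mark pushed from `l` to `l + 1` match those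
with the mark at `l + 1`, so the sum telescopes. -/
theorem gam_bl (hC : C.IsCocyclic) (hC' : C'.IsCocyclic) (n : ℕ) (x : (diag C C').X n) :
    gam C C' (n + 1) ((diag C C').bl (n + 1) ((diag C C').inc n x)) =
      dgt C C' 0 (gam C C' n ((diag C C').inc n x)) +
        zr C C' 0 n (jd C C' ((diag C C').nt ((diag C C').inc n x))) := by
  have hD := hC.diag hC'
  set a := (diag C C').inc n x with ha
  have h0 : ∀ m, ∃ y, (diag C C').nl m a = (diag C C').inc n y := fun m => nl_inc_mem n m x
  have h1 : dgt C C' 0 (gam C C' n a) = ∑ l ∈ Finset.range n,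
      (mt C C' l (n - l) (jd C C' ((diag C C').bt ((diag C C').nl (n - l) a) -
        (diag C C').bl (l + 1) ((diag C C').nl (n - l) a))) +
      mt C C' (l + 1) (n - (l + 1)) (jd C C' ((diag C C').bl (l + 2) ((diag C C').nl (n - l) a)))) := by
    rw [gam, LinearMap.sum_apply, map_sum]
    refine Finset.sum_congr rfl fun l hl => ?_
    rw [Finset.mem_range] at hl
    obtain ⟨y, hy⟩ := h0 (n - l)
    obtain ⟨r, rfl⟩ : ∃ r, n = l + 1 + r := ⟨n - l - 1, by omega⟩
    rw [LinearMap.comp_apply, LinearMap.comp_apply, hy,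
      show l + 1 + r - 1 - l = r by omega, show l + 1 + r - l = r + 1 by omega,
      Nat.add_sub_cancel_left, dgt_mt_jd hC hC' rfl]
  have h2 : gam C C' (n + 1) ((diag C C').bl (n + 1) a) = ∑ l ∈ Finset.range (n + 1),
      (mt C C' l (n - l) (jd C C' ((diag C C').bt ((diag C C').nl (n - l) a) -
        (diag C C').bl (l + 1) ((diag C C').nl (n - l) a))) +
      mt C C' l (n - l) (jd C C' ((diag C C').bl (l + 1) ((diag C C').nl (n + 1 - l) a)))) := by
    rw [gam, LinearMap.sum_apply]
    refine Finset.sum_congr rfl fun l hl => ?_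
    rw [Finset.mem_range] at hl
    rw [LinearMap.comp_apply, LinearMap.comp_apply, ← map_add, ← map_add,
      show n + 1 - l = n - l + 1 by omega, ha, nl_bl hD x (r := l + 1) (by omega), nl_succ,
      map_add ((diag C C').bl (l + 1)), Nat.add_sub_cancel]
    congr 2
    abel
  have h3 : (diag C C').nl (n + 1) a = (diag C C').nt a := (nt_inc n x).symm
  obtain ⟨y, hy⟩ := h0 (n + 1)
  -- After shifting the second sum by one, the unmatched terms are the one at `l = n`, zero because
  -- the partial norm is empty, and the one at `l = 0`, which is `mt_zero_jd` applied to the full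
  -- norm.
  rw [h1, h2, Finset.sum_add_distrib, Finset.sum_add_distrib, Finset.sum_range_succ _ n,
    Finset.sum_range_succ' _ n]
  simp only [Nat.sub_self, nl_zero, map_zero, sub_zero, Nat.sub_zero, zero_add, add_zero]
  rw [← h3, hy, ← mt_zero_jd hC hC', bl_succ, bl_zero, pow_zero, one_smul, zero_add,
    ← add_assoc]
  congr 2
  refine Finset.sum_congr rfl fun l _ => ?_
  rw [Nat.add_sub_add_right]

end CyclicFamily

end CocyclicData
end HopfCyc

namespace HopfCyc

/-! ### Sums over words in two letters, marked letters, and parity. -/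

section WordSums

variable {V : Type*} [AddCommMonoid V]

/-- The sum of `f` over all words of length `n` in two letters. -/
def wsum (n : ℕ) (f : List Bool → V) : V := ∑ W : Fin n → Bool, f (List.ofFn W)

theorem wsum_zero (f : List Bool → V) : wsum 0 f = f [] := by
  simp [wsum]

theorem wsum_succ (n : ℕ) (f : List Bool → V) :
    wsum (n + 1) f = wsum n (fun W => f (true :: W)) + wsum n (fun W => f (false :: W)) := by
  rw [wsum, ← (Fin.consEquiv fun _ : Fin (n + 1) => Bool).sum_comp, Fintype.sum_prod_type,
    Fintype.sum_bool]
  simp [wsum, Fin.consEquiv, List.ofFn_succ]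

theorem wsum_congr {n : ℕ} {f g : List Bool → V} (h : ∀ W, W.length = n → f W = g W) :
    wsum n f = wsum n g :=
  Finset.sum_congr rfl fun _ _ => h _ (List.length_ofFn ..)

theorem wsum_add (n : ℕ) (f g : List Bool → V) :
    wsum n (fun W => f W + g W) = wsum n f + wsum n g := Finset.sum_add_distrib

theorem wsum_comm (m n : ℕ) (f : List Bool → List Bool → V) :
    wsum m (fun A => wsum n (f A)) = wsum n (fun B => wsum m (fun A => f A B)) :=
  Finset.sum_comm

theorem wsum_sum {ι : Type*} (n : ℕ) (s : Finset ι) (f : List Bool → ι → V) :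
    wsum n (fun W => ∑ i ∈ s, f W i) = ∑ i ∈ s, wsum n (fun W => f W i) :=
  Finset.sum_comm

theorem map_wsum {V' F : Type*} [AddCommMonoid V'] [FunLike F V V'] [AddMonoidHomClass F V V']
    (φ : F) (n : ℕ) (f : List Bool → V) : φ (wsum n f) = wsum n (fun W => φ (f W)) :=
  map_sum _ _ _

theorem wsum_append (m n : ℕ) (f : List Bool → V) :
    wsum (m + n) f = wsum m (fun A => wsum n (fun B => f (A ++ B))) := by
  induction m generalizing f with
  | zero => simp [wsum_zero]
  | succ m ih => rw [Nat.add_right_comm, wsum_succ, wsum_succ, ih, ih]; rfl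

theorem wsum_one (f : List Bool → V) : wsum 1 f = f [true] + f [false] := by
  rw [wsum_succ, wsum_zero, wsum_zero]

/-- The sum over all words of length `N` with a marked letter, which is omitted. -/
def psum (N : ℕ) (G : List Bool → List Bool → V) : V :=
  ∑ l ∈ Finset.range N, wsum l (fun A => wsum (N - 1 - l) (G A))

theorem psum_succ (N : ℕ) (G : List Bool → List Bool → V) :
    psum (N + 1) G = wsum N (G []) +
      (psum N (fun A => G (true :: A)) + psum N (fun A => G (false :: A))) := by
  rw [psum, Finset.sum_range_succ', psum, psum, ← Finset.sum_add_distrib, add_comm, wsum_zero]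
  congr 1
  refine Finset.sum_congr rfl fun l _ => ?_
  rw [wsum_succ, show N + 1 - 1 - (l + 1) = N - 1 - l by omega]

theorem psum_congr {N : ℕ} {F G : List Bool → List Bool → V}
    (h : ∀ A B, A.length + 1 + B.length = N → F A B = G A B) : psum N F = psum N G := by
  refine Finset.sum_congr rfl fun l hl => wsum_congr fun A hA => wsum_congr fun B hB => h A B ?_
  rw [Finset.mem_range] at hl
  omega

theorem psum_swap (N : ℕ) (G : List Bool → List Bool → V) :
    psum N G = psum N (fun A B => G B A) := by
  rw [psum, psum, ← Finset.sum_range_reflect]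
  refine Finset.sum_congr rfl fun l hl => ?_
  rw [Finset.mem_range] at hl
  rw [wsum_comm, show N - 1 - (N - 1 - l) = l by omega]

theorem psum_sub {V : Type*} [AddCommGroup V] (N : ℕ) (F G : List Bool → List Bool → V) :
    psum N (fun A B => F A B - G A B) = psum N F - psum N G := by
  simp only [psum, wsum, Finset.sum_sub_distrib]

/-- A word together with one of its occurrences of `c` is the same as two words `A`, `B` around that
letter, and the number of the occurrence is the number of `c` in `A`. -/
theorem wsum_marked (c : Bool) (N : ℕ) (F : List Bool → ℕ → V) :
    wsum N (fun W => ∑ t ∈ Finset.range (W.count c), F W t) =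
      psum N (fun A B => F (A ++ c :: B) (A.count c)) := by
  induction N generalizing F with
  | zero => simp [wsum_zero, psum]
  | succ N ih =>
    rw [wsum_succ, psum_succ]
    rcases c with _ | _
    · have e1 := ih (fun W t => F (true :: W) t)
      have e2 := ih (fun W t => F (false :: W) (t + 1))
      simp only [List.cons_append, List.nil_append, List.count_nil, List.count_cons_self,
        List.count_cons_of_ne (show (true : Bool) ≠ false by decide), Finset.sum_range_succ',
        wsum_add] at e1 e2 ⊢
      rw [e1, e2]
      abel
    · have e1 := ih (fun W t => F (true :: W) (t + 1))
      have e2 := ih (fun W t => F (false :: W) t)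
      simp only [List.cons_append, List.nil_append, List.count_nil, List.count_cons_self,
        List.count_cons_of_ne (show (false : Bool) ≠ true by decide), Finset.sum_range_succ',
        wsum_add] at e1 e2 ⊢
      rw [e1, e2]
      abel

end WordSums

section WordStatistics

/-- The number of pairs of a letter `false` before a letter `true`. -/
def inversions : List Bool → ℕ
  | [] => 0
  | true :: W => inversions W
  | false :: W => inversions W + W.count true

theorem inversions_append (A B : List Bool) :
    inversions (A ++ B) = inversions A + inversions B + A.count false * B.count true := by
  induction A with
  | nil => simp [inversions]
  | cons c A ih =>
    rcases c with _ | _ <;> (simp [inversions, ih]; try ring)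

theorem count_true_add_count_false (W : List Bool) : W.count true + W.count false = W.length :=
  List.count_true_add_count_false W

theorem count_map_not (c : Bool) (W : List Bool) : (W.map not).count c = W.count (!c) := by
  induction W with
  | nil => rfl
  | cons a W ih => rcases a with _ | _ <;> rcases c with _ | _ <;> simp_all

/-- Reduces every comparison of signs to a polynomial identity over `ZMod 2`. -/
theorem neg_one_pow_congr {R : Type*} [Ring R] {a b : ℕ} (h : (a : ZMod 2) = b) :
    (-1 : R) ^ a = (-1 : R) ^ b := by
  rw [ZMod.natCast_eq_natCast_iff] at h
  rw [← Nat.div_add_mod a 2, ← Nat.div_add_mod b 2, h, pow_add, pow_add, pow_mul, pow_mul]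
  simp

end WordStatistics

namespace CocyclicData

/-! ### Words of codegeneracies and their rotation. -/

section WordOperators

variable {k : Type u} [Field k] (C : CocyclicData.{u, w} k)

/-- The product of the codegeneracies at the places of the letters `false`. -/
noncomputable def opAt : ℕ → List Bool → Module.End k C.Total
  | _, [] => 1
  | i, true :: W => opAt (i + 1) W
  | i, false :: W => C.sg i * opAt (i + 1) W

/-- The identity for `true` and the extra degeneracy for `false`. -/
noncomputable def xb : Bool → Module.End k C.Total
  | true => 1
  | false => C.xs

variable {C}

theorem opAt_nil (i : ℕ) (a : C.Total) : C.opAt i [] a = a := rfl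

theorem opAt_true (i : ℕ) (W : List Bool) (a : C.Total) :
    C.opAt i (true :: W) a = C.opAt (i + 1) W a := rfl

theorem opAt_false (i : ℕ) (W : List Bool) (a : C.Total) :
    C.opAt i (false :: W) a = C.sg i (C.opAt (i + 1) W a) := rfl

theorem opAt_append (i : ℕ) (A B : List Bool) (a : C.Total) :
    C.opAt i (A ++ B) a = C.opAt i A (C.opAt (i + A.length) B a) := by
  induction A generalizing i with
  | nil => rfl
  | cons c A ih =>
    rcases c with _ | _
    · rw [List.cons_append, opAt_false, opAt_false, ih, List.length_cons,
        show i + 1 + A.length = i + (A.length + 1) by omega]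
    · rw [List.cons_append, opAt_true, opAt_true, ih, List.length_cons,
        show i + 1 + A.length = i + (A.length + 1) by omega]

theorem opAt_mem_ge (i : ℕ) (W : List Bool) {m : ℕ} {a : C.Total} (ha : a ∈ C.ge (m + W.length)) :
    C.opAt i W a ∈ C.ge m := by
  induction W generalizing i m with
  | nil => exact ha
  | cons c W ih =>
    rw [List.length_cons] at ha
    rcases c with _ | _
    · rw [opAt_false]
      exact sg_mem_ge i (ih (i + 1) (by rwa [Nat.add_right_comm, add_assoc]))
    · exact ih (i + 1) (ge_mono (by omega) ha)

theorem exists_inc_eq {n m : ℕ} (h : n = m) (x : C.X n) : ∃ y, C.inc n x = C.inc m y := by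
  subst h; exact ⟨x, rfl⟩

theorem opAt_inc (i : ℕ) (W : List Bool) (m : ℕ) (x : C.X (m + W.count false)) :
    ∃ y, C.opAt i W (C.inc (m + W.count false) x) = C.inc m y := by
  induction W generalizing i m with
  | nil => exact ⟨x, rfl⟩
  | cons c W ih =>
    rcases c with _ | _
    · have h : m + List.count false (false :: W) = m + 1 + W.count false := by
        rw [List.count_cons_self]; omega
      obtain ⟨x', hx'⟩ := exists_inc_eq h x
      obtain ⟨y, hy⟩ := ih (i + 1) (m + 1) x'
      rw [opAt_false, hx', hy, sg_inc_succ]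
      split_ifs
      · exact ⟨_, rfl⟩
      · exact ⟨0, (map_zero _).symm⟩
    · have h : m + List.count false (true :: W) = m + W.count false := by simp
      obtain ⟨x', hx'⟩ := exists_inc_eq h x
      rw [opAt_true, hx']
      exact ih _ _ _

theorem opAt_inc_of_eq (i : ℕ) (W : List Bool) {m n : ℕ} (h : m + W.count false = n) (x : C.X n) :
    ∃ y, C.opAt i W (C.inc n x) = C.inc m y := by
  subst h; exact opAt_inc i W m x

theorem opAt_sg (hC : C.IsCocyclic) {i j : ℕ} (h : i ≤ j) (W : List Bool) (a : C.Total) :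
    C.opAt j W (C.sg i a) = C.sg i (C.opAt (j + 1) W a) := by
  induction W generalizing j with
  | nil => rfl
  | cons c W ih =>
    rcases c with _ | _
    · rw [opAt_false, opAt_false, ih (by omega), sg_sg hC h]
    · rw [opAt_true, opAt_true, ih (by omega)]

/-- The letters `true` number the surviving slots, so a codegeneracy applied afterwards with that
number removes the corresponding slot. -/
theorem sg_opAt (hC : C.IsCocyclic) (i : ℕ) (A B : List Bool) (a : C.Total) :
    C.sg (i + A.count true) (C.opAt i (A ++ true :: B) a) = C.opAt i (A ++ false :: B) a := by
  induction A generalizing i with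
  | nil => rfl
  | cons c A ih =>
    rcases c with _ | _
    · rw [List.cons_append, List.cons_append, opAt_false, opAt_false, ← ih,
        List.count_cons_of_ne (by decide), sg_sg hC (by omega), Nat.add_right_comm]
    · rw [List.cons_append, List.cons_append, opAt_true, opAt_true, ← ih, List.count_cons_self,
        show i + (A.count true + 1) = i + 1 + A.count true by omega]

theorem opAt_append_false (hC : C.IsCocyclic) (i : ℕ) (A B : List Bool) (a : C.Total) :
    C.opAt i (A ++ false :: B) a = C.opAt i (A ++ B) (C.sg (i + A.length) a) := by
  rw [opAt_append, opAt_append, opAt_false, opAt_sg hC le_rfl]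

theorem opAt_xs (hC : C.IsCocyclic) (i : ℕ) (W : List Bool) (a : C.Total) :
    C.opAt i W (C.xs a) = C.xs (C.opAt (i + 1) W a) := by
  induction W generalizing i with
  | nil => rfl
  | cons c W ih =>
    rcases c with _ | _
    · rw [opAt_false, opAt_false, ih, xs_sg_succ hC]
    · rw [opAt_true, opAt_true, ih]

theorem opAt_tw (hC : C.IsCocyclic) (i : ℕ) (W : List Bool) {a : C.Total}
    (ha : a ∈ C.ge (i + W.length + 1)) :
    C.opAt i W (C.tw a) = C.tw (C.opAt (i + 1) W a) := by
  induction W generalizing i with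
  | nil => rfl
  | cons c W ih =>
    rw [List.length_cons] at ha
    have ha' : a ∈ C.ge (i + 1 + W.length + 1) := ge_mono (by omega) ha
    rcases c with _ | _
    · rw [opAt_false, opAt_false, ih _ ha', tw_sg hC]
      exact opAt_mem_ge _ _ (ge_mono (by omega) ha)
    · rw [opAt_true, opAt_true, ih _ ha']

theorem xb_opAt_xs (hC : C.IsCocyclic) (c : Bool) (W : List Bool) (a : C.Total) :
    C.xb c (C.opAt 0 W (C.xs a)) = C.xs (C.opAt 0 (c :: W) a) := by
  rcases c with _ | _
  · rw [opAt_false, xs_sg_zero hC, opAt_xs hC]; rfl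
  · rw [opAt_true, opAt_xs hC]; rfl

/-- View `c` as a letter in an additional slot -1, where `false` means the extra degeneracy. A turn
shifts the cyclic word: `l` moves to slot -1 and `c` to slot 0. A surviving letter crossing the seam
costs one turn of the target. -/
theorem xb_opAt_tw (hC : C.IsCocyclic) (c l : Bool) (W : List Bool) (x : C.X (W.length + 1)) :
    C.xb c (C.opAt 0 (W ++ [l]) (C.tw (C.inc _ x))) =
      (C.tw ^ ([l].count true)) (C.xb l (C.opAt 0 (c :: W) (C.inc _ x))) := by
  rw [opAt_append, zero_add]
  rcases l with _ | _
  · rw [opAt_false, opAt_nil, sg_last_tw, xb_opAt_xs hC]; rfl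
  · rw [opAt_true, opAt_nil, opAt_tw hC _ _ (inc_mem_ge (by omega) _)]
    rcases c with _ | _
    · rw [opAt_false]
      exact xs_tw hC _
    · rfl

/-- Iterating the one-letter shift cuts the word and exchanges the two pieces; the resulting power
of `τ` counts the surviving letters that crossed the seam. -/
theorem xb_opAt_tw_pow (hC : C.IsCocyclic) (c l : Bool) (W U : List Bool) {n : ℕ} (x : C.X n)
    (hn : W.length + 1 + U.length = n) :
    C.xb c (C.opAt 0 (W ++ l :: U) ((C.tw ^ (U.length + 1)) (C.inc n x))) =
      (C.tw ^ ((l :: U).count true)) (C.xb l (C.opAt 0 (U ++ c :: W) (C.inc n x))) := by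
  induction U using List.reverseRecOn generalizing c W with
  | nil =>
    subst hn
    exact xb_opAt_tw hC c l W x
  | append_singleton U m ih =>
    rw [List.length_append, List.length_singleton] at hn
    subst hn
    have e : W ++ l :: (U ++ [m]) = (W ++ l :: U) ++ [m] := by simp
    have e' : (W ++ l :: U).length + 1 = W.length + 1 + (U.length + 1) := by
      simp only [List.length_append, List.length_cons]; omega
    have h := ih m (c :: W) (by simp only [List.length_cons]; omega)
    rw [List.length_append, List.length_singleton, pow_succ', Module.End.mul_apply, tw_pow_inc, e]
    have h2 : ∀ y : C.X (W.length + 1 + (U.length + 1)),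
        C.xb c (C.opAt 0 ((W ++ l :: U) ++ [m]) (C.tw (C.inc _ y))) =
        (C.tw ^ ([m].count true)) (C.xb m (C.opAt 0 (c :: (W ++ l :: U)) (C.inc _ y))) := by
      rw [← e']; exact xb_opAt_tw hC c m _
    rw [h2, ← tw_pow_inc, ← List.cons_append, h, ← Module.End.mul_apply, ← pow_add,
      List.append_assoc, ← List.cons_append, List.count_append, add_comm]
    rfl

theorem xb_opAt_tw_pow_xs (hC : C.IsCocyclic) (c : Bool) (W U : List Bool) {n : ℕ} (x : C.X n)
    (hn : W.length + U.length + 1 = n) :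
    C.xb c (C.opAt 0 (W ++ U) ((C.tw ^ U.length) (C.xs (C.inc n x)))) =
      (C.tw ^ (U.count true)) (C.xs (C.opAt 0 (U ++ c :: W) (C.inc n x))) := by
  rcases U with _ | ⟨l, U⟩
  · rw [List.append_nil]
    exact xb_opAt_xs hC c W (C.inc n x)
  · rw [List.length_cons] at hn
    obtain ⟨m, rfl⟩ : ∃ m, n = m + 1 := ⟨n - 1, by omega⟩
    rw [xs_inc_succ, List.length_cons, xb_opAt_tw_pow hC c l W U _ (by omega), ← xs_inc_succ,
      xb_opAt_xs hC, List.cons_append]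

end WordOperators

end CocyclicData
end HopfCyc

namespace HopfCyc
namespace CocyclicData

/-! ### Expansion of the letter products over words, with signs, and the value of Γ on `1 - λ`. -/

section TensorWords

variable {k : Type u} [Field k] {C C' : CocyclicData.{u, w} k}

variable (C C') in
/-- The product of the letters `ε (1 ⊗ σ)` for `true` and `σ ⊗ 1` for `false`. -/
noncomputable def zw : ℕ → List Bool → Module.End k (Total2 C C')
  | _, [] => 1
  | i, true :: W => sn C C' * actR (C'.sg i) * zw (i + 1) W
  | i, false :: W => actL (C.sg i) * zw (i + 1) W

variable (C C') in
/-- The pair of iterated codegeneracies given by a word and its complement. -/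
noncomputable def sw (i : ℕ) (W : List Bool) : Module.End k (Total2 C C') :=
  actL (C.opAt i W) * actR (C'.opAt i (W.map not))

variable (C C') in
/-- The tensors of bidegree `(p, q)`. -/
noncomputable abbrev bideg (p q : ℕ) : Submodule k (Total2 C C') :=
  subTens (LinearMap.range (C.inc p)) (LinearMap.range (C'.inc q))

theorem zw_true (i : ℕ) (W : List Bool) (z : Total2 C C') :
    zw C C' i (true :: W) z = sn C C' (actR (C'.sg i) (zw C C' (i + 1) W z)) := rfl

theorem zw_false (i : ℕ) (W : List Bool) (z : Total2 C C') :
    zw C C' i (false :: W) z = actL (C.sg i) (zw C C' (i + 1) W z) := rfl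

theorem sw_apply (i : ℕ) (W : List Bool) (z : Total2 C C') :
    sw C C' i W z = actL (C.opAt i W) (actR (C'.opAt i (W.map not)) z) := rfl

theorem actL_actR (f : Module.End k C.Total) (g : Module.End k C'.Total) (z : Total2 C C') :
    actL f (actR g z) = TensorProduct.map f g z := by
  rw [actL, actR, ← LinearMap.comp_apply, ← TensorProduct.map_comp]; rfl

theorem zw_append (i : ℕ) (A B : List Bool) (z : Total2 C C') :
    zw C C' i (A ++ B) z = zw C C' i A (zw C C' (i + A.length) B z) := by
  induction A generalizing i with
  | nil => rfl
  | cons c A ih =>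
    rcases c with _ | _ <;> simp only [List.cons_append, zw_true, zw_false, ih, List.length_cons] <;>
      rw [show i + 1 + A.length = i + (A.length + 1) by omega]

theorem sn_of_mem {n : ℕ} {Q : Submodule k C'.Total} {z : Total2 C C'}
    (hz : z ∈ subTens (LinearMap.range (C.inc n)) Q) : sn C C' z = (-1 : k) ^ n • z := by
  rw [sn, actL_congr (f' := (-1 : k) ^ n • 1) (by rintro _ ⟨x, rfl⟩; exact ep_inc n x) hz,
    actL_smul, actL_one]

theorem actL_opAt_mem (i : ℕ) (W : List Bool) {m n : ℕ} (h : m + W.count false = n)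
    {Q : Submodule k C'.Total} {z : Total2 C C'}
    (hz : z ∈ subTens (LinearMap.range (C.inc n)) Q) :
    actL (C.opAt i W) z ∈ subTens (LinearMap.range (C.inc m)) Q :=
  actL_mem (by rintro _ ⟨x, rfl⟩; obtain ⟨y, hy⟩ := opAt_inc_of_eq i W h x; exact ⟨y, hy.symm⟩) hz

theorem actR_opAt_mem (i : ℕ) (W : List Bool) {m n : ℕ} (h : m + W.count false = n)
    {P : Submodule k C.Total} {z : Total2 C C'}
    (hz : z ∈ subTens P (LinearMap.range (C'.inc n))) :
    actR (C'.opAt i W) z ∈ subTens P (LinearMap.range (C'.inc m)) :=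
  actR_mem (by rintro _ ⟨x, rfl⟩; obtain ⟨y, hy⟩ := opAt_inc_of_eq i W h x; exact ⟨y, hy.symm⟩) hz

theorem sw_mem {n : ℕ} {W : List Bool} (hW : W.length = n) {z : Total2 C C'}
    (hz : z ∈ deg2 C C' n) : sw C C' 0 W z ∈ bideg C C' (W.count true) (W.count false) := by
  have h := count_true_add_count_false W
  refine actL_opAt_mem 0 W (by omega) (actR_opAt_mem 0 _ ?_ hz)
  rw [count_map_not]
  simpa [add_comm] using h.trans hW

/-- Each letter `true` carries ε, whose value depends on the letters `false` acting to its right and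
on the degree `n`; the parity formula collects these contributions. -/
theorem zw_eq (i : ℕ) (W : List Bool) {n : ℕ} (hn : W.count false ≤ n) {z : Total2 C C'}
    (hz : z ∈ deg2 C C' n) : zw C C' i W z =
      (-1 : k) ^ (n * W.count true + W.count true * W.count false + inversions W) •
        sw C C' i W z := by
  induction W generalizing i with
  | nil => simp [zw, sw, opAt, inversions, actL_one, actR_one]
  | cons c W ih =>
    rcases c with _ | _
    · rw [List.count_cons_self] at hn
      rw [zw_false, ih (i + 1) (by omega), map_smul, sw_apply, sw_apply, ← actL_mul]
      refine congrArg₂ _ (neg_one_pow_congr ?_) rfl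
      simp only [List.count_cons_self, List.count_cons_of_ne (show (false : Bool) ≠ true by decide),
        inversions]
      push_cast
      generalize (n : ZMod 2) = x1, (W.count true : ZMod 2) = x2, (W.count false : ZMod 2) = x3
      linear_combination -x2 * (by decide : (2 : ZMod 2) = 0)
    · rw [List.count_cons_of_ne (by decide)] at hn
      obtain ⟨m, rfl⟩ := Nat.exists_eq_add_of_le' hn
      have hm : actL (C.opAt (i + 1) W) (actR (C'.opAt i (List.map not (true :: W))) z) ∈
          subTens (LinearMap.range (C.inc m)) ⊤ :=
        actL_opAt_mem _ _ rfl (actR_mem (Q' := ⊤) (fun _ _ => Submodule.mem_top) hz)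
      rw [zw_true, ih (i + 1) hn, map_smul, map_smul, sw_apply, actR_actL, ← actR_mul]
      refine (congrArg _ (sn_of_mem hm)).trans ?_
      rw [smul_smul, ← pow_add]
      refine congrArg₂ _ (neg_one_pow_congr ?_) rfl
      simp only [List.count_cons_self, List.count_cons_of_ne (show (true : Bool) ≠ false by decide),
        inversions]
      push_cast
      generalize (m : ZMod 2) = x1, (W.count true : ZMod 2) = x2, (W.count false : ZMod 2) = x3
      linear_combination -x3 * (by decide : (2 : ZMod 2) = 0)

/-- For a full word everything except the left degree and the inversions cancels modulo 2. A further
ε therefore leaves the sign of the shuffle. -/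
theorem zw_eq_of_length {n : ℕ} {W : List Bool} (hW : W.length = n) {z : Total2 C C'}
    (hz : z ∈ deg2 C C' n) :
    zw C C' 0 W z = (-1 : k) ^ (W.count true + inversions W) • sw C C' 0 W z := by
  have h := count_true_add_count_false W
  rw [zw_eq 0 W (by omega) hz]
  refine congrArg₂ _ (neg_one_pow_congr ?_) rfl
  rw [← hW, ← h]
  push_cast
  generalize (W.count true : ZMod 2) = x2, (W.count false : ZMod 2) = x3,
    (inversions W : ZMod 2) = x4
  revert x2 x3 x4
  decide

theorem zr_succ' (l r : ℕ) (z : Total2 C C') :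
    zr C C' l (r + 1) z = zt C C' l (zr C C' (l + 1) r z) := by
  induction r generalizing z with
  | zero => rfl
  | succ r ih => rw [zr_succ, ih, zr_succ, show l + (r + 1) = l + 1 + r by omega]

theorem zr_eq (l r : ℕ) (z : Total2 C C') : zr C C' l r z = wsum r (fun W => zw C C' l W z) := by
  induction r generalizing l with
  | zero => rw [wsum_zero]; rfl
  | succ r ih =>
    rw [zr_succ', ih, wsum_succ, zt_apply, map_wsum, map_wsum, map_wsum, add_comm]
    rfl

/-- Only the letters `false` carry a factor `λ` in the recursion, so the exponent is their number in
front of the mark. -/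
theorem qt_eq (l : ℕ) (z : Total2 C C') : qt C C' l z =
    wsum l (fun A => actR (C'.cy ^ A.count false) (qt C C' 0 (zw C C' 0 A z))) := by
  induction l generalizing z with
  | zero => rw [wsum_zero]; exact (actR_one _).symm
  | succ l ih =>
    rw [qt_succ, ih, ih, wsum_append l 1, map_wsum, ← wsum_add]
    refine wsum_congr fun A hA => ?_
    rw [wsum_one, zw_append, zw_append, List.count_append, List.count_append, zero_add, hA,
      ← actR_mul, ← pow_succ', add_comm]
    rfl

theorem mt_eq (l r : ℕ) (z : Total2 C C') : mt C C' l r z =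
    wsum l (fun A => wsum r (fun B =>
      actR (C'.cy ^ A.count false) (qt C C' 0 (zw C C' 0 (A ++ false :: B) z)))) := by
  rw [mt_apply, qt_eq]
  refine wsum_congr fun A hA => ?_
  rw [zr_eq]
  simp only [map_wsum]
  refine wsum_congr fun B _ => ?_
  rw [zw_append, zero_add, hA, zw_false]

theorem gam_eq (N : ℕ) (a : (diag C C').Total) : gam C C' N a = psum N (fun A B =>
    actR (C'.cy ^ A.count false) (qt C C' 0 (zw C C' 0 (A ++ false :: B)
      (jd C C' ((diag C C').nl (B.length + 1) a))))) := by
  rw [gam, LinearMap.sum_apply, psum]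
  refine Finset.sum_congr rfl fun l hl => ?_
  rw [Finset.mem_range] at hl
  rw [LinearMap.comp_apply, LinearMap.comp_apply, mt_eq]
  refine wsum_congr fun A hA => wsum_congr fun B hB => ?_
  rw [hB, show N - 1 - l + 1 = N - l by omega]

theorem cy_pow_eq (m t : ℕ) {a : C.Total} (ha : a ∈ LinearMap.range (C.inc m)) :
    (C.cy ^ t) a = (-1 : k) ^ (m * t) • (C.tw ^ t) a := by
  obtain ⟨x, rfl⟩ := ha
  rw [cy_pow_inc, smul_pow, ← pow_mul, LinearMap.smul_apply, map_smul, tw_pow_inc]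

theorem xs_mem_range {m : ℕ} {a : C.Total} (ha : a ∈ LinearMap.range (C.inc (m + 1))) :
    C.xs a ∈ LinearMap.range (C.inc m) := by
  obtain ⟨x, rfl⟩ := ha
  exact ⟨_, (xs_inc_succ m x).symm⟩

/-- Normal form with the sign separated from unsigned operators; together with `cy_xs_zw` it lets
the rotation of a word be compared factor by factor. -/
theorem cy_qt_zw (W : List Bool) {q t n : ℕ} (hW : W.length = n) (hq : W.count false = q + 1)
    {z : Total2 C C'} (hz : z ∈ deg2 C C' n) :
    actR (C'.cy ^ t) (qt C C' 0 (zw C C' 0 W z)) = (-1 : k) ^ (q * t + inversions W) •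
      actL (C.opAt 0 W) (actR (C'.tw ^ t * C'.xs * C'.opAt 0 (W.map not)) z) := by
  have h1 := sw_mem hW hz
  rw [hq] at h1
  have h2 : actR C'.xs (sw C C' 0 W z) ∈ bideg C C' (W.count true) q :=
    actR_mem (fun _ => xs_mem_range) h1
  rw [zw_eq_of_length hW hz, qt_zero, map_smul, map_smul, sn_of_mem h2, map_smul, map_smul,
    actR_congr (f' := (-1 : k) ^ (q * t) • C'.tw ^ t) (fun a ha => cy_pow_eq q t ha) h2, actR_smul,
    actR_mul, actR_mul, smul_smul, smul_smul, ← pow_add, ← pow_add, ← actR_actL, ← actR_actL]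
  refine congrArg₂ _ (neg_one_pow_congr ?_) rfl
  push_cast
  linear_combination (W.count true : ZMod 2) * (by decide : (2 : ZMod 2) = 0)

theorem cy_xs_zw (W : List Bool) {p t n : ℕ} (hW : W.length = n) (hp : W.count true = p + 1)
    {z : Total2 C C'} (hz : z ∈ deg2 C C' n) :
    actL (C.cy ^ t) (actL C.xs (zw C C' 0 W z)) = (-1 : k) ^ (p * t + (p + 1) + inversions W) •
      actL (C.tw ^ t * C.xs * C.opAt 0 W) (actR (C'.opAt 0 (W.map not)) z) := by
  have h1 := sw_mem hW hz
  rw [hp] at h1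
  have h2 : actL C.xs (sw C C' 0 W z) ∈ bideg C C' p (W.count false) :=
    actL_mem (fun _ => xs_mem_range) h1
  rw [zw_eq_of_length hW hz, map_smul, map_smul,
    actL_congr (f' := (-1 : k) ^ (p * t) • C.tw ^ t) (fun a ha => cy_pow_eq p t ha) h2, actL_smul,
    actL_mul, actL_mul, smul_smul, ← pow_add, hp]
  refine congrArg₂ _ (neg_one_pow_congr ?_) rfl
  push_cast
  ring

theorem jd_tw_pow (r : ℕ) (a : (diag C C').Total) :
    jd C C' (((diag C C').tw ^ r) a) = actL (C.tw ^ r) (actR (C'.tw ^ r) (jd C C' a)) := by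
  induction r with
  | zero => exact ((actL_one _).trans (actR_one _)).symm
  | succ r ih =>
    rw [pow_succ', Module.End.mul_apply, jd_tw, ih, pow_succ', pow_succ', actL_mul, actR_mul,
      actR_actL]

theorem jd_xs (a : (diag C C').Total) :
    jd C C' ((diag C C').xs a) = actL C.xs (actR C'.xs (jd C C' a)) := by
  refine jd_ext (f := jd C C' ∘ₗ (diag C C').xs)
    (g := actL C.xs ∘ₗ actR C'.xs ∘ₗ jd C C') (fun n x y => ?_) a
  simp only [LinearMap.comp_apply]
  rw [jd_inc, TensorProduct.map_tmul, actR_tmul, actL_tmul]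
  rcases n with _ | n
  · rw [xs_inc_zero, xs_inc_zero]; simp
  · rw [xs_inc_succ, xs_inc_succ, xs_inc_succ, jd_inc]; rfl

/-- The rotation of a marked word. -/
theorem cy_qt_zw_rotate (hC : C.IsCocyclic) (hC' : C'.IsCocyclic) (A B : List Bool) {N : ℕ}
    (hN : A.length + 1 + B.length = N) (x : (diag C C').X N) :
    actR (C'.cy ^ A.count false) (qt C C' 0 (zw C C' 0 (A ++ false :: B)
      (jd C C' (((diag C C').cy ^ (B.length + 1)) ((diag C C').inc N x))))) =
    actL (C.cy ^ B.count true) (actL C.xs (zw C C' 0 (B ++ true :: A)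
      (jd C C' ((diag C C').inc N x)))) := by
  have hz := jd_inc_mem (C := C) (C' := C') N x
  have hA := count_true_add_count_false A
  have hB := count_true_add_count_false B
  have hz' : jd C C' (((diag C C').tw ^ (B.length + 1)) ((diag C C').inc N x)) ∈ deg2 C C' N := by
    rw [tw_pow_inc]; exact jd_inc_mem _ _
  rw [cy_pow_eq N _ ⟨x, rfl⟩, map_smul, map_smul, map_smul, map_smul,
    cy_qt_zw (q := A.count false + B.count false) _ (by simp; omega) (by simp; omega) hz',
    cy_xs_zw (p := B.count true + A.count true) _ (by simp; omega) (by simp; omega) hz,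
    jd_tw_pow, actR_actL, ← actR_mul, ← actL_mul, smul_smul, ← pow_add, actL_actR, actL_actR]
  refine congrArg₂ _ (neg_one_pow_congr ?_) ?_
  · simp only [inversions_append, inversions, List.count_cons_self,
      List.count_cons_of_ne (show (false : Bool) ≠ true by decide),
      ← hN, ← hA, ← hB]
    push_cast
    generalize (A.count true : ZMod 2) = x1, (A.count false : ZMod 2) = x2,
      (B.count true : ZMod 2) = x3, (B.count false : ZMod 2) = x4,
      (inversions A : ZMod 2) = x5, (inversions B : ZMod 2) = x6
    revert x1 x2 x3 x4 x5 x6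
    decide
  · refine map_congr_subTens ?_ ?_ hz
    · rintro _ ⟨y, rfl⟩
      have := xb_opAt_tw_pow hC true false A B y (by omega)
      rw [List.count_cons_of_ne (by decide)] at this
      exact this
    · rintro _ ⟨y, rfl⟩
      have := xb_opAt_tw_pow hC' false true (A.map not) (B.map not) y (by simpa using hN)
      simp only [List.length_map] at this
      simp only [Module.End.mul_apply, List.map_append, List.map_cons, Bool.not_false,
        Bool.not_true]
      refine (congrArg _ this).trans ?_
      obtain ⟨y', hy'⟩ := opAt_inc_of_eq (C := C') 0 (B.map not ++ false :: A.map not)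
        (m := A.count false + B.count false) (n := N) (by
          rw [List.count_append, List.count_cons_self, count_map_not, count_map_not]
          simp only [Bool.not_false]
          omega) y
      rw [List.count_cons_self, count_map_not, ← Module.End.mul_apply, ← pow_add]
      refine (congrArg _ hy').trans ?_
      simp only [Bool.not_true]
      -- On the right factor the exponents add up to one more than the degree, so the turn closes
      -- and only the codegeneracies remain.
      rw [← add_assoc, tw_pow_self hC', hy']

theorem actR_nl (m : ℕ) (z : Total2 C C') :
    actR (C'.nl m) z = ∑ t ∈ Finset.range m, actR (C'.cy ^ t) z := by
  induction m with
  | zero => simp [nl, actR]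
  | succ m ih => rw [Finset.sum_range_succ, ← ih, ← actR_add, nl, Finset.sum_range_succ]; rfl

theorem actL_nl (m : ℕ) (z : Total2 C C') :
    actL (C.nl m) z = ∑ t ∈ Finset.range m, actL (C.cy ^ t) z := by
  induction m with
  | zero => simp [nl, actL]
  | succ m ih => rw [Finset.sum_range_succ, ← ih, ← actL_add, nl, Finset.sum_range_succ]; rfl

theorem nt_xs_of_mem {m : ℕ} {a : C.Total} (ha : a ∈ LinearMap.range (C.inc m)) :
    C.nt (C.xs a) = C.nl m (C.xs a) := by
  obtain ⟨x, rfl⟩ := ha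
  rcases m with _ | m
  · rw [xs_inc_zero, map_zero, map_zero]
  · rw [xs_inc_succ, nt_inc]

theorem zw_mem {n : ℕ} {W : List Bool} (hW : W.length = n) {z : Total2 C C'}
    (hz : z ∈ deg2 C C' n) : zw C C' 0 W z ∈ bideg C C' (W.count true) (W.count false) := by
  rw [zw_eq_of_length hW hz]
  exact Submodule.smul_mem _ _ (sw_mem hW hz)

/-- The partial norm of `(1 - λ)a` is `a - λᵐ a`. The terms from `a`, summed over marked letters
`false`, make up `N s` on the right factor; in those from `λᵐ a` the rotation changes the mark to
`true` and moves it to the left factor. -/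
theorem gam_sub_cy (hC : C.IsCocyclic) (hC' : C'.IsCocyclic) (N : ℕ) (x : (diag C C').X N) :
    gam C C' N ((diag C C').inc N x - (diag C C').cy ((diag C C').inc N x)) =
      sn C C' (actR C'.nt (actR C'.xs (zr C C' 0 N (jd C C' ((diag C C').inc N x))))) -
        actL C.nt (actL C.xs (zr C C' 0 N (jd C C' ((diag C C').inc N x)))) := by
  have hz := jd_inc_mem (C := C) (C' := C') N x
  set a := (diag C C').inc N x with ha
  have h1 : ∀ m, (diag C C').nl m (a - (diag C C').cy a) = a - ((diag C C').cy ^ m) a := by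
    intro m
    have h := (nl_succ m a).symm.trans (nl_succ' m a)
    rw [map_sub, nl_cy, sub_eq_sub_iff_add_eq_add, h, add_comm]
  have h2 : sn C C' (actR C'.nt (actR C'.xs (zr C C' 0 N (jd C C' a)))) =
      psum N (fun A B => actR (C'.cy ^ A.count false)
        (qt C C' 0 (zw C C' 0 (A ++ false :: B) (jd C C' a)))) := by
    rw [← wsum_marked false N (fun W t => actR (C'.cy ^ t) (qt C C' 0 (zw C C' 0 W (jd C C' a)))),
      zr_eq]
    simp only [map_wsum]
    refine wsum_congr fun W hW => ?_
    rw [← actR_nl, qt_zero, actR_sn, ← actR_mul, ← actR_mul]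
    exact congrArg _ (actR_congr (fun b hb => nt_xs_of_mem hb) (zw_mem hW hz))
  have h3 : actL C.nt (actL C.xs (zr C C' 0 N (jd C C' a))) =
      psum N (fun A B => actL (C.cy ^ A.count true)
        (actL C.xs (zw C C' 0 (A ++ true :: B) (jd C C' a)))) := by
    rw [← wsum_marked true N (fun W t => actL (C.cy ^ t) (actL C.xs (zw C C' 0 W (jd C C' a)))),
      zr_eq]
    simp only [map_wsum]
    refine wsum_congr fun W hW => ?_
    rw [← actL_nl, ← actL_mul, ← actL_mul]
    exact actL_congr (fun b hb => nt_xs_of_mem hb) (zw_mem hW hz)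
  rw [gam_eq, h2, h3, psum_swap N (fun A B => actL _ _), ← psum_sub]
  refine psum_congr fun A B h => ?_
  rw [h1, map_sub, map_sub, map_sub, map_sub, ha, cy_qt_zw_rotate hC hC' A B h]

end TensorWords

end CocyclicData
end HopfCyc

namespace HopfCyc

/-- The number of letters `false` before the `p`-th letter `true`. -/
def falseBefore : List Bool → ℕ → ℕ
  | [], _ => 0
  | true :: _, 0 => 0
  | true :: W, p + 1 => falseBefore W p
  | false :: W, p => falseBefore W p + 1

theorem falseBefore_marked (A B : List Bool) :
    falseBefore (A ++ true :: B) (A.count true) = A.count false := by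
  induction A with
  | nil => rfl
  | cons c A ih => rcases c with _ | _ <;> simp [falseBefore, ih]

namespace CocyclicData

/-! ### Cyclic shuffles as doubly marked words. -/

section CyclicShuffleWords

variable {k : Type u} [Field k] {C C' : CocyclicData.{u, w} k}

variable (C C') in
/-- The summand of the cyclic shuffle map given by a word and two rotations. -/
noncomputable def csw (W : List Bool) (p q : ℕ) : Module.End k (Total2 C C') :=
  (-1 : k) ^ ((W.count true - 1) + (p * (W.count true - 1) + q * (W.count false - 1)) +
    inversions W) •
  (actL (C.tw ^ p * C.xs * C.opAt 0 W) * actR (C'.tw ^ q * C'.xs * C'.opAt 0 (W.map not)))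

theorem csw_apply (W : List Bool) (p q : ℕ) (z : Total2 C C') : csw C C' W p q z =
    (-1 : k) ^ ((W.count true - 1) + (p * (W.count true - 1) + q * (W.count false - 1)) +
      inversions W) • actL (C.tw ^ p * C.xs * C.opAt 0 W)
        (actR (C'.tw ^ q * C'.xs * C'.opAt 0 (W.map not)) z) := rfl

/-- The rotation of a doubly marked word. -/
theorem cy_qt_zw_xs (hC : C.IsCocyclic) (hC' : C'.IsCocyclic) (A B D : List Bool) {N : ℕ}
    (hN : A.length + B.length + D.length + 1 = N) (x : (diag C C').X (N + 1)) :
    sn C C' (actR (C'.cy ^ A.count false) (qt C C' 0 (zw C C' 0 (A ++ false :: (B ++ D))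
      (jd C C' (((diag C C').cy ^ D.length)
        ((diag C C').xs ((diag C C').inc (N + 1) x))))))) =
    csw C C' (D ++ true :: (A ++ false :: B)) (D.count true) (D.count false + A.count false)
      (jd C C' ((diag C C').inc (N + 1) x)) := by
  have hz := jd_inc_mem (C := C) (C' := C') (N + 1) x
  have hA := count_true_add_count_false A
  have hB := count_true_add_count_false B
  have hD := count_true_add_count_false D
  obtain ⟨y, hy⟩ : (diag C C').xs ((diag C C').inc (N + 1) x) ∈
    LinearMap.range ((diag C C').inc N) := xs_mem_range ⟨x, rfl⟩
  have hz' : jd C C' (((diag C C').tw ^ D.length) ((diag C C').inc N y)) ∈ deg2 C C' N := by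
    rw [tw_pow_inc]; exact jd_inc_mem _ _
  have hm : ∀ z ∈ deg2 C C' N, actR (C'.tw ^ A.count false * C'.xs *
      C'.opAt 0 ((A ++ false :: (B ++ D)).map not)) z ∈
        subTens (LinearMap.range (C.inc N)) ⊤ :=
    fun z hz => actR_mem (Q' := ⊤) (fun _ _ => Submodule.mem_top) hz
  rw [← hy, cy_pow_eq N _ ⟨y, rfl⟩, map_smul, map_smul, map_smul, map_smul, map_smul,
    cy_qt_zw (q := A.count false + B.count false + D.count false) _ (by simp; omega)
      (by simp; omega) hz', map_smul,
    sn_of_mem (actL_opAt_mem (m := A.count true + B.count true + D.count true) _ _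
      (by simp; omega) (hm _ hz')), hy,
    jd_tw_pow, jd_xs, actR_actL, ← actL_mul, ← actR_mul, smul_smul, smul_smul, ← pow_add,
    ← pow_add, csw_apply, actR_actL, ← actR_mul, ← actL_mul, actL_actR, actL_actR]
  refine congrArg₂ _ (neg_one_pow_congr ?_) ?_
  · simp only [inversions_append, inversions, List.count_cons_self, List.count_append,
      List.count_cons_of_ne (show (false : Bool) ≠ true by decide),
      List.count_cons_of_ne (show (true : Bool) ≠ false by decide), ← hN, ← hA, ← hB, ← hD]
    rw [show D.count true + (A.count true + B.count true + 1) - 1 =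
      A.count true + B.count true + D.count true by omega,
      show D.count false + (A.count false + (B.count false + 1)) - 1 =
      A.count false + B.count false + D.count false by omega]
    push_cast
    have h2 : (2 : ZMod 2) = 0 := by decide
    generalize (A.count true : ZMod 2) = x1, (A.count false : ZMod 2) = x2,
      (B.count true : ZMod 2) = x3, (B.count false : ZMod 2) = x4,
      (D.count true : ZMod 2) = x5, (D.count false : ZMod 2) = x6,
      (inversions A : ZMod 2) = y1, (inversions B : ZMod 2) = y2, (inversions D : ZMod 2) = y3
    -- The inversions within each block occur equally on both sides; what remains is a parity
    -- identity in the letter counts of the three blocks.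
    have h : ∀ x1 x2 x3 x4 x5 x6 : ZMod 2,
      (x1 + x2 + (x3 + x4) + (x5 + x6) + 1) * (x5 + x6) + ((x2 + x4 + x6) * x2 +
        ((x3 + x5) + x4 * x5 + x2 * (x3 + x5))) + (x1 + x3 + x5) =
      (x1 + x3 + x5) + (x5 * (x1 + x3 + x5) + (x6 + x2) * (x2 + x4 + x6)) +
        (x3 + x2 * x3 + x6 * (x1 + x3 + 1)) := by decide
    linear_combination h x1 x2 x3 x4 x5 x6
  · refine map_congr_subTens ?_ ?_ hz
    · rintro _ ⟨y, rfl⟩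
      have := xb_opAt_tw_pow_xs hC true (A ++ false :: B) D y
        (by simp only [List.length_append, List.length_cons]; omega)
      rw [List.append_assoc, List.cons_append] at this
      exact this
    · rintro _ ⟨y, rfl⟩
      have := xb_opAt_tw_pow_xs hC' false ((A ++ false :: B).map not) (D.map not) y
        (by simp only [List.length_map, List.length_append, List.length_cons]; omega)
      rw [← List.map_append, List.append_assoc, List.cons_append, List.length_map] at this
      refine (congrArg (C'.tw ^ A.count false) this).trans ?_
      rw [count_map_not, ← Module.End.mul_apply, ← pow_add, add_comm]
      simp only [List.map_append, List.map_cons]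
      rfl

variable (C C') in
/-- The cyclic shuffle operator on tensors of bidegree `(N, N)`. -/
noncomputable def csh (N : ℕ) (z : Total2 C C') : Total2 C C' :=
  wsum N (fun W => ∑ p ∈ Finset.range (W.count true), ∑ q ∈ Finset.range (W.count false),
    if falseBefore W p ≤ q then csw C C' W p q z else 0)

theorem sum_range_if_le {V : Type*} [AddCommMonoid V] (a b : ℕ) (f : ℕ → V) :
    ∑ q ∈ Finset.range (a + b), (if a ≤ q then f q else 0) = ∑ q ∈ Finset.range b, f (a + q) := by
  rw [Finset.sum_range_add, Finset.sum_eq_zero, zero_add]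
  · exact Finset.sum_congr rfl fun q _ => if_pos (Nat.le_add_right _ _)
  · intro q hq
    exact if_neg (by rw [Finset.mem_range] at hq; omega)

/-- The condition says that the marked `false` stands behind the marked `true`, so the word splits
as `D`, `true`, `A`, `false`, `B` without further constraint. -/
theorem csh_eq (N : ℕ) (z : Total2 C C') : csh C C' N z =
    ∑ r ∈ Finset.range N, wsum r (fun D => ∑ l ∈ Finset.range (N - 1 - r), wsum l (fun A =>
      wsum (N - 1 - r - 1 - l) (fun B => csw C C' (D ++ true :: (A ++ false :: B)) (D.count true)
        (D.count false + A.count false) z))) := by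
  rw [csh, wsum_marked true N (fun W p => ∑ q ∈ Finset.range (W.count false),
    if falseBefore W p ≤ q then csw C C' W p q z else 0), psum]
  refine Finset.sum_congr rfl fun r _ => wsum_congr fun D _ => ?_
  refine Eq.trans ?_ (wsum_marked false (N - 1 - r)
    (fun V q => csw C C' (D ++ true :: V) (D.count true) (D.count false + q) z))
  refine wsum_congr fun V _ => ?_
  rw [falseBefore_marked, List.count_append, List.count_cons_of_ne (by decide), sum_range_if_le]

/-- Γ marks one letter `false`; each power of `λ` in its partial norm cuts off a terminal piece `D`.
Rotating `D` to the front inserts a marked `true` at the cut, which yields every doubly marked word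
exactly once. -/
theorem sn_gam_xs (hC : C.IsCocyclic) (hC' : C'.IsCocyclic) (N : ℕ) (x : (diag C C').X N) :
    sn C C' (gam C C' (N - 1) ((diag C C').xs ((diag C C').inc N x))) =
      csh C C' N (jd C C' ((diag C C').inc N x)) := by
  -- For fewer than two letters there is no doubly marked word and Γ is an empty sum.
  rcases N with _ | _ | M
  · simp [csh_eq, gam]
  · simp [csh_eq, gam, wsum_zero]
  set a := (diag C C').inc (M + 1 + 1) x with ha
  have h1 : ∀ l ∈ Finset.range (M + 1), ∀ A : List Bool, A.length = l →
      wsum (M - l) (fun U => sn C C' (actR (C'.cy ^ A.count false)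
        (qt C C' 0 (zw C C' 0 (A ++ false :: U)
          (jd C C' ((diag C C').nl (U.length + 1) ((diag C C').xs a))))))) =
      ∑ r ∈ Finset.range (M - l + 1), wsum r (fun D => wsum (M - l - r) (fun B =>
        csw C C' (D ++ true :: (A ++ false :: B)) (D.count true) (D.count false + A.count false)
          (jd C C' a))) := by
    intro l hl A hA
    rw [Finset.mem_range] at hl
    have h2 : wsum (M - l) (fun U => sn C C' (actR (C'.cy ^ A.count false)
        (qt C C' 0 (zw C C' 0 (A ++ false :: U)
          (jd C C' ((diag C C').nl (U.length + 1) ((diag C C').xs a))))))) =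
        wsum (M - l) (fun U => ∑ r ∈ Finset.range (M - l + 1),
          sn C C' (actR (C'.cy ^ A.count false) (qt C C' 0 (zw C C' 0 (A ++ false :: U)
            (jd C C' (((diag C C').cy ^ r) ((diag C C').xs a))))))) := by
      refine wsum_congr fun U hU => ?_
      rw [hU, nl, LinearMap.sum_apply]
      simp only [map_sum]
    rw [h2, wsum_sum]
    refine Finset.sum_congr rfl fun r hr => ?_
    rw [Finset.mem_range] at hr
    have h3 := wsum_append (M - l - r) r (fun U => sn C C' (actR (C'.cy ^ A.count false)
      (qt C C' 0 (zw C C' 0 (A ++ false :: U)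
        (jd C C' (((diag C C').cy ^ r) ((diag C C').xs a)))))))
    rw [Nat.sub_add_cancel (by omega)] at h3
    rw [h3, wsum_comm]
    refine wsum_congr fun D hD => wsum_congr fun B hB => ?_
    rw [← cy_qt_zw_xs hC hC' A B D (by omega) x, hD]
  rw [csh_eq, gam_eq, psum, map_sum, Finset.sum_range_succ _ (M + 1)]
  simp only [map_wsum, Nat.add_sub_cancel, Nat.sub_self, Finset.range_zero, Finset.sum_empty]
  have h4 : (wsum (M + 1) fun _ => 0 : Total2 C C') = 0 := Finset.sum_const_zero
  rw [h4, add_zero]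
  have h5 : ∀ l ∈ Finset.range (M + 1), (wsum l fun A => wsum (M - l) (fun U =>
      sn C C' (actR (C'.cy ^ A.count false) (qt C C' 0 (zw C C' 0 (A ++ false :: U)
        (jd C C' ((diag C C').nl (U.length + 1) ((diag C C').xs a)))))))) =
      ∑ r ∈ Finset.range (M - l + 1), wsum l (fun A => wsum r (fun D => wsum (M - l - r) (fun B =>
        csw C C' (D ++ true :: (A ++ false :: B)) (D.count true) (D.count false + A.count false)
          (jd C C' a)))) := fun l hl =>
    (wsum_congr fun A hA => h1 l hl A hA).trans (wsum_sum _ _ _)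
  refine (Finset.sum_congr rfl h5).trans ?_
  simp only [wsum_sum]
  refine (Finset.sum_comm' (s' := fun r => Finset.range (M + 1 - r)) (t' := Finset.range (M + 1))
    fun l r => by simp only [Finset.mem_range]; omega).trans ?_
  refine Finset.sum_congr rfl fun r hr => Finset.sum_congr rfl fun l hl => ?_
  rw [Finset.mem_range] at hr hl
  rw [wsum_comm, show M + 1 - r - 1 - l = M - l - r by omega]

end CyclicShuffleWords

end CocyclicData
end HopfCyc

namespace HopfCyc

/-! ### Kernels in one factor of a tensor product over a field. -/

section KernelOfTensor

variable {k : Type u} [Field k] {V : Type*} {W : Type*} {U : Type*}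
  [AddCommGroup V] [Module k V] [AddCommGroup W] [Module k W] [AddCommGroup U] [Module k U]

/-- Expanding in a basis of `Q`, the coefficients are unique, so each of them is annihilated by all
`f i`. -/
theorem mem_subTens_of_map_left_eq_zero {ι : Type*} {P : Submodule k V} {Q : Submodule k W}
    {f : ι → V →ₗ[k] U} {z : V ⊗[k] W} (hz : z ∈ subTens P Q)
    (h : ∀ i, TensorProduct.map (f i) (LinearMap.id : W →ₗ[k] W) z = 0) :
    z ∈ subTens (P ⊓ ⨅ i, LinearMap.ker (f i)) Q := by
  obtain ⟨z, rfl⟩ := hz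
  let b := Module.Basis.ofVectorSpace k Q
  obtain ⟨c, rfl⟩ := TensorProduct.eq_repr_basis_right b z
  have h' : ∀ i j, f i (c j) = 0 := by
    intro i j
    have h1 := h i
    rw [TensorProduct.map_map, LinearMap.id_comp, ← LinearMap.id_comp (f i ∘ₗ P.subtype),
      ← LinearMap.comp_id Q.subtype, TensorProduct.map_comp, LinearMap.comp_apply] at h1
    have h2 : Function.Injective (TensorProduct.map (LinearMap.id : U →ₗ[k] U) Q.subtype) :=
      Module.Flat.lTensor_preserves_injective_linearMap _ Q.injective_subtype
    rw [map_eq_zero_iff _ h2, Finsupp.sum, map_sum] at h1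
    have h3 := TensorProduct.sum_tmul_basis_right_eq_zero b
      (c.mapRange (f i ∘ₗ P.subtype) (map_zero _)) (by
        rw [Finsupp.sum_mapRange_index (by simp), Finsupp.sum, ← h1]
        rfl)
    simpa using DFunLike.congr_fun h3 j
  rw [Finsupp.sum, map_sum]
  refine sum_mem fun j _ => ?_
  rw [TensorProduct.map_tmul]
  refine tmul_mem_subTens ⟨(c j).2, ?_⟩ (b j).2
  simpa using fun i => h' i j

theorem comm_mem_subTens {P : Submodule k V} {Q : Submodule k W} {z : V ⊗[k] W}
    (hz : z ∈ subTens P Q) : TensorProduct.comm k V W z ∈ subTens Q P :=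
  subTens_induction (p := fun z => TensorProduct.comm k V W z ∈ subTens Q P)
    (by rw [map_zero]; exact zero_mem _) (fun x y hx hy => by rw [map_add]; exact add_mem hx hy)
    (fun x hx y hy => tmul_mem_subTens hy hx) hz

theorem mem_subTens_of_map_right_eq_zero {ι : Type*} {P : Submodule k V} {Q : Submodule k W}
    {f : ι → W →ₗ[k] U} {z : V ⊗[k] W} (hz : z ∈ subTens P Q)
    (h : ∀ i, TensorProduct.map (LinearMap.id : V →ₗ[k] V) (f i) z = 0) :
    z ∈ subTens P (Q ⊓ ⨅ i, LinearMap.ker (f i)) := by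
  rw [← (TensorProduct.comm k V W).symm_apply_apply z]
  refine comm_mem_subTens (mem_subTens_of_map_left_eq_zero (comm_mem_subTens hz) fun i => ?_)
  rw [TensorProduct.map_comm, h, map_zero]

end KernelOfTensor

namespace CocyclicData

/-! ### Shuffles of normalized diagonal cochains are normalized in both factors. -/

section NormalizedShuffles

variable {k : Type u} [Field k] {C C' : CocyclicData.{u, w} k}

variable (C) in
/-- The normalized elements of degree `n`. -/
noncomputable def normDeg (n : ℕ) : Submodule k C.Total := LinearMap.range (C.inc n) ⊓ C.normTotal

variable (C) in
/-- The elements of degree `n` killed by all codegeneracies and the extra degeneracy. -/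
noncomputable def extraNormDeg (n : ℕ) : Submodule k C.Total :=
  LinearMap.range (C.inc n) ⊓ C.extraNormTotal

theorem xs_mem_extraNormDeg (hC : C.IsCocyclic) {n : ℕ} {a : C.Total}
    (ha : a ∈ C.normDeg (n + 1)) : C.xs a ∈ C.extraNormDeg n :=
  ⟨xs_mem_range ha.1, xs_mem_extraNormTotal hC ha.2⟩

theorem tw_mem_extraNormDeg (hC : C.IsCocyclic) {n : ℕ} {a : C.Total}
    (ha : a ∈ C.extraNormDeg n) : C.tw a ∈ C.extraNormDeg n := by
  obtain ⟨⟨x, rfl⟩, h⟩ := ha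
  have h2 : C.tw (C.inc n x) = (-1 : k) ^ n • C.cy (C.inc n x) := by
    rw [tw_inc, cy_inc, LinearMap.smul_apply, map_smul, smul_smul, ← mul_pow]; simp
  refine ⟨⟨C.τ n x, (tw_inc n x).symm⟩, ?_⟩
  rw [h2]
  exact Submodule.smul_mem _ _ (cy_mem_extraNormTotal hC h)

theorem tw_pow_mem_extraNormDeg (hC : C.IsCocyclic) {n : ℕ} {a : C.Total}
    (ha : a ∈ C.extraNormDeg n) (p : ℕ) : (C.tw ^ p) a ∈ C.extraNormDeg n := by
  induction p with
  | zero => exact ha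
  | succ p ih => rw [pow_succ', Module.End.mul_apply]; exact tw_mem_extraNormDeg hC ih

theorem exists_append_of_lt_count_true (W : List Bool) {t : ℕ} (h : t < W.count true) :
    ∃ A B, W = A ++ true :: B ∧ A.count true = t := by
  induction W generalizing t with
  | nil => simp at h
  | cons c W ih =>
    rcases c with _ | _
    · obtain ⟨A, B, rfl, hA⟩ := ih (t := t) (by simpa using h)
      exact ⟨false :: A, B, rfl, by simpa using hA⟩
    · rcases t with _ | t
      · exact ⟨[], W, rfl, rfl⟩
      · obtain ⟨A, B, rfl, hA⟩ := ih (t := t) (by simpa using h)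
        exact ⟨true :: A, B, rfl, by simpa using hA⟩

theorem sg_mul_opAt (hC : C.IsCocyclic) (A B : List Bool) :
    C.sg (A.count true) * C.opAt 0 (A ++ true :: B) = C.opAt 0 (A ++ B) * C.sg A.length := by
  refine LinearMap.ext fun a => ?_
  have h1 := sg_opAt hC 0 A B a
  have h2 := opAt_append_false hC 0 A B a
  rw [zero_add] at h1 h2
  exact h1.trans h2

theorem opAt_append_false_eq (hC : C.IsCocyclic) (A B : List Bool) :
    C.opAt 0 (A ++ false :: B) = C.opAt 0 (A ++ B) * C.sg A.length := by
  refine LinearMap.ext fun a => ?_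
  have h2 := opAt_append_false hC 0 A B a
  rw [zero_add] at h2
  exact h2

theorem actL_eq_zero {P : Submodule k C.Total} {Q : Submodule k C'.Total} {f : Module.End k C.Total}
    (h : ∀ a ∈ P, f a = 0) {z : Total2 C C'} (hz : z ∈ subTens P Q) : actL f z = 0 := by
  rw [actL_congr (f' := 0) h hz, ← zero_smul k (1 : Module.End k C.Total), actL_smul, zero_smul]

theorem actR_eq_zero {P : Submodule k C.Total} {Q : Submodule k C'.Total}
    {f : Module.End k C'.Total} (h : ∀ a ∈ Q, f a = 0) {z : Total2 C C'} (hz : z ∈ subTens P Q) :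
    actR f z = 0 := by
  rw [actR_congr (f' := 0) h hz, ← zero_smul k (1 : Module.End k C'.Total), actR_smul, zero_smul]

/-- A codegeneracy on the left turns the `t`-th letter `true` into a deletion; the complementary
word deletes the same slot on the right, so the operator factors through the diagonal codegeneracy
of that slot. Larger `t` is out of range. -/
theorem actL_sg_sw (hC : C.IsCocyclic) (hC' : C'.IsCocyclic) {n : ℕ} {W : List Bool}
    (hW : W.length = n) {z : Total2 C C'} (hz : z ∈ deg2 C C' n)
    (h : ∀ t, actL (C.sg t) (actR (C'.sg t) z) = 0) (t : ℕ) :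
    actL (C.sg t) (sw C C' 0 W z) = 0 := by
  by_cases ht : t < W.count true
  · obtain ⟨A, B, rfl, rfl⟩ := exists_append_of_lt_count_true W ht
    rw [sw_apply, ← actL_mul, sg_mul_opAt hC, List.map_append, List.map_cons, Bool.not_true,
      opAt_append_false_eq hC', actL_mul, actR_mul, ← actR_actL (C.sg _), List.length_map, h,
      map_zero, map_zero]
  · refine actL_eq_zero ?_ (sw_mem hW hz)
    rintro _ ⟨x, rfl⟩
    exact sg_inc_of_le (by omega) x

theorem actR_sg_sw (hC : C.IsCocyclic) (hC' : C'.IsCocyclic) {n : ℕ} {W : List Bool}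
    (hW : W.length = n) {z : Total2 C C'} (hz : z ∈ deg2 C C' n)
    (h : ∀ t, actL (C.sg t) (actR (C'.sg t) z) = 0) (t : ℕ) :
    actR (C'.sg t) (sw C C' 0 W z) = 0 := by
  by_cases ht : t < W.count false
  · obtain ⟨A, B, hA, rfl⟩ := exists_append_of_lt_count_true (W.map not) (t := t)
      (by rwa [count_map_not])
    have hW' : W = A.map not ++ false :: B.map not := by
      simpa [Function.comp_def] using congrArg (List.map not) hA
    subst hW'
    rw [sw_apply, actR_actL, ← actR_mul, hA, sg_mul_opAt hC', opAt_append_false_eq hC, actL_mul,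
      actR_mul, ← actR_actL (C.sg _), List.length_map, h, map_zero, map_zero]
  · refine actR_eq_zero ?_ (sw_mem hW hz)
    rintro _ ⟨x, rfl⟩
    exact sg_inc_of_le (by omega) x

theorem sw_mem_norm (hC : C.IsCocyclic) (hC' : C'.IsCocyclic) {n : ℕ} {W : List Bool}
    (hW : W.length = n) {z : Total2 C C'} (hz : z ∈ deg2 C C' n)
    (h : ∀ t, actL (C.sg t) (actR (C'.sg t) z) = 0) :
    sw C C' 0 W z ∈ subTens (C.normDeg (W.count true)) (C'.normDeg (W.count false)) :=
  mem_subTens_of_map_right_eq_zero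
    (mem_subTens_of_map_left_eq_zero (sw_mem hW hz) (actL_sg_sw hC hC' hW hz h))
    (actR_sg_sw hC hC' hW hz h)

theorem csw_mem_extraNorm (hC : C.IsCocyclic) (hC' : C'.IsCocyclic) {n : ℕ} {W : List Bool}
    (hW : W.length = n) {i j : ℕ} (hi : W.count true = i + 1) (hj : W.count false = j + 1)
    (p q : ℕ) {z : Total2 C C'} (hz : z ∈ deg2 C C' n)
    (h : ∀ t, actL (C.sg t) (actR (C'.sg t) z) = 0) :
    csw C C' W p q z ∈ subTens (C.extraNormDeg i) (C'.extraNormDeg j) := by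
  have h1 := sw_mem_norm hC hC' hW hz h
  rw [hi, hj, sw_apply] at h1
  rw [csw_apply]
  refine Submodule.smul_mem _ _ ?_
  rw [actL_mul, actR_mul, ← actR_actL (C.opAt 0 W)]
  refine actL_mem (fun a ha => ?_) (actR_mem (fun a ha => ?_) h1)
  · exact tw_pow_mem_extraNormDeg hC (xs_mem_extraNormDeg hC ha) p
  · exact tw_pow_mem_extraNormDeg hC' (xs_mem_extraNormDeg hC' ha) q

/-- The extra degeneracy in each factor maps normalized elements into its own kernel, and that
kernel with normalization is stable under turns. This gives `B sh' = 0`. -/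
theorem csh_mem_extraNorm (hC : C.IsCocyclic) (hC' : C'.IsCocyclic) {n : ℕ} {z : Total2 C C'}
    (hz : z ∈ deg2 C C' n) (h : ∀ t, actL (C.sg t) (actR (C'.sg t) z) = 0) :
    csh C C' n z ∈ subTens C.extraNormTotal C'.extraNormTotal := by
  refine sum_mem fun W _ => sum_mem fun p hp => sum_mem fun q hq => ?_
  rw [Finset.mem_range] at hp hq
  split_ifs
  · obtain ⟨i, hi⟩ := Nat.exists_eq_add_of_lt hp
    obtain ⟨j, hj⟩ := Nat.exists_eq_add_of_lt hq
    exact subTens_mono inf_le_right inf_le_right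
      (csw_mem_extraNorm hC hC' (by simp) hi hj p q hz h)
  · exact zero_mem _

theorem sn_mem_subTens_norm {z : Total2 C C'} (hz : z ∈ subTens C.normTotal C'.normTotal) :
    sn C C' z ∈ subTens C.normTotal C'.normTotal :=
  actL_mem (fun a ha => mem_normTotal.2 fun i => by
    rw [← neg_eq_iff_eq_neg.2 (ep_sg i a), mem_normTotal.1 ha, map_zero, neg_zero]) hz

theorem zr_mem_norm (hC : C.IsCocyclic) (hC' : C'.IsCocyclic) {n : ℕ} {z : Total2 C C'}
    (hz : z ∈ deg2 C C' n) (h : ∀ t, actL (C.sg t) (actR (C'.sg t) z) = 0) :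
    zr C C' 0 n z ∈ subTens C.normTotal C'.normTotal := by
  rw [zr_eq]
  refine sum_mem fun W _ => ?_
  refine (congrArg (· ∈ subTens C.normTotal C'.normTotal)
    (zw_eq_of_length List.length_ofFn hz)).mpr ?_
  exact Submodule.smul_mem _ _ (subTens_mono inf_le_right inf_le_right
    (sw_mem_norm hC hC' (by simp) hz h))

end NormalizedShuffles

/-! ### The homotopy identity for the shuffle and cyclic shuffle operators. -/

section TensorDifferentials

variable {k : Type u} [Field k] {C C' : CocyclicData.{u, w} k}

variable (C) in
/-- Connes' differential on the total space. -/
noncomputable def cb : Module.End k C.Total := C.nt * C.xs * (1 - C.cy)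

theorem cb_apply (a : C.Total) : C.cb a = C.nt (C.xs (a - C.cy a)) := rfl

theorem cb_of_mem (hC : C.IsCocyclic) {a : C.Total} (ha : a ∈ C.normTotal) :
    C.cb a = (C.nt * C.xs) a := by
  rw [cb_apply, map_sub, xs_cy hC, mem_normTotal.1 ha, map_zero, neg_zero, sub_zero]; rfl

theorem ep_nt (a : C.Total) : C.ep (C.nt a) = C.nt (C.ep a) := by
  refine total_ext (f := C.ep ∘ₗ C.nt) (g := C.nt ∘ₗ C.ep) (fun n x => ?_) a
  obtain ⟨y, hy⟩ := nl_inc_mem n (n + 1) x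
  simp only [LinearMap.comp_apply]
  rw [nt_inc, ep_inc, map_smul, nt_inc, hy, ep_inc]

variable (C C') in
/-- The differential `b ⊗ 1 + (-1)ᵖ 1 ⊗ b`. -/
noncomputable def b2 (z : Total2 C C') : Total2 C C' := actL C.bt z + sn C C' (actR C'.bt z)

variable (C C') in
/-- The differential `B ⊗ 1 + (-1)ᵖ 1 ⊗ B`. -/
noncomputable def B2 (z : Total2 C C') : Total2 C C' := actL C.cb z + sn C C' (actR C'.cb z)

/-- Conjugation with ε changes the relative sign of the two summands; this is why the letter
calculus uses `b ⊗ 1 - ε(1 ⊗ b)`. -/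
theorem b2_sn (z : Total2 C C') : b2 C C' (sn C C' z) = - sn C C' (dgt C C' 0 z) := by
  have h := actL_bge_sn (C := C) (C' := C') 0 z
  rw [bge_zero] at h
  rw [b2, dgt_apply, bge_zero, bge_zero, h, actR_sn, sn_sn, map_sub, sn_sn]
  abel

theorem B2_of_mem_norm (hC : C.IsCocyclic) (hC' : C'.IsCocyclic) {z : Total2 C C'}
    (hz : z ∈ subTens C.normTotal C'.normTotal) :
    B2 C C' z = actL C.nt (actL C.xs z) + sn C C' (actR C'.nt (actR C'.xs z)) := by
  rw [B2, actL_congr (fun a ha => cb_of_mem hC ha) hz, actR_congr (fun a ha => cb_of_mem hC' ha) hz,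
    actL_mul, actR_mul]

theorem B2_of_mem_extraNorm (hC : C.IsCocyclic) (hC' : C'.IsCocyclic) {z : Total2 C C'}
    (hz : z ∈ subTens C.extraNormTotal C'.extraNormTotal) : B2 C C' z = 0 := by
  rw [B2_of_mem_norm hC hC' (subTens_mono inf_le_left inf_le_left hz),
    actL_eq_zero (P := C.extraNormTotal) (fun a ha => ha.2) hz,
    actR_eq_zero (Q := C'.extraNormTotal) (fun a ha => ha.2) hz]
  simp

theorem b2_sn_zr (hC : C.IsCocyclic) (hC' : C'.IsCocyclic) (n : ℕ) (x : (diag C C').X n) :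
    b2 C C' (sn C C' (zr C C' 0 n (jd C C' ((diag C C').inc n x)))) =
      sn C C' (zr C C' 0 (n + 1) (jd C C' ((diag C C').bt ((diag C C').inc n x)))) := by
  rw [b2_sn, dgt_zr_jd hC hC', map_neg, neg_neg]

/-- `b' s x = (1 - λ)x - s b x`; applying Γ, with `gam_bl` on the left and `gam_sub_cy` and
`sn_gam_xs` on the right, gives the identity after multiplication by ε. Normalization is used only
to replace `B` by `N s` on the tensor product. -/
theorem B2_sn_zr_add (hC : C.IsCocyclic) (hC' : C'.IsCocyclic) (n : ℕ) (x : (diag C C').X (n + 1))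
    (hx : (diag C C').inc (n + 1) x ∈ (diag C C').normTotal) :
    B2 C C' (sn C C' (zr C C' 0 (n + 1) (jd C C' ((diag C C').inc (n + 1) x)))) +
        b2 C C' (csh C C' (n + 1) (jd C C' ((diag C C').inc (n + 1) x))) =
      sn C C' (zr C C' 0 n
        (jd C C' ((diag C C').nt ((diag C C').xs ((diag C C').inc (n + 1) x))))) +
      csh C C' (n + 2) (jd C C' ((diag C C').bt ((diag C C').inc (n + 1) x))) := by
  have hD := IsCocyclic.diag hC hC'
  have hz := jd_inc_mem (C := C) (C' := C') (n + 1) x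
  have h0 : ∀ t, actL (C.sg t) (actR (C'.sg t) (jd C C' ((diag C C').inc (n + 1) x))) = 0 :=
    fun t => by rw [← jd_sg, mem_normTotal.1 hx, map_zero]
  have h1 := zr_mem_norm hC hC' hz h0
  have h2 := gam_sub_cy hC hC' (n + 1) x
  have h3 := sn_gam_xs hC hC' (n + 2) ((diag C C').b (n + 1) x)
  obtain ⟨y, hy⟩ := xs_mem_range (C := diag C C') ⟨x, rfl⟩
  have h4 := gam_bl hC hC' n y
  have h5 := xs_bt hD x
  have h6 : (diag C C').bl (n + 1) ((diag C C').xs ((diag C C').inc (n + 1) x)) =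
      ((diag C C').inc (n + 1) x - (diag C C').cy ((diag C C').inc (n + 1) x)) -
        (diag C C').xs ((diag C C').bt ((diag C C').inc (n + 1) x)) := by rw [h5]; abel
  rw [inc_b] at h3
  rw [hy, h6, map_sub, h2] at h4
  rw [← sn_gam_xs hC hC', b2_sn, ← h3, Nat.add_sub_cancel,
    B2_of_mem_norm hC hC' (sn_mem_subTens_norm h1), eq_sub_of_add_eq h4.symm, actL_xs_sn, map_neg,
    actR_sn, actR_sn, sn_sn, show n + 2 - 1 = n + 1 from rfl]
  have h7 : ∀ z, actL C.nt (sn C C' z) = sn C C' (actL C.nt z) := fun z => by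
    rw [sn, ← actL_mul, ← actL_mul]
    exact congrArg (fun f => actL f z) (LinearMap.ext fun a => (ep_nt a).symm)
  rw [h7]
  simp only [map_sub, sn_sn]
  abel

end TensorDifferentials

end CocyclicData
end HopfCyc

namespace HopfCyc

/-! ### The correspondence between shuffles and words. -/

section ShuffleWords

variable {i j : ℕ}

theorem mem_shuffles {s : Equiv.Perm (Fin (i + j))} : s ∈ shuffles i j ↔
    StrictMono (fun a => s (Fin.castAdd j a)) ∧ StrictMono (fun b => s (Fin.natAdd i b)) := by
  simp only [shuffles, Finset.mem_filter, Finset.mem_univ, true_and]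
  rfl

/-- The letters of the word of a permutation: `true` at the images of the first `i` points. -/
def letter (s : Equiv.Perm (Fin (i + j))) (t : Fin (i + j)) : Bool := decide ((s.symm t : ℕ) < i)

theorem letter_castAdd (s : Equiv.Perm (Fin (i + j))) (a : Fin i) :
    letter s (s (Fin.castAdd j a)) = true := by simp [letter]

theorem letter_natAdd (s : Equiv.Perm (Fin (i + j))) (b : Fin j) :
    letter s (s (Fin.natAdd i b)) = false := by simp [letter]

theorem sum_apply_letter {V : Type*} [AddCommMonoid V] (s : Equiv.Perm (Fin (i + j)))
    (F : Fin (i + j) → Bool → V) : ∑ t, F t (letter s t) =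
      ∑ a, F (s (Fin.castAdd j a)) true + ∑ b, F (s (Fin.natAdd i b)) false := by
  rw [← Equiv.sum_comp s, Fin.sum_univ_add]
  simp only [letter_castAdd, letter_natAdd]

theorem count_take_ofFn {n : ℕ} (W : Fin n → Bool) (c : Bool) (t : ℕ) :
    ((List.ofFn W).take t).count c = ∑ u : Fin n, if (u : ℕ) < t ∧ W u = c then 1 else 0 := by
  induction n generalizing t with
  | zero => simp
  | succ n ih =>
    rw [List.ofFn_succ, Fin.sum_univ_succ]
    rcases t with _ | t
    · simp
    · rw [List.take_succ_cons, List.count_cons, ih, add_comm]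
      simp

theorem count_ofFn {n : ℕ} (W : Fin n → Bool) (c : Bool) :
    (List.ofFn W).count c = ∑ u : Fin n, if W u = c then 1 else 0 := by
  have h := count_take_ofFn W c n
  rw [List.take_of_length_le (by simp)] at h
  rw [h]
  exact Finset.sum_congr rfl fun u _ => by simp

theorem count_true_letter (s : Equiv.Perm (Fin (i + j))) :
    (List.ofFn (letter s)).count true = i := by
  rw [count_ofFn, sum_apply_letter s (fun _ c => if c = true then 1 else 0)]
  simp

theorem count_false_letter (s : Equiv.Perm (Fin (i + j))) :
    (List.ofFn (letter s)).count false = j := by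
  rw [count_ofFn, sum_apply_letter s (fun _ c => if c = false then 1 else 0)]
  simp

theorem falseBefore_letter {s : Equiv.Perm (Fin (i + j))} (hs : s ∈ shuffles i j) (p : Fin i) :
    falseBefore (List.ofFn (letter s)) p =
      (Finset.univ.filter fun b => s (Fin.natAdd i b) < s (Fin.castAdd j p)).card := by
  rw [mem_shuffles] at hs
  set t := s (Fin.castAdd j p) with ht
  have h1 : (List.ofFn (letter s)).take t ++ true :: (List.ofFn (letter s)).drop (t + 1) =
      List.ofFn (letter s) := by
    have h2 : (List.ofFn (letter s))[(t : ℕ)]'(by simp) = true := by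
      rw [List.getElem_ofFn, Fin.eta, ht, letter_castAdd]
    rw [← h2, List.getElem_cons_drop, List.take_append_drop]
  have h3 : ((List.ofFn (letter s)).take t).count true = p := by
    rw [count_take_ofFn, sum_apply_letter s (fun u c => if (u : ℕ) < t ∧ c = true then 1 else 0)]
    simp only [and_true, reduceCtorEq, and_false, if_false, Finset.sum_const_zero, add_zero]
    have h4 : ∀ a : Fin i, ((s (Fin.castAdd j a) : ℕ) < t ↔ a < p) := fun a => hs.1.lt_iff_lt
    simp only [h4]
    rw [Finset.sum_boole, show (Finset.univ.filter fun a => a < p) = Finset.Iio p by ext; simp]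
    simp
  rw [← h1, ← h3, falseBefore_marked, count_take_ofFn,
    sum_apply_letter s (fun u c => if (u : ℕ) < t ∧ c = false then 1 else 0)]
  simp only [and_true, reduceCtorEq, and_false, if_false, Finset.sum_const_zero, zero_add]
  rw [Finset.sum_boole]
  rfl

/-- A shuffle is increasing on the second block, so the letters `false` preceding a given position
form an initial segment, and comparing its length with `q` locates the `q`-th one. -/
theorem falseBefore_letter_le_iff {s : Equiv.Perm (Fin (i + j))} (hs : s ∈ shuffles i j)
    (p : Fin i) (q : Fin j) : falseBefore (List.ofFn (letter s)) p ≤ q ↔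
      s (Fin.castAdd j p) < s (Fin.natAdd i q) := by
  have hm := (mem_shuffles.1 hs).2
  rw [falseBefore_letter hs]
  constructor
  · intro h
    by_contra hc
    have hne : s (Fin.natAdd i q) ≠ s (Fin.castAdd j p) := fun h => by
      have := congrArg Fin.val (s.injective h)
      simp at this
      omega
    have hlt := lt_of_le_of_ne (not_lt.1 hc) hne
    have h2 : Finset.Iic q ⊆
        Finset.univ.filter fun b => s (Fin.natAdd i b) < s (Fin.castAdd j p) := fun b hb =>
      Finset.mem_filter.2 ⟨Finset.mem_univ _, (hm.monotone (Finset.mem_Iic.1 hb)).trans_lt hlt⟩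
    have h3 := Finset.card_le_card h2
    rw [Fin.card_Iic] at h3
    omega
  · intro h
    have h2 : (Finset.univ.filter fun b => s (Fin.natAdd i b) < s (Fin.castAdd j p)) ⊆
        Finset.Iio q := fun b hb =>
      Finset.mem_Iio.2 (hm.lt_iff_lt.1 ((Finset.mem_filter.1 hb).2.trans h))
    have h3 := Finset.card_le_card h2
    rwa [Fin.card_Iio] at h3

theorem inversions_eq_sum_falseBefore (W : List Bool) :
    inversions W = ∑ p ∈ Finset.range (W.count true), falseBefore W p := by
  induction W with
  | nil => rfl
  | cons c W ih =>
    rcases c with _ | _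
    · rw [List.count_cons_of_ne (by decide), inversions, ih]
      simp only [falseBefore]
      rw [Finset.sum_add_distrib]
      simp
    · rw [List.count_cons_self, Finset.sum_range_succ', inversions, ih]
      rfl

/-- Within each block a shuffle is increasing, so only pairs from different blocks can be inverted,
and these are the letters `false` standing before a letter `true`. -/
theorem sign_eq_inversions {s : Equiv.Perm (Fin (i + j))} (hs : s ∈ shuffles i j) :
    Equiv.Perm.sign s = (-1) ^ inversions (List.ofFn (letter s)) := by
  have hm := mem_shuffles.1 hs
  have h1 : ∀ t (f : Fin (i + j) → ℤˣ), ∏ u ∈ Finset.Iio t, f u =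
      ∏ u, if u < t then f u else 1 := fun t f => by
    rw [Finset.prod_ite, Finset.prod_const_one, mul_one]
    exact Finset.prod_congr (by ext; simp) fun _ _ => rfl
  rw [Equiv.Perm.sign_eq_prod_prod_Iio]
  simp only [h1]
  rw [Fin.prod_univ_add]
  simp only [Fin.prod_univ_add]
  have h2 : ∀ a a' : Fin i, (if Fin.castAdd j a' < Fin.castAdd j a then
      (if s (Fin.castAdd j a') < s (Fin.castAdd j a) then (1 : ℤˣ) else -1) else 1) = 1 := by
    intro a a'
    split_ifs with h h' <;> first | rfl | exact absurd (hm.1 h) h'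
  have h3 : ∀ b b' : Fin j, (if Fin.natAdd i b' < Fin.natAdd i b then
      (if s (Fin.natAdd i b') < s (Fin.natAdd i b) then (1 : ℤˣ) else -1) else 1) = 1 := by
    intro b b'
    split_ifs with h h' <;>
      first | rfl | exact absurd (hm.2 ((Fin.natAdd_lt_natAdd_iff i).1 h)) h'
  have h4 : ∀ (a : Fin i) (b : Fin j), (if Fin.natAdd i b < Fin.castAdd j a then
      (if s (Fin.natAdd i b) < s (Fin.castAdd j a) then (1 : ℤˣ) else -1) else 1) = 1 :=
    fun a b => if_neg (by rw [Fin.lt_def]; simp; omega)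
  have h5 : ∀ (a : Fin i) (b : Fin j), Fin.castAdd j a < Fin.natAdd i b :=
    fun a b => by rw [Fin.lt_def]; simp; omega
  simp only [h2, h3, h4, h5, if_true, Finset.prod_const_one, one_mul, mul_one]
  rw [Finset.prod_comm, inversions_eq_sum_falseBefore, count_true_letter, Finset.sum_range,
    ← Finset.prod_pow_eq_pow_sum]
  refine Finset.prod_congr rfl fun p _ => ?_
  rw [Finset.prod_ite, Finset.prod_const_one, one_mul, Finset.prod_const, falseBefore_letter hs]
  congr 2
  refine Finset.filter_congr fun b _ => ?_
  rw [not_lt]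
  refine ⟨fun h => lt_of_le_of_ne h fun h' => ?_, le_of_lt⟩
  exact (h5 p b).ne' (s.injective h')

/-- The word fixes the image of each block as a set, and an increasing enumeration of a finite set
is unique; `exists_letter_eq` uses these enumerations to build the shuffle. -/
theorem eq_of_letter_eq {s s' : Equiv.Perm (Fin (i + j))} (hs : s ∈ shuffles i j)
    (hs' : s' ∈ shuffles i j) (h : letter s = letter s') : s = s' := by
  rw [mem_shuffles] at hs hs'
  have key : ∀ (c : Bool) (m : ℕ) (f f' : Fin m → Fin (i + j)), StrictMono f → StrictMono f' →
      (Finset.univ.filter fun t => letter s t = c).card = m → (∀ a, letter s (f a) = c) →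
      (∀ a, letter s' (f' a) = c) → f = f' := by
    intro c m f f' hf hf' hm h1 h2
    rw [Finset.orderEmbOfFin_unique hm (fun a => by simpa using h1 a) hf,
      Finset.orderEmbOfFin_unique hm (fun a => by simpa [h] using h2 a) hf']
  have hcard : ∀ c, (Finset.univ.filter fun t => letter s t = c).card =
      (List.ofFn (letter s)).count c := fun c => by
    rw [count_ofFn, Finset.sum_boole]; rfl
  have h1 := key true i _ _ hs.1 hs'.1 (by rw [hcard, count_true_letter])
    (letter_castAdd s) (letter_castAdd s')
  have h2 := key false j _ _ hs.2 hs'.2 (by rw [hcard, count_false_letter])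
    (letter_natAdd s) (letter_natAdd s')
  refine Equiv.ext fun t => ?_
  induction t using Fin.addCases with
  | left a => exact congrFun h1 a
  | right b => exact congrFun h2 b

theorem exists_letter_eq (W : Fin (i + j) → Bool) (hW : (List.ofFn W).count true = i) :
    ∃ s ∈ shuffles i j, letter s = W := by
  set S := Finset.univ.filter fun t => W t = true with hS
  have hcard : S.card = i := by
    refine Eq.trans ?_ hW
    rw [count_ofFn, Finset.sum_boole]; rfl
  have hcard' : Sᶜ.card = j := by rw [Finset.card_compl, hcard]; simp
  let s : Equiv.Perm (Fin (i + j)) :=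
    finSumFinEquiv.symm.trans (finSumEquivOfFinset hcard hcard')
  have h1 : ∀ a, s (Fin.castAdd j a) = S.orderEmbOfFin hcard a := fun a => by simp [s]
  have h2 : ∀ b, s (Fin.natAdd i b) = Sᶜ.orderEmbOfFin hcard' b := fun b => by simp [s]
  refine ⟨s, mem_shuffles.2 ⟨?_, ?_⟩, funext fun t => ?_⟩
  · simp only [h1]; exact (S.orderEmbOfFin hcard).strictMono
  · simp only [h2]; exact (Sᶜ.orderEmbOfFin hcard').strictMono
  · obtain ⟨t, rfl⟩ := s.surjective t
    induction t using Fin.addCases with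
    | left a =>
      rw [letter_castAdd, h1]
      exact (Finset.mem_filter.1 (S.orderEmbOfFin_mem hcard a)).2.symm
    | right b =>
      rw [letter_natAdd, h2]
      have := Finset.mem_compl.1 (Sᶜ.orderEmbOfFin_mem hcard' b)
      exact (eq_false_of_ne_true
        fun h => this (Finset.mem_filter.2 ⟨Finset.mem_univ _, h⟩)).symm

/-- A sum over words with `i` letters `true` and `j` letters `false` is a sum over shuffles. -/
theorem sum_shuffles {V : Type*} [AddCommMonoid V] (F : List Bool → V)
    (hF : ∀ W : List Bool, W.length = i + j → W.count true ≠ i → F W = 0) :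
    wsum (i + j) F = ∑ s ∈ shuffles i j, F (List.ofFn (letter s)) := by
  refine (Finset.sum_of_injOn letter (fun s hs s' hs' h => eq_of_letter_eq hs hs' h)
    (fun _ _ => Finset.mem_univ _) (fun W _ h => ?_) (fun s _ => rfl)).symm
  refine hF _ (by simp) fun hW => h ?_
  obtain ⟨s, hs, rfl⟩ := exists_letter_eq W hW
  exact ⟨s, hs, rfl⟩

end ShuffleWords

end HopfCyc

namespace HopfCyc

namespace CocyclicData

/-! ### Iterated codegeneracies of shuffles as word operators. -/

section Degeneracies

variable {k : Type u} [Field k] {C C' : CocyclicData.{u, w} k}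

theorem opAt_ofFn {n : ℕ} (l : ℕ) (W : Fin n → Bool) : C.opAt l (List.ofFn W) =
    (((List.finRange n).filter (fun t => W t = false)).map (fun t : Fin n => C.sg (l + (t : ℕ)))).prod := by
  induction n generalizing l with
  | zero => rfl
  | succ n ih =>
    rw [List.ofFn_succ, List.finRange_succ, List.filter_cons, List.filter_map]
    have h1 : (((List.finRange n).filter (fun t => W t.succ = false)).map
        (fun t : Fin n => C.sg (l + 1 + (t : ℕ)))).prod = ((((List.finRange n).filter
        ((fun t => decide (W t = false)) ∘ Fin.succ)).map Fin.succ).map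
          (fun t : Fin (n + 1) => C.sg (l + (t : ℕ)))).prod := by
      rw [List.map_map]
      congr 2
      funext t
      simp only [Function.comp_apply, Fin.val_succ]
      rw [add_assoc, add_comm 1]
    rcases h : W 0 with _ | _
    · refine (congrArg (C.sg l * ·) (ih (l + 1) fun t => W t.succ)).trans ?_
      simp only [decide_true, if_true, List.map_cons, List.prod_cons, h1]
      rfl
    · refine (ih (l + 1) fun t => W t.succ).trans ?_
      simp only [h1]
      rfl

theorem filter_finRange_eq_ofFn {n m : ℕ} {p : Fin n → Bool} {f : Fin m → Fin n}
    (hf : StrictMono f) (h : ∀ t, p t = true ↔ t ∈ Set.range f) :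
    (List.finRange n).filter p = List.ofFn f := by
  refine List.SortedLT.eq_of_mem_iff ?_ hf.sortedLT_ofFn fun t => ?_
  · exact (List.Pairwise.filter _ (List.pairwise_lt_finRange n)).sortedLT
  · simp [h, List.mem_ofFn]

/-- The bound on `f` keeps every index in range, so the reduction built into `Fin.ofNat` does
nothing. -/
theorem inc_degens (i j : ℕ) (f : Fin j → ℕ) (hf : ∀ b, f b ≤ i + b) (x : C.X (i + j)) :
    C.inc i (C.degens i j f x) = (List.ofFn fun b => C.sg (f b)).prod (C.inc (i + j) x) := by
  induction j with
  | zero => rfl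
  | succ j ih =>
    have h := hf (Fin.last j)
    rw [Fin.val_last] at h
    rw [List.ofFn_succ', List.prod_concat, Module.End.mul_apply, degens, LinearMap.comp_apply,
      ih _ fun b => hf b.castSucc]
    refine congrArg _ ?_
    refine Eq.trans ?_ (sg_inc_of_lt (Nat.lt_succ_of_le h) x).symm
    refine congrArg (fun t => C.inc (i + j) (C.σ (i + j) t x)) (Fin.ext ?_)
    exact Nat.mod_eq_of_lt (Nat.lt_succ_of_le h)

theorem inc_castX {n m : ℕ} (h : n = m) (x : C.X n) : C.inc m (C.castX h x) = C.inc n x := by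
  subst h; rfl

theorem le_add_of_strictMono {i j : ℕ} {f : Fin j → Fin (i + j)} (hf : StrictMono f) (b : Fin j) :
    (f b : ℕ) ≤ i + b := by
  have h : ∀ m, ∀ b : Fin j, (b : ℕ) + m + 1 = j → (f b : ℕ) ≤ i + b := by
    intro m
    induction m with
    | zero => intro b hb; have := (f b).2; omega
    | succ m ih =>
      intro b hb
      have h1 := ih ⟨b + 1, by omega⟩ (by dsimp only; omega)
      have h2 : (f b : ℕ) < f ⟨b + 1, by omega⟩ := hf (Fin.lt_def.2 (Nat.lt_succ_self _))
      dsimp only at h1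
      omega
  exact h (j - 1 - b) b (by have := b.2; omega)

theorem inc_degensLeft {i j : ℕ} {s : Equiv.Perm (Fin (i + j))} (hs : s ∈ shuffles i j)
    (x : C.X (i + j)) : C.inc i (C.degensLeft s x) =
      C.opAt 0 (List.ofFn (letter s)) (C.inc (i + j) x) := by
  have hm := (mem_shuffles.1 hs).2
  rw [degensLeft, inc_degens _ _ _ (le_add_of_strictMono hm), opAt_ofFn,
    filter_finRange_eq_ofFn hm, List.map_ofFn]
  · simp [Function.comp_def]
  · intro t
    obtain ⟨t, rfl⟩ := s.surjective t
    induction t using Fin.addCases with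
    | left a =>
      rw [letter_castAdd]
      simp [Fin.ext_iff]
      intro b hb
      omega
    | right b => simp [letter_natAdd]

theorem inc_degensRight {i j : ℕ} {s : Equiv.Perm (Fin (i + j))} (hs : s ∈ shuffles i j)
    (x : C.X (i + j)) : C.inc j (C.degensRight s x) =
      C.opAt 0 ((List.ofFn (letter s)).map not) (C.inc (i + j) x) := by
  have hm := (mem_shuffles.1 hs).1
  have hle : ∀ a, (s (Fin.castAdd j a) : ℕ) ≤ j + a := fun a =>
    le_add_of_strictMono (f := fun a => Fin.cast (Nat.add_comm i j) (s (Fin.castAdd j a)))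
      (fun a b h => hm h) a
  rw [degensRight, LinearMap.comp_apply, inc_degens _ _ _ hle, inc_castX, List.map_ofFn, opAt_ofFn,
    filter_finRange_eq_ofFn hm, List.map_ofFn]
  · simp [Function.comp_def]
  · intro t
    obtain ⟨t, rfl⟩ := s.surjective t
    induction t using Fin.addCases with
    | left a => simp [letter_castAdd]
    | right b =>
      simp [letter_natAdd, Fin.ext_iff]
      intro a ha
      omega

theorem tw_pow_sg (hC : C.IsCocyclic) {n : ℕ} (i p : ℕ) (h : i + p ≤ n) (x : C.X (n + 1)) :
    (C.tw ^ p) (C.sg (i + p) (C.inc (n + 1) x)) = C.sg i ((C.tw ^ p) (C.inc (n + 1) x)) := by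
  induction p generalizing i with
  | zero => rfl
  | succ p ih =>
    have h1 := ih (i + 1) (by omega)
    rw [show i + 1 + p = i + (p + 1) by omega] at h1
    rw [pow_succ', Module.End.mul_apply, Module.End.mul_apply, h1,
      tw_sg hC (by rw [tw_pow_inc]; exact inc_mem_ge (by omega) _)]

/-- Carrying `σ` past `p` turns raises its index from `a - p` to the last one `a`, where together
with the remaining turn it forms the extra degeneracy. -/
theorem inc_cycDegen (hC : C.IsCocyclic) (a : ℕ) (p : Fin (a + 1)) (x : C.X (a + 1)) :
    C.inc a (C.cycDegen a p x) = (C.tw ^ (p : ℕ) * C.xs) (C.inc (a + 1) x) := by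
  have hp := p.2
  have h1 := tw_pow_sg hC (n := a) (a - p) p (by omega) (C.τ (a + 1) x)
  rw [Nat.sub_add_cancel (by omega), ← tw_inc, sg_last_tw, ← Module.End.mul_apply (C.tw ^ (p : ℕ)) C.tw,
    ← pow_succ, tw_pow_inc, sg_inc_of_lt (by omega)] at h1
  rw [Module.End.mul_apply, h1, cycDegen, LinearMap.comp_apply]
  refine congrArg (fun t => C.inc a (C.σ a t _)) (Fin.ext ?_)
  rw [Fin.val_rev]; dsimp only; omega

end Degeneracies

end CocyclicData
end HopfCyc

namespace HopfCyc

namespace CocyclicData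

/-! ### Projection from the total space to the bidegrees. -/

section Components

variable {k : Type u} [Field k] {C C' : CocyclicData.{u, w} k}

variable (C) in
/-- The component of degree `n`. -/
noncomputable def comp (n : ℕ) : C.Total →ₗ[k] C.X n := DirectSum.component k ℕ C.X n

theorem comp_inc (n : ℕ) (x : C.X n) : C.comp n (C.inc n x) = x :=
  DirectSum.component.lof_self k n x

theorem comp_inc_of_ne {n m : ℕ} (h : m ≠ n) (x : C.X m) : C.comp n (C.inc m x) = 0 :=
  (DirectSum.component.of k n m x).trans (dif_neg h)

theorem comp_bt_zero (a : C.Total) : C.comp 0 (C.bt a) = 0 := by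
  refine total_ext (f := C.comp 0 ∘ₗ C.bt) (g := 0) (fun n x => ?_) a
  rw [LinearMap.comp_apply, ← inc_b, comp_inc_of_ne (by omega), LinearMap.zero_apply]

theorem comp_bt_succ (n : ℕ) (a : C.Total) : C.comp (n + 1) (C.bt a) = C.b n (C.comp n a) := by
  refine total_ext (f := C.comp (n + 1) ∘ₗ C.bt) (g := C.b n ∘ₗ C.comp n) (fun m x => ?_) a
  rw [LinearMap.comp_apply, LinearMap.comp_apply, ← inc_b]
  rcases eq_or_ne m n with rfl | h
  · rw [comp_inc, comp_inc]
  · rw [comp_inc_of_ne (by omega), comp_inc_of_ne h, map_zero]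

theorem comp_cb (n : ℕ) (a : C.Total) : C.comp n (C.cb a) = C.B n (C.comp (n + 1) a) := by
  refine total_ext (f := C.comp n ∘ₗ C.cb) (g := C.B n ∘ₗ C.comp (n + 1)) (fun m x => ?_) a
  rw [LinearMap.comp_apply, LinearMap.comp_apply, cb_apply]
  rcases m with _ | m
  · rw [cy_inc, ← map_sub, xs_inc_zero, map_zero, map_zero, comp_inc_of_ne (by omega), map_zero]
  · rw [← inc_B]
    rcases eq_or_ne m n with rfl | h
    · rw [comp_inc, comp_inc]
    · rw [comp_inc_of_ne h, comp_inc_of_ne (by omega), map_zero]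

theorem comp_ep (n : ℕ) (a : C.Total) : C.comp n (C.ep a) = (-1 : k) ^ n • C.comp n a := by
  refine total_ext (f := C.comp n ∘ₗ C.ep) (g := (-1 : k) ^ n • C.comp n) (fun m x => ?_) a
  rw [LinearMap.comp_apply, LinearMap.smul_apply, ep_inc, map_smul]
  rcases eq_or_ne m n with rfl | h
  · rfl
  · rw [comp_inc_of_ne h, smul_zero, smul_zero]

theorem comp_sg {n t : ℕ} (ht : t < n + 1) (a : C.Total) :
    C.comp n (C.sg t a) = C.σ n ⟨t, ht⟩ (C.comp (n + 1) a) := by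
  refine total_ext (f := C.comp n ∘ₗ C.sg t) (g := C.σ n ⟨t, ht⟩ ∘ₗ C.comp (n + 1))
    (fun m x => ?_) a
  rw [LinearMap.comp_apply, LinearMap.comp_apply]
  rcases eq_or_ne m (n + 1) with rfl | h
  · rw [sg_inc_of_lt ht, comp_inc, comp_inc]
  · rw [comp_inc_of_ne h, map_zero]
    rcases m with _ | m
    · rw [sg_inc_zero, map_zero]
    · rw [sg_inc_succ]
      split_ifs
      · rw [comp_inc_of_ne (by omega)]
      · rw [map_zero]

theorem comp_mem_normalized {a : C.Total} (ha : a ∈ C.normTotal) (n : ℕ) :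
    C.comp n a ∈ C.normalized n := by
  rcases n with _ | n
  · exact Submodule.mem_top
  · refine Submodule.mem_iInf _ |>.2 fun t => LinearMap.mem_ker.2 ?_
    rw [← Fin.eta t t.2, ← comp_sg, mem_normTotal.1 ha, map_zero]

variable (C C') in
/-- The component of bidegree `(i, j)`. -/
noncomputable def comp2 (i j : ℕ) : Total2 C C' →ₗ[k] C.X i ⊗[k] C'.X j :=
  TensorProduct.map (C.comp i) (C'.comp j)

variable (C C') in
/-- The components of total degree `n`. -/
noncomputable def comps (n : ℕ) : Total2 C C' →ₗ[k] GTens k C.X C'.X 0 n :=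
  LinearMap.pi fun p => comp2 C C' p.1.1 p.1.2

theorem comps_apply (n : ℕ) (z : Total2 C C') (p : Idx 0 n) :
    comps C C' n z p = comp2 C C' p.1.1 p.1.2 z := rfl

theorem comp2_actL {i j i' : ℕ} {f : Module.End k C.Total} {g : C.X i' →ₗ[k] C.X i}
    (h : ∀ a, C.comp i (f a) = g (C.comp i' a)) (z : Total2 C C') :
    comp2 C C' i j (actL f z) = TensorProduct.map g LinearMap.id (comp2 C C' i' j z) := by
  rw [comp2, comp2, actL, TensorProduct.map_map, TensorProduct.map_map, LinearMap.id_comp,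
    show C.comp i ∘ₗ f = g ∘ₗ C.comp i' from LinearMap.ext h]
  rfl

theorem comp2_actR {i j j' : ℕ} {f : Module.End k C'.Total} {g : C'.X j' →ₗ[k] C'.X j}
    (h : ∀ a, C'.comp j (f a) = g (C'.comp j' a)) (z : Total2 C C') :
    comp2 C C' i j (actR f z) = TensorProduct.map LinearMap.id g (comp2 C C' i j' z) := by
  rw [comp2, comp2, actR, TensorProduct.map_map, TensorProduct.map_map, LinearMap.id_comp,
    show C'.comp j ∘ₗ f = g ∘ₗ C'.comp j' from LinearMap.ext h]
  rfl

theorem comp2_sn (i j : ℕ) (z : Total2 C C') :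
    comp2 C C' i j (sn C C' z) = (-1 : k) ^ i • comp2 C C' i j z := by
  rw [sn, comp2_actL (g := (-1 : k) ^ i • LinearMap.id) (comp_ep i), TensorProduct.map_smul_left,
    TensorProduct.map_id, LinearMap.smul_apply, LinearMap.id_apply]

/-- With `lower_comps` this transfers the operator identities on the total space to the complexes;
bidegrees with a zero entry match because `b` has no component in degree 0. -/
theorem raise_comps (n : ℕ) (z : Total2 C C') :
    raise C.b C'.b 0 n (comps C C' n z) = comps C C' (n + 1) (b2 C C' z) := by
  funext ⟨⟨p, q⟩, h⟩
  rw [comps_apply, b2, map_add, comp2_sn]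
  change raiseLeft C.b 0 n ⟨(p, q), h⟩ (comps C C' n z) +
    raiseRight C'.b 0 n ⟨(p, q), h⟩ (comps C C' n z) = _
  refine congrArg₂ (· + ·) ?_ ?_
  · rcases p with _ | p
    · rw [comp2_actL (g := (0 : C.X 0 →ₗ[k] C.X 0)) comp_bt_zero, TensorProduct.map_zero_left]
      rfl
    · rw [comp2_actL (comp_bt_succ p)]
      rfl
  · rcases q with _ | q
    · rw [comp2_actR (g := (0 : C'.X 0 →ₗ[k] C'.X 0)) comp_bt_zero, TensorProduct.map_zero_right,
        LinearMap.zero_apply, smul_zero]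
      rfl
    · rw [comp2_actR (comp_bt_succ q)]
      rfl

theorem lower_comps (n : ℕ) (z : Total2 C C') :
    lower C.B C'.B n (comps C C' (n + 1) z) = comps C C' n (B2 C C' z) := by
  funext ⟨⟨p, q⟩, h⟩
  rw [comps_apply, B2, map_add, comp2_sn, comp2_actL (comp_cb p), comp2_actR (comp_cb q)]
  rfl

theorem comps_mem {z : Total2 C C'} (hz : z ∈ subTens C.normTotal C'.normTotal) (n : ℕ) :
    comps C C' n z ∈ (tens C C').N n :=
  Submodule.mem_pi.2 fun _ _ => map_mem_subTens (fun _ ha => comp_mem_normalized ha _)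
    (fun _ ha => comp_mem_normalized ha _) hz

theorem comp2_actL_actR_jd (i j n : ℕ) (f : Module.End k C.Total) (g : Module.End k C'.Total)
    (x : (diag C C').X n) : comp2 C C' i j (actL f (actR g (jd C C' ((diag C C').inc n x)))) =
      TensorProduct.map (C.comp i ∘ₗ f ∘ₗ C.inc n) (C'.comp j ∘ₗ g ∘ₗ C'.inc n) x := by
  rw [actL_actR, jd_inc, comp2, TensorProduct.map_map, TensorProduct.map_map]
  rfl

end Components

/-! ### Identification of `sh` and `sh'` with the operators on words. -/

section ShuffleMaps

variable {k : Type u} [Field k] {C C' : CocyclicData.{u, w} k}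

theorem sn_zr_eq {n : ℕ} {z : Total2 C C'} (hz : z ∈ deg2 C C' n) :
    sn C C' (zr C C' 0 n z) = wsum n (fun W => (-1 : k) ^ inversions W • sw C C' 0 W z) := by
  rw [zr_eq, map_wsum]
  refine wsum_congr fun W hW => ?_
  rw [zw_eq_of_length hW hz, map_smul, sn_of_mem (sw_mem hW hz), smul_smul, ← pow_add]
  refine congrArg (· • _) (neg_one_pow_congr ?_)
  push_cast
  linear_combination (W.count true : ZMod 2) * (by decide : (2 : ZMod 2) = 0)

theorem intCast_sign {i j : ℕ} {s : Equiv.Perm (Fin (i + j))} (hs : s ∈ shuffles i j) :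
    ((Equiv.Perm.sign s : ℤ) : k) = (-1) ^ inversions (List.ofFn (letter s)) := by
  rw [sign_eq_inversions hs]
  simp

theorem comp_opAt_of_ne {i n : ℕ} {W : List Bool} (hW : W.length = n) (h : W.count true ≠ i) :
    C.comp i ∘ₗ C.opAt 0 W ∘ₗ C.inc n = 0 := by
  refine LinearMap.ext fun x => ?_
  have hc := count_true_add_count_false W
  obtain ⟨y, hy⟩ := opAt_inc_of_eq 0 W (m := W.count true) (by omega) x
  rw [LinearMap.comp_apply, LinearMap.comp_apply, hy, comp_inc_of_ne h, LinearMap.zero_apply]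

theorem comp2_sn_zr {n i j : ℕ} (h : n = i + j) (x : (diag C C').X n) :
    comp2 C C' i j (sn C C' (zr C C' 0 n (jd C C' ((diag C C').inc n x)))) =
      ∑ s ∈ shuffles i j, ((Equiv.Perm.sign s : ℤ) : k) • TensorProduct.map
        (C.degensLeft s ∘ₗ C.castX h) (C'.degensRight s ∘ₗ C'.castX h) x := by
  subst h
  rw [sn_zr_eq (jd_inc_mem _ _), map_wsum, sum_shuffles]
  · refine Finset.sum_congr rfl fun s hs => ?_
    rw [map_smul, intCast_sign hs, sw_apply, comp2_actL_actR_jd]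
    refine congrArg (_ • ·) (congrArg₂ (fun f g => TensorProduct.map f g x) ?_ ?_)
    · refine LinearMap.ext fun x => ?_
      rw [LinearMap.comp_apply, LinearMap.comp_apply, ← inc_degensLeft hs, comp_inc]
      rfl
    · refine LinearMap.ext fun x => ?_
      rw [LinearMap.comp_apply, LinearMap.comp_apply, ← inc_degensRight hs, comp_inc]
      rfl
  · intro W hW hc
    rw [map_smul, sw_apply, comp2_actL_actR_jd, comp_opAt_of_ne hW hc,
      TensorProduct.map_zero_left, LinearMap.zero_apply, smul_zero]

theorem sh_eq (n : ℕ) (x : (diag C C').X n) : sh C C' n x =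
    comps C C' n (sn C C' (zr C C' 0 n (jd C C' ((diag C C').inc n x)))) := by
  funext p
  rw [comps_apply, comp2_sn_zr (i := p.1.1) (j := p.1.2) p.2.symm, sh, LinearMap.pi_apply, LinearMap.sum_apply]
  rfl

theorem comp_cyc_opAt_of_ne {a n p : ℕ} {W : List Bool} (hW : W.length = n)
    (hc : 0 < W.count true) (h : W.count true ≠ a + 1) :
    C.comp a ∘ₗ (C.tw ^ p * C.xs * C.opAt 0 W) ∘ₗ C.inc n = 0 := by
  refine LinearMap.ext fun x => ?_
  have hc' := count_true_add_count_false W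
  obtain ⟨y, hy⟩ := opAt_inc_of_eq 0 W (m := W.count true - 1 + 1) (by omega) x
  rw [LinearMap.comp_apply, LinearMap.comp_apply, Module.End.mul_apply, Module.End.mul_apply, hy,
    xs_inc_succ, tw_pow_inc, comp_inc_of_ne (by omega), LinearMap.zero_apply]

/-- Words whose letter counts do not match the bidegree project to zero; the others correspond to
shuffles, with marks `p` and `q` becoming rotations and the order of the marks becoming the
condition on `s`. -/
theorem comp2_csh (hC : C.IsCocyclic) (hC' : C'.IsCocyclic) {n a b : ℕ} (h : n = a + 1 + (b + 1))
    (x : (diag C C').X n) : comp2 C C' a b (csh C C' n (jd C C' ((diag C C').inc n x))) =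
      ∑ p : Fin (a + 1), ∑ q : Fin (b + 1),
        ∑ s ∈ (shuffles (a + 1) (b + 1)).filter
          (fun s => s (Fin.castAdd (b + 1) p) < s (Fin.natAdd (a + 1) q)),
        ((-1 : k) ^ a * ((-1 : k) ^ ((p : ℕ) * a + (q : ℕ) * b) *
          ((Equiv.Perm.sign s : ℤ) : k))) •
        TensorProduct.map (C.cycDegen a p ∘ₗ C.degensLeft s ∘ₗ C.castX h)
          (C'.cycDegen b q ∘ₗ C'.degensRight s ∘ₗ C'.castX h) x := by
  subst h
  have h1 : ∀ s ∈ shuffles (a + 1) (b + 1), ∀ (p : Fin (a + 1)) (q : Fin (b + 1)),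
      comp2 C C' a b (csw C C' (List.ofFn (letter s)) p q
        (jd C C' ((diag C C').inc (a + 1 + (b + 1)) x))) =
      ((-1 : k) ^ a * ((-1 : k) ^ ((p : ℕ) * a + (q : ℕ) * b) *
          ((Equiv.Perm.sign s : ℤ) : k))) •
        TensorProduct.map (C.cycDegen a p ∘ₗ C.degensLeft s ∘ₗ C.castX rfl)
          (C'.cycDegen b q ∘ₗ C'.degensRight s ∘ₗ C'.castX rfl) x := by
    intro s hs p q
    rw [csw_apply, map_smul, comp2_actL_actR_jd, intCast_sign hs, count_true_letter,
      count_false_letter, Nat.add_sub_cancel, Nat.add_sub_cancel, pow_add, pow_add _ a, mul_assoc]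
    refine congrArg (_ • ·) (congrArg₂ (fun f g => TensorProduct.map f g x) ?_ ?_)
    · refine LinearMap.ext fun x => ?_
      rw [LinearMap.comp_apply, LinearMap.comp_apply, Module.End.mul_apply, ← inc_degensLeft hs,
        ← inc_cycDegen hC, comp_inc]
      rfl
    · refine LinearMap.ext fun x => ?_
      rw [LinearMap.comp_apply, LinearMap.comp_apply, Module.End.mul_apply, ← inc_degensRight hs,
        ← inc_cycDegen hC', comp_inc]
      rfl
  rw [csh, map_wsum, sum_shuffles]
  · have h2 : ∀ s ∈ shuffles (a + 1) (b + 1), comp2 C C' a b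
        (∑ p ∈ Finset.range ((List.ofFn (letter s)).count true),
          ∑ q ∈ Finset.range ((List.ofFn (letter s)).count false),
            if falseBefore (List.ofFn (letter s)) p ≤ q then csw C C' (List.ofFn (letter s)) p q
              (jd C C' ((diag C C').inc (a + 1 + (b + 1)) x)) else 0) =
        ∑ p : Fin (a + 1), ∑ q : Fin (b + 1),
          if s (Fin.castAdd (b + 1) p) < s (Fin.natAdd (a + 1) q) then
            ((-1 : k) ^ a * ((-1 : k) ^ ((p : ℕ) * a + (q : ℕ) * b) *
              ((Equiv.Perm.sign s : ℤ) : k))) •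
            TensorProduct.map (C.cycDegen a p ∘ₗ C.degensLeft s ∘ₗ C.castX rfl)
              (C'.cycDegen b q ∘ₗ C'.degensRight s ∘ₗ C'.castX rfl) x else 0 := by
      intro s hs
      rw [count_true_letter, count_false_letter, Finset.sum_range, map_sum]
      refine Finset.sum_congr rfl fun p _ => ?_
      rw [Finset.sum_range, map_sum]
      refine Finset.sum_congr rfl fun q _ => ?_
      rw [apply_ite (comp2 C C' a b), map_zero, h1 s hs]
      simp only [falseBefore_letter_le_iff hs]
    rw [Finset.sum_congr rfl h2, Finset.sum_comm]
    refine Finset.sum_congr rfl fun p _ => ?_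
    rw [Finset.sum_comm]
    refine Finset.sum_congr rfl fun q _ => ?_
    rw [Finset.sum_filter]
  · intro W hW hc
    rw [map_sum]
    refine Finset.sum_eq_zero fun p hp => ?_
    rw [map_sum]
    refine Finset.sum_eq_zero fun q hq => ?_
    rw [Finset.mem_range] at hp
    split_ifs
    · rw [csw_apply, map_smul, comp2_actL_actR_jd, comp_cyc_opAt_of_ne hW (by omega) hc,
        TensorProduct.map_zero_left, LinearMap.zero_apply, smul_zero]
    · rw [map_zero]

theorem sh'_eq (hC : C.IsCocyclic) (hC' : C'.IsCocyclic) (n : ℕ) (x : (diag C C').X (n + 2)) :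
    sh' C C' n x = comps C C' n (csh C C' (n + 2) (jd C C' ((diag C C').inc (n + 2) x))) := by
  funext c
  have h : n + 2 = c.1.1 + 1 + (c.1.2 + 1) := by have := c.2; omega
  rw [comps_apply, comp2_csh hC hC' h, sh', LinearMap.pi_apply]
  simp only [LinearMap.sum_apply, LinearMap.smul_apply]

end ShuffleMaps

end CocyclicData
end HopfCyc

namespace HopfCyc

namespace CocyclicData

/-! ### The shuffle maps and ρ as maps of total complexes commuting with `S`. -/

section ShuffleSMap

variable {k : Type u} [Field k] {C C' : CocyclicData.{u, w} k}

theorem actL_actR_sg_jd_inc {n : ℕ} {x : (diag C C').X n} (hx : x ∈ (diag C C').normalized n)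
    (t : ℕ) : actL (C.sg t) (actR (C'.sg t) (jd C C' ((diag C C').inc n x))) = 0 := by
  rw [← jd_sg, mem_normTotal.1 (inc_mem_normTotal.2 hx), map_zero]

theorem sh_mem (hC : C.IsCocyclic) (hC' : C'.IsCocyclic) (n : ℕ) {x : (diag C C').X n}
    (hx : x ∈ (diag C C').normalized n) : sh C C' n x ∈ (tens C C').N n := by
  rw [sh_eq]
  exact comps_mem (sn_mem_subTens_norm
    (zr_mem_norm hC hC' (jd_inc_mem n x) (actL_actR_sg_jd_inc hx))) n

theorem sh'_mem (hC : C.IsCocyclic) (hC' : C'.IsCocyclic) (n : ℕ) {x : (diag C C').X (n + 2)}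
    (hx : x ∈ (diag C C').normalized (n + 2)) : sh' C C' n x ∈ (tens C C').N n := by
  rw [sh'_eq hC hC']
  exact comps_mem (subTens_mono inf_le_left inf_le_left
    (csh_mem_extraNorm hC hC' (jd_inc_mem _ x) (actL_actR_sg_jd_inc hx))) n

theorem raise_sh (hC : C.IsCocyclic) (hC' : C'.IsCocyclic) (n : ℕ) (x : (diag C C').X n) :
    (tens C C').b n (sh C C' n x) = sh C C' (n + 1) ((diag C C').b n x) := by
  rw [sh_eq, sh_eq, inc_b, ← b2_sn_zr hC hC']
  exact raise_comps n _

theorem csh_one (z : Total2 C C') : csh C C' 1 z = 0 := by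
  rw [csh_eq]
  simp [wsum_zero]

/-- In degree 1 there is no cyclic shuffle, so the term `b sh'` is absent and the relation needs a
statement of its own. -/
theorem lower_sh_one (hC : C.IsCocyclic) (hC' : C'.IsCocyclic) {x : (diag C C').X 1}
    (hx : x ∈ (diag C C').normalized 1) : (tens C C').B 0 (sh C C' 1 x) =
      sh C C' 0 ((diag C C').B 0 x) + sh' C C' 0 ((diag C C').b 1 x) := by
  have hx' := inc_mem_normTotal.2 hx
  have h := B2_sn_zr_add hC hC' 0 x hx'
  rw [csh_one, ← inc_b, ← inc_B_normalized (IsCocyclic.diag hC hC') hx'] at h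
  rw [sh_eq, sh_eq, sh'_eq hC hC', ← map_add]
  refine (lower_comps 0 _).trans (congrArg _ (Eq.trans ?_ h))
  simp [b2]

theorem lower_sh_add_raise_sh' (hC : C.IsCocyclic) (hC' : C'.IsCocyclic) (n : ℕ)
    {x : (diag C C').X (n + 2)} (hx : x ∈ (diag C C').normalized (n + 2)) :
    (tens C C').B (n + 1) (sh C C' (n + 2) x) + (tens C C').b n (sh' C C' n x) =
      sh C C' (n + 1) ((diag C C').B (n + 1) x) + sh' C C' (n + 1) ((diag C C').b (n + 2) x) := by
  have hx' := inc_mem_normTotal.2 hx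
  have h := B2_sn_zr_add hC hC' (n + 1) x hx'
  rw [← inc_b, ← inc_B_normalized (IsCocyclic.diag hC hC') hx'] at h
  rw [sh_eq, sh_eq, sh'_eq hC hC', sh'_eq hC hC', ← map_add, ← h, map_add]
  exact congrArg₂ (· + ·) (lower_comps _ _) (raise_comps _ _)

theorem lower_sh' (hC : C.IsCocyclic) (hC' : C'.IsCocyclic) (n : ℕ)
    {x : (diag C C').X (n + 3)} (hx : x ∈ (diag C C').normalized (n + 3)) :
    (tens C C').B n (sh' C C' (n + 1) x) = 0 := by
  rw [sh'_eq hC hC']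
  refine (lower_comps n _).trans ?_
  rw [B2_of_mem_extraNorm hC hC'
    (csh_mem_extraNorm hC hC' (jd_inc_mem _ x) (actL_actR_sg_jd_inc hx)), map_zero]

/-- `sh'` begins with the extra degeneracy, which annihilates `N s x` for normalized `x`. -/
theorem sh'_B (hC : C.IsCocyclic) (hC' : C'.IsCocyclic) (n : ℕ)
    {x : (diag C C').X (n + 3)} (hx : x ∈ (diag C C').normalized (n + 3)) :
    sh' C C' n ((diag C C').B (n + 2) x) = 0 := by
  have hD := IsCocyclic.diag hC hC'
  have hx' := inc_mem_normTotal.2 hx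
  rw [sh'_eq hC hC', ← sn_gam_xs hC hC', inc_B_normalized hD hx',
    LinearMap.mem_ker.1 (nt_xs_mem_extraNormTotal hD hx').2, map_zero, map_zero, map_zero]

/-- Comparing powers of `u`: the lowest gives `b sh = sh b`, the next `B sh + b sh' = sh B + sh' b`,
and the last `B sh' = 0 = sh' B`. The case distinction removes the summands that do not exist near
the edges of the total complex. -/
theorem isSMap_shTilde (hC : C.IsCocyclic) (hC' : C'.IsCocyclic) :
    IsSMap (diag C C').mixed (tens C C') (shTilde C C') := by
  refine ⟨fun n x hx => ⟨?_, ?_⟩, fun n x hx => ?_⟩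
  · refine MixedData.mem_tot_N.2 ?_
    rintro ⟨⟨m, j⟩, h⟩
    refine add_mem (sh_mem hC hC' m (MixedData.mem_tot_N.1 hx ⟨(m, j), h⟩)) ?_
    rcases j with _ | j
    · exact zero_mem _
    · exact sh'_mem hC hC' m (MixedData.mem_tot_N.1 hx ⟨(m + 2, j), _⟩)
  · have hx := MixedData.mem_tot_N.1 hx
    funext ⟨⟨m, j⟩, h⟩
    rcases j with _ | j
    · rcases m with _ | m
      · dsimp only at h; omega
      · change sh C C' (m + 1) ((diag C C').b m (x ⟨(m, 0), _⟩) + 0) + 0 =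
          (tens C C').b m (sh C C' m (x ⟨(m, 0), _⟩) + 0) + 0
        rw [add_zero, add_zero, add_zero, add_zero, raise_sh hC hC']
    · rcases m with _ | m <;> rcases j with _ | j
      · change sh C C' 0 (0 + (diag C C').B 0 (x ⟨(1, 0), _⟩)) +
          sh' C C' 0 ((diag C C').b 1 (x ⟨(1, 0), _⟩) + 0) =
          0 + (tens C C').B 0 (sh C C' 1 (x ⟨(1, 0), _⟩) + 0)
        rw [zero_add ((diag C C').B 0 _), zero_add ((tens C C').B 0 _), add_zero, add_zero,
          lower_sh_one hC hC' (hx ⟨(1, 0), by dsimp only at h ⊢; omega⟩)]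
      · change sh C C' 0 (0 + (diag C C').B 0 (x ⟨(1, j + 1), _⟩)) +
          sh' C C' 0 ((diag C C').b 1 (x ⟨(1, j + 1), _⟩) + (diag C C').B 2 (x ⟨(3, j), _⟩)) =
          0 + (tens C C').B 0 (sh C C' 1 (x ⟨(1, j + 1), _⟩) + sh' C C' 1 (x ⟨(3, j), _⟩))
        rw [zero_add ((diag C C').B 0 _), zero_add ((tens C C').B 0 _), map_add, map_add, sh'_B hC hC' 0 (hx ⟨(3, j), _⟩),
          lower_sh' hC hC' 0 (hx ⟨(3, j), _⟩), 
          lower_sh_one hC hC' (hx ⟨(1, j + 1), by dsimp only at h ⊢; omega⟩), add_zero, add_zero]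
      · change sh C C' (m + 1) ((diag C C').b m (x ⟨(m, 1), _⟩) +
            (diag C C').B (m + 1) (x ⟨(m + 2, 0), _⟩)) +
          sh' C C' (m + 1) ((diag C C').b (m + 2) (x ⟨(m + 2, 0), _⟩) + 0) =
          (tens C C').b m (sh C C' m (x ⟨(m, 1), _⟩) + sh' C C' m (x ⟨(m + 2, 0), _⟩)) +
            (tens C C').B (m + 1) (sh C C' (m + 2) (x ⟨(m + 2, 0), _⟩) + 0)
        have h1 := lower_sh_add_raise_sh' hC hC' m (hx ⟨(m + 2, 0), by dsimp only at h ⊢; omega⟩)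
        rw [add_zero, add_zero, map_add, map_add, raise_sh hC hC', add_assoc, ← h1]
        abel
      · change sh C C' (m + 1) ((diag C C').b m (x ⟨(m, j + 2), _⟩) +
            (diag C C').B (m + 1) (x ⟨(m + 2, j + 1), _⟩)) +
          sh' C C' (m + 1) ((diag C C').b (m + 2) (x ⟨(m + 2, j + 1), _⟩) +
            (diag C C').B (m + 3) (x ⟨(m + 4, j), _⟩)) =
          (tens C C').b m (sh C C' m (x ⟨(m, j + 2), _⟩) + sh' C C' m (x ⟨(m + 2, j + 1), _⟩)) +
            (tens C C').B (m + 1) (sh C C' (m + 2) (x ⟨(m + 2, j + 1), _⟩) +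
              sh' C C' (m + 2) (x ⟨(m + 4, j), _⟩))
        have h1 := lower_sh_add_raise_sh' hC hC' m
          (hx ⟨(m + 2, j + 1), by dsimp only at h ⊢; omega⟩)
        rw [map_add, map_add, map_add, map_add, raise_sh hC hC', sh'_B hC hC' (m + 1) (hx ⟨(m + 4, j), _⟩),
          lower_sh' hC hC' (m + 1) (hx ⟨(m + 4, j), _⟩), add_zero, add_zero, add_assoc, ← h1]
        abel
  · funext ⟨⟨m, j⟩, h⟩
    rcases j with _ | _ | j
    · change sh C C' m 0 + 0 = 0
      rw [map_zero, add_zero]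
    · change sh C C' m (x ⟨(m, 0), _⟩) + sh' C C' m 0 = sh C C' m (x ⟨(m, 0), _⟩) + 0
      rw [map_zero]
    · rfl

theorem isSMap_totMap {f : ∀ m, C.X m →ₗ[k] C'.X m}
    (hσ : ∀ n i, f n ∘ₗ C.σ n i = C'.σ n i ∘ₗ f (n + 1))
    (hδ : ∀ n i, f (n + 1) ∘ₗ C.δ n i = C'.δ n i ∘ₗ f n)
    (hτ : ∀ n, f n ∘ₗ C.τ n = C'.τ n ∘ₗ f n) : IsSMap C.mixed C'.mixed (totMap C C' f) := by
  have hN : ∀ n, ∀ x ∈ C.normalized n, f n x ∈ C'.normalized n := by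
    intro n x hx
    rcases n with _ | n
    · exact Submodule.mem_top
    · refine (Submodule.mem_iInf _).2 fun i => LinearMap.mem_ker.2 ?_
      have h := LinearMap.congr_fun (hσ n i) x
      rw [LinearMap.comp_apply, LinearMap.comp_apply,
        LinearMap.mem_ker.1 ((Submodule.mem_iInf _).1 hx i), map_zero] at h
      exact h.symm
  have hb : ∀ n x, f (n + 1) (C.b n x) = C'.b n (f n x) := by
    intro n x
    rw [b, b, LinearMap.sum_apply, LinearMap.sum_apply, map_sum]
    refine Finset.sum_congr rfl fun i _ => ?_
    rw [LinearMap.smul_apply, LinearMap.smul_apply, map_smul]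
    exact congrArg _ (LinearMap.congr_fun (hδ n i) x)
  have hτ' : ∀ (n : ℕ) (c : k) x, f n ((c • C.τ n) x) = (c • C'.τ n) (f n x) := fun n c x => by
    rw [LinearMap.smul_apply, LinearMap.smul_apply, map_smul]
    exact congrArg _ (LinearMap.congr_fun (hτ n) x)
  have hpow : ∀ (n : ℕ) (c : k) (j : ℕ) x, f n (((c • C.τ n) ^ j) x) =
      ((c • C'.τ n) ^ j) (f n x) := by
    intro n c j
    induction j with
    | zero => intro x; rfl
    | succ j ih =>
      intro x
      rw [pow_succ, pow_succ, Module.End.mul_apply, Module.End.mul_apply, ih, hτ']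
  have hB : ∀ n x, f n (C.B n x) = C'.B n (f (n + 1) x) := by
    intro n x
    rw [B, B, LinearMap.comp_apply, LinearMap.comp_apply _ _ (f (n + 1) x), LinearMap.sum_apply,
      LinearMap.sum_apply, map_sum]
    refine Finset.sum_congr rfl fun j _ => ?_
    rw [hpow]
    refine congrArg _ ?_
    have h1 := fun y => LinearMap.congr_fun (hσ n (Fin.last n)) y
    have h2 := fun y => LinearMap.congr_fun (hτ (n + 1)) y
    simp only [LinearMap.comp_apply] at h1 h2
    simp only [LinearMap.comp_apply, LinearMap.sub_apply, LinearMap.id_apply]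
    rw [h1, h2, map_sub, hτ']
  refine ⟨fun n x hx => ⟨?_, ?_⟩, fun n x hx => ?_⟩
  · exact MixedData.mem_tot_N.2 fun r => hN _ _ (MixedData.mem_tot_N.1 hx r)
  · funext ⟨⟨m, j⟩, h⟩
    rcases m with _ | m <;> rcases j with _ | j
    · dsimp only at h; omega
    · exact (congrArg (f 0) (zero_add _)).trans ((hB 0 _).trans (zero_add _).symm)
    · exact (congrArg (f (m + 1)) (add_zero _)).trans ((hb m _).trans (add_zero _).symm)
    · exact (map_add (f (m + 1)) _ _).trans (congrArg₂ (· + ·) (hb m _) (hB (m + 1) _))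
  · funext ⟨⟨m, j⟩, h⟩
    rcases j with _ | j
    · exact map_zero (f m)
    · rfl

end ShuffleSMap

/-! ### Existence and uniqueness of the cyclic Künneth map. -/

section CyclicKunneth

variable {k : Type u} [Field k] {C C' : CocyclicData.{u, w} k}

theorem exists_isCyclicKunnethMap (hC : C.IsCocyclic) (hC' : C'.IsCocyclic) :
    ∃ ς, IsCyclicKunnethMap C C' ς := by
  have hA := (mixed_isMixed hC).tot_isComplex
  have hB := (mixed_isMixed hC').tot_isComplex
  have h := MixedData.isShortExact_mu (A := C.mixed) (B := C'.mixed)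
  obtain ⟨S, hS⟩ := MixedData.exists_induces_per C.mixed
  obtain ⟨S', hS'⟩ := MixedData.exists_induces_per C'.mixed
  obtain ⟨κ₂, hκ₂⟩ := CochainData.exists_isKunnethIso hA hB 2
  obtain ⟨κ₀, hκ₀⟩ := CochainData.exists_isKunnethIso hA hB 0
  choose μ' hμ' using fun n => h.2.1.exists_induces n
  obtain ⟨conn, hconn⟩ := h.exists_isConnecting (CochainData.tensor_isComplex hA hB 2)
    (CochainData.tensor_isComplex hA hB 0)
  exact ⟨_, h, S, S', κ₂, κ₀, μ', conn, hS, hS', hκ₂, hκ₀, hμ', hconn, fun n => rfl⟩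

/-- Each map in the composite is characterized by its values on classes of cocycles, so the
auxiliary choices of any two presentations coincide. -/
theorem IsCyclicKunnethMap.unique (hC : C.IsCocyclic) (hC' : C'.IsCocyclic)
    {ς ς' : ∀ n, (tens C C').tot.H n →ₗ[k] CochainData.HTens 0 C.tot C'.tot n}
    (h : IsCyclicKunnethMap C C' ς) (h' : IsCyclicKunnethMap C C' ς') : ς = ς' := by
  have hA := (mixed_isMixed hC).tot_isComplex
  have hB := (mixed_isMixed hC').tot_isComplex
  obtain ⟨he, S, S', κ₂, κ₀, μ', conn, hS, hS', hκ₂, hκ₀, hμ', hconn, hς⟩ := h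
  obtain ⟨-, T, T', l₂, l₀, ν', conn', hT, hT', hl₂, hl₀, hν', hconn', hς'⟩ := h'
  obtain rfl : S = T := funext fun n => (hS n).unique (hT n)
  obtain rfl : S' = T' := funext fun n => (hS' n).unique (hT' n)
  obtain rfl : κ₂ = l₂ := hκ₂.unique hl₂
  obtain rfl : κ₀ = l₀ := hκ₀.unique hl₀
  obtain rfl : μ' = ν' := funext fun n => (hμ' n).unique (hν' n)
  obtain rfl : conn = conn' := hconn.unique he (CochainData.tensor_isComplex hA hB 2)
    (CochainData.tensor_isComplex hA hB 0) hconn'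
  exact funext fun n => (hς n).trans (hς' n).symm

end CyclicKunneth

end CocyclicData
end HopfCyc

/-! ### The coproduct on Hopf cyclic cohomology. -/

theorem mainTheorem1 {k : Type u} [Field k] [CharZero k] {H : Type v} [Ring H] [HopfAlgebra k H]
    [Coalgebra.IsCocomm k H] {M : Type w} [AddCommGroup M] [Module k M] [Module Hᵐᵒᵖ M]
    [IsScalarTower k Hᵐᵒᵖ M] [HopfCyc.SAYDModule k H M]
    (ψ : M →ₗ[k] M ⊗[k] M)
    (hψ_act : ψ ∘ₗ HopfCyc.rightAct k H M =
      HopfCyc.tensorAct (HopfCyc.rightAct k H M) (HopfCyc.rightAct k H M) ∘ₗ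
        TensorProduct.map ψ Coalgebra.comul)
    (hψ_coact : TensorProduct.map Coalgebra.comul ψ ∘ₗ HopfCyc.SAYDModule.coact =
      HopfCyc.tensorCoact (HopfCyc.SAYDModule.coact (k := k) (H := H))
        (HopfCyc.SAYDModule.coact (k := k) (H := H)) ∘ₗ ψ) :
    let C := HopfCyc.hopfCocyclic k H M
    let D := HopfCyc.CocyclicData.diag C C
    let E := HopfCyc.CocyclicData.tens C C
    C.IsCocyclic ∧ C.tot.IsComplex ∧ D.tot.IsComplex ∧ E.tot.IsComplex ∧
    HopfCyc.CocyclicData.IsSMap C.mixed D.mixed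
      (HopfCyc.CocyclicData.totMap C D (HopfCyc.rho (HopfCyc.rightAct k H M) ψ hψ_act)) ∧
    HopfCyc.CocyclicData.IsSMap D.mixed E (HopfCyc.CocyclicData.shTilde C C) ∧
    ∃! cup : ∀ n, C.HC n →ₗ[k] HopfCyc.CochainData.HTens 0 C.tot C.tot n,
      ∃ (shρ : ∀ n, C.HC n →ₗ[k] E.tot.H n)
        (ς : ∀ n, E.tot.H n →ₗ[k] HopfCyc.CochainData.HTens 0 C.tot C.tot n),
        (∀ n, HopfCyc.CochainData.Induces C.tot E.tot
          (HopfCyc.CocyclicData.shTilde C C n ∘ₗ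
            HopfCyc.CocyclicData.totMap C D
              (HopfCyc.rho (HopfCyc.rightAct k H M) ψ hψ_act) n) (shρ n)) ∧
        HopfCyc.CocyclicData.IsCyclicKunnethMap C C ς ∧
        ∀ n, cup n = ς n ∘ₗ shρ n := by
  intro C D E
  have hC : C.IsCocyclic := HopfCyc.hopfCocyclic_isCocyclic
  have hM := HopfCyc.CocyclicData.mixed_isMixed hC
  have hρ := HopfCyc.CocyclicData.isSMap_totMap (C := C) (C' := D)
    (HopfCyc.rho_σ ψ hψ_act) (HopfCyc.rho_δ ψ hψ_act hψ_coact)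
    (HopfCyc.rho_cyclicOp ψ hψ_act hψ_coact)
  have hSh := HopfCyc.CocyclicData.isSMap_shTilde hC hC
  refine ⟨hC, hM.tot_isComplex,
    (HopfCyc.CocyclicData.mixed_isMixed (hC.diag hC)).tot_isComplex,
    (hM.tensor hM).tot_isComplex, hρ, hSh, ?_⟩
  choose shρ hshρ using fun n => (hSh.1.comp hρ.1).exists_induces n
  obtain ⟨ς, hς⟩ := HopfCyc.CocyclicData.exists_isCyclicKunnethMap hC hC
  refine ⟨fun n => ς n ∘ₗ shρ n, ⟨shρ, ς, hshρ, hς, fun n => rfl⟩, ?_⟩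
  rintro cup ⟨shρ', ς', hshρ', hς', hcup⟩
  obtain rfl := hς.unique hC hC hς'
  funext n
  rw [hcup, (hshρ n).unique (hshρ' n)]
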